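/- Composite quantum query algorithms. Let $n\ge 1$, let $m\ge \log_2 n+2$, and let $f:\{0,1\}^n\to\{0,1\}$. The $2^m$ basis states of $m$ qubits are written $|i,b,z\rangle$, where $i$ is an index of $\lceil\log_2 n\rceil$ bits, $b$ is one bit, and $z$ is the content of the remaining qubits. A query to the input $X=(x_1,\dots,x_n)$ maps $|i,b,z\rangle$ to $|i,b\oplus x_i,z\rangle$ (and is the identity on $|i,b,z\rangle$ if $i$ is not the address of an input bit). A quantum query algorithm with $T\ge 0$ queries is a sequence $U_0,\dots,U_T$ of unitary $2^m\times 2^m$ matrices; starting from $|0\rangle$ it applies $U_0$, a query, $U_1$, a query, $\dots$, a query, $U_T$, and then a basis state is observed. A composite algorithm on $m$ qubits is a finite sequence $\Gamma_1\to D_1\to\cdots\to\Gamma_t\to D_t$ with $t\ge 1$, where each $\Gamma_k$ is a quantum query algorithm on $m$ qubits, with $T_k$ queries, and each decision point $D_k$ is an arbitrary function that, from the basis states observed after $\Gamma_1,\dots,\Gamma_k$, decides whether to halt and return $0$, to halt and return $1$, or to continue with $\Gamma_{k+1}$; $D_t$ must halt. On input $X$ it uses $\sum_{k=1}^t p_kT_k$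 queries, where $p_k$ is the probability that $\Gamma_k$ is invoked on $X$. Let $SQ_{2,m}(f)$ be the infimum, over all composite algorithms on $m$ qubits that compute $f$ with error probability at most $1/3$ on every input, of the number of queries used on a worst-case input. Theorem. For every $\epsilon>0$ there is an algorithm (a program for a random-access machine with addition, subtraction and indirect addressing at unit cost) which, given $n$, $m$ and the truth table of $f$, for all $n\ge1$, all $m\ge\log_2 n+2$ and all $f:\{0,1\}^n\to\{0,1\}$, halts within $2^{C\,4^m m n}$ steps, where $C$ depends only on $\epsilon$, and outputs a rational number $a$ with $$\frac{SQ_{2,m}(f)}{\sqrt{22}/3+\epsilon}\;\le\; a\;\le\;\Bigl(\frac{\sqrt{22}}3+\epsilon\Bigr)SQ_{2,m}(f).$$ For $m=O(\log n)$ its running time is $N^{\operatorname{polylog}N}$, where $N=2^n$: for every real $c$ there is an integer $k\ge0$ such that it halts within $N^{k(\log_2N)^k}$ steps whenever $\log_2 n+2\le m\le c(1+\log_2 n)$. -/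

import Mathlib

open scoped Matrix

/-! ## Quantum query algorithms on `m` qubits -/

namespace QuantumQuery

/-- The computational basis of `m` qubits, split into an index register of `⌈log₂ n⌉` qubits,
one answer qubit, and a workspace made of the remaining `m - ⌈log₂ n⌉ - 1` qubits
(there are `2 ^ m` basis states as soon as `⌈log₂ n⌉ + 1 ≤ m`). -/
abbrev BasisState (n m : ℕ) : Type :=
  Fin (2 ^ Nat.clog 2 n) × Bool × Fin (2 ^ (m - (Nat.clog 2 n + 1)))

/-- The basis state `|0, 0, 0⟩`. -/
def zeroState (n m : ℕ) : BasisState n m :=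
  (⟨0, Nat.two_pow_pos _⟩, false, ⟨0, Nat.two_pow_pos _⟩)

/-- The bit of the input `x` that is addressed by `i`; addresses beyond the input read `0`. -/
def inputBit {n : ℕ} (x : Fin n → Bool) (i : ℕ) : Bool :=
  if h : i < n then x ⟨i, h⟩ else false

/-- The action `|i, b, z⟩ ↦ |i, b ⊕ xᵢ, z⟩` of a query on basis states. -/
def queryBasis {n m : ℕ} (x : Fin n → Bool) (s : BasisState n m) : BasisState n m :=
  (s.1, xor s.2.1 (inputBit x s.1), s.2.2)

/-- The query transformation on state vectors, the linear extension of `queryBasis x`.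
As `queryBasis x` is an involution, the amplitude of `s` afterwards is the amplitude of
`queryBasis x s` before. -/
def query {n m : ℕ} (x : Fin n → Bool) (ψ : BasisState n m → ℂ) : BasisState n m → ℂ :=
  fun s => ψ (queryBasis x s)

/-- A quantum query algorithm `U₀ → Q → U₁ → ⋯ → Q → U_T`: its unitary transformations are
`first = U₀` and `rest = [U₁, …, U_T]`. -/
structure QueryAlgorithm (n m : ℕ) where
  first : Matrix.unitaryGroup (BasisState n m) ℂ
  rest : List (Matrix.unitaryGroup (BasisState n m) ℂ)

namespace QueryAlgorithm

variable {n m : ℕ}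

/-- The number `T` of queries. -/
def numQueries (Γ : QueryAlgorithm n m) : ℕ := Γ.rest.length

/-- The final state `U_T Q ⋯ Q U₁ Q U₀ |0⟩` on the input `x`. -/
noncomputable def finalState (Γ : QueryAlgorithm n m) (x : Fin n → Bool) :
    BasisState n m → ℂ :=
  Γ.rest.foldl (fun ψ U => (U : Matrix (BasisState n m) (BasisState n m) ℂ) *ᵥ query x ψ)
    ((Γ.first : Matrix (BasisState n m) (BasisState n m) ℂ) *ᵥ Pi.single (zeroState n m) 1)

/-- The probability that `s` is the basis state observed at the end, on the input `x`. -/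
noncomputable def outcomeProb (Γ : QueryAlgorithm n m) (x : Fin n → Bool)
    (s : BasisState n m) : ℝ :=
  ‖Γ.finalState x s‖ ^ 2

end QueryAlgorithm

/-- A composite algorithm `Γ₁ → D₁ → ⋯ → Γ_t → D_t`. After each stage the basis state is observed,
and the decision point sees the list of all basis states observed so far: `decide l = some b`
means "halt and return `b`", and `decide l = none` means "continue with the next stage"
(the decision point in question is determined by the length of `l`). The last decision point
must halt. -/
structure CompositeAlgorithm (n m : ℕ) where
  numStages : ℕ
  numStages_pos : 0 < numStages
  stage : Fin numStages → QueryAlgorithm n m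
  decide : List (BasisState n m) → Option Bool
  decide_last : ∀ l, l.length = numStages → (decide l).isSome

namespace CompositeAlgorithm

variable {n m : ℕ}

/-- The choice made by the decision point after the stage `k` (counted from `0`) when
`o` is the sequence of the basis states that are observed. It depends on the first `k + 1`
observations only. -/
def decision (Γ : CompositeAlgorithm n m) (o : Fin Γ.numStages → BasisState n m)
    (k : Fin Γ.numStages) : Option Bool :=
  Γ.decide ((List.ofFn o).take (k + 1))

/-- The stage `k` is invoked: all decision points before it continue. -/
def Invoked (Γ : CompositeAlgorithm n m) (o : Fin Γ.numStages → BasisState n m)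
    (k : Fin Γ.numStages) : Prop :=
  ∀ j < k, Γ.decision o j = none

/-- The algorithm returns `b`: some stage is invoked and the decision point after it returns `b`. -/
def Returns (Γ : CompositeAlgorithm n m) (o : Fin Γ.numStages → BasisState n m)
    (b : Bool) : Prop :=
  ∃ k, Γ.Invoked o k ∧ Γ.decision o k = some b

/-- The probability of the sequence `o` of observations on the input `x`. The stages all start
afresh, so their observations are independent. (Stages after the halting time are thought of as
being simulated without charge; neither `Invoked` nor `Returns` depends on their outcomes.) -/
noncomputable def runProb (Γ : CompositeAlgorithm n m) (x : Fin n → Bool)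
    (o : Fin Γ.numStages → BasisState n m) : ℝ :=
  ∏ k, (Γ.stage k).outcomeProb x (o k)

open Classical in
/-- The probability that the stage `k` is invoked on the input `x`. -/
noncomputable def invokedProb (Γ : CompositeAlgorithm n m) (x : Fin n → Bool)
    (k : Fin Γ.numStages) : ℝ :=
  ∑ o, if Γ.Invoked o k then Γ.runProb x o else 0

/-- The number of queries used on the input `x`: the sum of `p_k T_k` over all stages `k`, where
`p_k` is the probability that the stage `k` is invoked and `T_k` is its number of queries. -/
noncomputable def queries (Γ : CompositeAlgorithm n m) (x : Fin n → Bool) : ℝ :=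
  ∑ k, Γ.invokedProb x k * ((Γ.stage k).numQueries : ℝ)

open Classical in
/-- The probability that the algorithm returns the wrong value of `f` on the input `x`. -/
noncomputable def errorProb (Γ : CompositeAlgorithm n m) (f : (Fin n → Bool) → Bool)
    (x : Fin n → Bool) : ℝ :=
  ∑ o, if Γ.Returns o (!f x) then Γ.runProb x o else 0

/-- The algorithm computes `f` with error probability at most `1 / 3` on every input. -/
def Computes (Γ : CompositeAlgorithm n m) (f : (Fin n → Bool) → Bool) : Prop :=
  ∀ x, Γ.errorProb f x ≤ 1 / 3

end CompositeAlgorithm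

/-- The space-bounded bounded-error quantum query complexity of `f` with `m` qubits: the infimum,
over all composite algorithms on `m` qubits that compute `f` with error at most `1 / 3`, of
the number of queries used on a worst-case input. -/
noncomputable def spaceBoundedQueryComplexity {n : ℕ} (m : ℕ) (f : (Fin n → Bool) → Bool) : ℝ :=
  sInf {q : ℝ | ∃ Γ : CompositeAlgorithm n m, Γ.Computes f ∧ ∀ x, Γ.queries x ≤ q}

end QuantumQuery

/-! ## Random-access machines -/

namespace RAM

/-- The memory: registers numbered by `ℕ`, each holding a natural number. -/
abbrev Memory : Type := ℕ → ℕ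

/-- Structured programs for a random-access machine with addition, (truncated) subtraction and
indirect addressing. There is no multiplication, so that with unit costs the machine is
polynomially equivalent to a Turing machine. -/
inductive Program : Type
  | const (r c : ℕ) : Program
  | add (r a b : ℕ) : Program
  | sub (r a b : ℕ) : Program
  | load (r a : ℕ) : Program
  | store (a r : ℕ) : Program
  | seq (P Q : Program) : Program
  | ifNonzero (r : ℕ) (P Q : Program) : Program
  | whileNonzero (r : ℕ) (P : Program) : Program

/-- `Exec P M t M'`: the program `P`, started with the memory `M`, halts after exactly `t` steps
with the memory `M'`. Every elementary instruction and every test of a register is one step. -/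
inductive Exec : Program → Memory → ℕ → Memory → Prop
  | const (M : Memory) (r c : ℕ) :
      Exec (.const r c) M 1 (Function.update M r c)
  | add (M : Memory) (r a b : ℕ) :
      Exec (.add r a b) M 1 (Function.update M r (M a + M b))
  | sub (M : Memory) (r a b : ℕ) :
      Exec (.sub r a b) M 1 (Function.update M r (M a - M b))
  | load (M : Memory) (r a : ℕ) :
      Exec (.load r a) M 1 (Function.update M r (M (M a)))
  | store (M : Memory) (a r : ℕ) :
      Exec (.store a r) M 1 (Function.update M (M a) (M r))
  | seq {P Q : Program} {M M' M'' : Memory} {s t : ℕ}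
      (hP : Exec P M s M') (hQ : Exec Q M' t M'') :
      Exec (.seq P Q) M (s + t) M''
  | ifTrue {r : ℕ} {P Q : Program} {M M' : Memory} {t : ℕ}
      (hr : M r ≠ 0) (hP : Exec P M t M') :
      Exec (.ifNonzero r P Q) M (t + 1) M'
  | ifFalse {r : ℕ} {P Q : Program} {M M' : Memory} {t : ℕ}
      (hr : M r = 0) (hQ : Exec Q M t M') :
      Exec (.ifNonzero r P Q) M (t + 1) M'
  | whileTrue {r : ℕ} {P : Program} {M M' M'' : Memory} {s t : ℕ}
      (hr : M r ≠ 0) (hP : Exec P M s M') (hW : Exec (.whileNonzero r P) M' t M'') :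
      Exec (.whileNonzero r P) M (s + t + 1) M''
  | whileFalse {r : ℕ} {P : Program} {M : Memory} (hr : M r = 0) :
      Exec (.whileNonzero r P) M 1 M

/-- The initial memory for the input `(n, m, f)`: register `0` holds `n`, register `1` holds `m`,
and the next `2 ^ n` registers hold the truth table of `f`, where the row `k < 2 ^ n` belongs to
the input whose bits are the binary digits of `k`. All other registers hold `0`. -/
def inputMemory (n m : ℕ) (f : (Fin n → Bool) → Bool) : Memory
  | 0 => n
  | 1 => m
  | k + 2 => if k < 2 ^ n ∧ f (fun i => k.testBit i) = true then 1 else 0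

/-- On the input `(n, m, f)` the program `P` halts after exactly `t` steps and outputs the rational
number `p / q`, whose numerator and (nonzero) denominator it leaves in registers `0` and `1`. -/
def Outputs (P : Program) (n m : ℕ) (f : (Fin n → Bool) → Bool) (t p q : ℕ) : Prop :=
  ∃ M : Memory, Exec P (inputMemory n m f) t M ∧ M 0 = p ∧ M 1 = q ∧ q ≠ 0

end RAM

/-!
# Approximating the query complexity of composite quantum algorithms

As `√22 / 3 ≥ 3 / 2`, it suffices to compute the complexity `V` of `f` up to the factor `3 / 2`,
whatever `ε` is. This is done by an exhaustive search whose number of steps is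
`2 ^ O(4 ^ m * m * n)`.

*Reduction to a bounded problem.* Stages without queries have outcomes that do not depend on the
input, so they only provide random bits. When an algorithm is about to exceed `n` queries in all,
one can read the whole input with `n` classical queries instead. This at most doubles the number of
queries (`Search.optimum_reduce_le`), and leaves at most `n` stages with at most `n` queries in all,
hence at most `2 * n` unitary matrices. Up to the factor `2`, `V` is therefore the least cost of
such a family of matrices together with a mixture of strategies, where a strategy decides, for
every history of observations, whether to answer `0`, to answer `1`, or to go on.

*Candidates.* A candidate consists of numbers of queries, a cost, and matrices whose entries are
rounded to multiples of `1 / (2 ^ m) ^ 16`. The columns of a rounded unitary matrix are almost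
orthonormal (`Search.nearUnitary_of_round`), and conversely every matrix with almost orthonormal
columns is close to a unitary one, by the polar decomposition (`QuantumQuery.exists_unitary_close`).
So the outcomes of all strategies are those of an actual algorithm up to a small error
(`Search.abs_pay_sub_pay_le`).

*The mixture of strategies.* Whether some mixture has error at most `1 / 3` and the required cost on
all inputs at once is a question about a zero-sum game, and is answered by a perceptron. It keeps a
nonnegative weight for the error and one for the cost of every input, and responds to the current
weights by an optimal strategy, which backward induction on the tree of histories finds
(`DecisionTree.Problem.best_le_pay`). If every weighting admits a strategy that meets the targets on
the weighted average, then the weights grow only like the square root of the number of rounds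
(`DecisionTree.sum_sq_le`). If they have stayed small, then the average of the strategies that were
used meets the targets (`DecisionTree.sum_payoffs_le`). This average becomes an algorithm by
observing uniformly distributed seeds in stages without queries
(`Search.Accepted.exists_compositeAlgorithm`). Conversely, every algorithm for `f` gives rise to an
accepted candidate of about twice its cost (`Search.exists_accepted`). Since `V ≥ 1 / 3` unless `f`
is constant (`QuantumQuery.CompositeAlgorithm.one_third_le_queries`), the additive errors do not
matter, and a value between the two bounds for `V` is correct up to the factor `3 / 2`
(`Search.answer_bounds`).

*The program.* The search uses only natural numbers of at most `2 ^ O(4 ^ m * m * n)`. It is written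
as a command of a language with bounded loops, in which every loop is cut off at a number `cap`, so
that the running time is polynomial in `cap` for any command whatsoever
(`RAM.Cmd.polyBounded_time`). The compiler into programs for the random-access machine is proved
correct in `RAM.Cmd.runs_code`. Three such commands compute an exponent, a sufficient `cap` from it,
and the result of the search (`Search.exists_program`).
-/

/-! ### Running times of programs for the random-access machine -/

namespace RAM

/-- Started with the memory `M`, the program `P` halts after at most `τ` steps with a memory
that satisfies `Q`. -/
def Runs (P : Program) (M : Memory) (τ : ℕ) (Q : Memory → Prop) : Prop :=
  ∃ t M', Exec P M t M' ∧ t ≤ τ ∧ Q M'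

namespace Runs

variable {P P' : Program} {M : Memory} {τ τ' : ℕ} {Q Q' : Memory → Prop}

theorem mono (h : Runs P M τ Q) (hτ : τ ≤ τ') (hQ : ∀ M', Q M' → Q' M') : Runs P M τ' Q' := by
  obtain ⟨t, M', h1, h2, h3⟩ := h
  exact ⟨t, M', h1, h2.trans hτ, hQ _ h3⟩

theorem seq (h : Runs P M τ (fun M' => Runs P' M' τ' Q)) : Runs (.seq P P') M (τ + τ') Q := by
  obtain ⟨t, M', h1, h2, t', M'', h3, h4, h5⟩ := h
  exact ⟨t + t', M'', .seq h1 h3, add_le_add h2 h4, h5⟩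

theorem const {r c : ℕ} (h : Q (Function.update M r c)) : Runs (.const r c) M 1 Q :=
  ⟨1, _, .const M r c, le_rfl, h⟩

theorem add {r a b : ℕ} (h : Q (Function.update M r (M a + M b))) : Runs (.add r a b) M 1 Q :=
  ⟨1, _, .add M r a b, le_rfl, h⟩

theorem sub {r a b : ℕ} (h : Q (Function.update M r (M a - M b))) : Runs (.sub r a b) M 1 Q :=
  ⟨1, _, .sub M r a b, le_rfl, h⟩

theorem load {r a : ℕ} (h : Q (Function.update M r (M (M a)))) : Runs (.load r a) M 1 Q :=
  ⟨1, _, .load M r a, le_rfl, h⟩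

theorem store {r a : ℕ} (h : Q (Function.update M (M a) (M r))) : Runs (.store a r) M 1 Q :=
  ⟨1, _, .store M a r, le_rfl, h⟩

theorem ifNonzero {r : ℕ} (h1 : M r ≠ 0 → Runs P M τ Q) (h2 : M r = 0 → Runs P' M τ' Q) :
    Runs (.ifNonzero r P P') M (max τ τ' + 1) Q := by
  by_cases hr : M r = 0
  · obtain ⟨t, M', h1, h2, h3⟩ := h2 hr
    exact ⟨t + 1, M', .ifFalse hr h1, by have := le_max_right τ τ'; omega, h3⟩
  · obtain ⟨t, M', h1, h2, h3⟩ := h1 hr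
    exact ⟨t + 1, M', .ifTrue hr h1, by have := le_max_left τ τ'; omega, h3⟩

/-- A loop that counts the register `r` down to `0`. -/
theorem whileCount {r : ℕ} (I : ℕ → Memory → Prop)
    (step : ∀ j M, I (j + 1) M → M r = j + 1 → Runs P M τ (fun M' => I j M' ∧ M' r = j)) :
    ∀ j M, I j M → M r = j →
      Runs (.whileNonzero r P) M (j * (τ + 1) + 1) (fun M' => I 0 M' ∧ M' r = 0)
  | 0, M, hI, hr => ⟨1, M, .whileFalse hr, by simp, hI, hr⟩
  | j + 1, M, hI, hr => by
    obtain ⟨t, M', h1, h2, h3, h4⟩ := step j M hI hr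
    obtain ⟨t', M'', h5, h6, h7⟩ := whileCount I step j M' h3 h4
    exact ⟨t + t' + 1, M'', .whileTrue (by omega) h1 h5, by
      rw [Nat.add_mul]; omega, h7⟩

end Runs

/-! ### A loop language on top of the machine -/

/-- A store: countably many cells in each of countably many arrays. -/
abbrev Store : Type := ℕ → ℕ → ℕ

/-- Expressions over numbered variables and arrays. -/
inductive Exp : Type
  | const (c : ℕ) : Exp
  | var (v : ℕ) : Exp
  | read (a : ℕ) (i : Exp) : Exp
  | add (x y : Exp) : Exp
  | sub (x y : Exp) : Exp
  | mul (x y : Exp) : Exp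
  | div (x y : Exp) : Exp
  | ite (c x y : Exp) : Exp
  | sum (v : ℕ) (b e : Exp) : Exp

/-- The value of an expression. The first factor of a product, the dividend of a quotient and
the number of summands of a sum are cut off at `cap`: they are the numbers of iterations of
the loops that evaluate the expression, which therefore runs in a time that depends only
on `cap`. -/
def Exp.eval (cap : ℕ) (σ : Store) : Exp → (ℕ → ℕ) → ℕ
  | const c, _ => c
  | var v, ρ => ρ v
  | read a i, ρ => σ a (i.eval cap σ ρ)
  | add x y, ρ => x.eval cap σ ρ + y.eval cap σ ρ
  | sub x y, ρ => x.eval cap σ ρ - y.eval cap σ ρ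
  | mul x y, ρ => min (x.eval cap σ ρ) cap * y.eval cap σ ρ
  | div x y, ρ => min (x.eval cap σ ρ) cap / y.eval cap σ ρ
  | ite c x y, ρ => if c.eval cap σ ρ ≠ 0 then x.eval cap σ ρ else y.eval cap σ ρ
  | sum v b e, ρ => ∑ i ∈ Finset.range (min (b.eval cap σ ρ) cap),
      e.eval cap σ (Function.update ρ v i)

/-- Commands: assignment to an array cell, sequential composition, and bounded loops. -/
inductive Cmd : Type
  | set (a : ℕ) (i e : Exp) : Cmd
  | seq (c d : Cmd) : Cmd
  | loop (v : ℕ) (b : Exp) (c : Cmd) : Cmd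

/-- `F (k - 1) ∘ ⋯ ∘ F 0`. -/
def iter {α : Type} (F : ℕ → α → α) : ℕ → α → α
  | 0, s => s
  | k + 1, s => F k (iter F k s)

/-- The store with the cell `i` of the array `a` set to `x`. -/
def Store.set (σ : Store) (a i x : ℕ) : Store :=
  Function.update σ a (Function.update (σ a) i x)

/-- The effect of a command on the store, when the variables have the values `ρ`. -/
def Cmd.run (cap : ℕ) : Cmd → (ℕ → ℕ) → Store → Store
  | set a i e, ρ, σ => σ.set a (i.eval cap σ ρ) (e.eval cap σ ρ)
  | seq c d, ρ, σ => d.run cap ρ (c.run cap ρ σ)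
  | loop v b c, ρ, σ =>
      iter (fun i s => c.run cap (Function.update ρ v i) s) (min (b.eval cap σ ρ) cap) σ

/-- `Γ` contains the variables in scope; no loop reuses a variable in scope, and there are `16`
arrays. -/
def Exp.wf : List ℕ → Exp → Bool
  | _, const _ => true
  | Γ, var v => Γ.contains v
  | Γ, read a i => decide (a < 16) && i.wf Γ
  | Γ, add x y => x.wf Γ && y.wf Γ
  | Γ, sub x y => x.wf Γ && y.wf Γ
  | Γ, mul x y => x.wf Γ && y.wf Γ
  | Γ, div x y => x.wf Γ && y.wf Γ
  | Γ, ite c x y => c.wf Γ && x.wf Γ && y.wf Γ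
  | Γ, sum v b e => !Γ.contains v && b.wf Γ && e.wf (v :: Γ)

/-- The analogue of `Exp.wf` for commands. -/
def Cmd.wf : List ℕ → Cmd → Bool
  | Γ, set a i e => decide (a < 16) && i.wf Γ && e.wf Γ
  | Γ, seq c d => c.wf Γ && d.wf Γ
  | Γ, loop v b c => !Γ.contains v && b.wf Γ && c.wf (v :: Γ)

/-! ### Compilation

Register `0` holds the cut-off, register `4 v + 1` the variable `v`, register `4 k + 3` the
temporary `k`, and register `32 i + 2 a + 2` the cell `i` of the array `a`. -/

local infixr:60 " ;; " => Program.seq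

/-- Cuts off the temporary `k`. -/
def clampCode (k : ℕ) : Program :=
  .sub (4 * (k + 1) + 3) (4 * k + 3) 0 ;; .sub (4 * k + 3) (4 * k + 3) (4 * (k + 1) + 3)

/-- Turns the temporary `k` from an index into the array `a` to the address of the cell. -/
def addrCode (a k : ℕ) : Program :=
  .const (4 * (k + 1) + 3) (2 * a + 2) ;;
  .add (4 * k + 3) (4 * k + 3) (4 * k + 3) ;; .add (4 * k + 3) (4 * k + 3) (4 * k + 3) ;;
  .add (4 * k + 3) (4 * k + 3) (4 * k + 3) ;; .add (4 * k + 3) (4 * k + 3) (4 * k + 3) ;;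
  .add (4 * k + 3) (4 * k + 3) (4 * k + 3) ;; .add (4 * k + 3) (4 * k + 3) (4 * (k + 1) + 3)

/-- Multiplies the temporaries `k` and `k + 1` into the temporary `k`. -/
def mulCode (k : ℕ) : Program :=
  .const (4 * (k + 2) + 3) 0 ;; .const (4 * (k + 3) + 3) 1 ;;
  .whileNonzero (4 * k + 3)
    (.add (4 * (k + 2) + 3) (4 * (k + 2) + 3) (4 * (k + 1) + 3) ;;
     .sub (4 * k + 3) (4 * k + 3) (4 * (k + 3) + 3)) ;;
  .add (4 * k + 3) (4 * k + 3) (4 * (k + 2) + 3)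

/-- Divides the temporary `k` by the temporary `k + 1`. -/
def divCode (k : ℕ) : Program :=
  .const (4 * (k + 2) + 3) 0 ;; .const (4 * (k + 3) + 3) 1 ;;
  .add (4 * (k + 4) + 3) (4 * k + 3) (4 * (k + 2) + 3) ;;
  .ifNonzero (4 * (k + 1) + 3)
    (.whileNonzero (4 * (k + 4) + 3)
      (.add (4 * (k + 5) + 3) (4 * k + 3) (4 * (k + 3) + 3) ;;
       .sub (4 * (k + 5) + 3) (4 * (k + 5) + 3) (4 * (k + 1) + 3) ;;
       .ifNonzero (4 * (k + 5) + 3)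
         (.sub (4 * k + 3) (4 * k + 3) (4 * (k + 1) + 3) ;;
          .add (4 * (k + 2) + 3) (4 * (k + 2) + 3) (4 * (k + 3) + 3))
         (.const (4 * (k + 5) + 3) 0) ;;
       .sub (4 * (k + 4) + 3) (4 * (k + 4) + 3) (4 * (k + 3) + 3)))
    (.const (4 * (k + 5) + 3) 0) ;;
  .const (4 * k + 3) 0 ;; .add (4 * k + 3) (4 * k + 3) (4 * (k + 2) + 3)

/-- The program that evaluates an expression into the temporary `k`. -/
def Exp.code : Exp → ℕ → Program
  | const c, k => .const (4 * k + 3) c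
  | var v, k => .const (4 * k + 3) 0 ;; .add (4 * k + 3) (4 * k + 3) (4 * v + 1)
  | read a i, k => i.code k ;; addrCode a k ;; .load (4 * k + 3) (4 * k + 3)
  | add x y, k => x.code k ;; y.code (k + 1) ;; .add (4 * k + 3) (4 * k + 3) (4 * (k + 1) + 3)
  | sub x y, k => x.code k ;; y.code (k + 1) ;; .sub (4 * k + 3) (4 * k + 3) (4 * (k + 1) + 3)
  | mul x y, k => x.code k ;; clampCode k ;; y.code (k + 1) ;; mulCode k
  | div x y, k => x.code k ;; clampCode k ;; y.code (k + 1) ;; divCode k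
  | ite c x y, k => c.code k ;; .ifNonzero (4 * k + 3) (x.code k) (y.code k)
  | sum v b e, k => b.code k ;; clampCode k ;;
      .const (4 * (k + 1) + 3) 0 ;; .const (4 * v + 1) 0 ;;
      .whileNonzero (4 * k + 3)
        (e.code (k + 2) ;; .add (4 * (k + 1) + 3) (4 * (k + 1) + 3) (4 * (k + 2) + 3) ;;
         .const (4 * (k + 2) + 3) 1 ;; .add (4 * v + 1) (4 * v + 1) (4 * (k + 2) + 3) ;;
         .sub (4 * k + 3) (4 * k + 3) (4 * (k + 2) + 3)) ;;
      .add (4 * k + 3) (4 * k + 3) (4 * (k + 1) + 3)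

/-- The program that executes a command, using only the temporaries from `k` on. -/
def Cmd.code : Cmd → ℕ → Program
  | set a i e, k => i.code k ;; addrCode a k ;; e.code (k + 1) ;;
      .store (4 * k + 3) (4 * (k + 1) + 3)
  | seq c d, k => c.code k ;; d.code k
  | loop v b c, k => b.code k ;; clampCode k ;; .const (4 * v + 1) 0 ;;
      .whileNonzero (4 * k + 3)
        (c.code (k + 1) ;;
         .const (4 * (k + 1) + 3) 1 ;; .add (4 * v + 1) (4 * v + 1) (4 * (k + 1) + 3) ;;
         .sub (4 * k + 3) (4 * k + 3) (4 * (k + 1) + 3))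

/-- A bound for the time that the evaluation of an expression takes. -/
def Exp.time (cap : ℕ) : Exp → ℕ
  | const _ => 1
  | var _ => 2
  | read _ i => i.time cap + 8
  | add x y => x.time cap + y.time cap + 1
  | sub x y => x.time cap + y.time cap + 1
  | mul x y => x.time cap + y.time cap + (cap * 3 + 6)
  | div x y => x.time cap + y.time cap + (cap * 7 + 9)
  | ite c x y => c.time cap + x.time cap + y.time cap + 1
  | sum _ b e => b.time cap + cap * (e.time cap + 5) + 6

/-- A bound for the time that the execution of a command takes. -/
def Cmd.time (cap : ℕ) : Cmd → ℕ
  | set _ i e => i.time cap + e.time cap + 8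
  | seq c d => c.time cap + d.time cap
  | loop _ b c => b.time cap + cap * (c.time cap + 4) + 4

/-- The memory `M` represents the cut-off, the variables in `Γ`, and the store. -/
structure Rep (cap : ℕ) (Γ : List ℕ) (ρ : ℕ → ℕ) (σ : Store) (M : Memory) : Prop where
  cap_eq : M 0 = cap
  var_eq : ∀ v ∈ Γ, M (4 * v + 1) = ρ v
  cell_eq : ∀ a < 16, ∀ i, M (32 * i + 2 * a + 2) = σ a i

namespace Rep

variable {cap : ℕ} {Γ : List ℕ} {ρ : ℕ → ℕ} {σ : Store} {M : Memory}

theorem tmp (h : Rep cap Γ ρ σ M) (k x : ℕ) : Rep cap Γ ρ σ (Function.update M (4 * k + 3) x) where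
  cap_eq := by rw [Function.update_of_ne (by omega)]; exact h.cap_eq
  var_eq v hv := by rw [Function.update_of_ne (by omega)]; exact h.var_eq v hv
  cell_eq a ha i := by rw [Function.update_of_ne (by omega)]; exact h.cell_eq a ha i

theorem var (h : Rep cap Γ ρ σ M) {v : ℕ} (hv : v ∉ Γ) (x : ℕ) :
    Rep cap Γ ρ σ (Function.update M (4 * v + 1) x) where
  cap_eq := by rw [Function.update_of_ne (by omega)]; exact h.cap_eq
  var_eq w hw := by
    have : w ≠ v := fun e => hv (e ▸ hw)
    rw [Function.update_of_ne (by omega)]; exact h.var_eq w hw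
  cell_eq a ha i := by rw [Function.update_of_ne (by omega)]; exact h.cell_eq a ha i

theorem cons (h : Rep cap Γ ρ σ M) {v : ℕ} (hv : v ∉ Γ) {x : ℕ} (hx : M (4 * v + 1) = x) :
    Rep cap (v :: Γ) (Function.update ρ v x) σ M where
  cap_eq := h.cap_eq
  var_eq w hw := by
    by_cases e : w = v
    · subst e; simpa using hx
    · rw [Function.update_of_ne e]
      exact h.var_eq w (by simpa [e] using hw)
  cell_eq := h.cell_eq

theorem tail {v x : ℕ} (h : Rep cap (v :: Γ) (Function.update ρ v x) σ M) (hv : v ∉ Γ) :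
    Rep cap Γ ρ σ M where
  cap_eq := h.cap_eq
  var_eq w hw := by
    rw [h.var_eq w (List.mem_cons_of_mem _ hw), Function.update_of_ne]
    exact fun e => hv (e ▸ hw)
  cell_eq := h.cell_eq

theorem set (h : Rep cap Γ ρ σ M) {a : ℕ} (ha : a < 16) (i x : ℕ) :
    Rep cap Γ ρ (σ.set a i x) (Function.update M (32 * i + 2 * a + 2) x) where
  cap_eq := by rw [Function.update_of_ne (by omega)]; exact h.cap_eq
  var_eq w hw := by rw [Function.update_of_ne (by omega)]; exact h.var_eq w hw
  cell_eq b hb j := by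
    unfold Store.set
    by_cases e : b = a
    · subst e
      by_cases e' : j = i
      · subst e'; simp
      · rw [Function.update_of_ne (by omega), Function.update_self, Function.update_of_ne e']
        exact h.cell_eq b hb j
    · rw [Function.update_of_ne (by omega), Function.update_of_ne e]
      exact h.cell_eq b hb j

end Rep

/-- What holds after an evaluation into the temporary `k`: the value `x` is there, and the
represented data and the lower temporaries have not changed. -/
def Done (cap : ℕ) (Γ : List ℕ) (ρ : ℕ → ℕ) (σ : Store) (k x : ℕ) (M M' : Memory) : Prop :=
  M' (4 * k + 3) = x ∧ Rep cap Γ ρ σ M' ∧ ∀ j < k, M' (4 * j + 3) = M (4 * j + 3)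

section Compile

variable {cap : ℕ} {Γ : List ℕ} {ρ : ℕ → ℕ} {σ : Store} {M : Memory}

theorem runs_clampCode (h : Rep cap Γ ρ σ M) (k : ℕ) :
    Runs (clampCode k) M 2 (Done cap Γ ρ σ k (min (M (4 * k + 3)) cap) M) := by
  refine .seq (.sub (.sub ⟨?_, (h.tmp _ _).tmp _ _, fun j hj => ?_⟩))
  · simp (disch := omega) only [Function.update_self, Function.update_of_ne, h.cap_eq]; omega
  · simp (disch := omega) only [Function.update_of_ne]

theorem runs_addrCode (h : Rep cap Γ ρ σ M) (a k : ℕ) :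
    Runs (addrCode a k) M 7 (Done cap Γ ρ σ k (32 * M (4 * k + 3) + 2 * a + 2) M) := by
  refine .seq (.const (.seq (.add (.seq (.add (.seq (.add (.seq (.add (.seq (.add (.add
    ⟨?_, ((((((h.tmp _ _).tmp _ _).tmp _ _).tmp _ _).tmp _ _).tmp _ _).tmp _ _,
      fun j hj => ?_⟩))))))))))))
  · simp (disch := omega) only [Function.update_self, Function.update_of_ne]; omega
  · simp (disch := omega) only [Function.update_of_ne]

theorem runs_mulCode (h : Rep cap Γ ρ σ M) (k : ℕ) (hM : M (4 * k + 3) ≤ cap) :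
    Runs (mulCode k) M (cap * 3 + 4)
      (Done cap Γ ρ σ k (M (4 * k + 3) * M (4 * (k + 1) + 3)) M) := by
  refine .mono (τ := 1 + (1 + ((M (4 * k + 3) * (1 + 1 + 1) + 1) + 1))) (Q := Done cap Γ ρ σ k
    (M (4 * k + 3) * M (4 * (k + 1) + 3)) M) (.seq (.const (.seq (.const (.seq ?_)))))
    (by omega) (fun _ h => h)
  refine .mono (.whileCount (τ := 1 + 1) (fun j M' => Rep cap Γ ρ σ M' ∧
      M' (4 * (k + 3) + 3) = 1 ∧ M' (4 * (k + 1) + 3) = M (4 * (k + 1) + 3) ∧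
      M' (4 * (k + 2) + 3) + j * M (4 * (k + 1) + 3) = M (4 * k + 3) * M (4 * (k + 1) + 3) ∧
      ∀ j < k, M' (4 * j + 3) = M (4 * j + 3)) ?_ (M (4 * k + 3)) _ ?_ ?_) le_rfl ?_
  · rintro j N ⟨hN, h1, h2, h3, h4⟩ h5
    refine .seq (.add (.sub ⟨⟨(hN.tmp _ _).tmp _ _, ?_, ?_, ?_, fun i hi => ?_⟩, ?_⟩))
    · simp (disch := omega) only [Function.update_of_ne, h1]
    · simp (disch := omega) only [Function.update_of_ne, h2]
    · simp (disch := omega) only [Function.update_of_ne, Function.update_self, h2]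
      rw [← h3]; ring
    · simp (disch := omega) only [Function.update_of_ne, h4]
    · simp (disch := omega) only [Function.update_of_ne, Function.update_self, h5, h1]; omega
  · refine ⟨(h.tmp _ _).tmp _ _, ?_, ?_, ?_, fun i hi => ?_⟩ <;>
      simp (disch := omega) only [Function.update_of_ne, Function.update_self, zero_add]
  · simp (disch := omega) only [Function.update_of_ne]
  · rintro N ⟨⟨hN, h1, h2, h3, h4⟩, h5⟩
    refine .add ⟨?_, hN.tmp _ _, fun i hi => ?_⟩
    · simp (disch := omega) only [Function.update_self, h5]; omega
    · simp (disch := omega) only [Function.update_of_ne, h4]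

set_option maxHeartbeats 1000000 in
theorem runs_divCode (h : Rep cap Γ ρ σ M) (k : ℕ) (hM : M (4 * k + 3) ≤ cap) :
    Runs (divCode k) M (cap * 7 + 7)
      (Done cap Γ ρ σ k (M (4 * k + 3) / M (4 * (k + 1) + 3)) M) := by
  set a := M (4 * k + 3) with ha
  set b := M (4 * (k + 1) + 3) with hb
  refine .mono (τ := 1 + (1 + (1 + ((max (a * (1 + (1 + ((max (1 + 1) 1 + 1) + 1)) + 1) + 1) 1 + 1)
    + (1 + 1))))) (Q := Done cap Γ ρ σ k (a / b) M)
    (.seq (.const (.seq (.const (.seq (.add (.seq ?_)))))))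
    (by simp only [Nat.reduceAdd, Nat.max_def]; split_ifs <;> omega) (fun _ h => h)
  have fin : ∀ N : Memory, Rep cap Γ ρ σ N → N (4 * (k + 2) + 3) = a / b →
      (∀ j < k, N (4 * j + 3) = M (4 * j + 3)) →
      Runs (.const (4 * k + 3) 0 ;; .add (4 * k + 3) (4 * k + 3) (4 * (k + 2) + 3)) N (1 + 1)
        (Done cap Γ ρ σ k (a / b) M) := by
    intro N hN h1 h2
    refine .seq (.const (.add ⟨?_, (hN.tmp _ _).tmp _ _, fun i hi => ?_⟩))
    · simp (disch := omega) only [Function.update_self, Function.update_of_ne, h1]; omega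
    · simp (disch := omega) only [Function.update_of_ne, h2]
  refine .ifNonzero (fun h0 => ?_) (fun h0 => ?_)
  · simp (disch := omega) only [Function.update_of_ne] at h0
    refine .mono (.whileCount (τ := 1 + (1 + ((max (1 + 1) 1 + 1) + 1)))
      (fun j M' => Rep cap Γ ρ σ M' ∧
      M' (4 * (k + 3) + 3) = 1 ∧ M' (4 * (k + 1) + 3) = b ∧
      M' (4 * (k + 2) + 3) * b + M' (4 * k + 3) = a ∧
      (M' (4 * k + 3) ≤ j ∨ M' (4 * k + 3) < b) ∧
      ∀ j < k, M' (4 * j + 3) = M (4 * j + 3)) ?_ a _ ?_ ?_) le_rfl ?_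
    · rintro j N ⟨hN, h1, h2, h3, h3', h4⟩ h5
      refine .seq (.add (.seq (.sub (.seq (.ifNonzero (fun h6 => .seq (.sub (.add (.sub
        ⟨⟨((((hN.tmp _ _).tmp _ _).tmp _ _).tmp _ _).tmp _ _, ?_, ?_, ?_, ?_, fun i hi => ?_⟩,
            ?_⟩))))
        (fun h6 => .const (.sub
        ⟨⟨(((hN.tmp _ _).tmp _ _).tmp _ _).tmp _ _, ?_, ?_, ?_, ?_, fun i hi => ?_⟩, ?_⟩)))))))
      all_goals
        simp (disch := omega) only [Function.update_of_ne, Function.update_self, h1, h2] at h6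
        simp (disch := omega) only [Function.update_of_ne, Function.update_self, h1, h2, h5, h4]
      · rw [Nat.add_mul, ← h3]; omega
      · omega
      · rfl
      · exact h3
      · omega
      · rfl
    · refine ⟨((h.tmp _ _).tmp _ _).tmp _ _, ?_, ?_, ?_, ?_, fun i hi => ?_⟩ <;>
      simp (disch := omega) only [Function.update_of_ne, Function.update_self]
      · exact hb.symm
      · rw [zero_mul, zero_add]
      · exact .inl le_rfl
    · simp (disch := omega) only [Function.update_of_ne, Function.update_self]; omega
    · rintro N ⟨⟨hN, h1, h2, h3, h3', h4⟩, h5⟩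
      refine fin N hN ?_ h4
      have hb0 : 0 < b := Nat.pos_of_ne_zero h0
      rw [← h3, mul_comm _ b, Nat.mul_add_div hb0, Nat.div_eq_of_lt (by omega), add_zero]
  · simp (disch := omega) only [Function.update_of_ne] at h0
    refine .const (fin _ ((((h.tmp _ _).tmp _ _).tmp _ _).tmp _ _) ?_ fun i hi => ?_)
    · simp (disch := omega) only [Function.update_of_ne, Function.update_self]
      rw [hb, h0, Nat.div_zero]
    · simp (disch := omega) only [Function.update_of_ne]

/-- The compiled expression leaves its value in the temporary `k`, in time `Exp.time`. -/
theorem Exp.runs_code (e : Exp) : ∀ (Γ : List ℕ) (ρ : ℕ → ℕ) (k : ℕ) (M : Memory),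
    e.wf Γ = true → Rep cap Γ ρ σ M →
    Runs (e.code k) M (e.time cap) (Done cap Γ ρ σ k (e.eval cap σ ρ) M) := by
  induction e with
  | const c =>
    intro Γ ρ k M _ h
    refine .const ⟨by simp [Exp.eval], h.tmp _ _, fun j hj => ?_⟩
    simp (disch := omega) only [Function.update_of_ne]
  | var v =>
    intro Γ ρ k M hw h
    refine .seq (.const (.add ⟨?_, (h.tmp _ _).tmp _ _, fun j hj => ?_⟩))
    · simp (disch := omega) only [Function.update_of_ne, Function.update_self]
      rw [h.var_eq v (by simpa [Exp.wf] using hw), zero_add]; rfl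
    · simp (disch := omega) only [Function.update_of_ne]
  | read a i ih =>
    intro Γ ρ k M hw h
    simp only [Exp.wf, Bool.and_eq_true, decide_eq_true_eq] at hw
    refine .mono (.seq (.mono (ih Γ ρ k M hw.2 h) le_rfl ?_)) (le_refl (_ + (7 + 1))) fun _ h => h
    rintro N ⟨h1, h2, h3⟩
    refine .seq (.mono (runs_addrCode h2 a k) le_rfl ?_)
    rintro N' ⟨h1', h2', h3'⟩
    refine .load ⟨?_, h2'.tmp _ _, fun j hj => ?_⟩
    · simp (disch := omega) only [Function.update_self, h1', h1, h2'.cell_eq a hw.1]; rfl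
    · simp (disch := omega) only [Function.update_of_ne, h3' j hj, h3 j hj]
  | add x y ihx ihy =>
    intro Γ ρ k M hw h
    simp only [Exp.wf, Bool.and_eq_true] at hw
    refine .mono (.seq (.mono (ihx Γ ρ k M hw.1 h) le_rfl ?_)) (le_of_eq (add_assoc _ _ _).symm)
      fun _ h => h
    rintro N ⟨h1, h2, h3⟩
    refine .seq (.mono (ihy Γ ρ (k + 1) N hw.2 h2) le_rfl ?_)
    rintro N' ⟨h1', h2', h3'⟩
    refine .add ⟨?_, h2'.tmp _ _, fun j hj => ?_⟩
    · simp (disch := omega) only [Function.update_self, h1', h3' k (by omega), h1]; rfl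
    · simp (disch := omega) only [Function.update_of_ne, h3' j (by omega), h3 j hj]
  | sub x y ihx ihy =>
    intro Γ ρ k M hw h
    simp only [Exp.wf, Bool.and_eq_true] at hw
    refine .mono (.seq (.mono (ihx Γ ρ k M hw.1 h) le_rfl ?_)) (le_of_eq (add_assoc _ _ _).symm)
      fun _ h => h
    rintro N ⟨h1, h2, h3⟩
    refine .seq (.mono (ihy Γ ρ (k + 1) N hw.2 h2) le_rfl ?_)
    rintro N' ⟨h1', h2', h3'⟩
    refine .sub ⟨?_, h2'.tmp _ _, fun j hj => ?_⟩
    · simp (disch := omega) only [Function.update_self, h1', h3' k (by omega), h1]; rfl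
    · simp (disch := omega) only [Function.update_of_ne, h3' j (by omega), h3 j hj]
  | mul x y ihx ihy =>
    intro Γ ρ k M hw h
    simp only [Exp.wf, Bool.and_eq_true] at hw
    refine .mono (.seq (.mono (ihx Γ ρ k M hw.1 h) le_rfl ?_))
      (τ := x.time cap + (2 + (y.time cap + (cap * 3 + 4))))
        (by simp only [Exp.time]; omega) fun _ h => h
    rintro N ⟨h1, h2, h3⟩
    refine .seq (.mono (runs_clampCode h2 k) le_rfl ?_)
    rintro N' ⟨h1', h2', h3'⟩
    refine .seq (.mono (ihy Γ ρ (k + 1) N' hw.2 h2') le_rfl ?_)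
    rintro N'' ⟨h1'', h2'', h3''⟩
    refine .mono (runs_mulCode h2'' k (by rw [h3'' k (by omega), h1']; omega)) le_rfl ?_
    rintro N''' ⟨h1''', h2''', h3'''⟩
    refine ⟨?_, h2''', fun j hj => ?_⟩
    · rw [h1''', h3'' k (by omega), h1', h1, h1'']; rfl
    · rw [h3''' j hj, h3'' j (by omega), h3' j hj, h3 j hj]
  | div x y ihx ihy =>
    intro Γ ρ k M hw h
    simp only [Exp.wf, Bool.and_eq_true] at hw
    refine .mono (.seq (.mono (ihx Γ ρ k M hw.1 h) le_rfl ?_))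
      (τ := x.time cap + (2 + (y.time cap + (cap * 7 + 7))))
        (by simp only [Exp.time]; omega) fun _ h => h
    rintro N ⟨h1, h2, h3⟩
    refine .seq (.mono (runs_clampCode h2 k) le_rfl ?_)
    rintro N' ⟨h1', h2', h3'⟩
    refine .seq (.mono (ihy Γ ρ (k + 1) N' hw.2 h2') le_rfl ?_)
    rintro N'' ⟨h1'', h2'', h3''⟩
    refine .mono (runs_divCode h2'' k (by rw [h3'' k (by omega), h1']; omega)) le_rfl ?_
    rintro N''' ⟨h1''', h2''', h3'''⟩
    refine ⟨?_, h2''', fun j hj => ?_⟩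
    · rw [h1''', h3'' k (by omega), h1', h1, h1'']; rfl
    · rw [h3''' j hj, h3'' j (by omega), h3' j hj, h3 j hj]
  | ite c x y ihc ihx ihy =>
    intro Γ ρ k M hw h
    simp only [Exp.wf, Bool.and_eq_true] at hw
    refine .mono (.seq (.mono (ihc Γ ρ k M hw.1.1 h) le_rfl ?_)) (τ := c.time cap +
      (max (x.time cap) (y.time cap) + 1))
        (by simp only [Exp.time, Nat.max_def]; split_ifs <;> omega)
      fun _ h => h
    rintro N ⟨h1, h2, h3⟩
    refine .ifNonzero (fun h0 => ?_) (fun h0 => ?_) <;> rw [h1] at h0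
    · refine .mono (ihx Γ ρ k N hw.1.2 h2) le_rfl ?_
      rintro N' ⟨h1', h2', h3'⟩
      exact ⟨by rw [h1', Exp.eval, if_pos h0], h2', fun j hj => by rw [h3' j hj, h3 j hj]⟩
    · refine .mono (ihy Γ ρ k N hw.2 h2) le_rfl ?_
      rintro N' ⟨h1', h2', h3'⟩
      exact ⟨by rw [h1', Exp.eval, if_neg (not_not.2 h0)], h2',
        fun j hj => by rw [h3' j hj, h3 j hj]⟩
  | sum v b e ihb ihe =>
    intro Γ ρ k M hw h
    simp only [Exp.wf, Bool.and_eq_true, Bool.not_eq_true', List.contains_eq_mem,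
      decide_eq_false_iff_not] at hw
    obtain ⟨⟨hv, hb⟩, he⟩ := hw
    set c := min (b.eval cap σ ρ) cap with hc
    refine .mono (.seq (.mono (ihb Γ ρ k M hb h) le_rfl ?_)) (τ := b.time cap +
      (2 + (1 + (1 + ((c * (e.time cap + (1 + (1 + (1 + 1))) + 1) + 1) + 1))))) ?_ fun _ h => h
    swap
    · have : c * (e.time cap + 5) ≤ cap * (e.time cap + 5) :=
        Nat.mul_le_mul_right _ (min_le_right _ _)
      simp only [Exp.time, Nat.reduceAdd, add_assoc] at *; omega
    rintro N ⟨h1, h2, h3⟩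
    refine .seq (.mono (runs_clampCode h2 k) le_rfl ?_)
    rintro N' ⟨h1', h2', h3'⟩
    rw [h1, ← hc] at h1'
    refine .seq (.const (.seq (.const (.seq ?_))))
    refine .mono (.whileCount (τ := e.time cap + (1 + (1 + (1 + 1))))
      (fun j M' => Rep cap Γ ρ σ M' ∧ j ≤ c ∧ M' (4 * v + 1) = c - j ∧
      M' (4 * (k + 1) + 3) = ∑ i ∈ Finset.range (c - j), e.eval cap σ (Function.update ρ v i) ∧
      ∀ j < k, M' (4 * j + 3) = M (4 * j + 3)) ?_ c _ ?_ ?_) le_rfl ?_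
    · rintro j L ⟨g1, g2, g3, g4, g5⟩ g6
      refine .seq (.mono (ihe _ _ (k + 2) L he (g1.cons hv g3)) le_rfl ?_)
      rintro L' ⟨f1, f2, f3⟩
      refine .seq (.add (.seq (.const (.seq (.add (.sub
        ⟨⟨((((f2.tail hv).tmp _ _).tmp _ _).var hv _).tmp _ _, ?_, ?_, ?_, fun i hi => ?_⟩,
            ?_⟩))))))
      · omega
      · have := f2.var_eq v (by simp)
        simp (disch := omega) only [Function.update_of_ne, Function.update_self, this]
        omega
      · simp (disch := omega) only [Function.update_of_ne, Function.update_self, f1,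
          f3 (k + 1) (by omega), g4]
        rw [show c - j = c - (j + 1) + 1 by omega, Finset.sum_range_succ]
      · simp (disch := omega) only [Function.update_of_ne, f3 i (by omega), g5 i hi]
      · simp (disch := omega) only [Function.update_of_ne, Function.update_self,
          f3 k (by omega), g6]
        omega
    · refine ⟨(h2'.tmp _ _).var hv _, le_rfl, ?_, ?_, fun i hi => ?_⟩
      · simp
      · simp (disch := omega) only [Function.update_of_ne, Function.update_self]; simp
      · simp (disch := omega) only [Function.update_of_ne, h3' i hi, h3 i hi]
    · simp (disch := omega) only [Function.update_of_ne, h1']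
    · rintro L ⟨⟨g1, g2, g3, g4, g5⟩, g6⟩
      refine .add ⟨?_, g1.tmp _ _, fun i hi => ?_⟩
      · simp only [Function.update_self, g6, g4, Nat.sub_zero, zero_add]; rfl
      · simp (disch := omega) only [Function.update_of_ne, g5 i hi]

/-- The compiled command transforms the represented store as `Cmd.run` does, in time `Cmd.time`. -/
theorem Cmd.runs_code (c : Cmd) : ∀ (Γ : List ℕ) (ρ : ℕ → ℕ) (σ : Store) (k : ℕ) (M : Memory),
    c.wf Γ = true → Rep cap Γ ρ σ M →
    Runs (c.code k) M (c.time cap) (fun M' => Rep cap Γ ρ (c.run cap ρ σ) M' ∧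
      ∀ j < k, M' (4 * j + 3) = M (4 * j + 3)) := by
  induction c with
  | set a i e =>
    intro Γ ρ σ k M hw h
    simp only [Cmd.wf, Bool.and_eq_true, decide_eq_true_eq] at hw
    refine .mono (.seq (.mono (i.runs_code Γ ρ k M hw.1.2 h) le_rfl ?_))
      (τ := i.time cap + (7 + (e.time cap + 1))) (by simp only [Cmd.time]; omega) fun _ h => h
    rintro N ⟨h1, h2, h3⟩
    refine .seq (.mono (runs_addrCode h2 a k) le_rfl ?_)
    rintro N' ⟨h1', h2', h3'⟩
    refine .seq (.mono (e.runs_code Γ ρ (k + 1) N' hw.2 h2') le_rfl ?_)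
    rintro N'' ⟨h1'', h2'', h3''⟩
    rw [h1] at h1'
    refine .store ?_
    rw [h1'', h3'' k (by omega), h1']
    refine ⟨h2''.set hw.1.1 _ _, fun j hj => ?_⟩
    rw [Function.update_of_ne (by omega), h3'' j (by omega), h3' j hj, h3 j hj]
  | seq c d ihc ihd =>
    intro Γ ρ σ k M hw h
    simp only [Cmd.wf, Bool.and_eq_true] at hw
    refine .seq (.mono (ihc Γ ρ σ k M hw.1 h) le_rfl ?_)
    rintro N ⟨h1, h2⟩
    refine .mono (ihd Γ ρ _ k N hw.2 h1) le_rfl ?_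
    rintro N' ⟨h1', h2'⟩
    exact ⟨h1', fun j hj => by rw [h2' j hj, h2 j hj]⟩
  | loop v b c ih =>
    intro Γ ρ σ k M hw h
    simp only [Cmd.wf, Bool.and_eq_true, Bool.not_eq_true', List.contains_eq_mem,
      decide_eq_false_iff_not] at hw
    obtain ⟨⟨hv, hb⟩, hc⟩ := hw
    set n := min (b.eval cap σ ρ) cap with hn
    refine .mono (.seq (.mono (b.runs_code Γ ρ k M hb h) le_rfl ?_)) (τ := b.time cap +
      (2 + (1 + (n * (c.time cap + (1 + (1 + 1)) + 1) + 1)))) ?_ fun _ h => h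
    swap
    · have : n * (c.time cap + 4) ≤ cap * (c.time cap + 4) :=
        Nat.mul_le_mul_right _ (min_le_right _ _)
      simp only [Cmd.time, Nat.reduceAdd, add_assoc] at *; omega
    rintro N ⟨h1, h2, h3⟩
    refine .seq (.mono (runs_clampCode h2 k) le_rfl ?_)
    rintro N' ⟨h1', h2', h3'⟩
    rw [h1, ← hn] at h1'
    refine .seq (.const ?_)
    refine .mono (.whileCount (τ := c.time cap + (1 + (1 + 1)))
      (fun j M' => j ≤ n ∧ Rep cap Γ ρ
        (iter (fun i s => c.run cap (Function.update ρ v i) s) (n - j) σ) M' ∧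
        M' (4 * v + 1) = n - j ∧
        ∀ j < k, M' (4 * j + 3) = M (4 * j + 3)) ?_ n _ ?_ ?_) le_rfl ?_
    · rintro j L ⟨g2, g1, g3, g5⟩ g6
      refine .seq (.mono (ih _ _ _ (k + 1) L hc (g1.cons hv g3)) le_rfl ?_)
      rintro L' ⟨f2, f3⟩
      refine .seq (.const (.seq (.add (.sub
        ⟨⟨by omega, ?_, ?_, fun i hi => ?_⟩, ?_⟩))))
      · rw [show n - j = n - (j + 1) + 1 by omega]
        exact ((((f2.tail hv).tmp _ _).var hv _).tmp _ _)
      · have := f2.var_eq v (by simp)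
        simp (disch := omega) only [Function.update_of_ne, Function.update_self, this]
        omega
      · simp (disch := omega) only [Function.update_of_ne, f3 i (by omega), g5 i hi]
      · simp (disch := omega) only [Function.update_of_ne, Function.update_self,
          f3 k (by omega), g6]
        omega
    · refine ⟨le_rfl, ?_, ?_, fun i hi => ?_⟩
      · simpa [iter] using h2'.var hv _
      · simp
      · simp (disch := omega) only [Function.update_of_ne, h3' i hi, h3 i hi]
    · simp (disch := omega) only [Function.update_of_ne, h1']
    · rintro L ⟨⟨g1, g2, g3, g4⟩, g6⟩
      exact ⟨by simpa [Cmd.run, hn] using g2, g4⟩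

end Compile

/-- `g` grows at most polynomially. -/
def PolyBounded (g : ℕ → ℕ) : Prop := ∃ κ, ∀ c, g c ≤ (c + 2) ^ κ

namespace PolyBounded

variable {f g : ℕ → ℕ}

theorem const (c : ℕ) : PolyBounded fun _ => c :=
  ⟨c, fun x => (Nat.lt_two_pow_self (n := c)).le.trans (Nat.pow_le_pow_left (by omega) _)⟩

theorem id : PolyBounded fun x => x := ⟨1, fun x => by simp⟩

theorem add (hf : PolyBounded f) (hg : PolyBounded g) : PolyBounded fun x => f x + g x := by
  obtain ⟨a, ha⟩ := hf
  obtain ⟨b, hb⟩ := hg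
  refine ⟨max a b + 1, fun x => ?_⟩
  have h1 := (ha x).trans (Nat.pow_le_pow_right (by omega) (le_max_left a b))
  have h2 := (hb x).trans (Nat.pow_le_pow_right (by omega) (le_max_right a b))
  calc f x + g x ≤ (x + 2) ^ max a b * 2 := by omega
    _ ≤ _ := by rw [pow_succ]; exact Nat.mul_le_mul_left _ (by omega)

theorem mul (hf : PolyBounded f) (hg : PolyBounded g) : PolyBounded fun x => f x * g x := by
  obtain ⟨a, ha⟩ := hf
  obtain ⟨b, hb⟩ := hg
  exact ⟨a + b, fun x => by rw [pow_add]; exact Nat.mul_le_mul (ha x) (hb x)⟩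

end PolyBounded

theorem Exp.polyBounded_time (e : Exp) : PolyBounded fun cap => e.time cap := by
  induction e with
  | const c => exact .const 1
  | var v => exact .const 2
  | read a i ih => exact ih.add (.const 8)
  | add x y ihx ihy | sub x y ihx ihy => exact (ihx.add ihy).add (.const 1)
  | mul x y ihx ihy => exact (ihx.add ihy).add ((PolyBounded.id.mul (.const 3)).add (.const 6))
  | div x y ihx ihy => exact (ihx.add ihy).add ((PolyBounded.id.mul (.const 7)).add (.const 9))
  | ite c x y ihc ihx ihy => exact ((ihc.add ihx).add ihy).add (.const 1)
  | sum v b e ihb ihe => exact (ihb.add (PolyBounded.id.mul (ihe.add (.const 5)))).add (.const 6)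

theorem Cmd.polyBounded_time (c : Cmd) : PolyBounded fun cap => c.time cap := by
  induction c with
  | set a i e => exact ((i.polyBounded_time).add e.polyBounded_time).add (.const 8)
  | seq c d ihc ihd => exact ihc.add ihd
  | loop v b c ih =>
    exact (b.polyBounded_time.add (PolyBounded.id.mul (ih.add (.const 4)))).add (.const 4)

end RAM

/-! ### Loading the input -/

namespace RAM

local infixr:60 " ;; " => Program.seq

/-- Branches on the registers in the list, whose contents `b` are then known to the program
`F b`. -/
def branch : List ℕ → ((ℕ → ℕ) → Program) → Program
  | [], F => F fun _ => 0
  | r :: l, F => .ifNonzero r (branch l fun b => F (Function.update b r 1))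
      (branch l fun b => F (Function.update b r 0))

theorem Runs.branch {M : Memory} {τ : ℕ} {Q : Memory → Prop} :
    ∀ (l : List ℕ) (F : (ℕ → ℕ) → Program), (∀ r ∈ l, M r ≤ 1) →
      (∀ b : ℕ → ℕ, (∀ r ∈ l, b r = M r) → Runs (F b) M τ Q) →
      Runs (branch l F) M (τ + l.length) Q
  | [], F, _, h => h _ (by simp)
  | r :: l, F, hM, h => by
    have key : ∀ x, M r = x → Runs (RAM.branch l fun b => F (Function.update b r x)) M
        (τ + l.length) Q := by
      intro x hx
      refine Runs.branch l _ (fun s hs => hM s (List.mem_cons_of_mem _ hs)) fun b hb => h _ ?_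
      intro s hs
      by_cases e : s = r
      · subst e; simp [hx]
      · rw [Function.update_of_ne e]; exact hb s (by simpa [e] using hs)
    refine .mono (.ifNonzero (fun h0 => key 1 ?_) (fun h0 => key 0 h0)) (by simp [add_assoc])
      fun _ h => h
    exact le_antisymm (hM r (by simp)) (Nat.pos_of_ne_zero h0)

section Instr

variable {M : Memory} {Q : Memory → Prop}

theorem Runs.add' {r a b : ℕ}
    (h : ∀ M' : Memory, M' r = M a + M b → (∀ x, x ≠ r → M' x = M x) → Q M') :
    Runs (.add r a b) M 1 Q :=
  .add (h _ (by simp) fun x hx => Function.update_of_ne hx _ _)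

theorem Runs.sub' {r a b : ℕ}
    (h : ∀ M' : Memory, M' r = M a - M b → (∀ x, x ≠ r → M' x = M x) → Q M') :
    Runs (.sub r a b) M 1 Q :=
  .sub (h _ (by simp) fun x hx => Function.update_of_ne hx _ _)

theorem Runs.const' {r c : ℕ}
    (h : ∀ M' : Memory, M' r = c → (∀ x, x ≠ r → M' x = M x) → Q M') :
    Runs (.const r c) M 1 Q :=
  .const (h _ (by simp) fun x hx => Function.update_of_ne hx _ _)

theorem Runs.load' {r a : ℕ}
    (h : ∀ M' : Memory, M' r = M (M a) → (∀ x, x ≠ r → M' x = M x) → Q M') :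
    Runs (.load r a) M 1 Q :=
  .load (h _ (by simp) fun x hx => Function.update_of_ne hx _ _)

theorem Runs.store' {r a y : ℕ} (hy : M a = y)
    (h : ∀ M' : Memory, M' y = M r → (∀ x, x ≠ y → M' x = M x) → Q M') :
    Runs (.store a r) M 1 Q :=
  .store (h _ (by simp [hy]) fun x hx => Function.update_of_ne (by rw [hy]; exact hx) _ _)

end Instr

/-- The body of the loop that moves one row of the truth table. -/
def moveRowCode : Program :=
  .sub 2 2 3 ;; .add 4 2 5 ;; .load 7 4 ;; .add 4 2 2 ;; .add 4 4 4 ;; .add 4 4 4 ;;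
  .add 4 4 4 ;; .add 4 4 4 ;; .add 4 4 5 ;; .store 4 7 ;; .sub 6 6 3

theorem runs_moveRowCode {M : Memory} {k j : ℕ} (h2 : M 2 = k + 1) (h3 : M 3 = 1) (h5 : M 5 = 2)
    (h6 : M 6 = j + 1) (hk : 6 ≤ k) :
    Runs moveRowCode M 11 (fun M' => M' 0 = M 0 ∧ M' 1 = M 1 ∧ M' 2 = k ∧ M' 3 = 1 ∧ M' 5 = 2 ∧
      M' 6 = j ∧ M' (32 * k + 2) = M (k + 2) ∧ ∀ x, 8 ≤ x → x ≠ 32 * k + 2 → M' x = M x) := by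
  refine .seq (.sub' fun M1 a1 b1 => .seq (.add' fun M2 a2 b2 => .seq (.load' fun M3 a3 b3 =>
    .seq (.add' fun M4 a4 b4 => .seq (.add' fun M5 a5 b5 => .seq (.add' fun M6 a6 b6 =>
    .seq (.add' fun M7 a7 b7 => .seq (.add' fun M8 a8 b8 => .seq (.add' fun M9 a9 b9 =>
    .seq (.store' (y := 32 * k + 2) ?_ fun M10 a10 b10 => .sub' fun M11 a11 b11 => ?_))))))))))
  · have e1 : M1 2 = k := by rw [a1, h2, h3]; rfl
    have e4 : M4 4 = k + k := by rw [a4, b3 2 (by omega), b2 2 (by omega), e1]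
    rw [a9, a8, a7, a6, a5, e4, b8 5 (by omega), b7 5 (by omega), b6 5 (by omega), b5 5 (by omega),
      b4 5 (by omega), b3 5 (by omega), b2 5 (by omega), b1 5 (by omega), h5]
    omega
  · have e1 : M1 2 = k := by rw [a1, h2, h3]; rfl
    have frame : ∀ x, x ≠ 2 → x ≠ 4 → x ≠ 6 → x ≠ 7 → x ≠ 32 * k + 2 → M11 x = M x := by
      intro x x2 x4 x6 x7 x8
      rw [b11 x x6, b10 x x8, b9 x x4, b8 x x4, b7 x x4, b6 x x4, b5 x x4, b4 x x4, b3 x x7,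
        b2 x x4, b1 x x2]
    refine ⟨frame 0 (by omega) (by omega) (by omega) (by omega) (by omega),
      frame 1 (by omega) (by omega) (by omega) (by omega) (by omega), ?_, ?_, ?_, ?_, ?_,
      fun x h x' => frame x (by omega) (by omega) (by omega) (by omega) x'⟩
    · rw [b11 2 (by omega), b10 2 (by omega), b9 2 (by omega), b8 2 (by omega), b7 2 (by omega),
        b6 2 (by omega), b5 2 (by omega), b4 2 (by omega), b3 2 (by omega), b2 2 (by omega), e1]
    · rw [frame 3 (by omega) (by omega) (by omega) (by omega) (by omega), h3]
    · rw [frame 5 (by omega) (by omega) (by omega) (by omega) (by omega), h5]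
    · rw [a11, b10 6 (by omega), b9 6 (by omega), b8 6 (by omega), b7 6 (by omega), b6 6 (by omega),
        b5 6 (by omega), b4 6 (by omega), b3 6 (by omega), b2 6 (by omega), b1 6 (by omega), h6,
        b10 3 (by omega), b9 3 (by omega), b8 3 (by omega), b7 3 (by omega), b6 3 (by omega),
        b5 3 (by omega), b4 3 (by omega), b3 3 (by omega), b2 3 (by omega), b1 3 (by omega), h3]
      rfl
    · have e2 : M2 4 = k + 2 := by rw [a2, e1, b1 5 (by omega), h5]
      rw [b11 _ (by omega), a10, b9 7 (by omega), b8 7 (by omega), b7 7 (by omega), b6 7 (by omega),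
        b5 7 (by omega), b4 7 (by omega), a3, e2, b2 _ (by omega), b1 _ (by omega)]

/-- Doubles register `2` as often as register `4` says. -/
def doubleCode : Program := .add 2 2 2 ;; .sub 4 4 3

/-- Moves the truth table, except for its first six rows, from the registers `k + 2` to the
cells of the array `0`. The last row goes first, so that no row is overwritten before it
is moved. -/
def moveCode : Program :=
  .const 3 1 ;; .const 5 0 ;; .const 2 1 ;; .add 4 0 5 ;; .whileNonzero 4 doubleCode ;;
  .const 5 6 ;; .sub 6 2 5 ;; .const 5 2 ;; .whileNonzero 6 moveRowCode

theorem runs_moveCode (M : Memory) :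
    Runs moveCode M (3 * M 0 + 12 * 2 ^ M 0 + 9) (fun M' => M' 0 = M 0 ∧ M' 1 = M 1 ∧
      ∀ k, 6 ≤ k → k < 2 ^ M 0 → M' (32 * k + 2) = M (k + 2)) := by
  set n := M 0 with hn
  set N := 2 ^ n with hN
  set K := N - 6 with hK
  refine .mono (τ := 1 + (1 + (1 + (1 + ((n * (1 + 1 + 1) + 1) + (1 + (1 + (1 +
    (K * (11 + 1) + 1))))))))) (.seq (.const' fun M1 a1 b1 => .seq (.const' fun M2 a2 b2 =>
    .seq (.const' fun M3 a3 b3 => .seq (.add' fun M4 a4 b4 => .seq ?_)))))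
    (by omega) fun _ h => h
  refine .mono (.whileCount (τ := 1 + 1) (fun j M' => j ≤ n ∧ M' 2 = 2 ^ (n - j) ∧ M' 3 = 1 ∧
    ∀ x, x ≠ 2 → x ≠ 3 → x ≠ 4 → x ≠ 5 → M' x = M x) ?_ n M4 ?_ ?_) le_rfl ?_
  · rintro j L ⟨h1, h2, h3, h4⟩ h5
    refine .seq (.add' fun L1 a1 b1 => .sub' fun L2 a2 b2 => ⟨⟨by omega, ?_, ?_, ?_⟩, ?_⟩)
    · rw [b2 2 (by omega), a1, h2, show n - j = n - (j + 1) + 1 by omega, pow_succ]; omega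
    · rw [b2 3 (by omega), b1 3 (by omega), h3]
    · intro x x2 x3 x4 x5
      rw [b2 x x4, b1 x x2, h4 x x2 x3 x4 x5]
    · rw [a2, b1 4 (by omega), b1 3 (by omega), h3, h5]; rfl
  · refine ⟨le_rfl, ?_, ?_, ?_⟩
    · rw [b4 2 (by omega), a3]; simp
    · rw [b4 3 (by omega), b3 3 (by omega), b2 3 (by omega), a1]
    · intro x x2 x3 x4 x5
      rw [b4 x x4, b3 x x2, b2 x x5, b1 x x3]
  · rw [a4, b3 0 (by omega), b2 0 (by omega), b1 0 (by omega), b3 5 (by omega), a2]; rfl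
  · rintro L ⟨⟨-, h2, h3, h4⟩, h5⟩
    rw [Nat.sub_zero, ← hN] at h2
    refine .seq (.const' fun L1 a1 b1 => .seq (.sub' fun L2 a2 b2 => .seq (.const' fun L3 a3 b3 =>
      ?_)))
    refine .mono (.whileCount (τ := 11) (fun j M' => M' 0 = M 0 ∧ M' 1 = M 1 ∧ j ≤ K ∧
      M' 2 = N - (K - j) ∧ M' 3 = 1 ∧ M' 5 = 2 ∧
      (∀ k, 6 ≤ k → N - (K - j) ≤ k → k < N → M' (32 * k + 2) = M (k + 2)) ∧
      ∀ x, 8 ≤ x → x < 32 * (N - (K - j)) + 2 → M' x = M x) ?_ K L3 ?_ ?_) le_rfl ?_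
    · rintro j W ⟨w0, w1, w2, w3, w4, w5, w6, w7⟩ w8
      have e : N - (K - (j + 1)) = N - (K - j) + 1 := by omega
      rw [e] at w3 w6 w7
      refine .mono (runs_moveRowCode (k := N - (K - j)) (j := j) w3 w4 w5 w8 (by omega))
        le_rfl ?_
      rintro W' ⟨u0, u1, u2, u3, u4, u5, u6, u7⟩
      refine ⟨⟨by rw [u0, w0], by rw [u1, w1], by omega, u2, u3, u4, fun k h6 hk hkN => ?_,
        fun x h8 hx => ?_⟩, u5⟩
      · by_cases hk' : k = N - (K - j)
        · subst hk'
          rw [u6, w7 _ (by omega) (by omega)]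
        · rw [u7 _ (by omega) (by omega), w6 k h6 (by omega) hkN]
      · rw [u7 x h8 (by omega), w7 x h8 (by omega)]
    · have frame : ∀ x, x ≠ 2 → x ≠ 3 → x ≠ 4 → x ≠ 5 → x ≠ 6 → L3 x = M x := by
        intro x x2 x3 x4 x5 x6
        rw [b3 x x5, b2 x x6, b1 x x5, h4 x x2 x3 x4 x5]
      refine ⟨frame 0 (by omega) (by omega) (by omega) (by omega) (by omega),
        frame 1 (by omega) (by omega) (by omega) (by omega) (by omega), le_rfl, ?_, ?_, a3,
        fun k h6 hk hkN => by omega, fun x h8 _ => frame x (by omega) (by omega) (by omega)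
          (by omega) (by omega)⟩
      · rw [b3 2 (by omega), b2 2 (by omega), b1 2 (by omega), h2]; omega
      · rw [b3 3 (by omega), b2 3 (by omega), b1 3 (by omega), h3]
    · rw [b3 6 (by omega), a2, b1 2 (by omega), h2, a1]
    · rintro W ⟨⟨w0, w1, w2, w3, w4, w5, w6, w7⟩, w8⟩
      refine ⟨w0, w1, fun k h6 hk => w6 k h6 (by omega) hk⟩

/-- The value of row `k` of the truth table. -/
def truthTable {n : ℕ} (f : (Fin n → Bool) → Bool) (k : ℕ) : ℕ :=
  if f (fun i => k.testBit i) = true then 1 else 0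

/-- The store holds the input `(n, m, f)`: the truth table in the array `0`, and `n` and `m` in
the first two cells of the array `1`. -/
structure HoldsInput (n m : ℕ) (f : (Fin n → Bool) → Bool) (σ : Store) : Prop where
  table : ∀ k < 2 ^ n, σ 0 k = truthTable f k
  fst : σ 1 0 = n
  snd : σ 1 1 = m

/-- Moves the input into the arrays, when the first six rows of the truth table are known. -/
def loadCode (b : ℕ → ℕ) : Program :=
  moveCode ;; .const 2 (b 2) ;; .const 34 (b 3) ;; .const 66 (b 4) ;; .const 98 (b 5) ;;
  .const 130 (b 6) ;; .const 162 (b 7) ;; .const 5 0 ;; .add 4 0 5 ;; .add 36 1 5 ;;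
  .add 0 0 1 ;; .const 5 64 ;; .add 0 0 5

/-- The store that a memory represents. -/
def storeOf (M : Memory) : Store := fun a i => M (32 * i + 2 * a + 2)

theorem runs_loadCode {n m : ℕ} {f : (Fin n → Bool) → Bool} {b : ℕ → ℕ}
    (hb : ∀ r ∈ [2, 3, 4, 5, 6, 7], b r = inputMemory n m f r) :
    Runs (loadCode b) (inputMemory n m f) (3 * n + 12 * 2 ^ n + 21) (fun M =>
      HoldsInput n m f (storeOf M) ∧ M 0 = n + m + 64) := by
  have table : ∀ k < 2 ^ n, inputMemory n m f (k + 2) = truthTable f k := fun k hk => by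
    simp [inputMemory, truthTable, hk]
  refine .mono (.seq (.mono (runs_moveCode _) le_rfl ?_)) (τ := 3 * n + 12 * 2 ^ n + 9 + 12)
    le_rfl fun _ h => h
  rintro M ⟨h0, h1, h⟩
  change M 0 = n at h0
  change M 1 = m at h1
  change ∀ k, 6 ≤ k → k < 2 ^ n → _ at h
  refine .seq (.const' fun M1 a1 b1 => .seq (.const' fun M2 a2 b2 => .seq (.const' fun M3 a3 b3 =>
    .seq (.const' fun M4 a4 b4 => .seq (.const' fun M5 a5 b5 => .seq (.const' fun M6 a6 b6 =>
    .seq (.const' fun M7 a7 b7 => .seq (.add' fun M8 a8 b8 => .seq (.add' fun M9 a9 b9 =>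
    .seq (.add' fun M10 a10 b10 => .seq (.const' fun M11 a11 b11 =>
    .add' fun M12 a12 b12 => ⟨⟨fun k hk => ?_, ?_, ?_⟩, ?_⟩)))))))))))
  · have hk2 := table k hk
    have e : storeOf M12 0 k = M6 (32 * k + 2) := by
      unfold storeOf
      rw [b12 _ (by omega), b11 _ (by omega), b10 _ (by omega), b9 _ (by omega), b8 _ (by omega),
        b7 _ (by omega)]
    rw [e, ← hk2]
    by_cases h6 : 6 ≤ k
    · rw [b6 _ (by omega), b5 _ (by omega), b4 _ (by omega), b3 _ (by omega), b2 _ (by omega),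
        b1 _ (by omega), h k h6 hk]
    · interval_cases k
      · rw [b6 _ (by omega), b5 _ (by omega), b4 _ (by omega), b3 _ (by omega), b2 _ (by omega),
          a1, hb 2 (by simp)]
      · rw [b6 _ (by omega), b5 _ (by omega), b4 _ (by omega), b3 _ (by omega), a2, hb 3 (by simp)]
      · rw [b6 _ (by omega), b5 _ (by omega), b4 _ (by omega), a3, hb 4 (by simp)]
      · rw [b6 _ (by omega), b5 _ (by omega), a4, hb 5 (by simp)]
      · rw [b6 _ (by omega), a5, hb 6 (by simp)]
      · rw [a6, hb 7 (by simp)]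
  · simp (disch := omega) only [storeOf, b12, b11, b10, b9, a8, b7, b6, b5, b4, b3, b2, b1, h0, a7]
    rfl
  · simp (disch := omega) only [storeOf, b12, b11, b10, a9, b8, b7, b6, b5, b4, b3, b2, b1, h1, a7]
    rfl
  · simp (disch := omega) only [a12, b11, a11, a10, b9, b8, b7, b6, b5, b4, b3, b2, b1, h0, h1]

theorem rep_storeOf (M : Memory) (ρ : ℕ → ℕ) : Rep (M 0) [] ρ (storeOf M) M where
  cap_eq := rfl
  var_eq := by simp
  cell_eq _ _ _ := rfl

/-- Executes `c` and then uses the cell `j` of the array `1` as the new cut-off. -/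
def stageCode (c : Cmd) (j : ℕ) : Program :=
  c.code 0 ;; .const 3 0 ;; .add 0 (32 * j + 4) 3

/-- A new cut-off makes it possible to continue with the same store but larger numbers. -/
theorem runs_stageCode {c : Cmd} (hc : c.wf [] = true) (j : ℕ) {cap : ℕ} {σ : Store} {M : Memory}
    (h : Rep cap [] 0 σ M) :
    Runs (stageCode c j) M (c.time cap + 2)
      (Rep (c.run cap 0 σ 1 j) [] 0 (c.run cap 0 σ)) := by
  refine .seq (.mono (c.runs_code [] 0 σ 0 M hc h) le_rfl ?_)
  rintro N ⟨h1, -⟩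
  refine .seq (.const' fun M1 a1 b1 => .add' fun M2 a2 b2 => ⟨?_, by simp, fun a ha i => ?_⟩)
  · rw [a2, a1, b1 _ (by omega), ← h1.cell_eq 1 (by omega) j]; rfl
  · rw [b2 _ (by omega), b1 _ (by omega), h1.cell_eq a ha i]

/-- A program in three stages, each of which computes the cut-off for the next, and its running
time. The third leaves the output in the cells `4` and `5` of the array `1`. -/
theorem exists_program_of_stages {c₁ c₂ c₃ : Cmd} (h₁ : c₁.wf [] = true) (h₂ : c₂.wf [] = true)
    (h₃ : c₃.wf [] = true) : ∃ (P : Program) (κ : ℕ),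
      ∀ (n m : ℕ) (f : (Fin n → Bool) → Bool), ∃ σ, HoldsInput n m f σ ∧
        ∀ σ₁ σ₂ σ₃, σ₁ = c₁.run (n + m + 64) 0 σ → σ₂ = c₂.run (σ₁ 1 2) 0 σ₁ →
          σ₃ = c₃.run (σ₂ 1 3) 0 σ₂ → σ₃ 1 5 ≠ 0 →
          ∃ t, Outputs P n m f t (σ₃ 1 4) (σ₃ 1 5) ∧ t ≤ 3 * n + 12 * 2 ^ n + 36 +
            (n + m + 66) ^ κ + (σ₁ 1 2 + 2) ^ κ + (σ₂ 1 3 + 2) ^ κ := by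
  obtain ⟨κ₁, hκ₁⟩ := c₁.polyBounded_time
  obtain ⟨κ₂, hκ₂⟩ := c₂.polyBounded_time
  obtain ⟨κ₃, hκ₃⟩ := c₃.polyBounded_time
  refine ⟨branch [2, 3, 4, 5, 6, 7] loadCode ;; stageCode c₁ 2 ;; stageCode c₂ 3 ;;
    stageCode c₃ 4 ;; .const 3 0 ;; .add 1 164 3, κ₁ + κ₂ + κ₃, fun n m f => ?_⟩
  have hb : Runs (branch [2, 3, 4, 5, 6, 7] loadCode) (inputMemory n m f)
      (3 * n + 12 * 2 ^ n + 21 + 6) (fun M =>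
      HoldsInput n m f (storeOf M) ∧ M 0 = n + m + 64) :=
    Runs.branch _ _ (by
      have key : ∀ k, inputMemory n m f (k + 2) ≤ 1 := fun k => by
        simp only [inputMemory]; split_ifs <;> omega
      simp only [List.mem_cons, List.not_mem_nil, or_false]
      rintro r (rfl | rfl | rfl | rfl | rfl | rfl) <;> exact key _)
      fun b hb => runs_loadCode hb
  obtain ⟨t₀, M₀, e₀, ht₀, hM₀, hcap⟩ := hb
  refine ⟨storeOf M₀, hM₀, ?_⟩
  rintro _ _ _ rfl rfl rfl hne
  have r₀ := rep_storeOf M₀ 0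
  rw [hcap] at r₀
  obtain ⟨t₁, M₁, e₁, ht₁, r₁⟩ := runs_stageCode h₁ 2 r₀
  obtain ⟨t₂, M₂, e₂, ht₂, r₂⟩ := runs_stageCode h₂ 3 r₁
  obtain ⟨t₃, M₃, e₃, ht₃, r₃⟩ := runs_stageCode h₃ 4 r₂
  set σ₁ := c₁.run (n + m + 64) 0 (storeOf M₀)
  set σ₂ := c₂.run (σ₁ 1 2) 0 σ₁
  set σ₃ := c₃.run (σ₂ 1 3) 0 σ₂
  have e : 164 = 32 * 5 + 2 * 1 + 2 := rfl
  have bound : ∀ x {κ : ℕ}, κ ≤ κ₁ + κ₂ + κ₃ → (x + 2) ^ κ ≤ (x + 2) ^ (κ₁ + κ₂ + κ₃) :=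
    fun x κ h => Nat.pow_le_pow_right (by omega) h
  refine ⟨t₀ + (t₁ + (t₂ + (t₃ + (1 + 1)))), ⟨_, .seq e₀ (.seq e₁ (.seq e₂ (.seq e₃
    (.seq (.const _ _ _) (.add _ _ _ _))))), ?_, ?_, hne⟩, ?_⟩
  · rw [Function.update_of_ne (by omega), Function.update_of_ne (by omega)]
    exact r₃.cap_eq
  · rw [Function.update_self, Function.update_self, Function.update_of_ne (by omega), e,
      r₃.cell_eq 1 (by omega) 5, add_zero]
  · have b₁ := (hκ₁ (n + m + 64)).trans (bound _ (by omega))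
    have b₂ := (hκ₂ (σ₁ 1 2)).trans (bound _ (by omega))
    have b₃ := (hκ₃ (σ₂ 1 3)).trans (bound _ (by omega))
    simp only [add_assoc, Nat.reduceAdd] at b₁ b₂ b₃ ht₀ ht₁ ht₂ ht₃ ⊢
    omega

end RAM

/-! ### Decisions on a tree of histories -/

theorem Finset.sum_range_mul_add {M : Type*} [AddCommMonoid M] (a b : ℕ) (f : ℕ → M) :
    ∑ g ∈ Finset.range (a * b), f g =
      ∑ i ∈ Finset.range a, ∑ j ∈ Finset.range b, f (i * b + j) := by
  induction a with
  | zero => simp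
  | succ a ih => rw [Nat.add_mul, one_mul, Finset.sum_range_add, ih, Finset.sum_range_succ]

namespace DecisionTree

/-- Chooses one of three alternatives. -/
def select {α : Type*} (c : ℕ) (x y z : α) : α := if c = 0 then x else if c = 1 then y else z

/-- A sequential decision problem with vector-valued outcomes. The histories of length `k` are
the numbers below `S ^ k`, the children of `h` are `h * S + s` for `s < S`, and a complete
history `g` has weight `leaf y g` in the coordinate `y`. At a node of height `d` (with `d`
observations still missing), one may halt with the answer `b` and pay `halt b y`, or pay
`step d y` and go on. Going on at height `0` ends the process as well. All payments are weighted
by the total weight of the complete histories below the node. -/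
structure Problem (R : Type*) where
  S : ℕ
  leaf : ℕ → ℕ → R
  halt : ℕ → ℕ → R
  step : ℕ → ℕ → R

namespace Problem

section Defs

variable {R : Type*} [CommSemiring R] (G : Problem R)

/-- The weight of the node `h` of height `d`. -/
def node (d h y : ℕ) : R := ∑ g ∈ Finset.range (G.S ^ d), G.leaf y (h * G.S ^ d + g)

/-- The outcome of a strategy `δ` from the node `h` of height `d` on. -/
def pay (δ : ℕ → ℕ → ℕ) : ℕ → ℕ → ℕ → R
  | 0, h, y => select (δ 0 h) (G.halt 0 y * G.node 0 h y) (G.halt 1 y * G.node 0 h y)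
      (G.step 0 y * G.node 0 h y)
  | d + 1, h, y => select (δ (d + 1) h) (G.halt 0 y * G.node (d + 1) h y)
      (G.halt 1 y * G.node (d + 1) h y)
      (G.step (d + 1) y * G.node (d + 1) h y +
        ∑ s ∈ Finset.range G.S, pay δ d (h * G.S + s) y)

theorem node_succ (d h y : ℕ) :
    G.node (d + 1) h y = ∑ s ∈ Finset.range G.S, G.node d (h * G.S + s) y := by
  unfold node
  rw [pow_succ', Finset.sum_range_mul_add]
  refine Finset.sum_congr rfl fun s _ => Finset.sum_congr rfl fun g _ => ?_
  congr 1; ring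

/-- The image of a decision problem under a homomorphism. -/
def map {R' : Type*} [CommSemiring R'] (φ : R →+* R') : Problem R' where
  S := G.S
  leaf y g := φ (G.leaf y g)
  halt b y := φ (G.halt b y)
  step d y := φ (G.step d y)

theorem map_node {R' : Type*} [CommSemiring R'] (φ : R →+* R') (d h y : ℕ) :
    (G.map φ).node d h y = φ (G.node d h y) := by
  simp [node, map]

theorem map_pay {R' : Type*} [CommSemiring R'] (φ : R →+* R') (δ : ℕ → ℕ → ℕ) (d h y : ℕ) :
    (G.map φ).pay δ d h y = φ (G.pay δ d h y) := by
  have hs : ∀ (c : ℕ) (x y z : R), φ (select c x y z) = select c (φ x) (φ y) (φ z) := by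
    intro c x y z; unfold select; split_ifs <;> rfl
  induction d generalizing h with
  | zero => simp only [pay, hs, map_node, map_mul]; rfl
  | succ d ih => simp only [pay, hs, map_node, map_mul, map_add, map_sum, ← ih]; rfl

end Defs

section Order

/-- The alternative with the least score. -/
def choice {R : Type*} [LinearOrder R] (x y z : R) : ℕ :=
  if x ≤ y ∧ x ≤ z then 0 else if y ≤ z then 1 else 2

theorem select_choice_le {R : Type*} [LinearOrder R] (x y z : R) :
    select (choice x y z) x y z ≤ x ∧ select (choice x y z) x y z ≤ y ∧
      select (choice x y z) x y z ≤ z := by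
  unfold choice
  split_ifs with h1 h2
  · exact ⟨le_rfl, h1⟩
  · exact ⟨le_of_not_gt fun h => h1 ⟨h.le, h.le.trans h2⟩, le_rfl, h2⟩
  · have h3 := (not_le.1 h2).le
    exact ⟨le_of_not_gt fun h => h1 ⟨h.le.trans h3, h.le⟩, h3, le_rfl⟩

variable {R : Type*} [CommSemiring R] [LinearOrder R] (G : Problem R)

/-- The vector among the three whose scalar product with `w` is least. -/
def pick (Y : ℕ) (w u₀ u₁ u₂ : ℕ → R) : ℕ → R :=
  fun y => select (choice (∑ y ∈ Finset.range Y, w y * u₀ y) (∑ y ∈ Finset.range Y, w y * u₁ y)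
    (∑ y ∈ Finset.range Y, w y * u₂ y)) (u₀ y) (u₁ y) (u₂ y)

/-- The outcome of a best response to the weights `w`, by backward induction. -/
def best (Y : ℕ) (w : ℕ → R) : ℕ → ℕ → ℕ → R
  | 0, h => pick Y w (fun y => G.halt 0 y * G.node 0 h y) (fun y => G.halt 1 y * G.node 0 h y)
      (fun y => G.step 0 y * G.node 0 h y)
  | d + 1, h => pick Y w (fun y => G.halt 0 y * G.node (d + 1) h y)
      (fun y => G.halt 1 y * G.node (d + 1) h y)
      (fun y => G.step (d + 1) y * G.node (d + 1) h y +
        ∑ s ∈ Finset.range G.S, best Y w d (h * G.S + s) y)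

/-- A best response is a strategy. -/
theorem exists_best_eq_pay (Y : ℕ) (w : ℕ → R) :
    ∃ δ, ∀ d h y, G.best Y w d h y = G.pay δ d h y := by
  refine ⟨fun d h => match d with
    | 0 => choice (∑ y ∈ Finset.range Y, w y * (G.halt 0 y * G.node 0 h y))
        (∑ y ∈ Finset.range Y, w y * (G.halt 1 y * G.node 0 h y))
        (∑ y ∈ Finset.range Y, w y * (G.step 0 y * G.node 0 h y))
    | d + 1 => choice (∑ y ∈ Finset.range Y, w y * (G.halt 0 y * G.node (d + 1) h y))
        (∑ y ∈ Finset.range Y, w y * (G.halt 1 y * G.node (d + 1) h y))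
        (∑ y ∈ Finset.range Y, w y * (G.step (d + 1) y * G.node (d + 1) h y +
          ∑ s ∈ Finset.range G.S, G.best Y w d (h * G.S + s) y)), fun d h y => ?_⟩
  induction d generalizing h y with
  | zero => rfl
  | succ d ih => simp only [best, pick, pay, ih]

theorem pick_le (Y : ℕ) (w u₀ u₁ u₂ : ℕ → R) (c : ℕ) :
    ∑ y ∈ Finset.range Y, w y * pick Y w u₀ u₁ u₂ y ≤
      ∑ y ∈ Finset.range Y, w y * select c (u₀ y) (u₁ y) (u₂ y) := by
  have e : ∀ c, ∑ y ∈ Finset.range Y, w y * select c (u₀ y) (u₁ y) (u₂ y) =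
      select c (∑ y ∈ Finset.range Y, w y * u₀ y) (∑ y ∈ Finset.range Y, w y * u₁ y)
        (∑ y ∈ Finset.range Y, w y * u₂ y) := by
    intro c; unfold select; split_ifs <;> rfl
  unfold pick
  rw [e, e]
  obtain ⟨h0, h1, h2⟩ := select_choice_le (∑ y ∈ Finset.range Y, w y * u₀ y)
    (∑ y ∈ Finset.range Y, w y * u₁ y) (∑ y ∈ Finset.range Y, w y * u₂ y)
  conv_rhs => unfold select
  split_ifs
  exacts [h0, h1, h2]

variable [IsOrderedRing R]

/-- By backward induction, `best` minimizes the scalar product of the outcome with `w`. -/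
theorem best_le_pay (Y : ℕ) (w : ℕ → R) (δ : ℕ → ℕ → ℕ) (d h : ℕ) :
    ∑ y ∈ Finset.range Y, w y * G.best Y w d h y ≤
      ∑ y ∈ Finset.range Y, w y * G.pay δ d h y := by
  induction d generalizing h with
  | zero => exact pick_le _ _ _ _ _ _
  | succ d ih =>
    refine (pick_le _ _ _ _ _ (δ (d + 1) h)).trans ?_
    simp only [pay]
    unfold select
    split_ifs
    · exact le_rfl
    · exact le_rfl
    · simp only [mul_add, Finset.sum_add_distrib, Finset.mul_sum]
      refine add_le_add le_rfl ?_
      rw [Finset.sum_comm, Finset.sum_comm (s := Finset.range Y)]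
      exact Finset.sum_le_sum fun s _ => ih _

/-- A bound for the payments from height `d` on, relative to the weights of the nodes. -/
structure PayBound (c : ℕ → ℕ → R) : Prop where
  halt : ∀ b d y, G.halt b y ≤ c d y
  step_zero : ∀ y, G.step 0 y ≤ c 0 y
  step_succ : ∀ d y, G.step (d + 1) y + c d y ≤ c (d + 1) y

theorem PayBound.pay_le {G : Problem R} {c : ℕ → ℕ → R} (hc : G.PayBound c)
    (hl : ∀ y g, 0 ≤ G.leaf y g) (δ : ℕ → ℕ → ℕ) (d h y : ℕ) :
    G.pay δ d h y ≤ c d y * G.node d h y := by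
  have hn : ∀ d h, 0 ≤ G.node d h y := fun d h => Finset.sum_nonneg fun g _ => hl _ _
  induction d generalizing h with
  | zero =>
    unfold pay select
    split_ifs
    exacts [mul_le_mul_of_nonneg_right (hc.halt _ _ _) (hn _ _),
      mul_le_mul_of_nonneg_right (hc.halt _ _ _) (hn _ _),
      mul_le_mul_of_nonneg_right (hc.step_zero _) (hn _ _)]
  | succ d ih =>
    unfold pay select
    split_ifs
    · exact mul_le_mul_of_nonneg_right (hc.halt _ _ _) (hn _ _)
    · exact mul_le_mul_of_nonneg_right (hc.halt _ _ _) (hn _ _)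
    · refine (add_le_add le_rfl (Finset.sum_le_sum fun s _ => ih (h * G.S + s))).trans ?_
      rw [← Finset.mul_sum, ← node_succ, ← add_mul]
      exact mul_le_mul_of_nonneg_right (hc.step_succ _ _) (hn _ _)

end Order

/-- The outcome of a strategy depends continuously on the weights of the complete histories. -/
theorem PayBound.abs_pay_sub_le {G : Problem ℝ} {c : ℕ → ℕ → ℝ} (hc : G.PayBound c)
    (hh : ∀ b y, 0 ≤ G.halt b y) (hs : ∀ d y, 0 ≤ G.step d y) (leaf' : ℕ → ℕ → ℝ)
    (δ : ℕ → ℕ → ℕ) (d h y : ℕ) :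
    |G.pay δ d h y - ({ G with leaf := leaf' } : Problem ℝ).pay δ d h y| ≤
      c d y * ∑ g ∈ Finset.range (G.S ^ d),
        |G.leaf y (h * G.S ^ d + g) - leaf' y (h * G.S ^ d + g)| := by
  set G' : Problem ℝ := { G with leaf := leaf' } with hG'
  have hn : ∀ d h, |G.node d h y - G'.node d h y| ≤ ∑ g ∈ Finset.range (G.S ^ d),
      |G.leaf y (h * G.S ^ d + g) - leaf' y (h * G.S ^ d + g)| := by
    intro d h
    unfold node
    rw [← Finset.sum_sub_distrib]
    exact Finset.abs_sum_le_sum_abs _ _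
  have key : ∀ d h (x : ℝ), 0 ≤ x → x ≤ c d y → |x * G.node d h y - x * G'.node d h y| ≤
      c d y * ∑ g ∈ Finset.range (G.S ^ d),
        |G.leaf y (h * G.S ^ d + g) - leaf' y (h * G.S ^ d + g)| := by
    intro d h x h0 h1
    rw [← mul_sub, abs_mul, abs_of_nonneg h0]
    exact mul_le_mul h1 (hn d h) (abs_nonneg _) (h0.trans h1)
  induction d generalizing h with
  | zero =>
    unfold pay select
    split_ifs
    exacts [key 0 h _ (hh _ _) (hc.halt _ _ _), key 0 h _ (hh _ _) (hc.halt _ _ _),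
      key 0 h _ (hs _ _) (hc.step_zero _)]
  | succ d ih =>
    unfold pay select
    split_ifs
    · exact key _ h _ (hh _ _) (hc.halt _ _ _)
    · exact key _ h _ (hh _ _) (hc.halt _ _ _)
    · set Δ := ∑ g ∈ Finset.range (G.S ^ (d + 1)),
        |G.leaf y (h * G.S ^ (d + 1) + g) - leaf' y (h * G.S ^ (d + 1) + g)| with hΔ
      have h1 : |G.step (d + 1) y * G.node (d + 1) h y - G'.step (d + 1) y * G'.node (d + 1) h y| ≤
          G.step (d + 1) y * Δ := by
        change |G.step (d + 1) y * G.node (d + 1) h y - G.step (d + 1) y * G'.node (d + 1) h y| ≤ _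
        rw [← mul_sub, abs_mul, abs_of_nonneg (hs _ _)]
        exact mul_le_mul_of_nonneg_left (hn _ _) (hs _ _)
      have h2 : |∑ s ∈ Finset.range G.S, G.pay δ d (h * G.S + s) y -
          ∑ s ∈ Finset.range G'.S, G'.pay δ d (h * G'.S + s) y| ≤ c d y * Δ := by
        change |∑ s ∈ Finset.range G.S, G.pay δ d (h * G.S + s) y -
          ∑ s ∈ Finset.range G.S, G'.pay δ d (h * G.S + s) y| ≤ c d y * Δ
        rw [← Finset.sum_sub_distrib]
        refine (Finset.abs_sum_le_sum_abs _ _).trans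
          ((Finset.sum_le_sum fun s _ => ih (h * G.S + s)).trans (le_of_eq ?_))
        rw [← Finset.mul_sum, hΔ, pow_succ', Finset.sum_range_mul_add]
        congr 1
        refine Finset.sum_congr rfl fun s _ => Finset.sum_congr rfl fun g _ => ?_
        rw [show (h * G.S + s) * G.S ^ d + g = h * (G.S * G.S ^ d) + (s * G.S ^ d + g) by ring]
      have h3 : (G.step (d + 1) y + c d y) * Δ ≤ c (d + 1) y * Δ :=
        mul_le_mul_of_nonneg_right (hc.step_succ _ _) (Finset.sum_nonneg fun _ _ => abs_nonneg _)
      rw [add_sub_add_comm]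
      refine (abs_add_le _ _).trans ((add_le_add h1 h2).trans ?_)
      rw [← add_mul]; exact h3

end Problem

/-! ### The perceptron -/

/-- The weights of the perceptron bound the excess of the payoffs over the targets, since the
truncation of the subtraction only increases a weight. -/
theorem sum_payoffs_le {w v : ℕ → ℕ → ℕ} {τ : ℕ → ℕ}
    (h : ∀ r y, w (r + 1) y = w r y + v r y - τ y) (R y : ℕ) :
    ∑ r ∈ Finset.range R, v r y ≤ R * τ y + w R y := by
  induction R with
  | zero => simp
  | succ R ih => rw [Finset.sum_range_succ, h, Nat.add_mul]; omega

/-- If the payoffs never score above the targets, the weights of the perceptron grow like the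
square root of the number of rounds. -/
theorem sum_sq_le {w v : ℕ → ℕ → ℕ} {τ : ℕ → ℕ} {Y B : ℕ} (h0 : ∀ y, w 0 y = 0)
    (h : ∀ r y, w (r + 1) y = w r y + v r y - τ y)
    (hv : ∀ r, ∑ y ∈ Finset.range Y, w r y * v r y ≤ ∑ y ∈ Finset.range Y, w r y * τ y)
    (hvB : ∀ r, ∀ y < Y, v r y ≤ B) (hτB : ∀ y < Y, τ y ≤ B) (R : ℕ) :
    ∑ y ∈ Finset.range Y, w R y ^ 2 ≤ R * (Y * B ^ 2) := by
  induction R with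
  | zero => simp [h0]
  | succ R ih =>
    have key : ∀ y < Y, w (R + 1) y ^ 2 + 2 * (w R y * τ y) ≤
        w R y ^ 2 + 2 * (w R y * v R y) + B ^ 2 := by
      intro y hy
      have h1 := hvB R y hy
      have h2 := hτB y hy
      rw [h]
      rcases le_total (τ y) (w R y + v R y) with h3 | h3
      · zify [h3] at *
        nlinarith [mul_nonneg (sub_nonneg.2 h1) (by positivity : (0 : ℤ) ≤ τ y),
          mul_nonneg (sub_nonneg.2 h2) (by positivity : (0 : ℤ) ≤ v R y),
          mul_nonneg (sub_nonneg.2 h1) (sub_nonneg.2 h2),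
          mul_nonneg (sub_nonneg.2 h1) (sub_nonneg.2 h1),
          mul_nonneg (sub_nonneg.2 h2) (sub_nonneg.2 h2),
          mul_nonneg (sub_nonneg.2 h1) (by positivity : (0 : ℤ) ≤ v R y),
          mul_nonneg (sub_nonneg.2 h2) (by positivity : (0 : ℤ) ≤ τ y)]
      · rw [Nat.sub_eq_zero_of_le h3]
        zify at *
        nlinarith [mul_nonneg (sub_nonneg.2 h3) (sub_nonneg.2 h3),
          mul_nonneg (sub_nonneg.2 h1) (by positivity : (0 : ℤ) ≤ τ y),
          mul_nonneg (sub_nonneg.2 h2) (by positivity : (0 : ℤ) ≤ v R y),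
          mul_nonneg (sub_nonneg.2 h2) (sub_nonneg.2 h2),
          mul_nonneg (sub_nonneg.2 h2) (by positivity : (0 : ℤ) ≤ τ y),
          mul_nonneg (sub_nonneg.2 h1) (sub_nonneg.2 h1)]
    have key' := Finset.sum_le_sum fun y hy => key y (Finset.mem_range.1 hy)
    simp only [Finset.sum_add_distrib, ← Finset.mul_sum, Finset.sum_const, Finset.card_range,
      smul_eq_mul] at key'
    have := hv R
    rw [Nat.add_mul, one_mul]
    omega

end DecisionTree

/-! ### The search -/

namespace Search

open DecisionTree

/-- The number of values of the index register. -/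
def indexSize (n : ℕ) : ℕ := 2 ^ Nat.clog 2 n

/-- The number of values of the workspace. -/
def workSize (n m : ℕ) : ℕ := 2 ^ m / (2 * indexSize n)

/-- The common denominator of the matrix entries. -/
def den (m : ℕ) : ℕ := (2 ^ m) ^ 16

/-- The base of the number system in which candidates are encoded. -/
def base (m : ℕ) : ℕ := 2 * den m

/-- The number of digits of a candidate: the numbers of queries of `n` stages, the cost, and the
entries of `2 n` matrices. -/
def numDigits (n m : ℕ) : ℕ := n + 1 + 2 * n * (4 * (2 ^ m * 2 ^ m))

/-- The digits of the candidate `c`. -/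
def digit (m c j : ℕ) : ℕ := c / base m ^ j % base m

section Candidate

variable (n m : ℕ) (d : ℕ → ℕ)

/-- The number of queries of the stage `k`. -/
def queryCount (k : ℕ) : ℕ := min (d k) n

/-- The coefficient of `I ^ c` in the entry `(i, j)` of the `u`-th matrix. -/
def entry (u i j c : ℕ) : ℕ := d (n + 1 + (4 * (2 ^ m * (2 ^ m * u + i) + j) + c))

/-- The number of matrices before the stage `k`. -/
def offset (k : ℕ) : ℕ := ∑ j ∈ Finset.range k, (queryCount n d j + 1)

/-- The action of a query on codes of basis states. -/
def queryCode (x s : ℕ) : ℕ :=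
  if x / 2 ^ (s / (2 * workSize n m)) % 2 = 0 then s
  else if s / workSize n m % 2 = 0 then s + workSize n m else s - workSize n m

/-- The amplitudes after `t` queries of the stage `k` on the input `x`, as multiples of
`1 / den m ^ (t + 1)`. The index `4 * s + c` belongs to the coefficient of `I ^ c` in the
amplitude of the basis state `s`; as the coefficients are not reduced, they are natural
numbers. -/
def amplitude (k x : ℕ) : ℕ → ℕ → ℕ
  | 0, j => entry n m d (offset n d k) (j / 4) 0 (j % 4)
  | t + 1, j => ∑ u ∈ Finset.range (4 * 2 ^ m),
      entry n m d (offset n d k + (t + 1)) (j / 4) (u / 4) ((j % 4 + (4 - u % 4)) % 4) *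
        amplitude k x t (4 * queryCode n m x (u / 4) + u % 4)

/-- The square of the distance of two natural numbers. -/
def sqDist (a b : ℕ) : ℕ := (a - b + (b - a)) * (a - b + (b - a))

/-- The probability of observing `s` after the stage `k`, as a multiple of
`1 / den m ^ (2 * (queryCount n d k + 1))`. -/
def prob (k x s : ℕ) : ℕ :=
  sqDist (amplitude n m d k x (queryCount n d k) (4 * s))
      (amplitude n m d k x (queryCount n d k) (4 * s + 2)) +
    sqDist (amplitude n m d k x (queryCount n d k) (4 * s + 1))
      (amplitude n m d k x (queryCount n d k) (4 * s + 3))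

end Candidate

/-- The weight of the history `h` of length `k`, when `p k s` is the weight of observing `s` in the
stage `k`. -/
def pathWeight {R : Type*} [Mul R] [One R] (S : ℕ) (p : ℕ → ℕ → R) : ℕ → ℕ → R
  | 0, _ => 1
  | k + 1, h => p k (h % S) * pathWeight S p k (h / S)

/-- The weight of an error. It is three times the reciprocal of the tolerance. -/
def errorWeight (m : ℕ) : ℕ := 3 * (1024 * 2 ^ m)

section Candidate

variable (n m : ℕ) (F : ℕ → ℕ) (d : ℕ → ℕ)

/-- The penalty for the answer `b`: coordinates come in pairs, `2 x` for errors and `2 x + 1` for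
queries on the input `x`. -/
def haltPay (b y : ℕ) : ℕ :=
  if y % 2 = 0 then (if F (y / 2) = b then 0 else errorWeight m) else 0

/-- The queries for going on at height `h`: at height `0` all `n` input bits are queried. -/
def stepPay (h y : ℕ) : ℕ :=
  if y % 2 = 0 then 0 else 128 * (if h = 0 then n else queryCount n d (n - h))

/-- The decision problem for a candidate. -/
def problem : Problem ℕ where
  S := 2 ^ m
  leaf y g := pathWeight (2 ^ m) (fun k s => prob n m d k (y / 2) s) n g
  halt := haltPay m F
  step := stepPay n d

/-- The common denominator of the weights of complete histories. -/
def scale : ℕ := den m ^ (2 * offset n d n)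

/-- The targets of the perceptron: the error has to be a bit less than `1 / 3`, and the number of
queries at most a `128`-th of the digit `d n`. -/
def target (y : ℕ) : ℕ :=
  if y % 2 = 0 then (1024 * 2 ^ m - 2) * scale n m d else d n * scale n m d

/-- The number of rounds of the perceptron. -/
def rounds : ℕ := (2 ^ m) ^ (n + 16)

/-- The weights in the perceptron. -/
def weight : ℕ → ℕ → ℕ
  | 0, _ => 0
  | r + 1, y => weight r y +
      (problem n m F d).best (2 * 2 ^ n) (weight r) n 0 y - target n m d y

/-- The coefficient of `I ^ c` in the scalar product of the columns `i` and `j` of the `u`-th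
matrix. -/
def gram (u i j c : ℕ) : ℕ :=
  ∑ s ∈ Finset.range (2 ^ m), ∑ a ∈ Finset.range 4,
    entry n m d u s i a * entry n m d u s j ((a + c) % 4)

/-- The `u`-th matrix is close to a unitary matrix. -/
def NearUnitary (u : ℕ) : Prop :=
  ∀ i < 2 ^ m, ∀ j < 2 ^ m,
    gram n m d u i j 0 ≤ gram n m d u i j 2 + (if i = j then den m * den m else 0) +
        8 * (2 ^ m * 2 ^ m) * den m ∧
      gram n m d u i j 2 + (if i = j then den m * den m else 0) ≤
        gram n m d u i j 0 + 8 * (2 ^ m * 2 ^ m) * den m ∧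
      gram n m d u i j 1 ≤ gram n m d u i j 3 + 8 * (2 ^ m * 2 ^ m) * den m ∧
      gram n m d u i j 3 ≤ gram n m d u i j 1 + 8 * (2 ^ m * 2 ^ m) * den m

/-- A candidate is accepted if it makes at most `n` queries in all, its matrices are close to
unitary ones, and the perceptron meets its targets. -/
structure Accepted : Prop where
  queries : offset n d n ≤ 2 * n
  unitary : ∀ u < 2 * n, NearUnitary n m d u
  weights : ∀ y < 2 * 2 ^ n, weight n m F d (rounds n m) y ≤ rounds n m * scale n m d

end Candidate

open Classical in
/-- The least cost of an accepted candidate below `c`, or the trivial bound. -/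
noncomputable def result (n m : ℕ) (F : ℕ → ℕ) : ℕ → ℕ
  | 0 => 128 * n
  | c + 1 => if Accepted n m F (digit m c) ∧ digit m c n < result n m F c then digit m c n
      else result n m F c

end Search

/-! ### Reasoning about commands -/

namespace RAM

/-! Expressions can be written with the arithmetic operations and numerals. -/

instance : Add Exp := ⟨Exp.add⟩
instance : Sub Exp := ⟨Exp.sub⟩
instance : Mul Exp := ⟨Exp.mul⟩
instance : Div Exp := ⟨Exp.div⟩
instance (c : ℕ) : OfNat Exp c := ⟨Exp.const c⟩

namespace Exp

variable {cap : ℕ} {σ : Store} {ρ : ℕ → ℕ} {x y z : Exp} {X Y Z : ℕ}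

/-- The expression `x` has the value `X`. -/
def Is (cap : ℕ) (σ : Store) (ρ : ℕ → ℕ) (x : Exp) (X : ℕ) : Prop := x.eval cap σ ρ = X

theorem Is.congr (h : Is cap σ ρ x X) (e : X = Y) : Is cap σ ρ x Y := e ▸ h

theorem Is.lit (c : ℕ) : Is cap σ ρ (@OfNat.ofNat Exp c _) c := rfl

theorem Is.const (c : ℕ) : Is cap σ ρ (.const c) c := rfl

theorem Is.var {v : ℕ} (h : ρ v = X) : Is cap σ ρ (.var v) X := h

theorem Is.add (hx : Is cap σ ρ x X) (hy : Is cap σ ρ y Y) : Is cap σ ρ (x + y) (X + Y) := by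
  subst hx hy; rfl

theorem Is.sub (hx : Is cap σ ρ x X) (hy : Is cap σ ρ y Y) : Is cap σ ρ (x - y) (X - Y) := by
  subst hx hy; rfl

/-- The first factor is at most the cut-off, so that the product is not cut off. -/
theorem Is.mul (hx : Is cap σ ρ x X) (hy : Is cap σ ρ y Y) (h : X ≤ cap) :
    Is cap σ ρ (x * y) (X * Y) := by
  subst hx hy
  change min _ cap * _ = _
  rw [min_eq_left h]

/-- The dividend is at most the cut-off, so that the quotient is not cut off. -/
theorem Is.div (hx : Is cap σ ρ x X) (hy : Is cap σ ρ y Y) (h : X ≤ cap) :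
    Is cap σ ρ (x / y) (X / Y) := by
  subst hx hy
  change min _ cap / _ = _
  rw [min_eq_left h]

theorem Is.ite (hx : Is cap σ ρ x X) (hy : X ≠ 0 → Is cap σ ρ y Y) (hz : X = 0 → Is cap σ ρ z Z) :
    Is cap σ ρ (.ite x y z) (if X = 0 then Z else Y) := by
  subst hx
  unfold Is
  simp only [eval, ne_eq, ite_not]
  split_ifs with h
  exacts [hz h, hy h]

theorem Is.read {a : ℕ} (hx : Is cap σ ρ x X) (h : σ a X = Y) :
    Is cap σ ρ (.read a x) Y := by
  subst hx; exact h

theorem Is.sum {v : ℕ} {f : ℕ → ℕ} (hx : Is cap σ ρ x X) (h : X ≤ cap)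
    (hy : ∀ i < X, Is cap σ (Function.update ρ v i) y (f i)) :
    Is cap σ ρ (.sum v x y) (∑ i ∈ Finset.range X, f i) := by
  subst hx
  change ∑ i ∈ Finset.range (min _ cap), _ = _
  rw [min_eq_left h]
  exact Finset.sum_congr rfl fun i hi => hy i (Finset.mem_range.1 hi)

/-- The remainder of a division. -/
def md (x y : Exp) : Exp := x - y * (x / y)

theorem Is.md (hx : Is cap σ ρ x X) (hy : Is cap σ ρ y Y) (h : X ≤ cap) (h' : Y ≤ cap) :
    Is cap σ ρ (md x y) (X % Y) :=
  (hx.sub (hy.mul (hx.div hy h) h')).congr (Nat.mod_eq_sub _ _).symm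

/-- The minimum of two numbers. -/
def minimum (x y : Exp) : Exp := x - (x - y)

theorem Is.minimum (hx : Is cap σ ρ x X) (hy : Is cap σ ρ y Y) :
    Is cap σ ρ (minimum x y) (min X Y) :=
  (hx.sub (hx.sub hy)).congr (by omega)

/-- The scalar number `j`, kept in the array `1`. -/
def scalar (j : ℕ) : Exp := .read 1 (.const j)

end Exp

/-- The induction principle for the invariant `Q` of a loop. -/
theorem iter_induction {α : Type} {F : ℕ → α → α} {s : α} {Q : ℕ → α → Prop} (h0 : Q 0 s) :
    ∀ k, (∀ i < k, ∀ s, Q i s → Q (i + 1) (F i s)) → Q k (iter F k s)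
  | 0, _ => h0
  | k + 1, h => h k (by omega) _ (iter_induction h0 k fun i hi => h i (by omega))

theorem Cmd.run_loop {cap v B : ℕ} {ρ : ℕ → ℕ} {b : Exp} {c : Cmd} {σ : Store}
    (hb : b.Is cap σ ρ B) (hB : B ≤ cap) : (Cmd.loop v b c).run cap ρ σ =
      iter (fun i s => c.run cap (Function.update ρ v i) s) B σ := by
  change iter _ (min (b.eval cap σ ρ) cap) σ = _
  rw [hb, min_eq_left hB]

/-- Starting from the store `σ`, the first `p` cells of the array `a` have been filled with the
values `g`, and nothing else has changed. -/
structure Filled (a : ℕ) (σ : Store) (g : ℕ → ℕ) (p : ℕ) (σ' : Store) : Prop where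
  frame : ∀ a' ≠ a, σ' a' = σ a'
  eq : ∀ j < p, σ' a j = g j
  rest : ∀ j ≥ p, σ' a j = σ a j

namespace Filled

variable {a : ℕ} {σ σ' : Store} {g : ℕ → ℕ} {p cap : ℕ} {ρ : ℕ → ℕ}

theorem refl : Filled a σ g 0 σ := ⟨fun _ _ => rfl, fun j hj => by omega, fun _ _ => rfl⟩

/-- The loop fills a block of `len` cells in each iteration. -/
theorem loop {v B len q : ℕ} {b : Exp} {c : Cmd} (hb : b.Is cap σ' ρ B) (hB : B ≤ cap)
    (h : Filled a σ g p σ') (step : ∀ i < B, ∀ σ', Filled a σ g (p + len * i) σ' →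
      Filled a σ g (p + len * i + len) (c.run cap (Function.update ρ v i) σ'))
    (hq : q = p + len * B) :
    Filled a σ g q ((Cmd.loop v b c).run cap ρ σ') := by
  rw [Cmd.run_loop hb hB, hq]
  exact iter_induction (Q := fun i => Filled a σ g (p + len * i)) (by simpa using h) B
    fun i hi s hs => by have := step i hi s hs; rwa [mul_add, mul_one, ← add_assoc]

theorem set {q : ℕ} {i e : Exp} (hi : i.Is cap σ' ρ p) (he : e.Is cap σ' ρ (g p))
    (h : Filled a σ g p σ') (hq : q = p + 1) : Filled a σ g q ((Cmd.set a i e).run cap ρ σ') := by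
  subst hq
  refine ⟨fun a' ha => ?_, fun j hj => ?_, fun j hj => ?_⟩
  · change Function.update σ' a _ a' = _
    rw [Function.update_of_ne ha, h.frame a' ha]
  · change Function.update σ' a (Function.update (σ' a) (i.eval cap σ' ρ) (e.eval cap σ' ρ)) a j = _
    rw [Function.update_self, hi, he]
    by_cases e : j = p
    · rw [e, Function.update_self]
    · rw [Function.update_of_ne e, h.eq j (by omega)]
  · change Function.update σ' a (Function.update (σ' a) (i.eval cap σ' ρ) (e.eval cap σ' ρ)) a j = _
    rw [Function.update_self, hi, Function.update_of_ne (by omega), h.rest j (by omega)]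

end Filled

/-- The function of one index that belongs to a function of two. -/
def flat {α : Type} (b : ℕ) (f : ℕ → ℕ → α) (p : ℕ) : α := f (p / b) (p % b)

theorem flat_apply {α : Type} {b i j : ℕ} (f : ℕ → ℕ → α) (h : j < b) :
    flat b f (b * i + j) = f i j := by
  unfold flat
  rw [Nat.mul_add_div (by omega), Nat.div_eq_of_lt h, add_zero, Nat.mul_add_mod, Nat.mod_eq_of_lt h]

theorem flat_lt {b B i j : ℕ} (hi : i < B) (hj : j < b) : b * i + j < b * B :=
  calc b * i + j < b * i + b := by omega
    _ = b * (i + 1) := by ring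
    _ ≤ b * B := Nat.mul_le_mul_left _ hi

end RAM

/-! ### The search as a command -/

namespace Search

open RAM RAM.Exp

/-- The number of digits that are tabulated. It is larger than `numDigits`, as the amplitudes are
also computed for numbers of queries that a stage does not have. -/
def tableSize (n m : ℕ) : ℕ := n + 1 + 4 * (2 ^ m * (2 ^ m * ((n + 1) * (n + 1))))

/-- The largest exponent of `2 ^ m` that is tabulated. -/
def maxExponent (n : ℕ) : ℕ := 32 * (n * (n + 1)) + n + 16

/-- The parameters of the search and the truth table `F` are in their places: the scalars in the
array `1`, and tables of powers in the arrays `2`, `3` and `4`. -/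
structure Ctx (n m : ℕ) (F : ℕ → ℕ) (σ : Store) : Prop where
  table : ∀ k < 2 ^ n, σ 0 k = F k
  n_eq : σ 1 0 = n
  m_eq : σ 1 1 = m
  inputs : σ 1 6 = 2 ^ n
  states : σ 1 7 = 2 ^ m
  work : σ 1 8 = workSize n m
  den_eq : σ 1 9 = den m
  base_eq : σ 1 10 = base m
  size : σ 1 11 = tableSize n m
  leaves : σ 1 12 = (2 ^ m) ^ n
  rounds_eq : σ 1 13 = rounds n m
  errorWeight_eq : σ 1 17 = errorWeight m
  twoPow : ∀ j ≤ 2 * n + m, σ 2 j = 2 ^ j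
  statePow : ∀ j ≤ maxExponent n, σ 3 j = (2 ^ m) ^ j
  basePow : ∀ j ≤ tableSize n m, σ 4 j = base m ^ j

theorem Ctx.congr {n m : ℕ} {F : ℕ → ℕ} {σ σ' : Store} (h : Ctx n m F σ)
    (e : ∀ a < 5, σ' a = σ a) : Ctx n m F σ' := by
  have e0 := e 0 (by omega)
  have e1 := e 1 (by omega)
  have e2 := e 2 (by omega)
  have e3 := e 3 (by omega)
  have e4 := e 4 (by omega)
  constructor <;> simp only [e0, e1, e2, e3, e4]
  exacts [h.table, h.n_eq, h.m_eq, h.inputs, h.states, h.work, h.den_eq, h.base_eq, h.size,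
    h.leaves,
    h.rounds_eq, h.errorWeight_eq, h.twoPow, h.statePow, h.basePow]

/-- A bound for the amplitudes of all candidates. -/
def ampBound (n m : ℕ) : ℕ := (4 * 2 ^ m * base m) ^ (n + 1)

/-- A bound for the weights of complete histories. -/
def pathBound (n m : ℕ) : ℕ := (2 * ampBound n m ^ 2) ^ n

/-- A bound for the outcomes of strategies. -/
def payBound (n m : ℕ) : ℕ :=
  (errorWeight m + 128 * n * (n + 1)) * ((2 ^ m) ^ n * pathBound n m)

/-- The cut-off is large enough for the search. -/
structure Caps (cap n m : ℕ) : Prop where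
  small : 128 * (n + 1) ≤ cap
  states : 1024 * 2 ^ m ≤ cap
  statesSq : 8 * (2 ^ m * 2 ^ m) ≤ cap
  inputs : 2 * 2 ^ n ≤ cap
  twoPow : 2 * n + m + 1 ≤ cap
  statePow : maxExponent n + 1 ≤ cap
  size : tableSize n m + 1 ≤ cap
  leaves : (2 ^ m) ^ n ≤ cap
  rounds_le : rounds n m ≤ cap
  base_le : base m ≤ cap
  candidates : base m ^ numDigits n m ≤ cap
  errorWeight_le : errorWeight m ≤ cap
  amp : ampBound n m ≤ cap
  prob : 2 * ampBound n m ^ 2 ≤ cap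
  pay : payBound n m ≤ cap

/-! ### Expressions of the search -/

/-- The number of queries of a stage. -/
def queryCountE (k : Exp) : Exp := minimum (.read 5 k) (scalar 0)

/-- The number of matrices before a stage. -/
def offsetE (k : Exp) : Exp := .sum 12 k (queryCountE (.var 12) + 1)

/-- A matrix entry. -/
def entryE (u i j c : Exp) : Exp :=
  .read 5 (scalar 0 + 1 + (4 * (scalar 7 * (scalar 7 * u + i) + j) + c))

/-- The action of a query. -/
def queryCodeE (x s : Exp) : Exp :=
  .ite (md (x / .read 2 (s / (2 * scalar 8))) 2)
    (.ite (md (s / scalar 8) 2) (s - scalar 8) (s + scalar 8)) s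

/-- The place of an amplitude. -/
def ampIndex (k t x j : Exp) : Exp :=
  4 * scalar 7 * (scalar 6 * ((scalar 0 + 1) * k + t) + x) + j

/-- The squared distance of two numbers. -/
def sqDistE (x y : Exp) : Exp := (x - y + (y - x)) * (x - y + (y - x))

/-- The place of a path weight. -/
def pathIndex (x d h : Exp) : Exp := scalar 12 * ((scalar 0 + 1) * x + d) + h

/-- The place of an outcome of the best response. -/
def bestIndex (d h y : Exp) : Exp := 2 * scalar 6 * (scalar 12 * d + h) + y

/-- The weight of the node with the height `var 2` and the number `var 3`. -/
def nodeE (y : Exp) : Exp :=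
  .sum 8 (.read 3 (.var 2))
    (.read 8 (pathIndex (y / 2) (scalar 0) (.read 3 (.var 2) * .var 3 + .var 8)))

/-- The outcome of answering `0` at this node. -/
def halt0E (y : Exp) : Exp :=
  .ite (md y 2) 0 (.ite (.read 0 (y / 2)) (scalar 17) 0) * nodeE y

/-- The outcome of answering `1` at this node. -/
def halt1E (y : Exp) : Exp :=
  .ite (md y 2) 0 (.ite (.read 0 (y / 2)) 0 (scalar 17)) * nodeE y

/-- The outcome of going on at this node. -/
def stepE (y : Exp) : Exp :=
  .ite (md y 2) (128 * .ite (.var 2) (queryCountE (scalar 0 - .var 2)) (scalar 0)) 0 * nodeE y +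
    .ite (.var 2) (.sum 9 (scalar 7)
      (.read 9 (bestIndex (.var 2 - 1) (scalar 7 * .var 3 + .var 9) y))) 0

/-- The score of an alternative. -/
def scoreE (e : Exp → Exp) : Exp := .sum 6 (2 * scalar 6) (e (.var 6) * .read 10 (.var 6))

/-- The alternative with the least score. -/
def pickE (y : Exp) : Exp :=
  .ite (scoreE halt0E - scoreE halt1E)
    (.ite (scoreE halt1E - scoreE stepE) (stepE y) (halt1E y))
    (.ite (scoreE halt0E - scoreE stepE)
      (.ite (scoreE halt1E - scoreE stepE) (stepE y) (halt1E y)) (halt0E y))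

/-- A coefficient of the scalar product of two columns. -/
def gramE (u i j c : Exp) : Exp :=
  .sum 6 (scalar 7) (.sum 7 4
    (entryE u (.var 6) i (.var 7) * entryE u (.var 6) j (md (.var 7 + c) 4)))

/-- The numbers by which the columns `var 3` and `var 4` of the matrix `var 2` violate
orthonormality. -/
def orthoE : Exp :=
  let δ : Exp := .ite (.var 3 - .var 4 + (.var 4 - .var 3)) 0 (scalar 9 * scalar 9)
  let τ : Exp := 8 * (scalar 7 * scalar 7) * scalar 9
  let g := gramE (.var 2) (.var 3) (.var 4)
  (g 0 - (g 2 + δ + τ)) + ((g 2 + δ) - (g 0 + τ)) + (g 1 - (g 3 + τ)) + (g 3 - (g 1 + τ))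

/-- It is `0` if and only if the candidate is accepted. -/
def violationE : Exp :=
  (offsetE (scalar 0) - 2 * scalar 0) +
    .sum 2 (2 * scalar 0) (.sum 3 (scalar 7) (.sum 4 (scalar 7) orthoE)) +
    .sum 2 (2 * scalar 6) (.read 10 (.var 2) - scalar 13 * .read 11 (.const 1))

/-! ### Commands of the search -/

/-- Tabulates the digits of the candidate `var 0` in the array `5`. -/
def digitCmd : Cmd :=
  .loop 2 (scalar 11) (.set 5 (.var 2) (md (.var 0 / .read 4 (.var 2)) (scalar 10)))

/-- Tabulates the amplitudes in the array `6`. -/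
def ampCmd : Cmd :=
  .loop 2 (scalar 0) (.loop 3 (scalar 0 + 1) (.loop 4 (scalar 6) (.loop 5 (4 * scalar 7)
    (.set 6 (ampIndex (.var 2) (.var 3) (.var 4) (.var 5)) (.ite (.var 3)
      (.sum 6 (4 * scalar 7)
        (entryE (offsetE (.var 2) + .var 3) (.var 5 / 4) (.var 6 / 4)
            (md (md (.var 5) 4 + (4 - md (.var 6) 4)) 4) *
          .read 6 (ampIndex (.var 2) (.var 3 - 1) (.var 4)
            (4 * queryCodeE (.var 4) (.var 6 / 4) + md (.var 6) 4))))
      (entryE (offsetE (.var 2)) (.var 5 / 4) 0 (md (.var 5) 4)))))))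

/-- Tabulates the probabilities in the array `7`. -/
def probCmd : Cmd :=
  let z : Exp → Exp := fun c =>
    .read 6 (ampIndex (.var 2) (queryCountE (.var 2)) (.var 4) (4 * .var 5 + c))
  .loop 2 (scalar 0) (.loop 4 (scalar 6) (.loop 5 (scalar 7)
    (.set 7 (scalar 7 * (scalar 6 * .var 2 + .var 4) + .var 5)
      (sqDistE (z 0) (z 2) + sqDistE (z 1) (z 3)))))

/-- Tabulates the path weights in the array `8`. -/
def pathCmd : Cmd :=
  .loop 2 (scalar 6) (.loop 3 (scalar 0 + 1) (.loop 4 (scalar 12)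
    (.set 8 (pathIndex (.var 2) (.var 3) (.var 4)) (.ite (.var 3)
      (.read 7 (scalar 7 * (scalar 6 * (.var 3 - 1) + .var 2) + md (.var 4) (scalar 7)) *
        .read 8 (pathIndex (.var 2) (.var 3 - 1) (.var 4 / scalar 7)))
      1))))

/-- Computes the common denominator of the path weights. -/
def scaleCmd : Cmd := .set 11 (.const 1) (.read 3 (32 * offsetE (scalar 0)))

/-- Initializes the weights. -/
def zeroCmd : Cmd := .loop 2 (2 * scalar 6) (.set 10 (.var 2) 0)

/-- Tabulates the best response in the array `9`. -/
def bestCmd : Cmd :=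
  .loop 2 (scalar 0 + 1) (.loop 3 (scalar 12) (.loop 4 (2 * scalar 6)
    (.set 9 (bestIndex (.var 2) (.var 3) (.var 4))
      (.ite (.read 3 (scalar 0 - .var 2) - .var 3) (pickE (.var 4)) 0))))

/-- Updates the weights. -/
def weightCmd : Cmd :=
  .loop 2 (2 * scalar 6) (.set 10 (.var 2) (.read 10 (.var 2) +
    .read 9 (bestIndex (scalar 0) 0 (.var 2)) -
    .ite (md (.var 2) 2) (.read 5 (scalar 0) * .read 11 (.const 1))
      ((.const 1024 * scalar 7 - 2) * .read 11 (.const 1))))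

/-- Updates the result. -/
def resultCmd : Cmd :=
  .set 11 (.const 0) (.ite violationE (.read 11 (.const 0))
    (minimum (.read 5 (scalar 0)) (.read 11 (.const 0))))

/-- Treats the candidate `var 0`. -/
def candidateCmd : Cmd :=
  .seq digitCmd (.seq ampCmd (.seq probCmd (.seq pathCmd (.seq scaleCmd (.seq zeroCmd
    (.seq (.loop 1 (scalar 13) (.seq bestCmd weightCmd)) resultCmd))))))

end Search

/-! ### Tables of the digits, amplitudes and probabilities -/

namespace Search

open RAM RAM.Exp

theorem le_tableSize (n m : ℕ) : n < tableSize n m := by unfold tableSize; omega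

theorem base_pos (m : ℕ) : 0 < base m := by unfold base den; positivity

theorem indexSize_le (n : ℕ) : indexSize n ≤ 2 * n + 1 := by
  unfold indexSize
  rcases Nat.lt_or_ge 1 n with h | h
  · have h1 := Nat.pow_pred_clog_lt_self (b := 2) (by norm_num) h
    have h2 : 0 < Nat.clog 2 n := Nat.clog_pos (by norm_num) h
    have h3 : 2 ^ Nat.clog 2 n = 2 ^ (Nat.clog 2 n).pred * 2 := by
      rw [← pow_succ, Nat.pred_eq_sub_one]; congr 1; omega
    omega
  · rw [Nat.clog_of_right_le_one h]; omega

theorem workSize_eq {n m : ℕ} (h : Nat.clog 2 n + 1 ≤ m) :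
    workSize n m = 2 ^ (m - (Nat.clog 2 n + 1)) := by
  unfold workSize indexSize
  rw [← pow_succ', Nat.pow_div h (by norm_num)]

theorem workSize_mul {n m : ℕ} (h : Nat.clog 2 n + 1 ≤ m) :
    2 * indexSize n * workSize n m = 2 ^ m := by
  rw [workSize_eq h]
  unfold indexSize
  rw [← pow_succ', ← pow_add]; congr 1; omega

theorem workSize_pos {n m : ℕ} (h : Nat.clog 2 n + 1 ≤ m) : 0 < workSize n m := by
  rw [workSize_eq h]; positivity

theorem div_lt_indexSize {n m s : ℕ} (h : Nat.clog 2 n + 1 ≤ m) (hs : s < 2 ^ m) :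
    s / (2 * workSize n m) < indexSize n := by
  rw [Nat.div_lt_iff_lt_mul (by have := workSize_pos h; omega)]
  calc s < 2 ^ m := hs
    _ = _ := by rw [← workSize_mul h]; ring

theorem queryCode_lt {n m s : ℕ} (h : Nat.clog 2 n + 1 ≤ m) (x : ℕ) (hs : s < 2 ^ m) :
    queryCode n m x s < 2 ^ m := by
  unfold queryCode
  split_ifs with h1 h2
  · exact hs
  · have hz := workSize_pos h
    have e := workSize_mul h
    set z := workSize n m
    set q := s / z with hq
    have h3 : q < 2 * indexSize n := by
      rw [hq, Nat.div_lt_iff_lt_mul hz, e]; exact hs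
    have h4 : s < (q + 1) * z := (Nat.div_lt_iff_lt_mul hz).1 (Nat.lt_succ_self _)
    have h5 : (q + 1 + 1) * z ≤ 2 * indexSize n * z := Nat.mul_le_mul_right _ (by omega)
    rw [e] at h5
    have h6 : (q + 1 + 1) * z = (q + 1) * z + z := by ring
    omega
  · omega

theorem queryCount_le (n : ℕ) (d : ℕ → ℕ) (k : ℕ) : queryCount n d k ≤ n := min_le_right _ _

theorem offset_le (n : ℕ) (d : ℕ → ℕ) (k : ℕ) : offset n d k ≤ k * (n + 1) := by
  unfold offset
  refine (Finset.sum_le_card_nsmul _ _ (n + 1) fun j _ => ?_).trans (by simp)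
  have := queryCount_le n d j; omega

/-- The setting of the treatment of a candidate with the digits `d`. -/
structure Env (cap n m : ℕ) (F d : ℕ → ℕ) (σ : Store) : Prop where
  ctx : Ctx n m F σ
  caps : Caps cap n m
  addr : Nat.clog 2 n + 1 ≤ m
  digits : ∀ j < tableSize n m, σ 5 j = d j
  bound : ∀ j, d j < base m
  table_le : ∀ x, F x ≤ 1

theorem Env.congr {cap n m : ℕ} {F d : ℕ → ℕ} {σ σ' : Store} (h : Env cap n m F d σ)
    (e : ∀ a < 6, σ' a = σ a) : Env cap n m F d σ' where
  ctx := h.ctx.congr fun a ha => e a (by omega)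
  caps := h.caps
  addr := h.addr
  digits := by rw [e 5 (by omega)]; exact h.digits
  bound := h.bound
  table_le := h.table_le

section Candidate

variable {cap n m : ℕ} {F d : ℕ → ℕ} {σ : Store} {ρ : ℕ → ℕ} {k t x y i j u c s : Exp}
  {K T X Y I J U C A : ℕ}

theorem Ctx.n_is (h : Ctx n m F σ) : Is cap σ ρ (scalar 0) n := h.n_eq
theorem Ctx.inputs_is (h : Ctx n m F σ) : Is cap σ ρ (scalar 6) (2 ^ n) := h.inputs
theorem Ctx.states_is (h : Ctx n m F σ) : Is cap σ ρ (scalar 7) (2 ^ m) := h.states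
theorem Ctx.work_is (h : Ctx n m F σ) : Is cap σ ρ (scalar 8) (workSize n m) := h.work
theorem Ctx.den_is (h : Ctx n m F σ) : Is cap σ ρ (scalar 9) (den m) := h.den_eq
theorem Ctx.base_is (h : Ctx n m F σ) : Is cap σ ρ (scalar 10) (base m) := h.base_eq
theorem Ctx.size_is (h : Ctx n m F σ) : Is cap σ ρ (scalar 11) (tableSize n m) := h.size
theorem Ctx.leaves_is (h : Ctx n m F σ) : Is cap σ ρ (scalar 12) ((2 ^ m) ^ n) := h.leaves
theorem Ctx.rounds_is (h : Ctx n m F σ) : Is cap σ ρ (scalar 13) (rounds n m) := h.rounds_eq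
theorem Ctx.errorWeight_is (h : Ctx n m F σ) : Is cap σ ρ (scalar 17) (errorWeight m) :=
  h.errorWeight_eq

namespace Caps

variable (h : Caps cap n m)
include h

theorem n_le : n ≤ cap := by have := h.small; omega
theorem succ_le : n + 1 ≤ cap := by have := h.small; omega
theorem lit_le (hc : C ≤ 128) : C ≤ cap := by have := h.small; omega
theorem inputs_le : 2 ^ n ≤ cap := by have := h.inputs; omega
theorem states_le : 2 ^ m ≤ cap := by have := h.states; omega
theorem states4_le : 4 * 2 ^ m ≤ cap := by have := h.states; omega

end Caps

theorem digitCmd_run {c : ℕ} (hC : Ctx n m F σ) (hcap : Caps cap n m)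
    (hc : ρ 0 = c) (hlt : c < base m ^ numDigits n m) :
    Filled 5 σ (digit m c) (tableSize n m) (digitCmd.run cap ρ σ) := by
  have hs : Exp.Is cap σ ρ (scalar 11) (tableSize n m) := hC.size_is
  refine Filled.loop (len := 1) hs ((Nat.le_succ _).trans hcap.size) .refl ?_ (by omega)
  intro j hj σ' h
  have hC' : Ctx n m F σ' := hC.congr fun a ha => h.1 a (by omega)
  refine Filled.set (.var (by simp)) (.congr (.md (.div (.var hc) (.read (.var rfl)
    (hC'.basePow _ hj.le)) ?_) hC'.base_is ?_ hcap.base_le) ?_) h rfl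
  · exact hlt.le.trans hcap.candidates
  · exact (Nat.div_le_self _ _).trans (hlt.le.trans hcap.candidates)
  · simp [digit]

namespace Env

variable (E : Env cap n m F d σ)
include E

theorem queryCount_is (hk : Is cap σ ρ k K) (hK : K ≤ n) :
    Is cap σ ρ (queryCountE k) (queryCount n d K) :=
  .minimum (.read hk (E.digits _ (hK.trans_lt (le_tableSize n m)))) E.ctx.n_is

theorem offset_is (hk : Is cap σ ρ k K) (hK : K ≤ n) :
    Is cap σ ρ (offsetE k) (offset n d K) :=
  .sum hk (hK.trans E.caps.n_le) fun i hi => .add (E.queryCount_is (.var (by simp)) (by omega))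
    (.lit 1)

theorem entry_is (hu : Is cap σ ρ u U) (hi : Is cap σ ρ i I) (hj : Is cap σ ρ j J)
    (hc : Is cap σ ρ c C) (hU : U < (n + 1) * (n + 1)) (hI : I < 2 ^ m) (hJ : J < 2 ^ m)
    (hC : C < 4) : Is cap σ ρ (entryE u i j c) (entry n m d U I J C) := by
  have hS := E.ctx.states_is (cap := cap) (ρ := ρ)
  refine .read (.add (.add E.ctx.n_is (.lit 1)) (.add (.mul (.lit 4) (.add (.mul hS (.add
    (.mul hS hu E.caps.states_le) hi) E.caps.states_le) hj) (E.caps.lit_le (by omega))) hc)) ?_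
  refine E.digits _ (Nat.add_lt_add_left ?_ _)
  exact flat_lt (flat_lt (flat_lt hU hI) hJ) hC

theorem queryCode_is (hx : Is cap σ ρ x X) (hs : Is cap σ ρ s A) (hX : X < 2 ^ n)
    (hA : A < 2 ^ m) : Is cap σ ρ (queryCodeE x s) (queryCode n m X A) := by
  have hw := E.ctx.work_is (cap := cap) (ρ := ρ)
  have h2 : 2 ≤ cap := E.caps.lit_le (by omega)
  have hXc : X ≤ cap := hX.le.trans E.caps.inputs_le
  have hAc : A ≤ cap := hA.le.trans E.caps.states_le
  have h1 := indexSize_le n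
  have h3 := div_lt_indexSize E.addr hA
  have h4 := E.addr
  refine .ite (.md (.div hx (.read (.div hs (.mul (.lit 2) hw h2) hAc)
      (E.ctx.twoPow _ (by omega))) hXc) (.lit 2) ((Nat.div_le_self _ _).trans hXc) h2)
    (fun _ => .ite (.md (.div hs hw hAc) (.lit 2) ((Nat.div_le_self _ _).trans hAc) h2)
      (fun _ => .sub hs hw) (fun _ => .add hs hw)) (fun _ => hs)

theorem ampIndex_is (hk : Is cap σ ρ k K) (ht : Is cap σ ρ t T) (hx : Is cap σ ρ x X)
    (hj : Is cap σ ρ j J) :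
    Is cap σ ρ (ampIndex k t x j) (4 * 2 ^ m * (2 ^ n * ((n + 1) * K + T) + X) + J) :=
  .add (.mul (.mul (.lit 4) E.ctx.states_is (E.caps.lit_le (by omega)))
    (.add (.mul E.ctx.inputs_is (.add (.mul (.add E.ctx.n_is (.lit 1)) hk E.caps.succ_le) ht)
      E.caps.inputs_le) hx) E.caps.states4_le) hj

end Env

/-- The contents of the array of amplitudes. -/
def ampTable (n m : ℕ) (d : ℕ → ℕ) : ℕ → ℕ :=
  flat (4 * 2 ^ m) fun q j => flat (2 ^ n) (fun r x =>
    flat (n + 1) (fun k t => amplitude n m d k x t j) r) q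

theorem ampTable_apply (hj : J < 4 * 2 ^ m) (hX : X < 2 ^ n) (hT : T < n + 1) :
    ampTable n m d (4 * 2 ^ m * (2 ^ n * ((n + 1) * K + T) + X) + J) = amplitude n m d K X T J := by
  unfold ampTable
  rw [flat_apply _ hj, flat_apply _ hX, flat_apply _ hT]

theorem entry_lt (hB : ∀ j, d j < base m) (u i j c : ℕ) : entry n m d u i j c < base m := hB _

theorem amplitude_le (hB : ∀ j, d j < base m) (k x t j : ℕ) :
    amplitude n m d k x t j ≤ (4 * 2 ^ m * base m) ^ (t + 1) := by
  have hS : 0 < 2 ^ m := by positivity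
  induction t generalizing j with
  | zero =>
    rw [zero_add, pow_one]
    exact (entry_lt hB _ _ _ _).le.trans (Nat.le_mul_of_pos_left _ (by omega))
  | succ t ih =>
    rw [amplitude, pow_succ', mul_assoc (4 * 2 ^ m)]
    refine (Finset.sum_le_card_nsmul _ _ (base m * (4 * 2 ^ m * base m) ^ (t + 1))
      fun u _ => ?_).trans (by simp)
    exact Nat.mul_le_mul (entry_lt hB _ _ _ _).le (ih _)

theorem amplitude_le_ampBound (hB : ∀ j, d j < base m) (k x j : ℕ) {t : ℕ} (ht : t ≤ n) :
    amplitude n m d k x t j ≤ ampBound n m :=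
  (amplitude_le hB k x t j).trans (Nat.pow_le_pow_right
    (Nat.mul_pos (by positivity) (base_pos m)) (by omega))

theorem ampCmd_run (E : Env cap n m F d σ) :
    Filled 6 σ (ampTable n m d) (4 * 2 ^ m * (2 ^ n * ((n + 1) * n))) (ampCmd.run cap ρ σ) := by
  have hcap := E.caps
  have h4 : 4 ≤ cap := hcap.lit_le (by omega)
  refine .loop (len := 4 * 2 ^ m * (2 ^ n * (n + 1))) E.ctx.n_is hcap.n_le .refl ?_ (by ring)
  intro k hk σ h
  have hE := E.congr (σ' := σ) fun a ha => h.1 a (by omega)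
  refine .loop (len := 4 * 2 ^ m * 2 ^ n) (.add hE.ctx.n_is (.lit 1)) hcap.succ_le h ?_ (by ring)
  intro t ht σ h
  have hE := E.congr (σ' := σ) fun a ha => h.1 a (by omega)
  refine .loop (len := 4 * 2 ^ m) hE.ctx.inputs_is hcap.inputs_le h ?_ (by ring)
  intro x hx σ h
  have hE := E.congr (σ' := σ) fun a ha => h.1 a (by omega)
  refine .loop (len := 1) (.mul (.lit 4) hE.ctx.states_is h4) hcap.states4_le h ?_ (by ring)
  intro j hj σ h
  have hE := E.congr (σ' := σ) fun a ha => h.1 a (by omega)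
  have hjc : j ≤ cap := hj.le.trans hcap.states4_le
  have hoff := offset_le n d k
  have hkn : k * (n + 1) ≤ n * (n + 1) := Nat.mul_le_mul_right _ hk.le
  have hsq : (n + 1) * (n + 1) = n * (n + 1) + n + 1 := by ring
  have hkn' : k * (n + 1) + (n + 1) ≤ n * (n + 1) := by
    rw [← Nat.succ_mul]; exact Nat.mul_le_mul_right _ hk
  have e : 0 + 4 * 2 ^ m * (2 ^ n * (n + 1)) * k + 4 * 2 ^ m * 2 ^ n * t + 4 * 2 ^ m * x + 1 * j =
      4 * 2 ^ m * (2 ^ n * ((n + 1) * k + t) + x) + j := by ring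
  rw [e] at h ⊢
  refine Filled.set (p := 4 * 2 ^ m * (2 ^ n * ((n + 1) * k + t) + x) + j) (hE.ampIndex_is
      (.var rfl) (.var rfl) (.var rfl) (.var rfl)) ?_ h rfl
  rw [ampTable_apply hj hx ht]
  refine .congr (.ite (.var rfl) (fun h0 => .sum (.mul (.lit 4) hE.ctx.states_is h4)
    hcap.states4_le (f := fun u => entry n m d (offset n d k + t) (j / 4) (u / 4)
      ((j % 4 + (4 - u % 4)) % 4) * amplitude n m d k x (t - 1) (4 * queryCode n m x
          (u / 4) + u % 4))
      fun u hu => .mul (hE.entry_is (.add (hE.offset_is (.var rfl) hk.le) (.var rfl))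
        (.div (.var rfl) (.lit 4) hjc) (.div (.var rfl) (.lit 4) ?_) (.md (.add (.md (.var rfl)
          (.lit 4) hjc h4) (.sub (.lit 4) (.md (.var rfl) (.lit 4) ?_ h4))) (.lit 4) ?_ h4) ?_
              ?_ ?_ ?_)
        (.read (hE.ampIndex_is (.var rfl) (.sub (.var rfl) (.lit 1)) (.var rfl) (.add (.mul (.lit 4)
          (hE.queryCode_is (.var rfl) (.div (.var rfl) (.lit 4) ?_) hx ?_) h4)
          (.md (.var rfl) (.lit 4) ?_ h4))) ?_) ?_)
    (fun h0 => hE.entry_is (U := offset n d k) (I := j / 4) (C := j % 4) (hE.offset_is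
        (.var rfl) hk.le) (.div (.var rfl) (.lit 4) hjc)
      (.lit 0) (.md (.var rfl) (.lit 4) hjc h4) ?_ ?_ ?_ ?_)) ?_
  · exact hu.le.trans hcap.states4_le
  · exact hu.le.trans hcap.states4_le
  · exact le_trans (by omega) (hcap.lit_le (C := 8) (by omega))
  · omega
  · omega
  · omega
  · omega
  · exact hu.le.trans hcap.states4_le
  · change u / 4 < 2 ^ m; omega
  · exact hu.le.trans hcap.states4_le
  · have hq : 4 * queryCode n m x (u / 4) + u % 4 < 4 * 2 ^ m :=
      flat_lt (queryCode_lt E.addr _ (by omega)) (by omega)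
    change σ 6 (4 * 2 ^ m * (2 ^ n * ((n + 1) * k + (t - 1)) + x) +
      (4 * queryCode n m x (u / 4) + u % 4)) = _
    rw [h.2, ampTable_apply hq hx (by omega)]
    have : 4 * 2 ^ m * (2 ^ n * ((n + 1) * k + t) + x) =
        4 * 2 ^ m * (2 ^ n * ((n + 1) * k + (t - 1)) + x) + 4 * 2 ^ m * 2 ^ n := by
      obtain ⟨t, rfl⟩ := Nat.exists_eq_succ_of_ne_zero h0
      simp only [Nat.succ_eq_add_one, Nat.add_sub_cancel]; ring
    have h5 : 4 * 2 ^ m ≤ 4 * 2 ^ m * 2 ^ n := Nat.le_mul_of_pos_right _ (by positivity)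
    omega
  · exact (entry_lt E.bound _ _ _ _).le.trans hcap.base_le
  · omega
  · omega
  · positivity
  · omega
  · cases t with
    | zero => rfl
    | succ t => rfl

theorem sqDist_le (h : X ≤ A) (h' : Y ≤ A) : sqDist X Y ≤ A ^ 2 := by
  unfold sqDist
  rw [sq]; exact Nat.mul_le_mul (by omega) (by omega)

theorem prob_le (hB : ∀ j, d j < base m) (k x s : ℕ) : prob n m d k x s ≤ 2 * ampBound n m ^ 2 := by
  have h := fun j => amplitude_le_ampBound hB k x j (queryCount_le n d k)
  have h1 := sqDist_le (h (4 * s)) (h (4 * s + 2))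
  have h2 := sqDist_le (h (4 * s + 1)) (h (4 * s + 3))
  unfold prob
  omega

/-- The contents of the array of probabilities. -/
def probTable (n m : ℕ) (d : ℕ → ℕ) : ℕ → ℕ :=
  flat (2 ^ m) fun q s => flat (2 ^ n) (fun k x => prob n m d k x s) q

theorem probTable_apply (hA : A < 2 ^ m) (hX : X < 2 ^ n) :
    probTable n m d (2 ^ m * (2 ^ n * K + X) + A) = prob n m d K X A := by
  unfold probTable
  rw [flat_apply _ hA, flat_apply _ hX]

theorem sqDist_is (hx : Is cap σ ρ x X) (hy : Is cap σ ρ y Y) (hX : X ≤ A) (hY : Y ≤ A)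
    (hA : A ≤ cap) : Is cap σ ρ (sqDistE x y) (sqDist X Y) :=
  .mul (.add (.sub hx hy) (.sub hy hx)) (.add (.sub hx hy) (.sub hy hx)) (by omega)

theorem probCmd_run (E : Env cap n m F d σ)
    (h6 : ∀ p < 4 * 2 ^ m * (2 ^ n * ((n + 1) * n)), σ 6 p = ampTable n m d p) :
    Filled 7 σ (probTable n m d) (2 ^ m * (2 ^ n * n)) (probCmd.run cap ρ σ) := by
  have hcap := E.caps
  have h4 : 4 ≤ cap := hcap.lit_le (by omega)
  refine .loop (len := 2 ^ m * 2 ^ n) E.ctx.n_is hcap.n_le .refl ?_ (by ring)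
  intro k hk σ h
  have hE := E.congr (σ' := σ) fun a ha => h.1 a (by omega)
  refine .loop (len := 2 ^ m) hE.ctx.inputs_is hcap.inputs_le h ?_ (by ring)
  intro x hx σ h
  have hE := E.congr (σ' := σ) fun a ha => h.1 a (by omega)
  refine .loop (len := 1) hE.ctx.states_is hcap.states_le h ?_ (by ring)
  intro s hs σ h
  have hE := E.congr (σ' := σ) fun a ha => h.1 a (by omega)
  have e : 0 + 2 ^ m * 2 ^ n * k + 2 ^ m * x + 1 * s = 2 ^ m * (2 ^ n * k + x) + s := by ring
  rw [e] at h ⊢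
  refine Filled.set (p := 2 ^ m * (2 ^ n * k + x) + s) (.add (.mul hE.ctx.states_is
      (.add (.mul hE.ctx.inputs_is (.var rfl)
    hcap.inputs_le) (.var rfl)) hcap.states_le) (.var rfl)) ?_ h rfl
  rw [probTable_apply hs hx]
  have hq : queryCount n d k < n + 1 := (queryCount_le n d k).trans_lt (Nat.lt_succ_self _)
  have hz : ∀ (c : Exp) C, C < 4 → (∀ ρ, Is cap σ ρ c C) →
      Is cap σ (Function.update (Function.update
      (Function.update ρ 2 k) 4 x) 5 s) (.read 6 (ampIndex (.var 2) (queryCountE (.var 2)) (.var 4)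
        (4 * .var 5 + c))) (amplitude n m d k x (queryCount n d k) (4 * s + C)) := by
    intro c C hC hc
    refine .read (X := 4 * 2 ^ m * (2 ^ n * ((n + 1) * k + queryCount n d k) + x) + (4 * s + C))
      (hE.ampIndex_is (.var rfl) (hE.queryCount_is (.var rfl) hk.le) (.var rfl)
      (.add (.mul (.lit 4) (.var rfl) h4) (hc _))) ?_
    have hj : 4 * s + C < 4 * 2 ^ m := by omega
    rw [h.1 6 (by omega), h6, ampTable_apply hj hx hq]
    exact flat_lt (flat_lt (flat_lt hk hq) hx) hj
  have hb := fun j => amplitude_le_ampBound E.bound k x j (queryCount_le n d k)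
  exact .add (sqDist_is (.congr (hz _ 0 (by omega) fun _ => .lit 0) rfl)
      (hz _ 2 (by omega) fun _ => .lit 2)
    (hb _) (hb _) hcap.amp) (sqDist_is (hz _ 1 (by omega) fun _ => .lit 1)
        (hz _ 3 (by omega) fun _ => .lit 3)
    (hb _) (hb _) hcap.amp)

end Candidate

end Search

/-! ### The best response and the perceptron as commands -/

namespace Search

open RAM RAM.Exp DecisionTree

section Candidate

variable {cap n m : ℕ} {F d : ℕ → ℕ} {σ : Store} {ρ : ℕ → ℕ} {k t x y i j u c s h : Exp}
  {K T X Y I J U C A H : ℕ}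

theorem pathWeight_le {S B : ℕ} {p : ℕ → ℕ → ℕ} (hp : ∀ k s, p k s ≤ B) (k h : ℕ) :
    pathWeight S p k h ≤ B ^ k := by
  induction k generalizing h with
  | zero => exact le_rfl
  | succ k ih => rw [pathWeight, pow_succ']; exact Nat.mul_le_mul (hp _ _) (ih _)

/-- The contents of the array of path weights. -/
def pathTable (n m : ℕ) (d : ℕ → ℕ) : ℕ → ℕ :=
  flat ((2 ^ m) ^ n) fun q h => flat (n + 1) (fun x t =>
    pathWeight (2 ^ m) (fun k s => prob n m d k x s) t h) q

theorem pathTable_apply (hH : H < (2 ^ m) ^ n) (hT : T < n + 1) :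
    pathTable n m d ((2 ^ m) ^ n * ((n + 1) * X + T) + H) =
      pathWeight (2 ^ m) (fun k s => prob n m d k X s) T H := by
  unfold pathTable
  rw [flat_apply _ hH, flat_apply _ hT]

theorem Env.pathIndex_is (E : Env cap n m F d σ) (hx : Is cap σ ρ x X) (ht : Is cap σ ρ t T)
    (hh : Is cap σ ρ h H) :
    Is cap σ ρ (pathIndex x t h) ((2 ^ m) ^ n * ((n + 1) * X + T) + H) :=
  .add (.mul E.ctx.leaves_is (.add (.mul (.add E.ctx.n_is (.lit 1)) hx E.caps.succ_le) ht)
    E.caps.leaves) hh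

theorem pathCmd_run (E : Env cap n m F d σ)
    (h7 : ∀ p < 2 ^ m * (2 ^ n * n), σ 7 p = probTable n m d p) :
    Filled 8 σ (pathTable n m d) ((2 ^ m) ^ n * ((n + 1) * 2 ^ n)) (pathCmd.run cap ρ σ) := by
  have hcap := E.caps
  refine .loop (len := (2 ^ m) ^ n * (n + 1)) E.ctx.inputs_is hcap.inputs_le .refl ?_ (by ring)
  intro x hx σ h
  have hE := E.congr (σ' := σ) fun a ha => h.1 a (by omega)
  refine .loop (len := (2 ^ m) ^ n) (.add hE.ctx.n_is (.lit 1)) hcap.succ_le h ?_ (by ring)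
  intro t ht σ h
  have hE := E.congr (σ' := σ) fun a ha => h.1 a (by omega)
  refine .loop (len := 1) hE.ctx.leaves_is hcap.leaves h ?_ (by ring)
  intro g hg σ h
  have hE := E.congr (σ' := σ) fun a ha => h.1 a (by omega)
  have hgc : g ≤ cap := hg.le.trans hcap.leaves
  have hS : 0 < 2 ^ m := by positivity
  have e : 0 + (2 ^ m) ^ n * (n + 1) * x + (2 ^ m) ^ n * t + 1 * g =
      (2 ^ m) ^ n * ((n + 1) * x + t) + g := by ring
  rw [e] at h ⊢
  refine Filled.set (p := (2 ^ m) ^ n * ((n + 1) * x + t) + g)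
    (hE.pathIndex_is (.var rfl) (.var rfl) (.var rfl)) ?_ h rfl
  rw [pathTable_apply hg ht]
  refine .congr (.ite (.var rfl) (fun h0 => .mul (X := prob n m d (t - 1) x (g % 2 ^ m))
      (Y := pathWeight (2 ^ m) (fun k s => prob n m d k x s) (t - 1) (g / 2 ^ m))
      (.read (X := 2 ^ m * (2 ^ n * (t - 1) + x) + g % 2 ^ m) (.add (.mul hE.ctx.states_is
        (.add (.mul hE.ctx.inputs_is (.sub (.var rfl) (.lit 1)) hcap.inputs_le) (.var rfl))
        hcap.states_le) (.md (.var rfl) hE.ctx.states_is hgc hcap.states_le)) ?_)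
      (.read (X := (2 ^ m) ^ n * ((n + 1) * x + (t - 1)) + g / 2 ^ m) (hE.pathIndex_is (.var rfl)
        (.sub (.var rfl) (.lit 1)) (.div (.var rfl) hE.ctx.states_is hgc)) ?_) ?_)
    (fun h0 => .lit 1)) ?_
  · have hs : g % 2 ^ m < 2 ^ m := Nat.mod_lt _ hS
    have ht' : t - 1 < n := by change t ≠ 0 at h0; omega
    rw [h.1 7 (by omega), h7 _ (flat_lt (flat_lt ht' hx) hs), probTable_apply hs hx]
  · change t ≠ 0 at h0
    have hs : g / 2 ^ m < (2 ^ m) ^ n := (Nat.div_le_self _ _).trans_lt hg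
    rw [h.2, pathTable_apply hs (by omega)]
    have : (2 ^ m) ^ n * ((n + 1) * x + t) =
        (2 ^ m) ^ n * ((n + 1) * x + (t - 1)) + (2 ^ m) ^ n := by
      obtain ⟨t, rfl⟩ := Nat.exists_eq_succ_of_ne_zero h0
      simp only [Nat.succ_eq_add_one, Nat.add_sub_cancel]; ring
    omega
  · exact (prob_le E.bound _ _ _).trans hcap.prob
  · cases t with
    | zero => rfl
    | succ t => rfl

/-- The setting of the perceptron. -/
structure RoundEnv (cap n m : ℕ) (F d w : ℕ → ℕ) (σ : Store) : Prop extends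
    Env cap n m F d σ where
  paths : ∀ p < (2 ^ m) ^ n * ((n + 1) * 2 ^ n), σ 8 p = pathTable n m d p
  weights : ∀ y < 2 * 2 ^ n, σ 10 y = w y
  scale_eq : σ 11 1 = scale n m d

theorem RoundEnv.congr {w : ℕ → ℕ} {σ' : Store} (h : RoundEnv cap n m F d w σ)
    (e : ∀ a, a ≠ 9 → σ' a = σ a) : RoundEnv cap n m F d w σ' where
  toEnv := h.toEnv.congr fun a ha => e a (by omega)
  paths := by rw [e 8 (by omega)]; exact h.paths
  weights := by rw [e 10 (by omega)]; exact h.weights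
  scale_eq := by rw [e 11 (by omega)]; exact h.scale_eq

theorem node_le (hB : ∀ j, d j < base m) (hK : K ≤ n) :
    (problem n m F d).node K H Y ≤ (2 ^ m) ^ n * pathBound n m := by
  have hb : 0 < 2 * ampBound n m ^ 2 := by
    have : 0 < ampBound n m := Nat.pow_pos (Nat.mul_pos (by positivity) (base_pos m))
    positivity
  refine (Finset.sum_le_card_nsmul _ _ (pathBound n m) fun g _ => ?_).trans ?_
  · exact pathWeight_le (fun k s => prob_le hB k _ s) n _
  · rw [Finset.card_range, smul_eq_mul]
    exact Nat.mul_le_mul_right _ (Nat.pow_le_pow_right (Nat.two_pow_pos m) hK)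

/-- A bound for the payments of the problem of a candidate. -/
def payCoeff (n m h : ℕ) : ℕ := errorWeight m + 128 * n * (h + 1)

theorem haltPay_le (b y : ℕ) : haltPay m F b y ≤ errorWeight m := by
  unfold haltPay; split_ifs <;> omega

theorem stepPay_le (h y : ℕ) : stepPay n d h y ≤ 128 * n := by
  unfold stepPay
  have := queryCount_le n d (n - h)
  split_ifs <;> omega

theorem payBound_problem : (problem n m F d).PayBound fun h _ => payCoeff n m h where
  halt b h y := (haltPay_le b y).trans (Nat.le_add_right _ _)
  step_zero y := (stepPay_le 0 y).trans (by unfold payCoeff; omega)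
  step_succ h y := by
    have : (problem n m F d).step (h + 1) y ≤ 128 * n := stepPay_le _ _
    unfold payCoeff
    have e : 128 * n * (h + 1 + 1) = 128 * n * (h + 1) + 128 * n := by ring
    omega

theorem payCoeff_mul_le (hB : ∀ j, d j < base m) (hK : K ≤ n) :
    payCoeff n m K * (problem n m F d).node K H Y ≤ payBound n m := by
  refine Nat.mul_le_mul ?_ (node_le hB hK)
  unfold payCoeff
  exact Nat.add_le_add_left (Nat.mul_le_mul_left _ (by omega)) _

theorem pay_le_payBound (hB : ∀ j, d j < base m) (δ : ℕ → ℕ → ℕ) (hK : K ≤ n) :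
    (problem n m F d).pay δ K H Y ≤ payBound n m :=
  (payBound_problem.pay_le (fun _ _ => Nat.zero_le _) δ K H Y).trans (payCoeff_mul_le hB hK)

/-- The outcome of going on, and of a best response from then on. -/
def stepValue (n m : ℕ) (F d w : ℕ → ℕ) (K H Y : ℕ) : ℕ :=
  stepPay n d K Y * (problem n m F d).node K H Y + if K = 0 then 0 else
    ∑ s ∈ Finset.range (2 ^ m), (problem n m F d).best (2 * 2 ^ n) w (K - 1) (2 ^ m * H + s) Y

theorem best_eq_pick (w : ℕ → ℕ) : (problem n m F d).best (2 * 2 ^ n) w K H =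
    Problem.pick (2 * 2 ^ n) w (fun y => haltPay m F 0 y * (problem n m F d).node K H y)
      (fun y => haltPay m F 1 y * (problem n m F d).node K H y) (stepValue n m F d w K H) := by
  cases K with
  | zero => rfl
  | succ K =>
    have : stepValue n m F d w (K + 1) H = fun y =>
        (problem n m F d).step (K + 1) y * (problem n m F d).node (K + 1) H y +
        ∑ s ∈ Finset.range (problem n m F d).S,
          (problem n m F d).best (2 * 2 ^ n) w K (H * (problem n m F d).S + s) y := by
      funext y
      unfold stepValue
      rw [if_neg (Nat.succ_ne_zero K), Nat.add_sub_cancel, mul_comm (2 ^ m)]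
      rfl
    rw [this]; rfl

theorem stepValue_le (hB : ∀ j, d j < base m) (w : ℕ → ℕ) (hK : K ≤ n) :
    stepValue n m F d w K H Y ≤ payBound n m := by
  obtain ⟨δ, h⟩ := (problem n m F d).exists_best_eq_pay (2 * 2 ^ n) w
  let δ' : ℕ → ℕ → ℕ := fun K' H' => if K' = K then 2 else δ K' H'
  have e : ∀ K' < K, ∀ H Y, (problem n m F d).pay δ' K' H Y = (problem n m F d).pay δ K' H Y := by
    intro K'
    induction K' with
    | zero =>
      intro h H Y
      have : δ' 0 H = δ 0 H := if_neg (by omega)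
      simp only [Problem.pay, this]
    | succ K' ih =>
      intro h H Y
      have : δ' (K' + 1) H = δ (K' + 1) H := if_neg (by omega)
      simp only [Problem.pay, this, ih (by omega)]
  refine le_trans (le_of_eq ?_) (pay_le_payBound (F := F) (H := H) (Y := Y) hB δ' hK)
  have h2 : δ' K H = 2 := if_pos rfl
  cases K with
  | zero => simp only [Problem.pay, h2]; rfl
  | succ K =>
    simp only [Problem.pay, h2, select, stepValue]
    rw [if_neg (Nat.succ_ne_zero K), if_neg (by norm_num), if_neg (by norm_num), Nat.add_sub_cancel,
      mul_comm (2 ^ m)]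
    simp only [h, ← e K (Nat.lt_succ_self K)]
    rfl

namespace RoundEnv

variable {w : ℕ → ℕ} {v : ℕ}

theorem node_is (E : RoundEnv cap n m F d w σ) (h2 : ρ 2 = K) (h3 : ρ 3 = H) (hK : K ≤ n)
    (hH : H < (2 ^ m) ^ (n - K)) (hv : v ≠ 8) (hY : ρ v = Y) (hYN : Y < 2 * 2 ^ n) :
    Is cap σ ρ (nodeE (.var v)) ((problem n m F d).node K H Y) := by
  have hcap := E.caps
  have hKS : (2 ^ m) ^ K ≤ (2 ^ m) ^ n := Nat.pow_le_pow_right (by positivity) hK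
  have hKe : K ≤ maxExponent n := by unfold maxExponent; omega
  have hpow : ∀ ρ : ℕ → ℕ, ρ 2 = K → Is cap σ ρ (.read 3 (.var 2)) ((2 ^ m) ^ K) :=
    fun ρ h => .read (.var h) (E.ctx.statePow K hKe)
  refine .sum (hpow _ h2) (hKS.trans hcap.leaves) fun g hg => ?_
  refine .read (X := (2 ^ m) ^ n * ((n + 1) * (Y / 2) + n) + ((2 ^ m) ^ K * H + g))
    (E.pathIndex_is (.div (.var ?_) (.lit 2) ?_) E.ctx.n_is (.add (.mul (hpow _ ?_) (.var ?_)
      (hKS.trans hcap.leaves)) (.var (by simp)))) ?_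
  · rw [Function.update_of_ne hv, hY]
  · exact hYN.le.trans hcap.inputs
  · rw [Function.update_of_ne (by omega), h2]
  · rw [Function.update_of_ne (by omega), h3]
  · have hlt : (2 ^ m) ^ K * H + g < (2 ^ m) ^ n := by
      have hg' : g < (2 ^ m) ^ K := hg
      have := flat_lt hH hg'
      rwa [← pow_add, Nat.add_sub_cancel' hK] at this
    have hx : Y / 2 < 2 ^ n := by omega
    rw [E.paths _ (flat_lt (flat_lt hx (Nat.lt_succ_self n)) hlt),
      pathTable_apply hlt (Nat.lt_succ_self n), mul_comm ((2 ^ m) ^ K)]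
    rfl

theorem mul_node_is (E : RoundEnv cap n m F d w σ) (h2 : ρ 2 = K) (h3 : ρ 3 = H) (hK : K ≤ n)
    (hH : H < (2 ^ m) ^ (n - K)) (hv : v ≠ 8) (hY : ρ v = Y) (hYN : Y < 2 * 2 ^ n)
    (hx : Is cap σ ρ x X) (hX : X ≤ cap) :
    Is cap σ ρ (x * nodeE (.var v)) (X * (problem n m F d).node K H Y) :=
  .mul hx (E.node_is h2 h3 hK hH hv hY hYN) hX

theorem halt0_is (E : RoundEnv cap n m F d w σ) (h2 : ρ 2 = K) (h3 : ρ 3 = H) (hK : K ≤ n)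
    (hH : H < (2 ^ m) ^ (n - K)) (hv : v ≠ 8) (hY : ρ v = Y) (hYN : Y < 2 * 2 ^ n) :
    Is cap σ ρ (halt0E (.var v)) (haltPay m F 0 Y * (problem n m F d).node K H Y) := by
  have hYc : Y ≤ cap := hYN.le.trans E.caps.inputs
  have h2c : 2 ≤ cap := E.caps.lit_le (by omega)
  refine E.mul_node_is h2 h3 hK hH hv hY hYN (.congr (.ite (.md (.var hY) (.lit 2) hYc h2c)
    (fun _ => .lit 0) fun _ => .ite (.read (.div (.var hY) (.lit 2) hYc)
      (E.ctx.table (Y / 2) (by omega))) (fun _ => E.ctx.errorWeight_is) fun _ => .lit 0) ?_)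
    ((haltPay_le 0 Y).trans E.caps.errorWeight_le)
  rfl

theorem halt1_is (E : RoundEnv cap n m F d w σ) (h2 : ρ 2 = K) (h3 : ρ 3 = H) (hK : K ≤ n)
    (hH : H < (2 ^ m) ^ (n - K)) (hv : v ≠ 8) (hY : ρ v = Y) (hYN : Y < 2 * 2 ^ n) :
    Is cap σ ρ (halt1E (.var v)) (haltPay m F 1 Y * (problem n m F d).node K H Y) := by
  have hYc : Y ≤ cap := hYN.le.trans E.caps.inputs
  have h2c : 2 ≤ cap := E.caps.lit_le (by omega)
  refine E.mul_node_is h2 h3 hK hH hv hY hYN (.congr (.ite (.md (.var hY) (.lit 2) hYc h2c)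
    (fun _ => .lit 0) fun _ => .ite (.read (.div (.var hY) (.lit 2) hYc)
      (E.ctx.table (Y / 2) (by omega))) (fun _ => .lit 0) fun _ => E.ctx.errorWeight_is) ?_)
    ((haltPay_le 1 Y).trans E.caps.errorWeight_le)
  have := E.table_le (Y / 2)
  unfold haltPay
  congr 1
  split_ifs <;> first | rfl | omega

end RoundEnv

/-- The contents of the array of best responses. -/
def bestTable (n m : ℕ) (F d w : ℕ → ℕ) : ℕ → ℕ :=
  flat (2 * 2 ^ n) fun q y => flat ((2 ^ m) ^ n) (fun k h =>
    if h < (2 ^ m) ^ (n - k) then (problem n m F d).best (2 * 2 ^ n) w k h y else 0) q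

theorem bestTable_apply {w : ℕ → ℕ} (hY : Y < 2 * 2 ^ n) (hH : H < (2 ^ m) ^ (n - K)) :
    bestTable n m F d w (2 * 2 ^ n * ((2 ^ m) ^ n * K + H) + Y) =
      (problem n m F d).best (2 * 2 ^ n) w K H Y := by
  have : (2 ^ m) ^ (n - K) ≤ (2 ^ m) ^ n := Nat.pow_le_pow_right (by positivity) (Nat.sub_le _ _)
  unfold bestTable
  rw [flat_apply _ hY, flat_apply _ (hH.trans_le this), if_pos hH]

namespace RoundEnv

variable {w : ℕ → ℕ} {v : ℕ}

theorem bestIndex_is (E : RoundEnv cap n m F d w σ) (hk : Is cap σ ρ k K) (hh : Is cap σ ρ h H)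
    (hy : Is cap σ ρ y Y) :
    Is cap σ ρ (bestIndex k h y) (2 * 2 ^ n * ((2 ^ m) ^ n * K + H) + Y) :=
  .add (.mul (.mul (.lit 2) E.ctx.inputs_is (E.caps.lit_le (by omega)))
    (.add (.mul E.ctx.leaves_is hk E.caps.leaves) hh) E.caps.inputs) hy

theorem step_is (E : RoundEnv cap n m F d w σ) (h2 : ρ 2 = K) (h3 : ρ 3 = H) (hK : K ≤ n)
    (hH : H < (2 ^ m) ^ (n - K)) (hv : v ≠ 8) (hv' : v ≠ 9) (hY : ρ v = Y) (hYN : Y < 2 * 2 ^ n)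
    (h9 : ∀ p < 2 * 2 ^ n * ((2 ^ m) ^ n * K), σ 9 p = bestTable n m F d w p) :
    Is cap σ ρ (stepE (.var v)) (stepValue n m F d w K H Y) := by
  have hYc : Y ≤ cap := hYN.le.trans E.caps.inputs
  have h2c : 2 ≤ cap := E.caps.lit_le (by omega)
  refine .add (E.mul_node_is h2 h3 hK hH hv hY hYN (.congr (.ite (.md (.var hY) (.lit 2) hYc h2c)
      (fun _ => .mul (.lit 128) (.ite (.var h2) (fun _ => E.queryCount_is (.sub E.ctx.n_is
          (.var h2))
        (Nat.sub_le _ _)) (fun _ => E.ctx.n_is)) (E.caps.lit_le (by omega))) (fun _ => .lit 0)) ?_)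
      ((stepPay_le K Y).trans ?_))
    (.congr (.ite (.var h2) (fun h0 => .sum E.ctx.states_is E.caps.states_le
      (f := fun s => (problem n m F d).best (2 * 2 ^ n) w (K - 1) (2 ^ m * H + s) Y) fun s hs =>
        .read (X := 2 * 2 ^ n * ((2 ^ m) ^ n * (K - 1) + (2 ^ m * H + s)) + Y)
          (E.bestIndex_is (.sub (.var ?_) (.lit 1)) (.add (.mul E.ctx.states_is (.var ?_)
          E.caps.states_le) (.var (by simp))) (.var ?_)) ?_) (fun _ => .lit 0)) ?_)
  · rfl
  · have := E.caps.small; omega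
  · rw [Function.update_of_ne (by omega), h2]
  · rw [Function.update_of_ne (by omega), h3]
  · rw [Function.update_of_ne hv', hY]
  · have hlt : 2 ^ m * H + s < (2 ^ m) ^ (n - (K - 1)) := by
      have := flat_lt hH hs
      rw [← pow_succ'] at this
      convert this using 2; omega
    have hle : (2 ^ m) ^ (n - (K - 1)) ≤ (2 ^ m) ^ n :=
      Nat.pow_le_pow_right (by positivity) (Nat.sub_le _ _)
    rw [h9, bestTable_apply hYN hlt]
    refine flat_lt ?_ hYN
    exact flat_lt (by omega) (hlt.trans_le hle)
  · rfl

theorem score_is (E : RoundEnv cap n m F d w σ) {e : Exp → Exp} {u : ℕ → ℕ}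
    (he : ∀ y < 2 * 2 ^ n, Is cap σ (Function.update ρ 6 y) (e (.var 6)) (u y))
    (hu : ∀ y, u y ≤ cap) :
    Is cap σ ρ (scoreE e) (∑ y ∈ Finset.range (2 * 2 ^ n), w y * u y) :=
  .sum (.mul (.lit 2) E.ctx.inputs_is (E.caps.lit_le (by omega))) E.caps.inputs fun y hy =>
    .congr (.mul (he y hy) (.read (.var (by simp)) (E.weights y hy)) (hu y)) (mul_comm _ _)

theorem pick_is (E : RoundEnv cap n m F d w σ) (h2 : ρ 2 = K) (h3 : ρ 3 = H) (h4 : ρ 4 = Y)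
    (hK : K ≤ n) (hH : H < (2 ^ m) ^ (n - K)) (hYN : Y < 2 * 2 ^ n)
    (h9 : ∀ p < 2 * 2 ^ n * ((2 ^ m) ^ n * K), σ 9 p = bestTable n m F d w p) :
    Is cap σ ρ (pickE (.var 4)) ((problem n m F d).best (2 * 2 ^ n) w K H Y) := by
  have hpay : ∀ b y, haltPay m F b y * (problem n m F d).node K H y ≤ cap := fun b y =>
    ((Nat.mul_le_mul_right _ ((haltPay_le b y).trans (Nat.le_add_right _ _))).trans
      (payCoeff_mul_le (K := K) E.bound hK)).trans E.caps.pay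
  have u2 : ∀ y, Function.update ρ 6 y 2 = K := fun y => by
    rw [Function.update_of_ne (by omega), h2]
  have u3 : ∀ y, Function.update ρ 6 y 3 = H := fun y => by
    rw [Function.update_of_ne (by omega), h3]
  have u6 : ∀ y, Function.update ρ 6 y 6 = y := fun y => by simp
  have s0 := E.score_is (ρ := ρ) (fun y hy => E.halt0_is (u2 y) (u3 y) hK hH (by omega) (u6 y) hy)
    (hpay 0)
  have s1 := E.score_is (ρ := ρ) (fun y hy => E.halt1_is (u2 y) (u3 y) hK hH (by omega) (u6 y) hy)
    (hpay 1)
  have s2 := E.score_is (ρ := ρ) (fun y hy => E.step_is (u2 y) (u3 y) hK hH (by omega) (by omega)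
    (u6 y) hy h9) (fun y => (stepValue_le E.bound w hK).trans E.caps.pay)
  have p0 := E.halt0_is h2 h3 hK hH (by omega) h4 hYN
  have p1 := E.halt1_is h2 h3 hK hH (by omega) h4 hYN
  have p2 := E.step_is h2 h3 hK hH (by omega) (by omega) h4 hYN h9
  rw [best_eq_pick]
  refine .congr (.ite (.sub s0 s1) (fun _ => .ite (.sub s1 s2) (fun _ => p2) fun _ => p1) fun _ =>
    .ite (.sub s0 s2) (fun _ => .ite (.sub s1 s2) (fun _ => p2) fun _ => p1) fun _ => p0) ?_
  unfold Problem.pick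
  generalize ∑ y ∈ Finset.range (2 * 2 ^ n), w y * (haltPay m F 0 y *
    (problem n m F d).node K H y) = z0
  generalize ∑ y ∈ Finset.range (2 * 2 ^ n), w y * (haltPay m F 1 y *
    (problem n m F d).node K H y) = z1
  generalize ∑ y ∈ Finset.range (2 * 2 ^ n), w y * stepValue n m F d w K H y = z2
  unfold Problem.choice select
  by_cases h01 : z0 ≤ z1 <;> by_cases h02 : z0 ≤ z2 <;> by_cases h12 : z1 ≤ z2 <;>
    simp only [Nat.sub_eq_zero_iff_le, h01, h02, h12, and_true, and_false, if_true, if_false,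
      one_ne_zero, OfNat.ofNat_ne_zero, OfNat.ofNat_ne_one]

end RoundEnv

theorem bestCmd_run {w : ℕ → ℕ} (E : RoundEnv cap n m F d w σ) :
    Filled 9 σ (bestTable n m F d w) (2 * 2 ^ n * ((2 ^ m) ^ n * (n + 1)))
        (bestCmd.run cap ρ σ) := by
  have hcap := E.caps
  refine .loop (len := 2 * 2 ^ n * (2 ^ m) ^ n) (.add E.ctx.n_is (.lit 1)) hcap.succ_le .refl ?_
    (by ring)
  intro k hk σ h
  have hE := E.congr (σ' := σ) fun a ha => h.1 a (by omega)
  refine .loop (len := 2 * 2 ^ n) hE.ctx.leaves_is hcap.leaves h ?_ (by ring)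
  intro g hg σ h
  have hE := E.congr (σ' := σ) fun a ha => h.1 a (by omega)
  refine .loop (len := 1) (.mul (.lit 2) hE.ctx.inputs_is (hcap.lit_le (by omega))) hcap.inputs h ?_
    (by ring)
  intro y hy σ h
  have hE := E.congr (σ' := σ) fun a ha => h.1 a (by omega)
  have e : 0 + 2 * 2 ^ n * (2 ^ m) ^ n * k + 2 * 2 ^ n * g + 1 * y =
      2 * 2 ^ n * ((2 ^ m) ^ n * k + g) + y := by ring
  rw [e] at h ⊢
  refine Filled.set (p := 2 * 2 ^ n * ((2 ^ m) ^ n * k + g) + y)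
    (hE.bestIndex_is (.var rfl) (.var rfl) (.var rfl)) ?_ h rfl
  have hke : n - k ≤ maxExponent n := by unfold maxExponent; omega
  refine .congr (.ite (.sub (.read (.sub hE.ctx.n_is (.var rfl)) (hE.ctx.statePow (n - k) hke))
    (.var rfl)) (fun h0 => hE.pick_is (K := k) (H := g) rfl rfl rfl (by omega) ?_ hy fun p hp =>
        h.2 p ?_)
    fun _ => .lit 0) ?_
  · change (2 ^ m) ^ (n - k) - g ≠ 0 at h0; omega
  · have : 2 * 2 ^ n * ((2 ^ m) ^ n * k) ≤ 2 * 2 ^ n * ((2 ^ m) ^ n * k + g) :=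
      Nat.mul_le_mul_left _ (Nat.le_add_right _ _)
    omega
  · unfold bestTable
    rw [flat_apply _ hy, flat_apply _ hg]
    change (if (2 ^ m) ^ (n - k) - g = 0 then _ else _) = _
    split_ifs <;> first | rfl | omega

end Candidate

end Search

/-! ### The treatment of a candidate as a command -/

namespace Search

open RAM RAM.Exp DecisionTree

section Candidate

variable {cap n m : ℕ} {F d : ℕ → ℕ} {σ : Store} {ρ : ℕ → ℕ} {k t x y i j u c s h : Exp}
  {K T X Y I J U C A H : ℕ}

theorem zeroCmd_run (hC : Ctx n m F σ) (hcap : Caps cap n m) :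
    Filled 10 σ (fun _ => 0) (2 * 2 ^ n) (zeroCmd.run cap ρ σ) := by
  refine .loop (len := 1) (.mul (.lit 2) hC.inputs_is (hcap.lit_le (by omega))) hcap.inputs .refl ?_
    (by omega)
  intro y hy σ h
  exact .set (.var (by simp)) (.lit 0) h rfl

theorem scaleCmd_run (E : Env cap n m F d σ) :
    scaleCmd.run cap ρ σ = σ.set 11 1 (scale n m d) := by
  have h := offset_le n d n
  have : Is cap σ ρ (.read 3 (32 * offsetE (scalar 0))) (scale n m d) := by
    refine .read (.mul (.lit 32) (E.offset_is E.ctx.n_is le_rfl) (E.caps.lit_le (by omega))) ?_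
    rw [E.ctx.statePow _ (by unfold maxExponent; omega), scale, den, ← pow_mul (2 ^ m) 16]
    congr 1; omega
  exact congrArg (σ.set 11 1) this

/-- The next weights of the perceptron. -/
def nextWeight (n m : ℕ) (F d w : ℕ → ℕ) (y : ℕ) : ℕ :=
  w y + (problem n m F d).best (2 * 2 ^ n) w n 0 y - target n m d y

theorem weightCmd_run {w : ℕ → ℕ} (E : RoundEnv cap n m F d w σ)
    (h9 : ∀ p < 2 * 2 ^ n * ((2 ^ m) ^ n * (n + 1)), σ 9 p = bestTable n m F d w p) :
    Filled 10 σ (nextWeight n m F d w) (2 * 2 ^ n) (weightCmd.run cap ρ σ) := by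
  have hcap := E.caps
  refine .loop (len := 1) (.mul (.lit 2) E.ctx.inputs_is (hcap.lit_le (by omega))) hcap.inputs .refl
    ?_ (by omega)
  intro y hy σ h
  have hE : Env cap n m F d σ := E.toEnv.congr fun a ha => h.1 a (by omega)
  have hyc : y ≤ cap := hy.le.trans hcap.inputs
  have hp : 0 < (2 ^ m) ^ (n - n) := by positivity
  have hz : ∀ ρ : ℕ → ℕ, Is cap σ ρ (.read 11 (.const 1)) (scale n m d) := fun ρ =>
    .read (.const 1) (by rw [h.1 11 (by omega)]; exact E.scale_eq)
  have hS : 1024 * 2 ^ m - 2 ≤ cap := (Nat.sub_le _ _).trans hcap.states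
  refine .set (p := 0 + 1 * y) (.var (by simp)) (.sub (.add (.read (.var rfl) ?_)
    (.read (X := 2 * 2 ^ n * ((2 ^ m) ^ n * n + 0) + y) (.add (.mul (.mul (.lit 2) hE.ctx.inputs_is
      (hcap.lit_le (by omega))) (.add (.mul hE.ctx.leaves_is hE.ctx.n_is hcap.leaves) (.lit 0))
      hcap.inputs) (.var rfl)) ?_))
    (.congr (.ite (.md (.var rfl) (.lit 2) hyc (hcap.lit_le (by omega))) (fun _ => .mul
      (.read hE.ctx.n_is (hE.digits n (le_tableSize n m))) (hz _)
      ((hE.bound n).le.trans hcap.base_le)) (fun _ => .mul (.sub (.mul (.const 1024)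
      hE.ctx.states_is ?_) (.lit 2)) (hz _) hS)) ?_)) h rfl
  · rw [zero_add, one_mul]
    change σ 10 y = w y
    rw [h.3 y (by omega)]
    exact E.weights y hy
  · rw [h.1 9 (by omega), h9, bestTable_apply hy hp, zero_add, one_mul]
    exact flat_lt (flat_lt (Nat.lt_succ_self n) (by positivity)) hy
  · exact le_trans (by have : 0 < 2 ^ m := by positivity
                       omega) hcap.states
  · rw [zero_add, one_mul]; rfl

theorem roundsCmd_run (E : RoundEnv cap n m F d (fun _ => 0) σ) :
    ∃ σ', σ' = (Cmd.loop 1 (scalar 13) (.seq bestCmd weightCmd)).run cap ρ σ ∧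
      RoundEnv cap n m F d (weight n m F d (rounds n m)) σ' ∧
      ∀ a, a ≠ 9 → a ≠ 10 → σ' a = σ a := by
  refine ⟨_, rfl, ?_⟩
  rw [Cmd.run_loop E.ctx.rounds_is E.caps.rounds_le]
  refine iter_induction (Q := fun r σ' => RoundEnv cap n m F d (weight n m F d r) σ' ∧
    ∀ a, a ≠ 9 → a ≠ 10 → σ' a = σ a) ⟨E, fun _ _ _ => rfl⟩ _ ?_
  rintro r hr σ' ⟨h1, h2⟩
  have b := bestCmd_run (ρ := Function.update ρ 1 r) h1
  have h1' := h1.congr fun a ha => b.1 a ha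
  have b' := weightCmd_run (ρ := Function.update ρ 1 r) h1' b.2
  refine ⟨⟨h1'.toEnv.congr fun a ha => b'.1 a (by omega), ?_, fun y hy => b'.2 y hy, ?_⟩, ?_⟩
  · exact fun p hp => (congrFun (b'.1 8 (by omega)) p).trans (h1'.paths p hp)
  · exact (congrFun (b'.1 11 (by omega)) 1).trans h1'.scale_eq
  · intro a h9 h10
    exact (b'.1 a h10).trans ((b.1 a h9).trans (h2 a h9 h10))

namespace Env

variable (E : Env cap n m F d σ)
include E

theorem gram_is (hu : U < 2 * n) (hi : I < 2 ^ m) (hj : J < 2 ^ m) (hc : C < 4)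
    (h2 : ρ 2 = U) (h3 : ρ 3 = I) (h4 : ρ 4 = J) (hC : ∀ ρ : ℕ → ℕ, Is cap σ ρ c C) :
    Is cap σ ρ (gramE (.var 2) (.var 3) (.var 4) c) (gram n m d U I J C) := by
  have hu' : U < (n + 1) * (n + 1) := by nlinarith
  have l4 : 4 ≤ cap := E.caps.lit_le (by omega)
  refine .sum E.ctx.states_is E.caps.states_le fun s hs => .sum (.lit 4) l4 fun a ha => ?_
  exact .mul (E.entry_is (.var h2) (.var (X := s) rfl) (.var h3) (.var (X := a) rfl) hu' hs hi ha)
    (E.entry_is (.var h2) (.var (X := s) rfl) (.var h4) (.md (X := a + C) (Y := 4) (.add (.var rfl)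
    (hC _)) (.lit 4) (le_trans (by omega) (E.caps.lit_le (C := 8) (by omega))) l4) hu' hs hj
    (Nat.mod_lt _ (by omega))) ((entry_lt E.bound _ _ _ _).le.trans E.caps.base_le)

/-- The sum of the excesses in the conditions of orthonormality. -/
theorem ortho_is (hu : U < 2 * n) (hi : I < 2 ^ m) (hj : J < 2 ^ m)
    (h2 : ρ 2 = U) (h3 : ρ 3 = I) (h4 : ρ 4 = J) :
    ∃ V, Is cap σ ρ orthoE V ∧ (V = 0 ↔
      gram n m d U I J 0 ≤ gram n m d U I J 2 + (if I = J then den m * den m else 0) +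
          8 * (2 ^ m * 2 ^ m) * den m ∧
        gram n m d U I J 2 + (if I = J then den m * den m else 0) ≤
          gram n m d U I J 0 + 8 * (2 ^ m * 2 ^ m) * den m ∧
        gram n m d U I J 1 ≤ gram n m d U I J 3 + 8 * (2 ^ m * 2 ^ m) * den m ∧
        gram n m d U I J 3 ≤ gram n m d U I J 1 + 8 * (2 ^ m * 2 ^ m) * den m) := by
  have g0 := E.gram_is hu hi hj (by omega) h2 h3 h4 (fun _ => .lit 0)
  have g1 := E.gram_is hu hi hj (by omega) h2 h3 h4 (fun _ => .lit 1)
  have g2 := E.gram_is hu hi hj (by omega) h2 h3 h4 (fun _ => .lit 2)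
  have g3 := E.gram_is hu hi hj (by omega) h2 h3 h4 (fun _ => .lit 3)
  have hd : den m ≤ cap := le_trans (by unfold base; omega) E.caps.base_le
  have τ : Is cap σ ρ (8 * (scalar 7 * scalar 7) * scalar 9) (8 * (2 ^ m * 2 ^ m) * den m) :=
    .mul (.mul (.lit 8) (.mul E.ctx.states_is E.ctx.states_is E.caps.states_le)
      (E.caps.lit_le (by omega))) E.ctx.den_is E.caps.statesSq
  have δ : Is cap σ ρ (.ite (.var 3 - .var 4 + (.var 4 - .var 3)) 0 (scalar 9 * scalar 9))
      (if I = J then den m * den m else 0) := by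
    refine .congr (.ite (.add (.sub (.var h3) (.var h4)) (.sub (.var h4) (.var h3)))
      (fun _ => .lit 0) fun _ => .mul E.ctx.den_is E.ctx.den_is hd) ?_
    by_cases h : I = J
    · simp [h]
    · rw [if_neg (by omega), if_neg h]
  refine ⟨_, .add (.add (.add (.sub g0 (.add (.add g2 δ) τ)) (.sub (.add g2 δ) (.add g0 τ)))
    (.sub g1 (.add g3 τ))) (.sub g3 (.add g1 τ)), ?_⟩
  omega

end Env

theorem violation_is (E : RoundEnv cap n m F d (weight n m F d (rounds n m)) σ) :
    ∃ V, Is cap σ ρ violationE V ∧ (V = 0 ↔ Accepted n m F d) := by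
  have hcap := E.caps
  have l2 : 2 ≤ cap := hcap.lit_le (by omega)
  have h2n : 2 * n ≤ cap := by have := hcap.small; omega
  have ex : ∀ u i j, ∃ V, u < 2 * n → i < 2 ^ m → j < 2 ^ m →
      Is cap σ (Function.update (Function.update (Function.update ρ 2 u) 3 i) 4 j) orthoE V ∧
          (V = 0 ↔
      gram n m d u i j 0 ≤ gram n m d u i j 2 + (if i = j then den m * den m else 0) +
          8 * (2 ^ m * 2 ^ m) * den m ∧
        gram n m d u i j 2 + (if i = j then den m * den m else 0) ≤
          gram n m d u i j 0 + 8 * (2 ^ m * 2 ^ m) * den m ∧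
        gram n m d u i j 1 ≤ gram n m d u i j 3 + 8 * (2 ^ m * 2 ^ m) * den m ∧
        gram n m d u i j 3 ≤ gram n m d u i j 1 + 8 * (2 ^ m * 2 ^ m) * den m) := by
    intro u i j
    by_cases h : u < 2 * n ∧ i < 2 ^ m ∧ j < 2 ^ m
    · obtain ⟨V, h1, h2⟩ := E.ortho_is (ρ := Function.update (Function.update
        (Function.update ρ 2 u) 3 i) 4 j) h.1 h.2.1 h.2.2 rfl rfl rfl
      exact ⟨V, fun _ _ _ => ⟨h1, h2⟩⟩
    · exact ⟨0, fun a b c => absurd ⟨a, b, c⟩ h⟩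
  choose V hV using ex
  refine ⟨_, .add (.add (.sub (E.offset_is E.ctx.n_is le_rfl) (.mul (.lit 2) E.ctx.n_is l2))
    (.sum (.mul (.lit 2) E.ctx.n_is l2) h2n fun u hu => .sum E.ctx.states_is hcap.states_le
      fun i hi => .sum E.ctx.states_is hcap.states_le fun j hj => (hV u i j hu hi hj).1))
    (.sum (.mul (.lit 2) E.ctx.inputs_is l2) hcap.inputs
      (f := fun y => weight n m F d (rounds n m) y - rounds n m * scale n m d) fun y hy =>
      .sub (.read (.var rfl) (E.weights y hy)) (.mul E.ctx.rounds_is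
        (.read (.const 1) E.scale_eq) hcap.rounds_le)), ?_⟩
  rw [Nat.add_eq_zero_iff, Nat.add_eq_zero_iff, Nat.sub_eq_zero_iff_le]
  simp only [Finset.sum_eq_zero_iff, Finset.mem_range, Nat.sub_eq_zero_iff_le]
  constructor
  · rintro ⟨⟨h1, h2⟩, h3⟩
    exact ⟨h1, fun u hu i hi j hj => (hV u i j hu hi hj).2.1 (h2 u hu i hi j hj), h3⟩
  · rintro ⟨h1, h2, h3⟩
    exact ⟨⟨h1, fun u hu i hi j hj => (hV u i j hu hi hj).2.2 (h2 u hu i hi j hj)⟩, h3⟩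

open Classical in
/-- The cell `0` of the array `11` holds the least cost of a candidate accepted so far. -/
theorem candidateCmd_run {c : ℕ} (hC : Ctx n m F σ) (hcap : Caps cap n m)
    (ha : Nat.clog 2 n + 1 ≤ m) (hF : ∀ x, F x ≤ 1)
    (hc : ρ 0 = c) (hlt : c < base m ^ numDigits n m) :
    ∃ σ', σ' = candidateCmd.run cap ρ σ ∧ (∀ a < 5, σ' a = σ a) ∧
      σ' 11 0 = if Accepted n m F (digit m c) ∧ digit m c n < σ 11 0 then digit m c n
        else σ 11 0 := by
  have s1 := digitCmd_run hC hcap hc hlt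
  have E1 : Env cap n m F (digit m c) (digitCmd.run cap ρ σ) :=
    ⟨hC.congr fun a ha => s1.1 a (by omega), hcap, ha, s1.2,
      fun j => Nat.mod_lt _ (base_pos m), hF⟩
  have s2 := ampCmd_run (ρ := ρ) E1
  have E2 := E1.congr fun a ha => s2.1 a (by omega)
  have s3 := probCmd_run (ρ := ρ) E2 s2.2
  have E3 := E2.congr fun a ha => s3.1 a (by omega)
  have s4 := pathCmd_run (ρ := ρ) E3 s3.2
  have E4 := E3.congr fun a ha => s4.1 a (by omega)
  have s5 := scaleCmd_run (ρ := ρ) E4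
  generalize e5 : scaleCmd.run cap ρ _ = σ5 at s5
  have f5 : ∀ a, a ≠ 11 → σ5 a = _ := fun a ha => by rw [s5, Store.set, Function.update_of_ne ha]
  have E5 := E4.congr fun a ha => f5 a (by omega)
  have s6 := zeroCmd_run (ρ := ρ) E5.ctx hcap
  have E6 : RoundEnv cap n m F (digit m c) (fun _ => 0) (zeroCmd.run cap ρ σ5) :=
    { toEnv := E5.congr fun a ha => s6.1 a (by omega)
      paths := fun p hp => by rw [s6.1 8 (by omega), f5 8 (by omega)]; exact s4.2 p hp
      weights := s6.2
      scale_eq := by rw [s6.1 11 (by omega), s5, Store.set, Function.update_self,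
        Function.update_self] }
  obtain ⟨σ7, e7, E7, f7⟩ := roundsCmd_run (ρ := ρ) E6
  obtain ⟨V, hV, hV'⟩ := violation_is (ρ := ρ) E7
  have frame : ∀ a, (a < 5 ∨ a = 11) → ∀ j, j ≠ 1 → σ7 a j = σ a j := by
    intro a ha j hj
    rw [f7 a (by omega) (by omega), s6.1 a (by omega), s5]
    have : ∀ τ : Store, τ.set 11 1 (scale n m (digit m c)) a j = τ a j := by
      intro τ
      unfold Store.set
      by_cases h : a = 11
      · subst h; rw [Function.update_self, Function.update_of_ne hj]
      · rw [Function.update_of_ne h]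
    rw [this, s4.1 a (by omega), s3.1 a (by omega), s2.1 a (by omega), s1.1 a (by omega)]
  have frame' : ∀ a < 5, σ7 a = σ a := by
    intro a ha
    rw [f7 a (by omega) (by omega), s6.1 a (by omega), f5 a (by omega), s4.1 a (by omega),
      s3.1 a (by omega), s2.1 a (by omega), s1.1 a (by omega)]
  have hr : Is cap σ7 ρ (.read 11 (.const 0)) (σ 11 0) :=
    .read (.const 0) (frame 11 (by omega) 0 (by omega))
  have res : Is cap σ7 ρ (.ite violationE (.read 11 (.const 0))
      (minimum (.read 5 (scalar 0)) (.read 11 (.const 0))))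
      (if Accepted n m F (digit m c) ∧ digit m c n < σ 11 0 then digit m c n else σ 11 0) := by
    refine .congr (.ite hV (fun _ => hr) fun _ => .minimum (.read E7.ctx.n_is
      (E7.digits n (le_tableSize n m))) hr) ?_
    by_cases h : Accepted n m F (digit m c)
    · rw [if_pos (hV'.2 h)]
      simp only [h, true_and]
      split_ifs <;> omega
    · rw [if_neg fun h' => h (hV'.1 h')]
      simp only [h, false_and, if_false]
  refine ⟨σ7.set 11 0 (if Accepted n m F (digit m c) ∧ digit m c n < σ 11 0 then digit m c n
    else σ 11 0), ?_, fun a ha => ?_, ?_⟩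
  rotate_right
  · rw [Store.set, Function.update_self, Function.update_self]
  · simp only [candidateCmd, Cmd.run] at *
    rw [e5, ← e7]
    exact congrArg (σ7.set 11 0) res.symm
  · rw [Store.set, Function.update_of_ne (by omega), frame' a ha]

/-- Searches through all candidates. -/
def searchCmd : Cmd := .loop 0 (.read 4 (scalar 14)) candidateCmd

theorem searchCmd_run (hC : Ctx n m F σ) (hcap : Caps cap n m)
    (ha : Nat.clog 2 n + 1 ≤ m) (hF : ∀ x, F x ≤ 1) (h14 : σ 1 14 = numDigits n m)
    (hres : σ 11 0 = 128 * n) :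
    ∃ σ', σ' = searchCmd.run cap ρ σ ∧ (∀ a < 5, σ' a = σ a) ∧
      σ' 11 0 = result n m F (base m ^ numDigits n m) := by
  refine ⟨_, rfl, ?_⟩
  have hle : numDigits n m ≤ tableSize n m := by
    have e : (2 * n) * (4 * (2 ^ m * 2 ^ m)) ≤ ((n + 1) * (n + 1)) * (4 * (2 ^ m * 2 ^ m)) :=
      Nat.mul_le_mul_right _ (by nlinarith)
    have e' : 4 * (2 ^ m * (2 ^ m * ((n + 1) * (n + 1)))) =
      ((n + 1) * (n + 1)) * (4 * (2 ^ m * 2 ^ m)) := by ring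
    unfold numDigits tableSize
    rw [e']; omega
  have hb : Is cap σ ρ (.read 4 (scalar 14)) (base m ^ numDigits n m) :=
    .read (X := numDigits n m) (.read (.const 14) h14) (hC.basePow _ hle)
  unfold searchCmd
  rw [Cmd.run_loop hb hcap.candidates]
  refine iter_induction (Q := fun c (σ' : Store) => (∀ a < 5, σ' a = σ a) ∧ σ' 11 0 =
      result n m F c)
    ⟨fun _ _ => rfl, hres⟩ _ ?_
  rintro c hc σ' ⟨h1, h2⟩
  obtain ⟨σ'', e, h3, h4⟩ := candidateCmd_run (ρ := Function.update ρ 0 c) (hC.congr h1) hcap ha hF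
    (Function.update_self _ _ _) hc
  rw [← e]
  exact ⟨fun a ha => (h3 a ha).trans (h1 a ha), by rw [h4, h2]; rfl⟩

end Candidate

end Search

/-! ### The complete program -/

namespace Search

open RAM RAM.Exp DecisionTree

/-- The values of some scalars are known. -/
def Known (l : List (ℕ × ℕ)) (σ : Store) : Prop := ∀ p ∈ l, σ 1 p.1 = p.2

section Setup

variable {cap n m : ℕ} {F : ℕ → ℕ} {σ σ' : Store} {ρ : ℕ → ℕ} {i e : Exp} {a I X : ℕ}
  {l : List (ℕ × ℕ)}

theorem Known.congr (h : Known l σ) (e : σ' 1 = σ 1) : Known l σ' := fun p hp => by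
  rw [e]; exact h p hp

theorem Known.is (h : Known l σ) {j : ℕ} (hm : (j, X) ∈ l) : Is cap σ ρ (scalar j) X := h _ hm

theorem set_run (hi : Is cap σ ρ i I) (he : Is cap σ ρ e X) :
    (Cmd.set a i e).run cap ρ σ = σ.set a I X := by
  subst hi he; rfl

theorem set_other {b : ℕ} (h : b ≠ a) : σ.set a I X b = σ b := Function.update_of_ne h _ _

theorem set_cell : σ.set a I X a I = X := by simp [Store.set]

theorem set_other_cell {J : ℕ} (h : J ≠ I) : σ.set a I X a J = σ a J := by
  simp [Store.set, Function.update_of_ne h]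

theorem Known.set (h : Known l σ) {j : ℕ} (hj : j ∉ l.map Prod.fst) :
    Known ((j, X) :: l) (σ.set 1 j X) := by
  intro p hp
  rcases List.mem_cons.1 hp with rfl | hp
  · exact set_cell
  · rw [set_other_cell fun e => hj (by simpa [e] using List.mem_map_of_mem (f := Prod.fst) hp)]
    exact h p hp

/-- A command that tabulates the powers of `b` up to the exponent `B`. -/
def powersCmd (a : ℕ) (b B : Exp) : Cmd :=
  .seq (.set a 0 1) (.loop 0 B (.set a (.var 0 + 1) (b * .read a (.var 0))))

theorem powersCmd_run {b B : Exp} {x N : ℕ}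
    (hb : ∀ (σ' : Store) (ρ : ℕ → ℕ), σ' 1 = σ 1 → Is cap σ' ρ b x)
    (hB : ∀ (σ' : Store) (ρ : ℕ → ℕ), σ' 1 = σ 1 → Is cap σ' ρ B N) (ha : a ≠ 1)
    (hx : x ≤ cap) (hN : N ≤ cap) :
    Filled a σ (fun j => x ^ j) (N + 1) ((powersCmd a b B).run cap ρ σ) := by
  have h0 : Filled a σ (fun j => x ^ j) 1 ((Cmd.set a 0 1).run cap ρ σ) :=
    .set (.lit 0) (.congr (.lit 1) (pow_zero x).symm) .refl rfl
  refine .loop (len := 1) (hB _ ρ (h0.1 1 (by omega))) hN h0 ?_ (by omega)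
  intro j hj σ' h
  refine .set (p := 1 + 1 * j) (.congr (.add (.var (X := j) rfl) (.lit 1)) (by omega))
    (.congr (.mul (hb σ' _ (h.1 1 (by omega))) (.read (.var (X := j) rfl) (h.2 j (by omega))) hx)
        ?_)
    h rfl
  rw [one_mul, add_comm, pow_succ']

/-- The number of values of the index register. -/
def indexSizeE : Exp :=
  1 + .sum 0 (scalar 0) (.ite (scalar 0 - .read 2 (.var 0)) (.read 2 (.var 0)) 0)

theorem indexSize_eq_sum :
    indexSize n = 1 + ∑ j ∈ Finset.range n, if n - 2 ^ j = 0 then 0 else 2 ^ j := by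
  have h : ∀ j, n - 2 ^ j = 0 ↔ ¬ j < Nat.clog 2 n := fun j => by
    rw [Nat.sub_eq_zero_iff_le, not_lt, Nat.clog_le_iff_le_pow (by norm_num)]
  have hc : Nat.clog 2 n ≤ n := (Nat.clog_le_iff_le_pow (by norm_num)).2 Nat.lt_two_pow_self.le
  have e : ∑ j ∈ Finset.range n, (if n - 2 ^ j = 0 then 0 else 2 ^ j) =
      ∑ j ∈ Finset.range (Nat.clog 2 n), 2 ^ j := by
    rw [← Finset.sum_subset (Finset.range_subset_range.2 hc)]
    · exact Finset.sum_congr rfl fun j hj => if_neg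
        (by rw [h, not_not]; exact Finset.mem_range.1 hj)
    · intro j _ hj
      exact if_pos ((h j).2 fun h' => hj (Finset.mem_range.2 h'))
  have h2 : ∀ k, ∑ j ∈ Finset.range k, 2 ^ j + 1 = 2 ^ k := fun k => by
    induction k with
    | zero => rfl
    | succ k ih => rw [Finset.sum_range_succ, pow_succ, ← ih]; ring
  rw [e, add_comm, h2]; rfl

/-- Computes the parameters of the search and the tables of powers. -/
def setupCmd : Cmd :=
  .seq (powersCmd 2 2 (scalar 0 + scalar 0 + scalar 1)) (
  .seq (.set 1 (.const 6) (.read 2 (scalar 0))) (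
  .seq (.set 1 (.const 7) (.read 2 (scalar 1))) (
  .seq (.set 1 (.const 8) (scalar 7 / (2 * indexSizeE))) (
  .seq (powersCmd 3 (scalar 7) (32 * (scalar 0 * (scalar 0 + 1)) + scalar 0 + 16)) (
  .seq (.set 1 (.const 9) (.read 3 16)) (
  .seq (.set 1 (.const 10) (2 * scalar 9)) (
  .seq (.set 1 (.const 11) (scalar 0 + 1 +
    4 * (scalar 7 * (scalar 7 * ((scalar 0 + 1) * (scalar 0 + 1)))))) (
  .seq (.set 1 (.const 12) (.read 3 (scalar 0))) (
  .seq (.set 1 (.const 13) (.read 3 (scalar 0 + 16))) (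
  .seq (.set 1 (.const 14) (scalar 0 + 1 + 2 * scalar 0 * (4 * (scalar 7 * scalar 7)))) (
  .seq (.set 1 (.const 17) (3 * (.const 1024 * scalar 7))) (
  .seq (powersCmd 4 (scalar 10) (scalar 11)) (
  .set 11 (.const 0) (128 * scalar 0))))))))))))))

theorem run_seq (c d : Cmd) : (Cmd.seq c d).run cap ρ σ = d.run cap ρ (c.run cap ρ σ) := rfl

theorem setScalar_run (hk : Known l σ) {j : ℕ} (hj : j ∉ l.map Prod.fst) (he : Is cap σ ρ e X) :
    ∃ σ', (Cmd.set 1 (.const j) e).run cap ρ σ = σ' ∧ Known ((j, X) :: l) σ' ∧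
      ∀ a ≠ 1, σ' a = σ a :=
  ⟨_, set_run (.const j) he, hk.set hj, fun _ ha => set_other ha⟩

theorem setupCmd_run (hcap : Caps cap n m) (hk : Known [(0, n), (1, m)] σ)
    (h0 : ∀ k < 2 ^ n, σ 0 k = F k) :
    ∃ σ', setupCmd.run cap ρ σ = σ' ∧ Ctx n m F σ' ∧ σ' 1 14 = numDigits n m ∧
      σ' 11 0 = 128 * n := by
  have hS1 : 1024 * 2 ^ m ≤ cap := hcap.states
  have hSp : 0 < 2 ^ m := by positivity
  have c1 := hcap.lit_le (C := 128) le_rfl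
  have c2 := hcap.states_le
  have c3 := hcap.succ_le
  unfold setupCmd
  have h1 := powersCmd_run (cap := cap) (ρ := ρ) (σ := σ) (a := 2) (b := 2) (x := 2)
    (B := scalar 0 + scalar 0 + scalar 1) (N := n + n + m) (fun _ _ _ => .lit 2)
    (fun _ _ e => .add (.add ((hk.congr e).is (by simp)) ((hk.congr e).is (by simp)))
      ((hk.congr e).is (by simp))) (by omega) (by omega) (by have := hcap.twoPow; omega)
  rw [run_seq]
  generalize Cmd.run cap (powersCmd 2 2 (scalar 0 + scalar 0 + scalar 1)) ρ σ = σ1 at h1 ⊢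
  have k1 : Known [(0, n), (1, m)] σ1 := hk.congr (h1.1 1 (by omega))
  have t1 : ∀ j ≤ 2 * n + m, σ1 2 j = 2 ^ j := fun j hj => h1.2 j (by omega)
  obtain ⟨σ2, e2, k2, f2⟩ := setScalar_run (cap := cap) (ρ := ρ) k1 (j := 6) (X := 2 ^ n)
    (e := .read 2 (scalar 0)) (by simp) (.read (k1.is (by simp)) (t1 n (by omega)))
  rw [run_seq, e2]
  obtain ⟨σ3, e3, k3, f3⟩ := setScalar_run (cap := cap) (ρ := ρ) k2 (j := 7) (X := 2 ^ m)
    (e := .read 2 (scalar 1)) (by simp) (.read (X := m) (k2.is (by simp))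
      (by rw [f2 2 (by omega)]; exact t1 m (by omega)))
  rw [run_seq, e3]
  have hI : ∀ ρ : ℕ → ℕ, Is cap σ3 ρ indexSizeE (indexSize n) := fun ρ => by
    refine .congr (.add (.lit 1) (.sum (k3.is (by simp)) hcap.n_le fun j hj =>
      .ite (.sub (k3.is (by simp)) (.read (.var (X := j) rfl) ?_)) (fun _ =>
        .read (.var (X := j) rfl) ?_) fun _ => .lit 0)) indexSize_eq_sum.symm
    all_goals rw [f3 2 (by omega), f2 2 (by omega)]; exact t1 j (by omega)
  obtain ⟨σ4, e4, k4, f4⟩ := setScalar_run (cap := cap) (ρ := ρ) k3 (j := 8) (X := workSize n m)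
    (e := scalar 7 / (2 * indexSizeE)) (by simp) (.div (k3.is (by simp)) (.mul (.lit 2) (hI ρ)
      (by omega)) c2)
  rw [run_seq, e4]
  have h5 := powersCmd_run (cap := cap) (ρ := ρ) (σ := σ4) (a := 3) (b := scalar 7) (x := 2 ^ m)
    (B := 32 * (scalar 0 * (scalar 0 + 1)) + scalar 0 + 16) (N := maxExponent n)
    (fun _ _ e => (k4.congr e).is (by simp))
    (fun _ _ e => .add (.add (.mul (.lit 32) (.mul ((k4.congr e).is (by simp))
      (.add ((k4.congr e).is (by simp)) (.lit 1)) (by omega)) (by omega))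
      ((k4.congr e).is (by simp))) (.lit 16)) (by omega) c2 (by have := hcap.statePow; omega)
  rw [run_seq]
  generalize Cmd.run cap (powersCmd 3 (scalar 7) (32 * (scalar 0 * (scalar 0 + 1)) + scalar 0 + 16))
    ρ σ4 = σ5 at h5 ⊢
  have k5 := k4.congr (h5.1 1 (by omega))
  have t5 : ∀ j ≤ maxExponent n, σ5 3 j = (2 ^ m) ^ j := fun j hj => h5.2 j (by omega)
  have hmax : n + 16 ≤ maxExponent n := by unfold maxExponent; omega
  obtain ⟨σ6, e6, k6, f6⟩ := setScalar_run (cap := cap) (ρ := ρ) k5 (j := 9) (X := den m)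
    (e := .read 3 16) (by simp) (.read (.lit 16) (t5 16 (by omega)))
  rw [run_seq, e6]
  obtain ⟨σ7, e7, k7, f7⟩ := setScalar_run (cap := cap) (ρ := ρ) k6 (j := 10) (X := base m)
    (e := 2 * scalar 9) (by simp) (.mul (.lit 2) (k6.is (by simp)) (by omega))
  rw [run_seq, e7]
  obtain ⟨σ8, e8, k8, f8⟩ := setScalar_run (cap := cap) (ρ := ρ) k7 (j := 11)
    (X := tableSize n m) (e := scalar 0 + 1 +
    4 * (scalar 7 * (scalar 7 * ((scalar 0 + 1) * (scalar 0 + 1))))) (by simp)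
    (.add (.add (k7.is (by simp)) (.lit 1)) (.mul (.lit 4) (.mul (k7.is (by simp))
      (.mul (k7.is (by simp)) (.mul (.add (k7.is (by simp)) (.lit 1)) (.add (k7.is (by simp))
      (.lit 1)) c3) c2) c2) (by omega)))
  rw [run_seq, e8]
  obtain ⟨σ9, e9, k9, f9⟩ := setScalar_run (cap := cap) (ρ := ρ) k8 (j := 12)
    (X := (2 ^ m) ^ n) (e := .read 3 (scalar 0)) (by simp) (.read (X := n) (k8.is (by simp))
      (by rw [f8 3 (by omega), f7 3 (by omega), f6 3 (by omega)]; exact t5 n (by omega)))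
  rw [run_seq, e9]
  obtain ⟨σ10, e10, k10, f10⟩ := setScalar_run (cap := cap) (ρ := ρ) k9 (j := 13)
    (X := rounds n m) (e := .read 3 (scalar 0 + 16)) (by simp) (.read (X := n + 16)
        (.add (k9.is (by simp))
      (.lit 16)) (by rw [f9 3 (by omega), f8 3 (by omega), f7 3 (by omega), f6 3 (by omega)]
                     exact t5 _ hmax))
  rw [run_seq, e10]
  obtain ⟨σ11, e11, k11, f11⟩ := setScalar_run (cap := cap) (ρ := ρ) k10 (j := 14)
    (X := numDigits n m) (e := scalar 0 + 1 + 2 * scalar 0 * (4 * (scalar 7 * scalar 7)))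
    (by simp) (.add (.add (k10.is (by simp)) (.lit 1)) (.mul (.mul (.lit 2) (k10.is (by simp))
      (by omega)) (.mul (.lit 4) (.mul (k10.is (by simp)) (k10.is (by simp)) c2) (by omega))
      (by have := hcap.small; omega)))
  rw [run_seq, e11]
  obtain ⟨σ12, e12, k12, f12⟩ := setScalar_run (cap := cap) (ρ := ρ) k11 (j := 17)
    (X := errorWeight m) (e := 3 * (.const 1024 * scalar 7)) (by simp)
    (.mul (.lit 3) (.mul (.const 1024) (k11.is (X := 2 ^ m) (by simp)) (by omega)) (by omega))
  rw [run_seq, e12]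
  have h13 := powersCmd_run (cap := cap) (ρ := ρ) (σ := σ12) (a := 4) (b := scalar 10)
    (x := base m) (B := scalar 11) (N := tableSize n m) (fun _ _ e => (k12.congr e).is (by simp))
    (fun _ _ e => (k12.congr e).is (by simp)) (by omega) hcap.base_le
    (by have := hcap.size; omega)
  rw [run_seq]
  generalize Cmd.run cap (powersCmd 4 (scalar 10) (scalar 11)) ρ σ12 = σ13 at h13 ⊢
  have k13 := k12.congr (h13.1 1 (by omega))
  have f13 : ∀ a, a ≠ 1 → a ≠ 3 → a ≠ 4 → a ≠ 2 → σ13 a = σ a := by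
    intro a a1 a3 a4 a2
    rw [h13.1 a a4, f12 a a1, f11 a a1, f10 a a1, f9 a a1, f8 a a1, f7 a a1, f6 a a1, h5.1 a a3,
      f4 a a1, f3 a a1, f2 a a1, h1.1 a a2]
  have t2 : σ13 2 = σ1 2 := by
    rw [h13.1 2 (by omega), f12 2 (by omega), f11 2 (by omega), f10 2 (by omega), f9 2 (by omega),
      f8 2 (by omega), f7 2 (by omega), f6 2 (by omega), h5.1 2 (by omega), f4 2 (by omega),
      f3 2 (by omega), f2 2 (by omega)]
  have t3 : σ13 3 = σ5 3 := by
    rw [h13.1 3 (by omega), f12 3 (by omega), f11 3 (by omega), f10 3 (by omega), f9 3 (by omega),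
      f8 3 (by omega), f7 3 (by omega), f6 3 (by omega)]
  rw [set_run (.const 0) (.mul (.lit 128) (k13.is (X := n) (by simp)) (by omega))]
  refine ⟨_, rfl, ?_, ?_, set_cell⟩
  · have C : Ctx n m F σ13 :=
      { table := fun k hk => by
            rw [f13 0 (by omega) (by omega) (by omega) (by omega)]
            exact h0 k hk
        n_eq := k13 (0, n) (by simp)
        m_eq := k13 (1, m) (by simp)
        inputs := k13 (6, 2 ^ n) (by simp)
        states := k13 (7, 2 ^ m) (by simp)
        work := k13 (8, workSize n m) (by simp)
        den_eq := k13 (9, den m) (by simp)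
        base_eq := k13 (10, base m) (by simp)
        size := k13 (11, tableSize n m) (by simp)
        leaves := k13 (12, (2 ^ m) ^ n) (by simp)
        rounds_eq := k13 (13, rounds n m) (by simp)
        errorWeight_eq := k13 (17, errorWeight m) (by simp)
        twoPow := fun j hj => by rw [t2]; exact t1 j hj
        statePow := fun j hj => by rw [t3]; exact t5 j hj
        basePow := fun j hj => h13.2 j (by omega) }
    exact C.congr fun a ha => set_other (by omega)
  · rw [set_other (by omega)]
    exact k13 (14, numDigits n m) (by simp)

end Setup

/-- Computes an exponent for the cut-off. -/
def exponentCmd : Cmd :=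
  .seq (.set 1 (.const 2) 1) (.seq (.loop 0 (scalar 1) (.set 1 (.const 2) (4 * scalar 2)))
    (.set 1 (.const 2) (32 * (32 * (scalar 1 * (scalar 0 * scalar 2))))))

/-- Computes the cut-off. -/
def cutoffCmd : Cmd :=
  .seq (.set 1 (.const 3) 1) (.loop 0 (scalar 2) (.set 1 (.const 3) (2 * scalar 3)))

/-- Leaves the numerator and the denominator of the approximation in two cells. -/
def outputCmd : Cmd :=
  let s : Exp := .sum 0 (scalar 6) (.read 0 (.var 0))
  .seq (.set 1 (.const 4) (.ite s (.ite (scalar 6 - s) (2 * (.read 11 (.const 0) + 2)) 0) 0))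
    (.set 1 (.const 5) (.const 384))

/-- The exponent of the cut-off. -/
def exponent (n m : ℕ) : ℕ := 1024 * (m * (n * 4 ^ m))

theorem exponentCmd_run {n m : ℕ} {σ : Store} {ρ : ℕ → ℕ} (hk : Known [(0, n), (1, m)] σ) :
    ∃ σ', exponentCmd.run (n + m + 64) ρ σ = σ' ∧ Known [(2, exponent n m), (0, n), (1, m)] σ' ∧
      ∀ a ≠ 1, σ' a = σ a := by
  unfold exponentCmd
  rw [run_seq, run_seq]
  obtain ⟨σ1, e1, k1, f1⟩ := setScalar_run (cap := n + m + 64) (ρ := ρ) hk (j := 2) (X := 1)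
    (e := 1) (by simp) (.lit 1)
  rw [e1, Cmd.run_loop (B := m) (k1.is (by simp)) (by omega)]
  have h := iter_induction (Q := fun k (σ' : Store) => Known [(2, 4 ^ k), (0, n), (1, m)] σ' ∧
    ∀ a ≠ 1, σ' a = σ a) (F := fun i s => Cmd.run (n + m + 64) (.set 1 (.const 2) (4 * scalar 2))
      (Function.update ρ 0 i) s) ⟨k1, f1⟩ m ?_
  · generalize iter _ m σ1 = σ2 at h ⊢
    obtain ⟨k2, f2⟩ := h
    have k2' : Known [(0, n), (1, m)] σ2 := fun p hp => k2 p (List.mem_cons_of_mem _ hp)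
    obtain ⟨σ3, e3, k3, f3⟩ := setScalar_run (cap := n + m + 64) (ρ := ρ) k2' (j := 2)
      (X := 32 * (32 * (m * (n * 4 ^ m)))) (e := 32 * (32 * (scalar 1 * (scalar 0 * scalar 2))))
      (by simp) (.mul (.lit 32) (.mul (.lit 32) (.mul (k2.is (by simp)) (.mul (k2.is (by simp))
        (k2.is (by simp)) (by omega)) (by omega)) (by omega)) (by omega))
    rw [e3]
    have e : 32 * (32 * (m * (n * 4 ^ m))) = exponent n m := by unfold exponent; ring
    exact ⟨σ3, rfl, e ▸ k3, fun a ha => (f3 a ha).trans (f2 a ha)⟩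
  · rintro i hi σ' ⟨k2, f2⟩
    have k2' : Known [(0, n), (1, m)] σ' := fun p hp => k2 p (List.mem_cons_of_mem _ hp)
    obtain ⟨σ3, e3, k3, f3⟩ := setScalar_run (cap := n + m + 64) (ρ := Function.update ρ 0 i) k2'
      (j := 2) (X := 4 * 4 ^ i) (e := 4 * scalar 2)
      (by simp) (.mul (.lit 4) (k2.is (by simp)) (by omega))
    rw [e3, pow_succ']
    exact ⟨k3, fun a ha => (f3 a ha).trans (f2 a ha)⟩

theorem cutoffCmd_run {n m x : ℕ} {σ : Store} {ρ : ℕ → ℕ} (hx : 2 ≤ x)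
    (hk : Known [(2, x), (0, n), (1, m)] σ) :
    ∃ σ', cutoffCmd.run x ρ σ = σ' ∧ Known [(3, 2 ^ x), (0, n), (1, m)] σ' ∧
      ∀ a ≠ 1, σ' a = σ a := by
  unfold cutoffCmd
  rw [run_seq]
  obtain ⟨σ1, e1, k1, f1⟩ := setScalar_run (cap := x) (ρ := ρ) hk (j := 3) (X := 1)
    (e := 1) (by simp) (.lit 1)
  rw [e1, Cmd.run_loop (B := x) (k1.is (by simp)) le_rfl]
  have h := iter_induction (Q := fun k (σ' : Store) => Known [(3, 2 ^ k), (0, n), (1, m)] σ' ∧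
    ∀ a ≠ 1, σ' a = σ a) (F := fun i s => Cmd.run x (.set 1 (.const 3) (2 * scalar 3))
      (Function.update ρ 0 i) s) ⟨fun p hp => k1 p (by simp at hp ⊢; tauto), f1⟩ x ?_
  · exact ⟨_, rfl, h⟩
  · rintro i hi σ' ⟨k2, f2⟩
    have k2' : Known [(0, n), (1, m)] σ' := fun p hp => k2 p (List.mem_cons_of_mem _ hp)
    obtain ⟨σ3, e3, k3, f3⟩ := setScalar_run (cap := x) (ρ := Function.update ρ 0 i) k2'
      (j := 3) (X := 2 * 2 ^ i) (e := 2 * scalar 3)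
      (by simp) (.mul (.lit 2) (k2.is (by simp)) hx)
    rw [e3, pow_succ']
    exact ⟨k3, fun a ha => (f3 a ha).trans (f2 a ha)⟩

theorem outputCmd_run {cap n m : ℕ} {F : ℕ → ℕ} {σ : Store} {ρ : ℕ → ℕ} (hC : Ctx n m F σ)
    (hcap : Caps cap n m) : ∃ σ', outputCmd.run cap ρ σ = σ' ∧ σ' 1 5 = 384 ∧
      σ' 1 4 = if ∑ k ∈ Finset.range (2 ^ n), F k = 0 then 0 else
        if 2 ^ n ≤ ∑ k ∈ Finset.range (2 ^ n), F k then 0 else 2 * (σ 11 0 + 2) := by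
  have hs : Is cap σ ρ (.sum 0 (scalar 6) (.read 0 (.var 0))) (∑ k ∈ Finset.range (2 ^ n), F k) :=
    .sum hC.inputs_is hcap.inputs_le fun k hk => .read (.var (X := k) rfl) (hC.table k hk)
  unfold outputCmd
  rw [run_seq, set_run (.const 4) (.ite hs (fun _ => .ite (.sub hC.inputs_is hs) (fun _ =>
    .mul (.lit 2) (.add (.read (.const 0) rfl) (.lit 2)) (hcap.lit_le (by omega))) fun _ => .lit 0)
    fun _ => .lit 0), set_run (.const 5) (.const 384)]
  refine ⟨_, rfl, set_cell, ?_⟩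
  rw [set_other_cell (by omega), set_cell]
  simp only [Nat.sub_eq_zero_iff_le]

end Search

/-! ### Existence of the program -/

namespace Search

open RAM RAM.Exp DecisionTree

/-- All numbers in the search, including the number of candidates, are at most `2 ^ exponent n m`,
where the exponent is a multiple of `4 ^ m * m * n`. -/
theorem caps_exponent {n m : ℕ} (hn : 1 ≤ n) (hm : 2 ≤ m) (hnm : n < 2 ^ m) :
    Caps (2 ^ exponent n m) n m := by
  have hm' : m + 1 ≤ 2 ^ m := Nat.lt_two_pow_self
  have hn' : n + 1 ≤ 2 ^ n := Nat.lt_two_pow_self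
  have h4 : 4 ^ m = 2 ^ m * 2 ^ m := by rw [← mul_pow]; norm_num
  have hSS : 2 ^ m ≤ 2 ^ m * 2 ^ m := Nat.le_mul_of_pos_left _ (by positivity)
  set W := m * (n * 4 ^ m) with hW
  have hX : exponent n m = 1024 * W := rfl
  have q16 : 16 ≤ 4 ^ m := by
    calc 16 = 4 ^ 2 := by norm_num
      _ ≤ 4 ^ m := Nat.pow_le_pow_right (by norm_num) hm
  have wn4 : 2 * (n * 4 ^ m) ≤ W := Nat.mul_le_mul_right _ hm
  have n4 : 16 ≤ n * 4 ^ m := by nlinarith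
  have wmn : 16 * (m * n) ≤ W := by
    calc 16 * (m * n) ≤ 4 ^ m * (m * n) := Nat.mul_le_mul_right _ q16
      _ = W := by rw [hW]; ring
  have wmnn : n * (m * n) ≤ W := by
    calc n * (m * n) ≤ 4 ^ m * (m * n) := Nat.mul_le_mul_right _ (by rw [h4]; omega)
      _ = W := by rw [hW]; ring
  have wm : m ≤ m * n := Nat.le_mul_of_pos_right _ hn
  have wn : 2 * n ≤ m * n := Nat.mul_le_mul_right _ hm
  have wnn : 2 * n * n ≤ n * (m * n) := by
    rw [mul_assoc, mul_comm n (m * n), ← mul_assoc]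
    exact Nat.mul_le_mul_right _ (by omega)
  have P : ∀ a, a ≤ 1024 * W → 2 ^ a ≤ 2 ^ exponent n m := fun a h =>
    Nat.pow_le_pow_right (by norm_num) (by rw [hX]; exact h)
  have p : ∀ {y : ℕ} a, y ≤ 2 ^ a → a ≤ 1024 * W → y ≤ 2 ^ exponent n m := fun a h h' =>
    h.trans (P a h')
  have hbase : base m = 2 ^ (16 * m + 1) := by
    unfold base den; rw [← pow_mul, pow_succ]; ring
  have hamp : ampBound n m = 2 ^ ((17 * m + 3) * (n + 1)) := by
    unfold ampBound
    rw [hbase, pow_mul]; congr 1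
    rw [show 4 = 2 ^ 2 by norm_num, ← pow_add, ← pow_add]; congr 1; ring
  have hprob : 2 * ampBound n m ^ 2 = 2 ^ ((17 * m + 3) * (n + 1) * 2 + 1) := by
    rw [hamp, ← pow_mul, pow_succ, mul_comm]
  have eamp : (17 * m + 3) * (n + 1) = 17 * (m * n) + 17 * m + 3 * n + 3 := by ring
  have herr : errorWeight m ≤ 2 ^ (m + 12) := by
    unfold errorWeight; rw [pow_add]; omega
  have hS : (2 : ℕ) ^ m * 2 ^ m = 2 ^ (m + m) := (pow_add _ _ _).symm
  constructor
  · exact p (m + 7) (by rw [pow_add]; omega) (by omega)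
  · exact p (m + 10) (by rw [pow_add]; omega) (by omega)
  · exact p (m + m + 3) (by rw [pow_add, ← hS]; omega) (by omega)
  · exact p (n + 1) (by rw [pow_add]; omega) (by omega)
  · exact p (m + 2) (by rw [pow_add]; omega) (by omega)
  · refine p (m + m + 7) ?_ (by omega)
    have : n * (n + 1) ≤ 2 ^ m * 2 ^ m := Nat.mul_le_mul hnm.le hnm
    unfold maxExponent
    rw [pow_add, ← hS]
    omega
  · refine p (m + m + m + m + 4) ?_ (by omega)
    have : (n + 1) * (n + 1) ≤ 2 ^ m * 2 ^ m := Nat.mul_le_mul hnm hnm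
    have h1 : 2 ^ m * ((n + 1) * (n + 1)) ≤ 2 ^ m * (2 ^ m * 2 ^ m) := Nat.mul_le_mul_left _ this
    have h2 := Nat.mul_le_mul_left (2 ^ m) h1
    have h3 : 2 ^ m ≤ 2 ^ m * (2 ^ m * (2 ^ m * 2 ^ m)) := Nat.le_mul_of_pos_right _ (by positivity)
    unfold tableSize
    rw [pow_add, pow_add, pow_add, pow_add]
    have e : (2 : ℕ) ^ m * 2 ^ m * 2 ^ m * 2 ^ m = 2 ^ m * (2 ^ m * (2 ^ m * 2 ^ m)) := by ring
    rw [e]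
    omega
  · rw [← pow_mul]; exact P _ (by omega)
  · unfold rounds
    rw [← pow_mul]
    exact P _ (by rw [mul_add]; omega)
  · rw [hbase]; exact P _ (by omega)
  · rw [hbase, ← pow_mul]
    refine P _ ?_
    have h1 : numDigits n m ≤ 10 * (n * 4 ^ m) := by
      unfold numDigits
      rw [← h4]
      have e : 2 * n * (4 * 4 ^ m) = 8 * (n * 4 ^ m) := by ring
      have : n * 1 ≤ n * 4 ^ m := Nat.mul_le_mul_left _ (by omega)
      omega
    calc (16 * m + 1) * numDigits n m ≤ (17 * m) * (10 * (n * 4 ^ m)) :=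
          Nat.mul_le_mul (by omega) h1
      _ = 170 * W := by rw [hW]; ring
      _ ≤ _ := by omega
  · exact p _ herr (by omega)
  · rw [hamp]; exact P _ (by omega)
  · rw [hprob]; exact P _ (by omega)
  · have h1 : errorWeight m + 128 * n * (n + 1) ≤ 2 ^ (m + m + 13) := by
      have h2 : n * (n + 1) ≤ 2 ^ m * 2 ^ m := Nat.mul_le_mul hnm.le hnm
      have e : 128 * n * (n + 1) = 128 * (n * (n + 1)) := by ring
      unfold errorWeight
      rw [pow_add, ← hS, e]
      omega
    unfold payBound pathBound
    rw [hprob, ← pow_mul, ← pow_mul, ← pow_add]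
    refine (Nat.mul_le_mul_right _ h1).trans ?_
    rw [← pow_add]
    refine P _ ?_
    rw [eamp]
    have e : ((17 * (m * n) + 17 * m + 3 * n + 3) * 2 + 1) * n =
      34 * (n * (m * n)) + 34 * (m * n) + 3 * (2 * n * n) + 7 * n := by ring
    rw [e]
    omega

/-- The program in the loop language. -/
def mainCmd : Cmd := .seq setupCmd (.seq searchCmd outputCmd)

theorem sum_truthTable_eq_zero_iff {n : ℕ} (f : (Fin n → Bool) → Bool) :
    ∑ k ∈ Finset.range (2 ^ n), truthTable f k = 0 ↔ ∀ k < 2 ^ n, truthTable f k = 0 := by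
  simp [Finset.sum_eq_zero_iff]

theorem truthTable_le {n : ℕ} (f : (Fin n → Bool) → Bool) (k : ℕ) : truthTable f k ≤ 1 := by
  unfold truthTable; split_ifs <;> omega

theorem le_sum_truthTable_iff {n : ℕ} (f : (Fin n → Bool) → Bool) :
    2 ^ n ≤ ∑ k ∈ Finset.range (2 ^ n), truthTable f k ↔ ∀ k < 2 ^ n, truthTable f k = 1 := by
  constructor
  · intro h k hk
    by_contra h'
    have h0 : truthTable f k < 1 := lt_of_le_of_ne (truthTable_le f k) h'
    have : ∑ k ∈ Finset.range (2 ^ n), truthTable f k < ∑ k ∈ Finset.range (2 ^ n), 1 :=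
      Finset.sum_lt_sum (fun k _ => truthTable_le f k) ⟨k, Finset.mem_range.2 hk, h0⟩
    simp at this
    omega
  · intro h
    rw [Finset.sum_congr rfl fun k hk => h k (Finset.mem_range.1 hk)]
    simp

open Classical in
/-- The numerator of the output. The denominator is `384`. -/
noncomputable def answer (n m : ℕ) (f : (Fin n → Bool) → Bool) : ℕ :=
  if (∀ k < 2 ^ n, truthTable f k = 0) ∨ (∀ k < 2 ^ n, truthTable f k = 1) then 0
  else 2 * (result n m (truthTable f) (base m ^ numDigits n m) + 2)

/-- The three stages compute the exponent of the cut-off, the cut-off, and the result of the search.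
The summands of the bound come from loading the input and from these stages. -/
theorem exists_program : ∃ (P : Program) (κ : ℕ), ∀ (n m : ℕ) (f : (Fin n → Bool) → Bool),
    1 ≤ n → 2 ≤ m → n < 2 ^ m → Nat.clog 2 n + 1 ≤ m →
    ∃ t, Outputs P n m f t (answer n m f) 384 ∧ t ≤ 3 * n + 12 * 2 ^ n + 36 + (n + m + 66) ^ κ +
      (exponent n m + 2) ^ κ + (2 ^ exponent n m + 2) ^ κ := by
  obtain ⟨P, κ, h⟩ := exists_program_of_stages (c₁ := exponentCmd) (c₂ := cutoffCmd)
    (c₃ := mainCmd) rfl rfl rfl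
  refine ⟨P, κ, fun n m f hn hm hnm ha => ?_⟩
  obtain ⟨σ, hσ, h⟩ := h n m f
  have k0 : Known [(0, n), (1, m)] σ := by
    intro p hp
    rcases List.mem_cons.1 hp with rfl | hp
    · exact hσ.fst
    · rw [List.mem_singleton.1 hp]; exact hσ.snd
  obtain ⟨σ1, e1, k1, f1⟩ := exponentCmd_run (ρ := 0) k0
  have hx : 2 ≤ exponent n m := by
    unfold exponent
    have : 0 < m * (n * 4 ^ m) := by positivity
    omega
  have x1 : σ1 1 2 = exponent n m := k1 (2, exponent n m) (by simp)
  obtain ⟨σ2, e2, k2, f2⟩ := cutoffCmd_run (ρ := 0) hx k1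
  have x2 : σ2 1 3 = 2 ^ exponent n m := k2 (3, 2 ^ exponent n m) (by simp)
  have hcap := caps_exponent hn hm hnm
  obtain ⟨σ3, e3, C3, d3, r3⟩ := setupCmd_run (ρ := 0) (F := truthTable f) hcap
    (fun p hp => k2 p (List.mem_cons_of_mem _ hp)) (fun k hk => by
      rw [f2 0 (by omega), f1 0 (by omega)]; exact hσ.table k hk)
  obtain ⟨σ4, e4, f4, r4⟩ := searchCmd_run (ρ := 0) C3 hcap ha (truthTable_le f) d3 r3
  obtain ⟨σ5, e5, r5, r6⟩ := outputCmd_run (ρ := 0) (C3.congr f4) hcap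
  have := h σ1 σ2 σ5 e1.symm (by rw [x1, e2]) (by
    rw [x2, mainCmd, run_seq, run_seq, e3, ← e4, e5]) (by rw [r5]; norm_num)
  rw [r5, r6, x1, x2] at this
  convert this using 3
  unfold answer
  rw [r4]
  simp only [sum_truthTable_eq_zero_iff, le_sum_truthTable_iff]
  split_ifs with h1 h2 h3 <;> first | rfl | tauto

end Search

/-! ### Composite algorithms as trees -/

namespace QuantumQuery

variable {n m : ℕ}

/-- The Euclidean norm of a state vector. -/
noncomputable def l2 {ι : Type*} [Fintype ι] (ψ : ι → ℂ) : ℝ :=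
  ‖(WithLp.toLp 2 ψ : EuclideanSpace ℂ ι)‖

section l2

variable {ι : Type*} [Fintype ι]

theorem l2_sq (ψ : ι → ℂ) : l2 ψ ^ 2 = ∑ s, ‖ψ s‖ ^ 2 := by
  rw [l2, EuclideanSpace.norm_sq_eq]

theorem l2_nonneg (ψ : ι → ℂ) : 0 ≤ l2 ψ := norm_nonneg _

theorem l2_add_le (ψ φ : ι → ℂ) : l2 (ψ + φ) ≤ l2 ψ + l2 φ := norm_add_le _ _

theorem l2_single [DecidableEq ι] (i : ι) : l2 (Pi.single i 1 : ι → ℂ) = 1 := by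
  rw [← pow_left_inj₀ (l2_nonneg _) zero_le_one two_ne_zero, l2_sq, one_pow,
    Finset.sum_eq_single i]
  · simp
  · intro j _ hj
    simp [hj]
  · simp

theorem l2_sq_eq_dotProduct (ψ : ι → ℂ) : ((l2 ψ ^ 2 : ℝ) : ℂ) = star ψ ⬝ᵥ ψ := by
  rw [l2_sq, dotProduct]
  push_cast
  refine Finset.sum_congr rfl fun s _ => ?_
  rw [Pi.star_apply, RCLike.star_def, Complex.conj_mul']

theorem l2_mulVec_of_star_mul_self [DecidableEq ι] {A : Matrix ι ι ℂ} (h : star A * A = 1)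
    (ψ : ι → ℂ) : l2 (A *ᵥ ψ) = l2 ψ := by
  rw [← pow_left_inj₀ (l2_nonneg _) (l2_nonneg _) two_ne_zero]
  have : ((l2 (A *ᵥ ψ) ^ 2 : ℝ) : ℂ) = ((l2 ψ ^ 2 : ℝ) : ℂ) := by
    rw [l2_sq_eq_dotProduct, l2_sq_eq_dotProduct, Matrix.star_mulVec, Matrix.dotProduct_mulVec,
      Matrix.vecMul_vecMul, ← Matrix.star_eq_conjTranspose, h, Matrix.vecMul_one]
  exact_mod_cast this

theorem l2_unitary [DecidableEq ι] (U : Matrix.unitaryGroup ι ℂ) (ψ : ι → ℂ) :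
    l2 ((U : Matrix ι ι ℂ) *ᵥ ψ) = l2 ψ :=
  l2_mulVec_of_star_mul_self (Matrix.UnitaryGroup.star_mul_self U) ψ

end l2

theorem queryBasis_queryBasis (x : Fin n → Bool) (s : BasisState n m) :
    queryBasis x (queryBasis x s) = s := by
  simp [queryBasis]

theorem l2_query (x : Fin n → Bool) (ψ : BasisState n m → ℂ) : l2 (query x ψ) = l2 ψ := by
  rw [← pow_left_inj₀ (l2_nonneg _) (l2_nonneg _) two_ne_zero, l2_sq, l2_sq]
  let e : Equiv.Perm (BasisState n m) :=
    ⟨queryBasis x, queryBasis x, queryBasis_queryBasis x, queryBasis_queryBasis x⟩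
  exact Equiv.sum_comp e fun s => ‖ψ s‖ ^ 2

namespace QueryAlgorithm

/-- The unitary transformation after `t` queries. -/
def unitary (Γ : QueryAlgorithm n m) : ℕ → Matrix.unitaryGroup (BasisState n m) ℂ
  | 0 => Γ.first
  | t + 1 => Γ.rest.getD t 1

/-- The state on the input `x` after `t` queries and the transformation that follows them. -/
noncomputable def state (Γ : QueryAlgorithm n m) (x : Fin n → Bool) : ℕ → BasisState n m → ℂ
  | 0 => (Γ.unitary 0 : Matrix (BasisState n m) (BasisState n m) ℂ) *ᵥ Pi.single (zeroState n m) 1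
  | t + 1 => (Γ.unitary (t + 1) : Matrix (BasisState n m) (BasisState n m) ℂ) *ᵥ
      query x (state Γ x t)

theorem state_congr {Γ Γ' : QueryAlgorithm n m} (x : Fin n → Bool) {t : ℕ}
    (h : ∀ j ≤ t, Γ.unitary j = Γ'.unitary j) : Γ.state x t = Γ'.state x t := by
  induction t with
  | zero => simp only [state, h 0 le_rfl]
  | succ t ih => simp only [state, h (t + 1) le_rfl, ih fun j hj => h j (by omega)]

theorem finalState_eq (Γ : QueryAlgorithm n m) (x : Fin n → Bool) :
    Γ.finalState x = Γ.state x Γ.numQueries := by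
  obtain ⟨U, l⟩ := Γ
  unfold finalState numQueries
  simp only [List.bind_eq_flatMap, List.pure_def]
  induction l using List.reverseRecOn with
  | nil => rfl
  | append_singleton l V ih =>
    rw [List.flatMap_append, List.flatMap_singleton, List.foldl_append, List.length_append,
      List.length_singleton, state]
    dsimp only [List.foldl_cons, List.foldl_nil] at ih ⊢
    rw [ih]
    congr 2
    · simp [unitary]
    · refine state_congr x fun j hj => ?_
      cases j with
      | zero => rfl
      | succ j =>
        simp only [unitary, List.getD_eq_getElem?_getD]
        rw [List.getElem?_append_left (by omega)]

theorem l2_state (Γ : QueryAlgorithm n m) (x : Fin n → Bool) (t : ℕ) : l2 (Γ.state x t) = 1 := by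
  induction t with
  | zero => rw [state, l2_unitary, l2_single]
  | succ t ih => rw [state, l2_unitary, l2_query, ih]

theorem outcomeProb_eq (Γ : QueryAlgorithm n m) (x : Fin n → Bool) (s : BasisState n m) :
    Γ.outcomeProb x s = ‖Γ.state x Γ.numQueries s‖ ^ 2 := by
  rw [outcomeProb, finalState_eq]

theorem outcomeProb_nonneg (Γ : QueryAlgorithm n m) (x : Fin n → Bool) (s : BasisState n m) :
    0 ≤ Γ.outcomeProb x s := by unfold outcomeProb; positivity

theorem sum_outcomeProb (Γ : QueryAlgorithm n m) (x : Fin n → Bool) :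
    ∑ s, Γ.outcomeProb x s = 1 := by
  simp only [outcomeProb_eq]
  rw [← l2_sq, l2_state, one_pow]

/-- The outcome of a stage without queries does not depend on the input. -/
theorem outcomeProb_of_numQueries_eq_zero {Γ : QueryAlgorithm n m} (h : Γ.numQueries = 0)
    (x y : Fin n → Bool) (s : BasisState n m) : Γ.outcomeProb x s = Γ.outcomeProb y s := by
  rw [outcomeProb_eq, outcomeProb_eq, h]; rfl

end QueryAlgorithm

/-- The probability that the answer is `b` on the input `x`, when the stages in the list are still
to come, and `D` decides, from what is still to be observed, when to stop with which answer. -/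
noncomputable def returnProb (x : Fin n → Bool) (b : Bool) :
    List (QueryAlgorithm n m) → (List (BasisState n m) → Option Bool) → ℝ
  | [], D => if D [] = some b then 1 else 0
  | g :: gs, D => match D [] with
    | some c => if c = b then 1 else 0
    | none => ∑ s, g.outcomeProb x s * returnProb x b gs fun l => D (s :: l)

/-- The expected number of queries on the input `x`, in the same situation. -/
noncomputable def expectedQueries (x : Fin n → Bool) :
    List (QueryAlgorithm n m) → (List (BasisState n m) → Option Bool) → ℝ
  | [], _ => 0
  | g :: gs, D => match D [] with
    | some _ => 0
    | none => g.numQueries + ∑ s, g.outcomeProb x s * expectedQueries x gs fun l => D (s :: l)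

section Recursion

variable {x : Fin n → Bool} {b c : Bool} {g : QueryAlgorithm n m} {gs : List (QueryAlgorithm n m)}
  {D : List (BasisState n m) → Option Bool}

theorem returnProb_of_some (h : D [] = some c) :
    returnProb x b gs D = if c = b then 1 else 0 := by
  cases gs <;> simp [returnProb, h]

theorem returnProb_cons_of_none (h : D [] = none) : returnProb x b (g :: gs) D =
    ∑ s, g.outcomeProb x s * returnProb x b gs fun l => D (s :: l) := by
  simp [returnProb, h]

theorem expectedQueries_of_some (h : D [] = some c) : expectedQueries x gs D = 0 := by
  cases gs <;> simp [expectedQueries, h]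

theorem expectedQueries_cons_of_none (h : D [] = none) : expectedQueries x (g :: gs) D =
    g.numQueries + ∑ s, g.outcomeProb x s * expectedQueries x gs fun l => D (s :: l) := by
  simp [expectedQueries, h]

theorem returnProb_nonneg (x : Fin n → Bool) (b : Bool) (gs : List (QueryAlgorithm n m))
    (D : List (BasisState n m) → Option Bool) : 0 ≤ returnProb x b gs D := by
  induction gs generalizing D with
  | nil => unfold returnProb; split_ifs <;> norm_num
  | cons g gs ih =>
    cases h : D [] with
    | some c => rw [returnProb_of_some h]; split_ifs <;> norm_num
    | none =>
      rw [returnProb_cons_of_none h]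
      exact Finset.sum_nonneg fun s _ => mul_nonneg (g.outcomeProb_nonneg x s) (ih _)

theorem expectedQueries_nonneg (x : Fin n → Bool) (gs : List (QueryAlgorithm n m))
    (D : List (BasisState n m) → Option Bool) : 0 ≤ expectedQueries x gs D := by
  induction gs generalizing D with
  | nil => exact le_rfl
  | cons g gs ih =>
    cases h : D [] with
    | some c => rw [expectedQueries_of_some h]
    | none =>
      rw [expectedQueries_cons_of_none h]
      exact add_nonneg (Nat.cast_nonneg _)
        (Finset.sum_nonneg fun s _ => mul_nonneg (g.outcomeProb_nonneg x s) (ih _))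

end Recursion

theorem sum_cons {α : Type*} [Fintype α] {k : ℕ} (F : (Fin (k + 1) → α) → ℝ) :
    ∑ o, F o = ∑ s, ∑ o : Fin k → α, F (Fin.cons s o) := by
  rw [← Fintype.sum_prod_type']
  exact (Fintype.sum_equiv (Fin.consEquiv fun _ => α) _ _ fun _ => rfl).symm

theorem sum_prod_outcomeProb (x : Fin n → Bool) {k : ℕ} (stage : Fin k → QueryAlgorithm n m) :
    ∑ o : Fin k → BasisState n m, ∏ i, (stage i).outcomeProb x (o i) = 1 := by
  rw [← Fintype.prod_sum fun i s => (stage i).outcomeProb x s]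
  simp [QueryAlgorithm.sum_outcomeProb]

open Classical in
/-- The recursion along the list of stages agrees with the sum over all complete sequences of
outcomes, as the probabilities of the outcomes after a decision add up to `1`. -/
theorem returnProb_ofFn (x : Fin n → Bool) (b : Bool) {k : ℕ} (stage : Fin k → QueryAlgorithm n m)
    (D : List (BasisState n m) → Option Bool) :
    returnProb x b (List.ofFn stage) D = ∑ o : Fin k → BasisState n m,
      if ∃ j ≤ k, (∀ i < j, D ((List.ofFn o).take i) = none) ∧ D ((List.ofFn o).take j) = some b
      then ∏ i, (stage i).outcomeProb x (o i) else 0 := by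
  induction k generalizing D with
  | zero => simp [returnProb]
  | succ k ih =>
    cases h : D [] with
    | some c =>
      rw [returnProb_of_some h]
      have e : ∀ o : Fin (k + 1) → BasisState n m, (∃ j ≤ k + 1,
          (∀ i < j, D ((List.ofFn o).take i) = none) ∧ D ((List.ofFn o).take j) = some b) ↔
          c = b := by
        intro o
        constructor
        · rintro ⟨j, -, h1, h2⟩
          cases j with
          | zero => rw [List.take_zero, h] at h2; exact Option.some.inj h2
          | succ j => have := h1 0 (by omega); simp [h] at this
        · rintro rfl
          exact ⟨0, by omega, by simp, by simpa using h⟩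
      simp only [e]
      split_ifs
      · exact (sum_prod_outcomeProb x stage).symm
      · simp
    | none =>
      rw [List.ofFn_succ, returnProb_cons_of_none h, sum_cons]
      refine Finset.sum_congr rfl fun s _ => ?_
      rw [ih, Finset.mul_sum]
      refine Finset.sum_congr rfl fun o _ => ?_
      have e : (∃ j ≤ k + 1, (∀ i < j, D ((List.ofFn (Fin.cons s o : Fin (k + 1) → _)).take i) =
          none)
          ∧ D ((List.ofFn (Fin.cons s o : Fin (k + 1) → _)).take j) = some b) ↔ ∃ j ≤ k,
          (∀ i < j, D (s :: (List.ofFn o).take i) = none) ∧ D (s :: (List.ofFn o).take j) =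
              some b := by
        simp only [List.ofFn_succ, Fin.cons_zero, Fin.cons_succ]
        constructor
        · rintro ⟨j, h1, h2, h3⟩
          cases j with
          | zero => simp [h] at h3
          | succ j => exact ⟨j, by omega, fun i hi => h2 (i + 1) (by omega), h3⟩
        · rintro ⟨j, h1, h2, h3⟩
          refine ⟨j + 1, by omega, fun i hi => ?_, h3⟩
          cases i with
          | zero => exact h
          | succ i => exact h2 i (by omega)
      rw [if_congr e rfl rfl, Fin.prod_univ_succ, mul_ite, mul_zero]
      simp only [Fin.cons_zero, Fin.cons_succ]

open Classical in
/-- The analogue of `returnProb_ofFn` for the numbers of queries. -/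
theorem expectedQueries_ofFn (x : Fin n → Bool) {k : ℕ} (stage : Fin k → QueryAlgorithm n m)
    (D : List (BasisState n m) → Option Bool) :
    expectedQueries x (List.ofFn stage) D = ∑ o : Fin k → BasisState n m,
      (∏ i, (stage i).outcomeProb x (o i)) * ∑ j : Fin k,
        if ∀ i ≤ (j : ℕ), D ((List.ofFn o).take i) = none then ((stage j).numQueries : ℝ)
            else 0 := by
  induction k generalizing D with
  | zero => simp [expectedQueries]
  | succ k ih =>
    cases h : D [] with
    | some c =>
      rw [expectedQueries_of_some h]
      have e : ∀ (o : Fin (k + 1) → BasisState n m) (j : ℕ),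
          ¬ ∀ i ≤ j, D ((List.ofFn o).take i) = none := by
        intro o j h'
        have := h' 0 (by omega)
        simp [h] at this
      simp only [e, if_false, Finset.sum_const_zero, mul_zero]
    | none =>
      rw [List.ofFn_succ, expectedQueries_cons_of_none h, sum_cons]
      have e : ∀ s (o : Fin k → BasisState n m) (j : Fin k), (∀ i ≤ ((j.succ : Fin (k + 1)) : ℕ),
          D ((List.ofFn (Fin.cons s o : Fin (k + 1) → _)).take i) = none) ↔
          ∀ i ≤ (j : ℕ), D (s :: (List.ofFn o).take i) = none := by
        intro s o j
        simp only [List.ofFn_succ, Fin.cons_zero, Fin.cons_succ, Fin.val_succ]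
        constructor
        · exact fun h' i hi => h' (i + 1) (by omega)
        · intro h' i hi
          cases i with
          | zero => exact h
          | succ i => exact h' i (by omega)
      have e0 : ∀ s (o : Fin k → BasisState n m), (∀ i ≤ (((0 : Fin (k + 1)) : ℕ)),
          D ((List.ofFn (Fin.cons s o : Fin (k + 1) → _)).take i) = none) ↔ True := by
        refine fun s o => iff_true_intro fun i hi => ?_
        have : i = 0 := by simpa using hi
        subst this
        simpa using h
      simp only [Fin.sum_univ_succ, e, e0, if_true, Fin.prod_univ_succ, Fin.cons_zero,
        Fin.cons_succ, mul_add, Finset.sum_add_distrib, ih]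
      congr 1
      · simp only [← Finset.sum_mul, ← Finset.mul_sum]
        rw [sum_prod_outcomeProb x fun i : Fin k => stage i.succ]
        simp [QueryAlgorithm.sum_outcomeProb]
      · refine Finset.sum_congr rfl fun s _ => ?_
        rw [Finset.mul_sum]
        exact Finset.sum_congr rfl fun o _ => (mul_assoc _ _ _).symm

namespace CompositeAlgorithm

/-- The decisions of a composite algorithm, including the one to begin. -/
def decisions (Γ : CompositeAlgorithm n m) (l : List (BasisState n m)) : Option Bool :=
  if l = [] then none else Γ.decide l

theorem decisions_take (Γ : CompositeAlgorithm n m) (o : Fin Γ.numStages → BasisState n m)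
    (k : Fin Γ.numStages) : Γ.decisions ((List.ofFn o).take (k + 1)) = Γ.decision o k := by
  rw [decisions, if_neg, decision]
  intro h
  have := congrArg List.length h
  simp at this

theorem invoked_iff (Γ : CompositeAlgorithm n m) (o : Fin Γ.numStages → BasisState n m)
    (k : Fin Γ.numStages) :
    Γ.Invoked o k ↔ ∀ i ≤ (k : ℕ), Γ.decisions ((List.ofFn o).take i) = none := by
  constructor
  · intro h i hi
    cases i with
    | zero => simp [decisions]
    | succ i =>
      rw [Γ.decisions_take o ⟨i, by omega⟩]
      exact h _ (Fin.lt_def.2 (by simpa using hi))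
  · intro h j hj
    rw [← decisions_take]
    exact h _ (Fin.lt_def.1 hj)

theorem returns_iff (Γ : CompositeAlgorithm n m) (o : Fin Γ.numStages → BasisState n m) (b : Bool) :
    Γ.Returns o b ↔ ∃ j ≤ Γ.numStages, (∀ i < j, Γ.decisions ((List.ofFn o).take i) = none) ∧
      Γ.decisions ((List.ofFn o).take j) = some b := by
  constructor
  · rintro ⟨k, h1, h2⟩
    rw [invoked_iff] at h1
    exact ⟨k + 1, k.2, fun i hi => h1 i (by omega), by rw [decisions_take, h2]⟩
  · rintro ⟨j, h1, h2, h3⟩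
    cases j with
    | zero => simp [decisions] at h3
    | succ j =>
      refine ⟨⟨j, h1⟩, ?_, ?_⟩
      · rw [invoked_iff]; exact fun i hi => h2 i (Nat.lt_succ_of_le hi)
      · rw [← decisions_take]; exact h3

theorem errorProb_eq (Γ : CompositeAlgorithm n m) (f : (Fin n → Bool) → Bool) (x : Fin n → Bool) :
    Γ.errorProb f x = returnProb x (!f x) (List.ofFn Γ.stage) Γ.decisions := by
  classical
  rw [returnProb_ofFn, errorProb]
  refine Finset.sum_congr rfl fun o _ => ?_
  rw [if_congr (Γ.returns_iff o _) rfl rfl]; rfl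

theorem queries_eq (Γ : CompositeAlgorithm n m) (x : Fin n → Bool) :
    Γ.queries x = expectedQueries x (List.ofFn Γ.stage) Γ.decisions := by
  classical
  rw [expectedQueries_ofFn, queries]
  simp only [invokedProb, Finset.sum_mul, Finset.mul_sum]
  rw [Finset.sum_comm]
  refine Finset.sum_congr rfl fun o _ => Finset.sum_congr rfl fun k _ => ?_
  rw [if_congr (Γ.invoked_iff o k) rfl rfl, ite_mul, zero_mul, mul_ite, mul_zero]; rfl

theorem isSome_decisions (Γ : CompositeAlgorithm n m) {l : List (BasisState n m)}
    (h : l.length = (List.ofFn Γ.stage).length) : (Γ.decisions l).isSome := by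
  rw [List.length_ofFn] at h
  rw [decisions, if_neg]
  · exact Γ.decide_last l h
  · rintro rfl
    exact Γ.numStages_pos.ne h

end CompositeAlgorithm

/-- A nonempty list of stages and decisions on them form a composite algorithm. -/
theorem exists_compositeAlgorithm {gs : List (QueryAlgorithm n m)}
    {D : List (BasisState n m) → Option Bool} (h0 : gs ≠ []) (h1 : D [] = none)
    (h2 : ∀ l, l.length = gs.length → (D l).isSome) : ∃ Γ : CompositeAlgorithm n m,
      (∀ f x, Γ.errorProb f x = returnProb x (!f x) gs D) ∧
      ∀ x, Γ.queries x = expectedQueries x gs D := by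
  let Γ : CompositeAlgorithm n m := ⟨gs.length, List.length_pos_iff.2 h0, gs.get, D, h2⟩
  have e1 : List.ofFn Γ.stage = gs := List.ofFn_get gs
  have e2 : Γ.decisions = D := by
    funext l
    unfold CompositeAlgorithm.decisions
    split_ifs with h
    · rw [h, h1]
    · rfl
  exact ⟨Γ, fun f x => by rw [Γ.errorProb_eq, e1, e2], fun x => by rw [Γ.queries_eq, e1, e2]⟩

end QuantumQuery

/-! ### Candidates as approximate algorithms -/

namespace Search

open QuantumQuery DecisionTree

variable {n m : ℕ}

/-- The input whose bits are the binary digits of `x`. -/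
def bits (n x : ℕ) : Fin n → Bool := fun i => x.testBit i

/-- The number of a basis state. -/
def code (s : BasisState n m) : ℕ :=
  s.2.2 + workSize n m * ((if s.2.1 then 1 else 0) + 2 * s.1)

/-- The basis state with a given number. -/
def decode (n m i : ℕ) : BasisState n m :=
  (⟨i / (2 * workSize n m) % 2 ^ Nat.clog 2 n, Nat.mod_lt _ (by positivity)⟩,
    decide (i / workSize n m % 2 = 1),
    ⟨i % 2 ^ (m - (Nat.clog 2 n + 1)), Nat.mod_lt _ (by positivity)⟩)

theorem code_zeroState : code (zeroState n m) = 0 := by simp [code, zeroState]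

section Code

variable (ha : Nat.clog 2 n + 1 ≤ m)
include ha

theorem code_div (s : BasisState n m) :
    code s / workSize n m = (if s.2.1 then 1 else 0) + 2 * s.1 := by
  have h : (s.2.2 : ℕ) < workSize n m := by rw [workSize_eq ha]; exact s.2.2.2
  rw [code, Nat.add_mul_div_left _ _ (workSize_pos ha), Nat.div_eq_of_lt h, zero_add]

theorem code_div_two (s : BasisState n m) : code s / (2 * workSize n m) = s.1 := by
  rw [mul_comm, ← Nat.div_div_eq_div_mul, code_div ha]
  split_ifs <;> omega

theorem decode_code (s : BasisState n m) : decode n m (code s) = s := by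
  obtain ⟨i, b, z⟩ := s
  have hz := z.2
  refine Prod.ext (Fin.ext ?_) (Prod.ext ?_ (Fin.ext ?_))
  · dsimp only [decode]
    rw [code_div_two ha]
    exact Nat.mod_eq_of_lt i.2
  · dsimp only [decode]
    rw [code_div ha]
    cases b <;> simp
  · dsimp only [decode, code]
    rw [workSize_eq ha, Nat.add_mul_mod_self_left]
    exact Nat.mod_eq_of_lt hz

theorem code_decode {i : ℕ} (hi : i < 2 ^ m) : code (decode n m i) = i := by
  have h1 := div_lt_indexSize ha hi
  change _ < 2 ^ Nat.clog 2 n at h1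
  change i % 2 ^ (m - (Nat.clog 2 n + 1)) + workSize n m *
    ((if decide (i / workSize n m % 2 = 1) = true then 1 else 0) +
      2 * (i / (2 * workSize n m) % 2 ^ Nat.clog 2 n)) = i
  rw [Nat.mod_eq_of_lt h1, ← workSize_eq ha, mul_comm 2 (workSize n m),
    ← Nat.div_div_eq_div_mul]
  have h2 : (if decide (i / workSize n m % 2 = 1) = true then 1 else 0) =
      i / workSize n m % 2 := by
    simp only [decide_eq_true_eq]
    split_ifs <;> omega
  rw [h2, Nat.mod_add_div, Nat.mod_add_div]

theorem code_lt (s : BasisState n m) : code s < 2 ^ m := by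
  have h1 : code s / (2 * workSize n m) < indexSize n := by rw [code_div_two ha]; exact s.1.2
  rw [Nat.div_lt_iff_lt_mul (by have := workSize_pos ha; omega)] at h1
  calc code s < _ := h1
    _ = 2 ^ m := by rw [← workSize_mul ha]; ring

theorem sum_code {M : Type*} [AddCommMonoid M] (g : ℕ → M) :
    ∑ s : BasisState n m, g (code s) = ∑ i ∈ Finset.range (2 ^ m), g i :=
  Finset.sum_nbij' code (decode n m) (fun s _ => Finset.mem_range.2 (code_lt ha s)) (by simp)
    (fun s _ => decode_code ha s) (fun _ hi => code_decode ha (Finset.mem_range.1 hi))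
    fun _ _ => rfl

theorem sum_decode {M : Type*} [AddCommMonoid M] (g : BasisState n m → M) :
    ∑ i ∈ Finset.range (2 ^ m), g (decode n m i) = ∑ s, g s := by
  rw [← sum_code ha]
  exact Finset.sum_congr rfl fun s _ => by rw [decode_code ha]

/-- `queryCode` describes a query. An index that is not the address of an input bit is at least `n`,
and that binary digit of `x < 2 ^ n` vanishes. -/
theorem queryCode_code {x : ℕ} (hx : x < 2 ^ n) (s : BasisState n m) :
    queryCode n m x (code s) = code (queryBasis (bits n x) s) := by
  have hb : inputBit (bits n x) s.1 = x.testBit s.1 := by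
    unfold inputBit bits
    split_ifs with h
    · rfl
    · exact (Nat.testBit_lt_two_pow (hx.trans_le (Nat.pow_le_pow_right (by omega)
        (not_lt.1 h)))).symm
  have ht : x.testBit s.1 = decide (x / 2 ^ (s.1 : ℕ) % 2 = 1) := Nat.testBit_eq_decide_div_mod_eq
  unfold queryCode
  rw [code_div_two ha, code_div ha]
  obtain ⟨i, b, z⟩ := s
  dsimp only [queryBasis, code] at *
  rw [hb, ht]
  have h2 := Nat.mod_two_eq_zero_or_one (x / 2 ^ (i : ℕ))
  have e1 : (1 + 2 * (i : ℕ)) % 2 ≠ 0 := by omega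
  have e0 : (0 + 2 * (i : ℕ)) % 2 = 0 := by omega
  rcases h2 with h2 | h2
  · simp [h2]
  · cases b
    · simp [h2]; ring
    · simp [h2, mul_add]; omega

end Code

section Amplitude

variable (n m) (d : ℕ → ℕ)

/-- The `u`-th matrix of a candidate. -/
noncomputable def matrixOf (u : ℕ) : Matrix (BasisState n m) (BasisState n m) ℂ := fun s s' =>
  (∑ c ∈ Finset.range 4, Complex.I ^ c * entry n m d u (code s) (code s') c) / den m

/-- The state of a candidate after `t` queries of the stage `k`. -/
noncomputable def stateOf (k x t : ℕ) : BasisState n m → ℂ := fun s =>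
  (∑ c ∈ Finset.range 4, Complex.I ^ c * amplitude n m d k x t (4 * code s + c)) /
    (den m : ℂ) ^ (t + 1)

/-- The probabilities of a candidate. -/
noncomputable def probOf (k x s : ℕ) : ℝ :=
  prob n m d k x s / (den m : ℝ) ^ (2 * (queryCount n d k + 1))

variable {n m} {d}

theorem den_pos (m : ℕ) : 0 < den m := by unfold den; positivity

theorem stateOf_zero (k x : ℕ) :
    stateOf n m d k x 0 = matrixOf n m d (offset n d k) *ᵥ Pi.single (zeroState n m) 1 := by
  funext s
  rw [Matrix.mulVec_single_one]
  simp only [stateOf, matrixOf, Matrix.col_apply, code_zeroState, zero_add, pow_one]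
  congr 1
  refine Finset.sum_congr rfl fun c hc => ?_
  have hc' := Finset.mem_range.1 hc
  rw [amplitude, show (4 * code s + c) / 4 = code s by omega,
    show (4 * code s + c) % 4 = c by omega]

/-- Multiplication of complex numbers, written as combinations of the powers of `I`. -/
theorem convolution_I (e a : ℕ → ℂ) :
    ∑ c ∈ Finset.range 4, Complex.I ^ c * ∑ b ∈ Finset.range 4, e ((c + (4 - b)) % 4) * a b =
      (∑ c ∈ Finset.range 4, Complex.I ^ c * e c) * ∑ b ∈ Finset.range 4, Complex.I ^ b * a b := by
  have h2 : Complex.I ^ 2 = -1 := Complex.I_sq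
  have h3 : Complex.I ^ 3 = -Complex.I := Complex.I_pow_three
  simp only [Finset.sum_range_succ, Finset.sum_range_zero, zero_add, pow_zero, pow_one, h2, h3]
  norm_num
  ring_nf
  rw [h2]
  ring

/-- The amplitudes of a candidate evolve like the state of a quantum query algorithm. -/
theorem stateOf_succ (ha : Nat.clog 2 n + 1 ≤ m) {x : ℕ} (hx : x < 2 ^ n) (k t : ℕ) :
    stateOf n m d k x (t + 1) = matrixOf n m d (offset n d k + (t + 1)) *ᵥ
      query (bits n x) (stateOf n m d k x t) := by
  funext s
  have hD : (den m : ℂ) ≠ 0 := by exact_mod_cast (den_pos m).ne'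
  simp only [stateOf, Matrix.mulVec, dotProduct, query, matrixOf]
  have e : ∀ s' : BasisState n m, (∑ c ∈ Finset.range 4, Complex.I ^ c *
      (entry n m d (offset n d k + (t + 1)) (code s) (code s') c : ℂ)) / den m *
      ((∑ c ∈ Finset.range 4, Complex.I ^ c *
        (amplitude n m d k x t (4 * code (queryBasis (bits n x) s') + c) : ℂ)) /
        (den m : ℂ) ^ (t + 1)) = (∑ c ∈ Finset.range 4, Complex.I ^ c * ∑ b ∈ Finset.range 4,
          (entry n m d (offset n d k + (t + 1)) (code s) (code s') ((c + (4 - b)) % 4) : ℂ) *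
          (amplitude n m d k x t (4 * code (queryBasis (bits n x) s') + b) : ℂ)) /
          (den m : ℂ) ^ (t + 1 + 1) := by
    intro s'
    rw [convolution_I (fun c => (entry n m d (offset n d k + (t + 1)) (code s) (code s') c : ℂ))
      fun b => (amplitude n m d k x t (4 * code (queryBasis (bits n x) s') + b) : ℂ)]
    rw [div_mul_div_comm, ← pow_succ']
  rw [Finset.sum_congr rfl fun s' _ => e s', ← Finset.sum_div]
  congr 1
  rw [Finset.sum_comm]
  refine Finset.sum_congr rfl fun c hc => ?_
  have hc' := Finset.mem_range.1 hc
  rw [← Finset.mul_sum]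
  congr 1
  rw [amplitude, show (4 * code s + c) / 4 = code s by omega,
    show (4 * code s + c) % 4 = c by omega,
    mul_comm 4, Finset.sum_range_mul_add]
  push_cast
  rw [← sum_code ha]
  refine Finset.sum_congr rfl fun s' _ => Finset.sum_congr rfl fun b hb => ?_
  have hb' := Finset.mem_range.1 hb
  rw [show (code s' * 4 + b) / 4 = code s' by omega, show (code s' * 4 + b) % 4 = b by omega,
    queryCode_code ha hx]

theorem cast_sqDist (a b : ℕ) : (sqDist a b : ℝ) = ((a : ℝ) - b) ^ 2 := by
  unfold sqDist
  rcases le_total a b with h | h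
  · rw [Nat.sub_eq_zero_of_le h, zero_add]; push_cast [h]; ring
  · rw [Nat.sub_eq_zero_of_le h, add_zero]; push_cast [h]; ring

theorem norm_sq_sum_I (z : ℕ → ℕ) :
    ‖∑ c ∈ Finset.range 4, Complex.I ^ c * (z c : ℂ)‖ ^ 2 =
      ((z 0 : ℝ) - z 2) ^ 2 + ((z 1 : ℝ) - z 3) ^ 2 := by
  have h2 : Complex.I ^ 2 = -1 := Complex.I_sq
  have h3 : Complex.I ^ 3 = -Complex.I := Complex.I_pow_three
  rw [← Complex.normSq_eq_norm_sq, Complex.normSq_apply]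
  simp only [Finset.sum_range_succ, Finset.sum_range_zero, zero_add, pow_zero, pow_one, h2, h3]
  simp
  ring

theorem norm_sq_stateOf (k x : ℕ) (s : BasisState n m) :
    ‖stateOf n m d k x (queryCount n d k) s‖ ^ 2 = probOf n m d k x (code s) := by
  rw [stateOf, norm_div, div_pow, norm_sq_sum_I, probOf, prob]
  push_cast
  rw [cast_sqDist, cast_sqDist, norm_pow, Complex.norm_natCast, ← pow_mul, mul_comm 2]
  rfl

end Amplitude

/-- The matrices `A` and `B` differ by at most `η` in the operator norm. -/
def Close {ι : Type*} [Fintype ι] (η : ℝ) (A B : Matrix ι ι ℂ) : Prop :=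
  ∀ φ : ι → ℂ, l2 ((A - B) *ᵥ φ) ≤ η * l2 φ

/-- Errors of relative size `η` in each of `t + 1` matrices accumulate to at most `(1 + η) ^ (t + 1)
- 1`. -/
theorem l2_stateOf_sub_le (ha : Nat.clog 2 n + 1 ≤ m) {d : ℕ → ℕ} {x : ℕ} (hx : x < 2 ^ n) {k t : ℕ}
    {g : QueryAlgorithm n m} {η : ℝ} (hη : 0 ≤ η)
    (hg : ∀ j ≤ t, Close η (matrixOf n m d (offset n d k + j)) (g.unitary j)) :
    l2 (stateOf n m d k x t - g.state (bits n x) t) ≤ (1 + η) ^ (t + 1) - 1 := by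
  induction t with
  | zero =>
    rw [stateOf_zero, QueryAlgorithm.state, ← Matrix.sub_mulVec]
    have := hg 0 le_rfl (Pi.single (zeroState n m) 1)
    rw [l2_single] at this
    simpa using this
  | succ t ih =>
    have ih := ih fun j hj => hg j (by omega)
    set a := stateOf n m d k x t
    set ψ := g.state (bits n x) t with hψ
    rw [stateOf_succ ha hx, QueryAlgorithm.state]
    set A := matrixOf n m d (offset n d k + (t + 1))
    have e : A *ᵥ query (bits n x) a -
        (g.unitary (t + 1) : Matrix (BasisState n m) (BasisState n m) ℂ) *ᵥ query (bits n x) ψ =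
        (A - (g.unitary (t + 1) : Matrix (BasisState n m) (BasisState n m) ℂ)) *ᵥ query
            (bits n x) a +
          (g.unitary (t + 1) : Matrix (BasisState n m) (BasisState n m) ℂ) *ᵥ
            query (bits n x) (a - ψ) := by
      have : query (bits n x) (a - ψ) = query (bits n x) a - query (bits n x) ψ := rfl
      rw [this, Matrix.sub_mulVec, Matrix.mulVec_sub]; abel
    rw [e]
    refine (l2_add_le _ _).trans ?_
    rw [l2_unitary, l2_query]
    have h1 := hg (t + 1) le_rfl (query (bits n x) a)
    rw [l2_query] at h1
    have h2 : l2 a ≤ 1 + l2 (a - ψ) := by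
      have := l2_add_le ψ (a - ψ)
      rwa [add_sub_cancel, hψ, g.l2_state] at this
    have h3 : η * l2 a ≤ η * (1 + l2 (a - ψ)) := mul_le_mul_of_nonneg_left h2 hη
    have h4 : (1 + η) ^ (t + 1 + 1) = (1 + η) ^ (t + 1) + η * (1 + η) ^ (t + 1) := by ring
    have h5 : η * l2 (a - ψ) ≤ η * ((1 + η) ^ (t + 1) - 1) := mul_le_mul_of_nonneg_left ih hη
    linarith

theorem sum_norm_mul_norm_le {ι : Type*} [Fintype ι] (ψ φ : ι → ℂ) :
    ∑ s, ‖ψ s‖ * ‖φ s‖ ≤ l2 ψ * l2 φ := by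
  refine (Real.sum_mul_le_sqrt_mul_sqrt _ _ _).trans (le_of_eq ?_)
  rw [← l2_sq, ← l2_sq, Real.sqrt_sq (l2_nonneg _), Real.sqrt_sq (l2_nonneg _)]

/-- By the Cauchy-Schwarz inequality, the probabilities of states `ψ` and `φ` differ in total by at
most `‖ψ - φ‖ (‖ψ‖ + ‖φ‖)`. -/
theorem sum_abs_outcomeProb_sub_le (ha : Nat.clog 2 n + 1 ≤ m) {d : ℕ → ℕ} {x : ℕ} (hx : x < 2 ^ n)
    {k : ℕ} {g : QueryAlgorithm n m} {η : ℝ} (hη : 0 ≤ η) (hT : g.numQueries = queryCount n d k)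
    (hg : ∀ j ≤ g.numQueries, Close η (matrixOf n m d (offset n d k + j)) (g.unitary j)) :
    ∑ i ∈ Finset.range (2 ^ m), |g.outcomeProb (bits n x) (decode n m i) - probOf n m d k x i| ≤
      (1 + η) ^ (2 * (queryCount n d k + 1)) - 1 := by
  rw [hT] at hg
  have h1 := l2_stateOf_sub_le ha hx hη hg
  rw [← sum_code ha]
  set a := stateOf n m d k x (queryCount n d k) with ha'
  set ψ := g.state (bits n x) (queryCount n d k) with hψ
  have hψ1 : l2 ψ = 1 := g.l2_state _ _
  have h2 : l2 a ≤ 1 + l2 (a - ψ) := by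
    have := l2_add_le ψ (a - ψ)
    rwa [add_sub_cancel, hψ1] at this
  set E := (1 + η) ^ (queryCount n d k + 1) with hE
  have hE1 : 1 ≤ E := one_le_pow₀ (by linarith)
  calc ∑ s : BasisState n m, |g.outcomeProb (bits n x) (decode n m (code s)) -
        probOf n m d k x (code s)|
      ≤ ∑ s, ‖(a - ψ) s‖ * ‖ψ s‖ + ∑ s, ‖(a - ψ) s‖ * ‖a s‖ := by
        rw [← Finset.sum_add_distrib]
        refine Finset.sum_le_sum fun s _ => ?_
        rw [decode_code ha, g.outcomeProb_eq, hT, ← norm_sq_stateOf, ← ha', ← hψ,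
          sq_sub_sq, abs_mul, abs_of_nonneg (by positivity : 0 ≤ ‖ψ s‖ + ‖a s‖), mul_comm,
          ← mul_add]
        refine mul_le_mul_of_nonneg_right ?_ (by positivity)
        rw [Pi.sub_apply, norm_sub_rev]
        exact abs_norm_sub_norm_le _ _
    _ ≤ l2 (a - ψ) * l2 ψ + l2 (a - ψ) * l2 a :=
        add_le_add (sum_norm_mul_norm_le _ _) (sum_norm_mul_norm_le _ _)
    _ = l2 (a - ψ) * (1 + l2 a) := by rw [hψ1]; ring
    _ ≤ (E - 1) * (1 + E) := mul_le_mul h1 (by linarith) (by linarith [l2_nonneg a]) (by linarith)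
    _ = _ := by rw [hE, mul_comm 2, pow_mul]; ring

/-! ### Path weights -/

section PathWeight

variable {S : ℕ} {p p' : ℕ → ℕ → ℝ}

theorem pathWeight_succ_mul_add {R : Type*} [Mul R] [One R] (p : ℕ → ℕ → R) {s : ℕ} (hs : s < S)
    (k h : ℕ) : pathWeight S p (k + 1) (h * S + s) = p k s * pathWeight S p k h := by
  rw [pathWeight, mul_comm h, Nat.mul_add_mod, Nat.mod_eq_of_lt hs, Nat.mul_add_div (by omega),
    Nat.div_eq_of_lt hs, add_zero]

theorem pathWeight_nonneg (hp : ∀ k s, 0 ≤ p k s) (k h : ℕ) : 0 ≤ pathWeight S p k h := by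
  induction k generalizing h with
  | zero => exact zero_le_one
  | succ k ih => exact mul_nonneg (hp _ _) (ih _)

theorem sum_pathWeight {k : ℕ} (h1 : ∀ j < k, ∑ s ∈ Finset.range S, p j s = 1) :
    ∑ h ∈ Finset.range (S ^ k), pathWeight S p k h = 1 := by
  induction k with
  | zero => simp [pathWeight]
  | succ k ih =>
    rw [pow_succ, Finset.sum_range_mul_add, ← ih fun j hj => h1 j (by omega)]
    refine Finset.sum_congr rfl fun h _ => ?_
    rw [Finset.sum_congr rfl fun s hs => pathWeight_succ_mul_add p (Finset.mem_range.1 hs) k h,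
      ← Finset.sum_mul, h1 k (by omega), one_mul]

/-- The errors `δ j - 1` in the distributions of independent outcomes accumulate multiplicatively.
-/
theorem sum_abs_pathWeight_sub_le {δ : ℕ → ℝ} (hp : ∀ k s, 0 ≤ p k s) {k : ℕ}
    (h1 : ∀ j < k, ∑ s ∈ Finset.range S, p j s = 1)
    (h2 : ∀ j < k, ∑ s ∈ Finset.range S, |p j s - p' j s| ≤ δ j - 1) :
    ∑ h ∈ Finset.range (S ^ k), |pathWeight S p k h - pathWeight S p' k h| ≤
      ∏ j ∈ Finset.range k, δ j - 1 := by
  induction k with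
  | zero => simp [pathWeight]
  | succ k ih =>
    have ih := ih (fun j hj => h1 j (by omega)) fun j hj => h2 j (by omega)
    have hk := h2 k (by omega)
    have h3 := sum_pathWeight fun j hj => h1 j (by omega : j < k + 1)
    have h3' := sum_pathWeight (k := k) fun j hj => h1 j (by omega)
    set P := pathWeight S p k with hP
    set P' := pathWeight S p' k with hP'
    set e := ∑ h ∈ Finset.range (S ^ k), |P h - P' h| with he
    have h4 : ∑ h ∈ Finset.range (S ^ k), |P' h| ≤ 1 + e := by
      rw [← h3', he, ← Finset.sum_add_distrib]
      refine Finset.sum_le_sum fun h _ => ?_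
      have h5 : |P' h| ≤ |P h| + |P h - P' h| := by
        have := abs_sub (P h) (P h - P' h)
        rwa [sub_sub_cancel] at this
      rwa [abs_of_nonneg (pathWeight_nonneg hp k h : 0 ≤ P h)] at h5
    have he0 : 0 ≤ e := Finset.sum_nonneg fun _ _ => abs_nonneg _
    have hd0 : 0 ≤ ∑ s ∈ Finset.range S, |p k s - p' k s| :=
        Finset.sum_nonneg fun _ _ => abs_nonneg _
    rw [pow_succ, Finset.sum_range_mul_add, Finset.prod_range_succ]
    calc ∑ h ∈ Finset.range (S ^ k), ∑ s ∈ Finset.range S,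
          |pathWeight S p (k + 1) (h * S + s) - pathWeight S p' (k + 1) (h * S + s)|
        ≤ ∑ h ∈ Finset.range (S ^ k), ∑ s ∈ Finset.range S,
          (p k s * |P h - P' h| + |p k s - p' k s| * |P' h|) := by
          refine Finset.sum_le_sum fun h _ => Finset.sum_le_sum fun s hs => ?_
          have hs' := Finset.mem_range.1 hs
          rw [pathWeight_succ_mul_add p hs', pathWeight_succ_mul_add p' hs', ← hP, ← hP',
            show p k s * P h - p' k s * P' h = p k s * (P h - P' h) +
                (p k s - p' k s) * P' h by ring]
          refine (abs_add_le _ _).trans (le_of_eq ?_)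
          rw [abs_mul, abs_mul, abs_of_nonneg (hp k s)]
      _ = e + (∑ s ∈ Finset.range S, |p k s - p' k s|) * ∑ h ∈ Finset.range (S ^ k), |P' h| := by
          simp only [Finset.sum_add_distrib, ← Finset.sum_mul, ← Finset.mul_sum, h1 k (by omega),
            one_mul]
          rfl
      _ ≤ e + (δ k - 1) * (1 + e) := by
          gcongr
          linarith
      _ ≤ _ := by nlinarith

end PathWeight

/-- The problem of choosing decisions for the stages `g`, with weights multiplied by `Z`. -/
noncomputable def exactProblem (n m : ℕ) (F d : ℕ → ℕ) (g : ℕ → QueryAlgorithm n m) (Z : ℝ) :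
    Problem ℝ where
  S := 2 ^ m
  leaf y h := Z * pathWeight (2 ^ m)
    (fun k s => (g k).outcomeProb (bits n (y / 2)) (decode n m s)) n h
  halt b y := haltPay m F b y
  step h y := stepPay n d h y

theorem cast_pathWeight (d : ℕ → ℕ) (x k h : ℕ) :
    ((pathWeight (2 ^ m) (fun k s => prob n m d k x s) k h : ℕ) : ℝ) =
      (den m : ℝ) ^ (2 * offset n d k) * pathWeight (2 ^ m) (fun k s => probOf n m d k x s)
          k h := by
  have hD : (den m : ℝ) ≠ 0 := by exact_mod_cast (den_pos m).ne'
  induction k generalizing h with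
  | zero => simp [pathWeight, offset]
  | succ k ih =>
    have e : offset n d (k + 1) = offset n d k + (queryCount n d k + 1) := by
      unfold offset; rw [Finset.sum_range_succ]
    rw [pathWeight, pathWeight, Nat.cast_mul, ih, probOf, e, mul_add, pow_add]
    field_simp

/-- The stages `g` are close to those that the candidate describes. -/
structure Approximates (n m : ℕ) (d : ℕ → ℕ) (η : ℝ) (g : ℕ → QueryAlgorithm n m) : Prop where
  numQueries : ∀ k < n, (g k).numQueries = queryCount n d k
  close : ∀ k < n, ∀ j ≤ (g k).numQueries,
    Close η (matrixOf n m d (offset n d k + j)) ((g k).unitary j)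

theorem offset_eq (n : ℕ) (d : ℕ → ℕ) : offset n d n = ∑ k ∈ Finset.range n,
    queryCount n d k + n := by
  unfold offset; simp [Finset.sum_add_distrib]

/-- The outcomes of a strategy against the candidate differ by at most `1`, in units of the common
denominator, from those against the exact stages. -/
theorem abs_pay_sub_pay_le (ha : Nat.clog 2 n + 1 ≤ m) (hnm : n ≤ 2 ^ m) {F d : ℕ → ℕ} {η : ℝ}
    (hη : 0 ≤ η) (hη' : (1 + η) ^ (4 * n) - 1 ≤ 1 / (4096 * 2 ^ m)) {g : ℕ → QueryAlgorithm n m}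
    (hg : Approximates n m d η g) (hd : offset n d n ≤ 2 * n) (δ : ℕ → ℕ → ℕ) {y : ℕ}
    (hy : y < 2 * 2 ^ n) :
    |(exactProblem n m F d g (scale n m d)).pay δ n 0 y - (problem n m F d).pay δ n 0 y| ≤
      scale n m d := by
  set G := exactProblem n m F d g (scale n m d) with hG
  let c : ℕ → ℕ → ℝ := fun h y => if y % 2 = 0 then (errorWeight m : ℝ) else
    128 * (n + ∑ j ∈ Finset.range h, (queryCount n d (n - (j + 1)) : ℝ))
  have hc : G.PayBound c := by
    constructor
    · intro b h y
      change (haltPay m F b y : ℝ) ≤ if _ then _ else _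
      by_cases h0 : y % 2 = 0
      · rw [if_pos h0]; exact_mod_cast haltPay_le b y
      · rw [if_neg h0, haltPay, if_neg h0, Nat.cast_zero]; positivity
    · intro y
      change (stepPay n d 0 y : ℝ) ≤ if _ then _ else _
      by_cases h0 : y % 2 = 0
      · rw [if_pos h0, stepPay, if_pos h0, Nat.cast_zero]; positivity
      · rw [if_neg h0, stepPay, if_neg h0, if_pos rfl]; simp
    · intro h y
      change (stepPay n d (h + 1) y : ℝ) + (if _ then _ else _) ≤ if _ then _ else _
      by_cases h0 : y % 2 = 0
      · rw [if_pos h0, if_pos h0, stepPay, if_pos h0, Nat.cast_zero, zero_add]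
      · rw [if_neg h0, if_neg h0, stepPay, if_neg h0, if_neg (Nat.succ_ne_zero h),
          Finset.sum_range_succ]
        push_cast
        linarith
  have hx : y / 2 < 2 ^ n := by omega
  set leaf' : ℕ → ℕ → ℝ := fun y h =>
    ((pathWeight (2 ^ m) (fun k s => prob n m d k (y / 2) s) n h : ℕ) : ℝ) with hl
  have e : ({ G with leaf := leaf' } : Problem ℝ) = (problem n m F d).map (Nat.castRingHom ℝ) := rfl
  have key := hc.abs_pay_sub_le (fun b y => Nat.cast_nonneg _) (fun h y => Nat.cast_nonneg _) leaf'
    δ n 0 y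
  rw [e, Problem.map_pay] at key
  refine key.trans ?_
  have hZ : (scale n m d : ℝ) = (den m : ℝ) ^ (2 * offset n d n) := by
    unfold scale; push_cast; rfl
  have hZ0 : (0 : ℝ) ≤ scale n m d := Nat.cast_nonneg _
  have h1 : ∑ h ∈ Finset.range (G.S ^ n), |G.leaf y (0 * G.S ^ n + h) - leaf' y (0 * G.S ^ n + h)| ≤
      scale n m d * (1 / (4096 * 2 ^ m)) := by
    have e1 : ∀ h, |G.leaf y (0 * G.S ^ n + h) - leaf' y (0 * G.S ^ n + h)| = scale n m d *
        |pathWeight (2 ^ m) (fun k s => (g k).outcomeProb (bits n (y / 2)) (decode n m s)) n h -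
          pathWeight (2 ^ m) (fun k s => probOf n m d k (y / 2) s) n h| := by
      intro h
      rw [zero_mul, zero_add, hl]
      dsimp only
      rw [cast_pathWeight, ← hZ, ← abs_of_nonneg hZ0, ← abs_mul, abs_of_nonneg hZ0, mul_sub]
      rfl
    rw [Finset.sum_congr rfl fun h _ => e1 h, ← Finset.mul_sum]
    refine mul_le_mul_of_nonneg_left (le_trans ?_ hη') hZ0
    refine (sum_abs_pathWeight_sub_le (δ := fun k => (1 + η) ^ (2 * (queryCount n d k + 1)))
      (fun k s => (g k).outcomeProb_nonneg _ _) (fun k _ => ?_) (fun k hk => ?_)).trans ?_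
    · refine (sum_decode ha fun s => (g k).outcomeProb (bits n (y / 2)) s).trans ?_
      exact (g k).sum_outcomeProb _
    · exact sum_abs_outcomeProb_sub_le ha hx hη (hg.numQueries k hk) (hg.close k hk)
    · rw [Finset.prod_pow_eq_pow_sum, ← Finset.mul_sum]
      refine sub_le_sub_right (pow_le_pow_right₀ (by linarith) ?_) _
      change 2 * offset n d n ≤ _
      omega
  have hc0 : c n y ≤ 4096 * 2 ^ m := by
    change (if _ then _ else _) ≤ _
    split_ifs
    · unfold errorWeight; push_cast
      have : (0 : ℝ) < 2 ^ m := by positivity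
      linarith
    · rw [Finset.sum_congr rfl fun j hj => by
        rw [show n - (j + 1) = n - 1 - j by omega]]
      rw [Finset.sum_range_reflect (fun k => (queryCount n d k : ℝ))]
      rw [offset_eq] at hd
      have h2 : ((∑ k ∈ Finset.range n, queryCount n d k : ℕ) : ℝ) ≤ n := by
        exact_mod_cast (by omega : ∑ k ∈ Finset.range n, queryCount n d k ≤ n)
      push_cast at h2
      have h3 : (n : ℝ) ≤ 2 ^ m := by exact_mod_cast hnm
      linarith
  have hS : (0 : ℝ) < 4096 * 2 ^ m := by positivity
  calc c n y * _ ≤ (4096 * 2 ^ m) * (scale n m d * (1 / (4096 * 2 ^ m))) :=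
        mul_le_mul hc0 h1 (Finset.sum_nonneg fun _ _ => abs_nonneg _) hS.le
    _ = scale n m d := by field_simp

/-- The precision of the matrices of candidates. -/
noncomputable def precision (m : ℕ) : ℝ := 16 / (2 ^ m) ^ 12

theorem precision_nonneg (m : ℕ) : 0 ≤ precision m := by unfold precision; positivity

/-- A history involves at most `2 * n` matrices, each of which enters its probability twice. Their
errors are negligible even when they are multiplied by the largest outcome, which is `4096 * 2 ^ m`.
-/
theorem one_add_precision_pow_le (hm : 2 ≤ m) (hnm : n ≤ 2 ^ m) :
    (1 + precision m) ^ (4 * n) - 1 ≤ 1 / (4096 * 2 ^ m) := by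
  have hS : (4 : ℝ) ≤ 2 ^ m := by
    calc (4 : ℝ) = 2 ^ 2 := by norm_num
      _ ≤ 2 ^ m := pow_le_pow_right₀ (by norm_num) hm
  have hn : (n : ℝ) ≤ 2 ^ m := by exact_mod_cast hnm
  set S : ℝ := 2 ^ m with hSdef
  have hS0 : 0 < S := by linarith
  have h10 : (2 : ℝ) ^ 20 ≤ S ^ 10 := by
    calc (2 : ℝ) ^ 20 = 4 ^ 10 := by norm_num
      _ ≤ S ^ 10 := pow_le_pow_left₀ (by norm_num) hS _
  set y : ℝ := 4 * n * precision m with hy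
  have hy0 : 0 ≤ y := mul_nonneg (by positivity) (precision_nonneg m)
  have hy1 : y ≤ 1 / (8192 * S) := by
    have : y ≤ 64 / S ^ 11 := by
      rw [hy, precision, ← hSdef]
      calc 4 * (n : ℝ) * (16 / S ^ 12) ≤ 4 * S * (16 / S ^ 12) := by gcongr
        _ = 64 / S ^ 11 := by field_simp; norm_num
    refine this.trans ?_
    rw [div_le_div_iff₀ (by positivity) (by positivity), one_mul, pow_succ, ← mul_assoc]
    exact mul_le_mul_of_nonneg_right (by linarith) hS0.le
  have hy2 : y ≤ 1 / 2 := hy1.trans (by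
    rw [div_le_div_iff₀ (by positivity) (by positivity)]; linarith)
  have h1 : (1 + precision m) ^ (4 * n) ≤ Real.exp y := by
    calc (1 + precision m) ^ (4 * n) ≤ Real.exp (precision m) ^ (4 * n) := by
          refine pow_le_pow_left₀ (by linarith [precision_nonneg m]) ?_ _
          rw [add_comm]; exact Real.add_one_le_exp _
      _ = Real.exp y := by rw [← Real.exp_nat_mul, hy]; push_cast; rfl
  have h2 : Real.exp y ≤ 1 + 2 * y := by
    have h3 := Real.add_one_le_exp (-y)
    have h4 : Real.exp y * Real.exp (-y) = 1 := by rw [← Real.exp_add]; simp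
    have h5 := Real.exp_pos y
    nlinarith
  calc (1 + precision m) ^ (4 * n) - 1 ≤ 2 * y := by linarith
    _ ≤ 2 * (1 / (8192 * S)) := by linarith
    _ = _ := by field_simp; norm_num

/-- The weight of a node is, in units of `Z`, the probability of its history, since the later
outcomes have total probability `1`. -/
theorem exactProblem_node (ha : Nat.clog 2 n + 1 ≤ m) {F d : ℕ → ℕ} {g : ℕ → QueryAlgorithm n m}
    {Z : ℝ} {h : ℕ} (hh : h ≤ n) (a y : ℕ) : (exactProblem n m F d g Z).node h a y =
      Z * pathWeight (2 ^ m) (fun k s => (g k).outcomeProb (bits n (y / 2)) (decode n m s))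
        (n - h) a := by
  induction h generalizing a with
  | zero => simp [Problem.node, exactProblem]
  | succ h ih =>
    rw [Problem.node_succ]
    change ∑ s ∈ Finset.range (2 ^ m), (exactProblem n m F d g Z).node h (a * 2 ^ m + s) y = _
    rw [Finset.sum_congr rfl fun s _ => ih (by omega) (a * 2 ^ m + s)]
    obtain ⟨k, rfl⟩ := Nat.exists_eq_add_of_le hh
    have e1 : h + 1 + k - h = k + 1 := by omega
    have e2 : h + 1 + k - (h + 1) = k := by omega
    rw [e1, e2, Finset.sum_congr rfl fun s hs => by
      rw [pathWeight_succ_mul_add _ (Finset.mem_range.1 hs)], ← Finset.mul_sum, ← Finset.sum_mul,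
      sum_decode ha fun s => (g k).outcomeProb (bits _ (y / 2)) s, (g k).sum_outcomeProb, one_mul]

end Search

/-! ### Almost unitary matrices -/

namespace QuantumQuery

variable {ι : Type*} [Fintype ι]

theorem l2_mulVec_le_of_norm_le {E : Matrix ι ι ℂ} {e : ℝ} (he : 0 ≤ e) (h : ∀ s s', ‖E s s'‖ ≤ e)
    (φ : ι → ℂ) : l2 (E *ᵥ φ) ≤ Fintype.card ι * e * l2 φ := by
  have h0 : 0 ≤ Fintype.card ι * e * l2 φ := by have := l2_nonneg φ; positivity
  rw [← pow_le_pow_iff_left₀ (l2_nonneg _) h0 two_ne_zero, l2_sq]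
  have h1 : ∀ s, ‖(E *ᵥ φ) s‖ ^ 2 ≤ e ^ 2 * (Fintype.card ι * l2 φ ^ 2) := by
    intro s
    have h2 : ‖(E *ᵥ φ) s‖ ≤ e * ∑ s', ‖φ s'‖ := by
      rw [Finset.mul_sum]
      refine (norm_sum_le _ _).trans (Finset.sum_le_sum fun s' _ => ?_)
      rw [norm_mul]
      exact mul_le_mul_of_nonneg_right (h _ _) (norm_nonneg _)
    refine (pow_le_pow_left₀ (norm_nonneg _) h2 2).trans ?_
    rw [mul_pow, l2_sq]
    exact mul_le_mul_of_nonneg_left (sq_sum_le_card_mul_sum_sq ..) (sq_nonneg e)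
  refine (Finset.sum_le_sum fun s _ => h1 s).trans (le_of_eq ?_)
  rw [Finset.sum_const, Finset.card_univ, nsmul_eq_mul]; ring

theorem l2_smul (c : ℂ) (φ : ι → ℂ) : l2 (c • φ) = ‖c‖ * l2 φ := norm_smul c (WithLp.toLp 2 φ)

variable [DecidableEq ι]

theorem l2_diagonal_mulVec_le {v : ι → ℂ} {e : ℝ} (he : 0 ≤ e) (h : ∀ s, ‖v s‖ ≤ e) (φ : ι → ℂ) :
    l2 (Matrix.diagonal v *ᵥ φ) ≤ e * l2 φ := by
  rw [← pow_le_pow_iff_left₀ (l2_nonneg _) (mul_nonneg he (l2_nonneg _)) two_ne_zero,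
    mul_pow, l2_sq,
    l2_sq, Finset.mul_sum]
  refine Finset.sum_le_sum fun s _ => ?_
  rw [Matrix.mulVec_diagonal, norm_mul, mul_pow]
  exact mul_le_mul_of_nonneg_right (pow_le_pow_left₀ (norm_nonneg _) (h s) 2) (sq_nonneg _)

/-- The polar decomposition: if `A⋆ A` is close to `1`, then `A` is close to the unitary matrix
`A (A⋆ A) ^ (-1 / 2)`. -/
theorem exists_unitary_close {A : Matrix ι ι ℂ} {η : ℝ} (hη : 0 ≤ η) (hη1 : η < 1)
    (h : ∀ φ, l2 ((star A * A - 1) *ᵥ φ) ≤ η * l2 φ) :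
    ∃ U : Matrix.unitaryGroup ι ℂ, ∀ φ, l2 ((A - (U : Matrix ι ι ℂ)) *ᵥ φ) ≤ η * l2 φ := by
  have hH : (star A * A).IsHermitian := Matrix.isHermitian_conjTranspose_mul_self A
  set l := hH.eigenvalues with hl
  set W : Matrix ι ι ℂ := hH.eigenvectorUnitary.1 with hW
  have hW1 : star W * W = 1 := Matrix.UnitaryGroup.star_mul_self hH.eigenvectorUnitary
  have hW2 : W * star W = 1 := Unitary.coe_mul_star_self hH.eigenvectorUnitary
  have hs : star A * A = W * Matrix.diagonal (fun i => (l i : ℂ)) * star W := by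
    have := hH.spectral_theorem
    rwa [Unitary.conjStarAlgAut_apply] at this
  have hl1 : ∀ i, |l i - 1| ≤ η := by
    intro i
    have h1 := h (W *ᵥ Pi.single i 1)
    have h2 : (star A * A - 1) *ᵥ (W *ᵥ Pi.single i 1) =
        ((l i - 1 : ℝ) : ℂ) • (W *ᵥ Pi.single i 1) := by
      rw [Matrix.sub_mulVec, Matrix.one_mulVec, Matrix.mulVec_mulVec, hs, mul_assoc, hW1, mul_one,
        ← Matrix.mulVec_mulVec, Matrix.diagonal_mulVec_single, mul_one]
      rw [show (Pi.single i (l i : ℂ) : ι → ℂ) = (l i : ℂ) • Pi.single i 1 by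
        rw [← Pi.single_smul, smul_eq_mul, mul_one], Matrix.mulVec_smul]
      push_cast
      rw [sub_smul, one_smul]
    rw [h2, l2_smul, l2_mulVec_of_star_mul_self hW1, l2_single, mul_one, mul_one, Complex.norm_real,
      Real.norm_eq_abs] at h1
    exact h1
  have hl0 : ∀ i, 0 < l i := fun i => by have := abs_le.1 (hl1 i); linarith
  set P : Matrix ι ι ℂ := W * Matrix.diagonal (fun i => ((√(l i))⁻¹ : ℂ)) * star W with hP
  set Q : Matrix ι ι ℂ := W * Matrix.diagonal (fun i => (√(l i) : ℂ)) * star W with hQ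
  have hc : ∀ a b : Matrix ι ι ℂ, (W * a * star W) * (W * b * star W) = W * (a * b) * star W := by
    intro a b
    calc _ = W * a * (star W * W) * b * star W := by simp only [mul_assoc]
      _ = _ := by rw [hW1]; simp only [mul_assoc, one_mul]
  have hsq : ∀ i, ((√(l i) : ℂ)) * √(l i) = l i := fun i => by
    rw [← Complex.ofReal_mul, Real.mul_self_sqrt (hl0 i).le]
  have hne : ∀ i, ((√(l i) : ℂ)) ≠ 0 := fun i => by
    exact_mod_cast (Real.sqrt_pos.2 (hl0 i)).ne'
  have hPQ : P * Q = 1 := by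
    rw [hP, hQ, hc, Matrix.diagonal_mul_diagonal]
    simp only [inv_mul_cancel₀ (hne _)]
    rw [Matrix.diagonal_one, mul_one, hW2]
  have hPs : star P = P := by
    rw [hP, star_mul, star_mul, star_star, mul_assoc]
    congr 2
    rw [Matrix.star_eq_conjTranspose, Matrix.diagonal_conjTranspose]
    congr 1
    funext i
    simp
  have hU : star (A * P) * (A * P) = 1 := by
    rw [star_mul, hPs, mul_assoc, ← mul_assoc (star A), hs, hP, hc, hc,
      Matrix.diagonal_mul_diagonal,
      Matrix.diagonal_mul_diagonal]
    have : (fun i => (√(l i) : ℂ)⁻¹ * ((l i : ℂ) * (√(l i) : ℂ)⁻¹)) = fun _ => 1 := by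
      funext i
      rw [← hsq i]
      have := hne i
      field_simp
    rw [this, Matrix.diagonal_one, mul_one, hW2]
  refine ⟨⟨A * P, Matrix.mem_unitaryGroup_iff'.2 hU⟩, fun φ => ?_⟩
  have e : A - A * P = A * P * (W * (Matrix.diagonal (fun i => (√(l i) : ℂ) - 1) * star W)) := by
    have : W * (Matrix.diagonal (fun i => (√(l i) : ℂ) - 1) * star W) = Q - 1 := by
      have hd : Matrix.diagonal (fun i => (√(l i) : ℂ) - 1) =
          Matrix.diagonal (fun i => (√(l i) : ℂ)) - 1 := by
        rw [← Matrix.diagonal_one, Matrix.diagonal_sub]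
      rw [hd, ← mul_assoc, mul_sub, sub_mul, mul_one, hW2]
    rw [this, mul_sub, mul_assoc, hPQ, mul_one, mul_one]
  change l2 ((A - A * P) *ᵥ φ) ≤ _
  rw [e, ← Matrix.mulVec_mulVec, l2_mulVec_of_star_mul_self hU, ← Matrix.mulVec_mulVec,
    l2_mulVec_of_star_mul_self hW1, ← Matrix.mulVec_mulVec]
  refine (l2_diagonal_mulVec_le hη (fun i => ?_) _).trans_eq ?_
  · rw [← Complex.ofReal_one, ← Complex.ofReal_sub, Complex.norm_real, Real.norm_eq_abs]
    refine le_trans ?_ (hl1 i)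
    have h3 : l i - 1 = (√(l i) - 1) * (√(l i) + 1) := by
      have := Real.mul_self_sqrt (hl0 i).le
      linarith
    rw [h3, abs_mul]
    refine le_mul_of_one_le_right (abs_nonneg _) ?_
    rw [abs_of_nonneg (by positivity)]
    linarith [Real.sqrt_nonneg (l i)]
  · rw [l2_mulVec_of_star_mul_self (by rw [star_star, hW2])]

end QuantumQuery

namespace Search

open QuantumQuery

variable {n m : ℕ}

theorem card_basisState (ha : Nat.clog 2 n + 1 ≤ m) : Fintype.card (BasisState n m) = 2 ^ m := by
  have := sum_code ha fun _ => 1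
  simpa using this

theorem sum_I_gram (ha : Nat.clog 2 n + 1 ≤ m) (d : ℕ → ℕ) (u : ℕ) (s s' : BasisState n m) :
    ∑ c ∈ Finset.range 4, Complex.I ^ c * (gram n m d u (code s) (code s') c : ℂ) =
      den m ^ 2 * (star (matrixOf n m d u) * matrixOf n m d u) s s' := by
  have hD : (den m : ℂ) ≠ 0 := by exact_mod_cast (den_pos m).ne'
  have h2 : Complex.I ^ 2 = -1 := Complex.I_sq
  have h3 : Complex.I ^ 3 = -Complex.I := Complex.I_pow_three
  have e1 : ∀ c, (gram n m d u (code s) (code s') c : ℂ) = ∑ t : BasisState n m,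
      ∑ a ∈ Finset.range 4, (entry n m d u (code t) (code s) a : ℂ) *
        (entry n m d u (code t) (code s') ((a + c) % 4) : ℂ) := by
    intro c
    unfold gram
    push_cast
    rw [← sum_code ha]
  simp only [e1, Finset.mul_sum (s := Finset.univ), Matrix.mul_apply]
  rw [Finset.sum_comm]
  refine Finset.sum_congr rfl fun t _ => ?_
  rw [Matrix.star_apply]
  simp only [matrixOf, Finset.sum_range_succ, Finset.sum_range_zero, zero_add, pow_zero,
    pow_one, h2,
    h3]
  simp only [star_div₀, star_add, star_mul', RCLike.star_def, Complex.conj_I, Complex.conj_natCast,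
    map_one, map_neg]
  norm_num
  field_simp
  ring_nf
  simp only [h2]
  ring

/-- The test in natural numbers compares the entries of `A⋆ A - 1`, where `A` is the matrix of the
candidate, with `8 * 4 ^ m / den m`. -/
theorem nearUnitary_iff (ha : Nat.clog 2 n + 1 ≤ m) (d : ℕ → ℕ) (u : ℕ) :
    NearUnitary n m d u ↔ ∀ s s',
      |((star (matrixOf n m d u) * matrixOf n m d u - 1) s s').re| ≤ 8 * (2 ^ m * 2 ^ m) / den m ∧
      |((star (matrixOf n m d u) * matrixOf n m d u - 1) s s').im| ≤
          8 * (2 ^ m * 2 ^ m) / den m := by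
  have hD : (0 : ℝ) < den m := by exact_mod_cast den_pos m
  have key : ∀ s s' : BasisState n m,
      ((gram n m d u (code s) (code s') 0 ≤ gram n m d u (code s) (code s') 2 +
        (if code s = code s' then den m * den m else 0) + 8 * (2 ^ m * 2 ^ m) * den m ∧
      gram n m d u (code s) (code s') 2 + (if code s = code s' then den m * den m else 0) ≤
        gram n m d u (code s) (code s') 0 + 8 * (2 ^ m * 2 ^ m) * den m ∧
      gram n m d u (code s) (code s') 1 ≤
        gram n m d u (code s) (code s') 3 + 8 * (2 ^ m * 2 ^ m) * den m ∧
      gram n m d u (code s) (code s') 3 ≤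
        gram n m d u (code s) (code s') 1 + 8 * (2 ^ m * 2 ^ m) * den m) ↔
      |((star (matrixOf n m d u) * matrixOf n m d u - 1) s s').re| ≤ 8 * (2 ^ m * 2 ^ m) / den m ∧
      |((star (matrixOf n m d u) * matrixOf n m d u - 1) s s').im| ≤
          8 * (2 ^ m * 2 ^ m) / den m) := by
    intro s s'
    have h := sum_I_gram ha d u s s'
    have hi : code s = code s' ↔ s = s' :=
      ⟨fun e => by rw [← decode_code ha s, e, decode_code ha], fun e => by rw [e]⟩
    set z := (star (matrixOf n m d u) * matrixOf n m d u) s s'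
    set g := gram n m d u (code s) (code s')
    have h2 : Complex.I ^ 2 = -1 := Complex.I_sq
    have h3 : Complex.I ^ 3 = -Complex.I := Complex.I_pow_three
    simp only [Finset.sum_range_succ, Finset.sum_range_zero, zero_add, pow_zero, pow_one, h2, h3]
      at h
    have hz : (den m : ℂ) ^ 2 * z = (((den m : ℝ) ^ 2 * z.re : ℝ) : ℂ) +
        (((den m : ℝ) ^ 2 * z.im : ℝ) : ℂ) * Complex.I := by
      conv_lhs => rw [← Complex.re_add_im z]
      push_cast; ring
    rw [hz] at h
    generalize hzr : (den m : ℝ) ^ 2 * z.re = a at h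
    generalize hzi : (den m : ℝ) ^ 2 * z.im = b at h
    have hre : (g 0 : ℝ) - g 2 = den m ^ 2 * z.re := by
      rw [hzr]
      have := congrArg Complex.re h
      simpa [sub_eq_add_neg] using this
    have him : (g 1 : ℝ) - g 3 = den m ^ 2 * z.im := by
      rw [hzi]
      have := congrArg Complex.im h
      simpa [sub_eq_add_neg] using this
    rw [Matrix.sub_apply, Matrix.one_apply, abs_le, abs_le]
    have hb : (8 * (2 ^ m * 2 ^ m) / den m : ℝ) = 8 * (2 ^ m * 2 ^ m) * den m / den m ^ 2 := by
      field_simp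
    have hx : ∀ x B : ℝ, (-(B / (den m : ℝ) ^ 2) ≤ x ∧ x ≤ B / (den m : ℝ) ^ 2) ↔
        (-B ≤ den m ^ 2 * x ∧ den m ^ 2 * x ≤ B) := by
      intro x B
      rw [← neg_div, div_le_iff₀ (by positivity), le_div_iff₀ (by positivity), mul_comm x]
    rw [hb, hx, hx, Complex.sub_re, Complex.sub_im]
    have e1 : ((if s = s' then 1 else 0 : ℂ)).re = if s = s' then 1 else 0 := by split_ifs <;> simp
    have e2 : ((if s = s' then 1 else 0 : ℂ)).im = 0 := by split_ifs <;> simp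
    rw [e1, e2, sub_zero, mul_sub, ← hre, ← him]
    simp only [hi]
    rw [← Nat.cast_le (α := ℝ), ← Nat.cast_le (α := ℝ), ← Nat.cast_le (α := ℝ),
      ← Nat.cast_le (α := ℝ)]
    have aux : ∀ a b c e t K : ℝ,
        (a ≤ b + t + K ∧ b + t ≤ a + K ∧ c ≤ e + K ∧ e ≤ c + K) ↔
          ((-K ≤ a - b - t ∧ a - b - t ≤ K) ∧ -K ≤ c - e ∧ c - e ≤ K) := by
      intro a b c e t K
      constructor
      · rintro ⟨h1, h2, h3, h4⟩
        exact ⟨⟨by linarith, by linarith⟩, by linarith, by linarith⟩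
      · rintro ⟨⟨h1, h2⟩, h3, h4⟩
        exact ⟨by linarith, by linarith, by linarith, by linarith⟩
    have et : (den m : ℝ) ^ 2 * (if s = s' then 1 else 0) =
        ((if s = s' then den m * den m else 0 : ℕ) : ℝ) := by
      split_ifs <;> push_cast <;> ring
    have eK : (8 * (2 ^ m * 2 ^ m) * den m : ℝ) = ((8 * (2 ^ m * 2 ^ m) * den m : ℕ) : ℝ) := by
      push_cast; rfl
    rw [et, eK, ← aux]
    simp only [Nat.cast_add]
  constructor
  · intro h s s'
    exact (key s s').1 (h _ (code_lt ha s) _ (code_lt ha s'))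
  · intro h i hi j hj
    have := (key (decode n m i) (decode n m j)).2 (h _ _)
    rwa [code_decode ha hi, code_decode ha hj] at this

end Search

namespace Search

open QuantumQuery

variable {n m : ℕ}

theorem cast_den (m : ℕ) : (den m : ℝ) = (2 ^ m) ^ 16 := by unfold den; push_cast; rfl

/-- A matrix that passes the test is close to a unitary one. -/
theorem NearUnitary.exists_close (ha : Nat.clog 2 n + 1 ≤ m) (hm : 2 ≤ m) {d : ℕ → ℕ} {u : ℕ}
    (h : NearUnitary n m d u) :
    ∃ U : Matrix.unitaryGroup (BasisState n m) ℂ, Close (precision m) (matrixOf n m d u) U := by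
  have hS : (4 : ℝ) ≤ 2 ^ m := by
    calc (4 : ℝ) = 2 ^ 2 := by norm_num
      _ ≤ 2 ^ m := pow_le_pow_right₀ (by norm_num) hm
  set S : ℝ := 2 ^ m with hSdef
  have hS0 : 0 < S := by linarith
  rw [nearUnitary_iff ha, cast_den, ← hSdef] at h
  have hle : S * (16 * (S * S) / S ^ 16) ≤ precision m := by
    rw [precision, ← hSdef, ← mul_div_assoc, div_le_div_iff₀ (by positivity) (by positivity)]
    calc S * (16 * (S * S)) * S ^ 12 = 16 * S ^ 15 := by ring
      _ ≤ 16 * S ^ 16 := by gcongr <;> linarith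
  have h1 : precision m < 1 := by
    rw [precision, ← hSdef, div_lt_one (by positivity)]
    calc (16 : ℝ) < 4 ^ 12 := by norm_num
      _ ≤ S ^ 12 := pow_le_pow_left₀ (by norm_num) hS _
  refine exists_unitary_close (precision_nonneg m) h1 fun φ => ?_
  refine (l2_mulVec_le_of_norm_le (e := 16 * (S * S) / S ^ 16) (by positivity) (fun s s' => ?_)
    φ).trans ?_
  · refine (Complex.norm_le_abs_re_add_abs_im _).trans ((add_le_add (h s s').1 (h s s').2).trans ?_)
    rw [← add_div]
    gcongr
    linarith
  · rw [card_basisState ha]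
    push_cast
    exact mul_le_mul_of_nonneg_right hle (l2_nonneg φ)

/-! ### Rounding -/

/-- The digits of a complex number. -/
noncomputable def roundDigit (m : ℕ) (z : ℂ) (c : ℕ) : ℕ := ⌊den m * (z * (-Complex.I) ^ c).re⌋₊

theorem roundDigit_lt {z : ℂ} (hz : ‖z‖ ≤ 1) (c : ℕ) : roundDigit m z c < base m := by
  have h1 : (z * (-Complex.I) ^ c).re ≤ 1 := by
    refine (Complex.re_le_norm _).trans ?_
    rw [norm_mul, norm_pow, norm_neg, Complex.norm_I, one_pow, mul_one]
    exact hz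
  have h2 : roundDigit m z c ≤ den m := by
    refine Nat.floor_le_of_le ?_
    exact mul_le_of_le_one_right (Nat.cast_nonneg _) h1
  have := den_pos m
  unfold base
  omega

theorem abs_floor_sub_floor_le (a : ℝ) : |((⌊a⌋₊ : ℝ) - ⌊-a⌋₊) - a| ≤ 1 := by
  rcases le_total 0 a with h | h
  · rw [Nat.floor_of_nonpos (by linarith : -a ≤ 0), Nat.cast_zero, sub_zero, abs_le]
    have h1 := Nat.floor_le h
    have h2 := Nat.lt_floor_add_one a
    constructor <;> linarith
  · rw [Nat.floor_of_nonpos h, Nat.cast_zero, zero_sub, abs_le]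
    have h1 := Nat.floor_le (by linarith : 0 ≤ -a)
    have h2 := Nat.lt_floor_add_one (-a)
    constructor <;> linarith

theorem norm_sum_roundDigit_sub_le (z : ℂ) :
    ‖(∑ c ∈ Finset.range 4, Complex.I ^ c * (roundDigit m z c : ℂ)) / den m - z‖ ≤ 2 / den m := by
  have hD : (0 : ℝ) < den m := by exact_mod_cast den_pos m
  have h2 : Complex.I ^ 2 = -1 := Complex.I_sq
  have h3 : Complex.I ^ 3 = -Complex.I := Complex.I_pow_three
  have e : (∑ c ∈ Finset.range 4, Complex.I ^ c * (roundDigit m z c : ℂ)) - den m * z =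
      ((((⌊den m * z.re⌋₊ : ℝ) - ⌊-(den m * z.re)⌋₊) - den m * z.re : ℝ) : ℂ) +
        ((((⌊den m * z.im⌋₊ : ℝ) - ⌊-(den m * z.im)⌋₊) - den m * z.im : ℝ) : ℂ) * Complex.I := by
    have e0 : roundDigit m z 0 = ⌊den m * z.re⌋₊ := by simp [roundDigit]
    have e1 : roundDigit m z 1 = ⌊den m * z.im⌋₊ := by simp [roundDigit]
    have e2 : roundDigit m z 2 = ⌊-(den m * z.re)⌋₊ := by simp [roundDigit]
    have e3 : roundDigit m z 3 = ⌊-(den m * z.im)⌋₊ := by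
      simp [roundDigit, Odd.neg_pow (by decide : Odd 3)]
    simp only [Finset.sum_range_succ, Finset.sum_range_zero, zero_add, pow_zero, pow_one,
      h2, h3, e0,
      e1, e2, e3]
    conv_lhs => rw [← Complex.re_add_im z]
    push_cast
    simp only [Complex.add_re, Complex.add_im, Complex.ofReal_re, Complex.ofReal_im,
      Complex.re_ofReal_mul, Complex.im_ofReal_mul, Complex.I_re, Complex.I_im, mul_zero, mul_one,
      add_zero, zero_add]
    ring
  have h : ‖(∑ c ∈ Finset.range 4, Complex.I ^ c * (roundDigit m z c : ℂ)) - den m * z‖ ≤ 2 := by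
    rw [e]
    refine (norm_add_le _ _).trans ?_
    rw [norm_mul, Complex.norm_I, mul_one, Complex.norm_real, Complex.norm_real, Real.norm_eq_abs,
      Real.norm_eq_abs]
    linarith [abs_floor_sub_floor_le (den m * z.re), abs_floor_sub_floor_le (den m * z.im)]
  have hDc : (den m : ℂ) ≠ 0 := by exact_mod_cast hD.ne'
  rw [show (∑ c ∈ Finset.range 4, Complex.I ^ c * (roundDigit m z c : ℂ)) / den m - z =
    ((∑ c ∈ Finset.range 4, Complex.I ^ c * (roundDigit m z c : ℂ)) - den m * z) / den m by
      field_simp, norm_div, Complex.norm_natCast]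
  gcongr

/-- A matrix that is obtained by rounding a unitary one is close to it, and passes the test. -/
theorem nearUnitary_of_round (ha : Nat.clog 2 n + 1 ≤ m) {d : ℕ → ℕ} {u : ℕ}
    {U : Matrix.unitaryGroup (BasisState n m) ℂ}
    (h : ∀ s s', ∀ c < 4, entry n m d u (code s) (code s') c =
      roundDigit m ((U : Matrix (BasisState n m) (BasisState n m) ℂ) s s') c) :
    NearUnitary n m d u ∧ Close (precision m) (matrixOf n m d u) U := by
  have hS : (1 : ℝ) ≤ 2 ^ m := one_le_pow₀ (by norm_num)
  set S : ℝ := 2 ^ m with hSdef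
  have hS0 : 0 < S := by linarith
  have hD : (1 : ℝ) ≤ den m := by exact_mod_cast den_pos m
  set V : Matrix (BasisState n m) (BasisState n m) ℂ := U.1 with hV
  set A := matrixOf n m d u with hA
  have hd : ∀ s s', ‖(A - V) s s'‖ ≤ 2 / den m := by
    intro s s'
    have := norm_sum_roundDigit_sub_le (m := m) (V s s')
    rw [Matrix.sub_apply, hA, matrixOf]
    rwa [Finset.sum_congr rfl fun c hc => by rw [h s s' c (Finset.mem_range.1 hc)]]
  have hcard : (Fintype.card (BasisState n m) : ℝ) = S := by rw [card_basisState ha]; push_cast; rfl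
  constructor
  · rw [nearUnitary_iff ha]
    have e : star A * A - 1 = star V * (A - V) + star (A - V) * V + star (A - V) * (A - V) := by
      have hVV : star V * V = 1 := Matrix.UnitaryGroup.star_mul_self U
      rw [star_sub]
      simp only [mul_sub, sub_mul, hVV]
      abel
    have hb : ∀ s s', ‖V s s'‖ ≤ 1 := fun s s' => entry_norm_bound_of_unitary U.2 s s'
    have hmul : ∀ (B C : Matrix (BasisState n m) (BasisState n m) ℂ) (b c : ℝ), 0 ≤ b →
        (∀ s s', ‖B s s'‖ ≤ b) → (∀ s s', ‖C s s'‖ ≤ c) → ∀ s s', ‖(B * C) s s'‖ ≤ S * (b * c) := by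
      intro B C b c hb0 hB hC s s'
      rw [Matrix.mul_apply]
      refine (norm_sum_le _ _).trans
        ((Finset.sum_le_sum (g := fun _ => b * c) fun t _ => ?_).trans_eq ?_)
      · rw [norm_mul]
        exact mul_le_mul (hB _ _) (hC _ _) (norm_nonneg _) hb0
      · rw [Finset.sum_const, Finset.card_univ, nsmul_eq_mul, hcard]
    have hstar : ∀ (B : Matrix (BasisState n m) (BasisState n m) ℂ) (b : ℝ),
        (∀ s s', ‖B s s'‖ ≤ b) → ∀ s s', ‖(star B) s s'‖ ≤ b := by
      intro B b hB s s'
      rw [Matrix.star_apply, norm_star]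
      exact hB _ _
    have hn : ∀ s s', ‖(star A * A - 1) s s'‖ ≤ 8 * (S * S) / den m := by
      intro s s'
      rw [e, Matrix.add_apply, Matrix.add_apply]
      have h2 : (0 : ℝ) ≤ 2 / den m := by positivity
      refine (norm_add₃_le).trans ((add_le_add (add_le_add
        (hmul _ _ _ _ zero_le_one (hstar _ _ hb) hd s s')
        (hmul _ _ _ _ h2 (hstar _ _ hd) hb s s'))
        (hmul _ _ _ _ h2 (hstar _ _ hd) hd s s')).trans ?_)
      have h4 : (2 : ℝ) / den m * (2 / den m) ≤ 4 / den m := by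
        rw [div_mul_div_comm, div_le_div_iff₀ (by positivity) (by positivity)]
        nlinarith
      have h5 : S * (4 / den m) ≤ S * S * (4 / den m) := by
        refine mul_le_mul_of_nonneg_right ?_ (by positivity)
        nlinarith
      have h6 := mul_le_mul_of_nonneg_left h4 hS0.le
      calc _ ≤ S * (1 * (2 / den m)) + S * (2 / den m * 1) + S * (4 / den m) := by gcongr
        _ = 2 * (S * (4 / den m)) := by ring
        _ ≤ 2 * (S * S * (4 / den m)) := by linarith
        _ = _ := by ring
    exact fun s s' => ⟨(Complex.abs_re_le_norm _).trans (hn s s'),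
      (Complex.abs_im_le_norm _).trans (hn s s')⟩
  · intro φ
    refine (l2_mulVec_le_of_norm_le (by positivity) hd φ).trans
      (mul_le_mul_of_nonneg_right ?_ (l2_nonneg φ))
    rw [hcard, cast_den, precision, ← hSdef, ← mul_div_assoc,
      div_le_div_iff₀ (by positivity) (by positivity)]
    have h13 : S ^ 13 ≤ S ^ 16 := pow_le_pow_right₀ hS (by norm_num)
    have h16 : 0 ≤ S ^ 16 := by positivity
    calc S * 2 * S ^ 12 = 2 * S ^ 13 := by ring
      _ ≤ 16 * S ^ 16 := by linarith

/-- Every sequence of digits belongs to a candidate. -/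
theorem exists_digit_eq {v : ℕ → ℕ} {k : ℕ} (h : ∀ j < k, v j < base m) :
    ∃ c < base m ^ k, ∀ j < k, digit m c j = v j := by
  have hB : 0 < base m := by unfold base; have := den_pos m; omega
  induction k generalizing v with
  | zero => exact ⟨0, by simp, fun j hj => by omega⟩
  | succ k ih =>
    obtain ⟨c, hc, hd⟩ := ih (v := fun j => v (j + 1)) fun j hj => h (j + 1) (by omega)
    have h0 := h 0 (by omega)
    refine ⟨v 0 + base m * c, ?_, fun j hj => ?_⟩
    · calc v 0 + base m * c < base m * (c + 1) := by rw [mul_add, mul_one]; omega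
        _ ≤ base m * base m ^ k := Nat.mul_le_mul_left _ hc
        _ = base m ^ (k + 1) := by ring
    · cases j with
      | zero =>
        unfold digit
        rw [pow_zero, Nat.div_one, Nat.add_mul_mod_self_left, Nat.mod_eq_of_lt h0]
      | succ j =>
        have := hd j (by omega)
        unfold digit at *
        rw [pow_succ', ← Nat.div_div_eq_div_mul, Nat.add_mul_div_left _ _ hB, Nat.div_eq_of_lt h0,
          zero_add, this]

/-- The candidate with given numbers of queries, given cost, and given matrices up to rounding. -/
theorem exists_candidate (ha : Nat.clog 2 n + 1 ≤ m) {T : ℕ → ℕ} {q : ℕ} (hT : ∀ k < n,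
    T k < base m)
    (hq : q < base m) (U : ℕ → Matrix.unitaryGroup (BasisState n m) ℂ) :
    ∃ c < base m ^ numDigits n m, (∀ k < n, digit m c k = T k) ∧ digit m c n = q ∧ ∀ u < 2 * n,
      NearUnitary n m (digit m c) u ∧ Close (precision m) (matrixOf n m (digit m c) u) (U u) := by
  set S := 2 ^ m with hS
  have hS0 : 0 < S := by positivity
  let v : ℕ → ℕ := fun j => if j < n then T j else if j = n then q else
    roundDigit m ((U ((j - (n + 1)) / 4 / S / S) : Matrix (BasisState n m) (BasisState n m) ℂ)
      (decode n m ((j - (n + 1)) / 4 / S % S)) (decode n m ((j - (n + 1)) / 4 % S)))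
      ((j - (n + 1)) % 4)
  obtain ⟨c, hc, hd⟩ := exists_digit_eq (m := m) (v := v) (k := numDigits n m) fun j _ => by
    change (if _ then _ else _) < _
    split_ifs with h1 h2
    · exact hT j h1
    · exact hq
    · exact roundDigit_lt (entry_norm_bound_of_unitary (U _).2 _ _) _
  refine ⟨c, hc, fun k hk => ?_, ?_, fun u hu => nearUnitary_of_round ha fun s s' b hb => ?_⟩
  · rw [hd k (by unfold numDigits; omega)]
    exact if_pos hk
  · rw [hd n (by unfold numDigits; omega)]
    change (if _ then _ else _) = _
    rw [if_neg (lt_irrefl _), if_pos rfl]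
  · have hs := code_lt ha s
    have hs' := code_lt ha s'
    rw [← hS] at hs hs'
    unfold entry
    rw [← hS]
    set j := 4 * (S * (S * u + code s) + code s') + b with hj
    have h1 : S * u + code s < 2 * n * S := by
      calc S * u + code s < S * u + S := by omega
        _ = (u + 1) * S := by ring
        _ ≤ _ := Nat.mul_le_mul_right _ (by omega)
    have h2 : S * (S * u + code s) + code s' < 2 * n * S * S := by
      calc S * (S * u + code s) + code s' < S * (S * u + code s) + S := by omega
        _ = (S * u + code s + 1) * S := by ring
        _ ≤ _ := Nat.mul_le_mul_right _ h1
    rw [hd _ (by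
      unfold numDigits
      rw [← hS, show 2 * n * (4 * (S * S)) = 4 * (2 * n * S * S) by ring]
      omega)]
    change (if _ then _ else if _ then _ else _) = _
    rw [if_neg (by omega), if_neg (by omega), Nat.add_sub_cancel_left]
    have e1 : j / 4 = S * (S * u + code s) + code s' := by omega
    have e2 : j % 4 = b := by omega
    rw [e1, e2, Nat.mul_add_div hS0, Nat.div_eq_of_lt hs', add_zero, Nat.mul_add_div hS0,
      Nat.div_eq_of_lt hs, add_zero, Nat.mul_add_mod, Nat.mod_eq_of_lt hs, Nat.mul_add_mod,
      Nat.mod_eq_of_lt hs', decode_code ha, decode_code ha]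

end Search

/-! ### Elementary stages -/

namespace QuantumQuery

variable {n m : ℕ}

/-- Every unit vector is a column of a unitary matrix. -/
theorem exists_unitary_mulVec_single {ι : Type*} [Fintype ι] [DecidableEq ι] (i : ι) {v : ι → ℂ}
    (hv : l2 v = 1) : ∃ U : Matrix.unitaryGroup ι ℂ, (U : Matrix ι ι ℂ) *ᵥ Pi.single i 1 = v := by
  have ho : Orthonormal ℂ (({i} : Set ι).domRestrict fun _ : ι =>
      (WithLp.toLp 2 v : EuclideanSpace ℂ ι)) :=
    ⟨fun _ => hv, fun j k hjk => absurd (Subsingleton.elim j k) hjk⟩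
  obtain ⟨b, hb⟩ := ho.exists_orthonormalBasis_extension_of_card_eq finrank_euclideanSpace
  refine ⟨⟨_, (EuclideanSpace.basisFun ι ℂ).toMatrix_orthonormalBasis_mem_unitary b⟩, ?_⟩
  funext s
  rw [Matrix.mulVec_single_one]
  change b i s = v s
  rw [hb i rfl]

/-- A stage without queries whose outcome is uniformly distributed. -/
theorem exists_uniform_stage (ha : Nat.clog 2 n + 1 ≤ m) : ∃ g : QueryAlgorithm n m,
    g.numQueries = 0 ∧ ∀ x s, g.outcomeProb x s = 1 / 2 ^ m := by
  have hS : (0 : ℝ) < 2 ^ m := by positivity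
  have hn : ‖((1 / √(2 ^ m) : ℝ) : ℂ)‖ ^ 2 = 1 / 2 ^ m := by
    rw [Complex.norm_real, Real.norm_eq_abs, sq_abs, div_pow, one_pow, Real.sq_sqrt hS.le]
  obtain ⟨U, hU⟩ := exists_unitary_mulVec_single (zeroState n m)
    (v := fun _ : BasisState n m => ((1 / √(2 ^ m) : ℝ) : ℂ)) (by
      rw [← pow_left_inj₀ (l2_nonneg _) zero_le_one two_ne_zero, l2_sq, Finset.sum_const, hn,
        Finset.card_univ, Search.card_basisState ha, nsmul_eq_mul]
      push_cast
      field_simp)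
  refine ⟨⟨U, []⟩, rfl, fun x s => ?_⟩
  rw [QueryAlgorithm.outcomeProb_eq]
  change ‖((U : Matrix (BasisState n m) (BasisState n m) ℂ) *ᵥ _) s‖ ^ 2 = _
  rw [hU, hn]

/-- A stage with one query that reads one bit of the input. -/
theorem exists_reading_stage (m : ℕ) (i : Fin n) : ∃ (g : QueryAlgorithm n m)
    (o : (Fin n → Bool) → BasisState n m), g.numQueries = 1 ∧ (∀ x, (o x).2.1 = x i) ∧
      ∀ x s, g.outcomeProb x s = if s = o x then 1 else 0 := by
  have hi : (i : ℕ) < 2 ^ Nat.clog 2 n := i.2.trans_le (Nat.le_pow_clog one_lt_two n)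
  set s₀ : BasisState n m := (⟨i, hi⟩, false, ⟨0, by positivity⟩) with hs
  obtain ⟨U, hU⟩ := exists_unitary_mulVec_single (zeroState n m) (l2_single s₀)
  refine ⟨⟨U, [1]⟩, fun x => queryBasis x s₀, rfl, fun x => ?_, fun x s => ?_⟩
  · simp [queryBasis, hs, inputBit]
  · rw [QueryAlgorithm.outcomeProb_eq]
    change ‖(((1 : Matrix.unitaryGroup (BasisState n m) ℂ) : Matrix (BasisState n m)
        (BasisState n m) ℂ) *ᵥ
      query x ((U : Matrix (BasisState n m) (BasisState n m) ℂ) *ᵥ _)) s‖ ^ 2 = _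
    rw [hU, OneMemClass.coe_one, Matrix.one_mulVec, query, Pi.single_apply]
    have : queryBasis x s = s₀ ↔ s = queryBasis x s₀ :=
      ⟨fun h => by rw [← h, queryBasis_queryBasis], fun h => by rw [h, queryBasis_queryBasis]⟩
    simp only [this]
    split_ifs <;> simp

/-- Stages with certain outcomes lead to one history. -/
theorem returnProb_of_deterministic (x : Fin n → Bool) (b : Bool) {k : ℕ}
    {g : Fin k → QueryAlgorithm n m} {o : Fin k → BasisState n m}
    (h : ∀ i s, (g i).outcomeProb x s = if s = o i then 1 else 0)
    {D : List (BasisState n m) → Option Bool} (hD : ∀ l, l.length < k → D l = none) :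
    returnProb x b (List.ofFn g) D = (if D (List.ofFn o) = some b then 1 else 0) ∧
      expectedQueries x (List.ofFn g) D = ∑ i, ((g i).numQueries : ℝ) := by
  induction k generalizing D with
  | zero => simp [returnProb, expectedQueries]
  | succ k ih =>
    have h0 := hD [] (by simp)
    have := ih (g := fun i => g i.succ) (o := fun i => o i.succ) (fun i s => h _ s)
      (D := fun l => D (o 0 :: l)) fun l hl => hD _ (by simpa using hl)
    rw [List.ofFn_succ, List.ofFn_succ, returnProb_cons_of_none h0, expectedQueries_cons_of_none h0,
      Fin.sum_univ_succ, ← this.1, ← this.2]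
    simp [h]

/-- The decision after the classical stages, which have read the whole input. -/
def readDecision (f : (Fin n → Bool) → Bool) (l : List (BasisState n m)) : Option Bool :=
  if l.length < n then none else some (f fun i => (l.getD i (zeroState n m)).2.1)

/-- The classical algorithm that reads the whole input. -/
theorem exists_reading (m : ℕ) (f : (Fin n → Bool) → Bool) : ∃ gs : List (QueryAlgorithm n m),
    gs.length = n ∧ ∀ x, (∀ b, returnProb x b gs (readDecision f) = if f x = b then 1 else 0) ∧
      expectedQueries x gs (readDecision f) = n := by
  choose g o h1 h2 h3 using fun i : Fin n => exists_reading_stage m i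
  refine ⟨List.ofFn g, by simp, fun x => ?_⟩
  have hD : ∀ l : List (BasisState n m), l.length < n → readDecision f l = none :=
    fun l hl => if_pos hl
  have key := fun b => returnProb_of_deterministic x b (fun i s => h3 i x s) hD
  refine ⟨fun b => ?_, ?_⟩
  · have : (fun i : Fin n => ((List.ofFn fun i => o i x).getD i (zeroState n m)).2.1) = x := by
      funext i
      rw [← h2 i x, List.getD_eq_getElem _ _ (by simp)]
      simp
    have h4 : readDecision f (List.ofFn fun i => o i x) = some (f x) := by
      rw [readDecision, if_neg (by rw [List.length_ofFn]; exact lt_irrefl n), this]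
    rw [(key b).1, h4]
    simp only [Option.some_inj]
  · rw [(key true).2]
    simp [h1]

end QuantumQuery

/-! ### From accepted candidates to algorithms -/

namespace Search

open QuantumQuery DecisionTree RAM

variable {n m : ℕ}

/-- The decisions of the strategy `δ`, followed by the classical algorithm. -/
def treeDecision (f : (Fin n → Bool) → Bool) (δ : ℕ → ℕ → ℕ) :
    ℕ → ℕ → List (BasisState n m) → Option Bool
  | 0, h, l => select (δ 0 h) (some false) (some true) (readDecision f l)
  | d + 1, h, l => select (δ (d + 1) h) (some false) (some true) (match l with
      | [] => none
      | s :: l => treeDecision f δ d (h * 2 ^ m + code s) l)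

/-- The decisions of a strategy that is chosen at random by means of `K` stages. -/
def seedDecision (f : (Fin n → Bool) → Bool) (δ : ℕ → ℕ → ℕ → ℕ) :
    ℕ → ℕ → List (BasisState n m) → Option Bool
  | 0, r, l => treeDecision f (δ r) n 0 l
  | _ + 1, _, [] => none
  | K + 1, r, s :: l => seedDecision f δ K (r * 2 ^ m + code s) l

/-- The last `d` of `n` stages, followed by those in the list `gs`. -/
def lastStages (g : ℕ → QueryAlgorithm n m) (gs : List (QueryAlgorithm n m)) :
    ℕ → List (QueryAlgorithm n m)
  | 0 => gs
  | d + 1 => g (n - (d + 1)) :: lastStages g gs d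

theorem length_lastStages (g : ℕ → QueryAlgorithm n m) (gs : List (QueryAlgorithm n m)) (d : ℕ) :
    (lastStages g gs d).length = d + gs.length := by
  induction d with
  | zero => simp [lastStages]
  | succ d ih => rw [lastStages, List.length_cons, ih]; omega

theorem isSome_treeDecision (f : (Fin n → Bool) → Bool) (δ : ℕ → ℕ → ℕ) (d h : ℕ)
    (l : List (BasisState n m)) (hl : l.length = d + n) : (treeDecision f δ d h l).isSome := by
  induction d generalizing h l with
  | zero =>
    unfold treeDecision select readDecision
    rw [if_neg (by omega : ¬ l.length < n)]
    split_ifs <;> rfl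
  | succ d ih =>
    cases l with
    | nil => simp at hl; omega
    | cons s l =>
      unfold treeDecision select
      split_ifs
      · rfl
      · rfl
      · exact ih _ _ (by rw [List.length_cons] at hl; omega)

theorem isSome_seedDecision (f : (Fin n → Bool) → Bool) (δ : ℕ → ℕ → ℕ → ℕ) (K r : ℕ)
    (l : List (BasisState n m)) (hl : l.length = K + (n + n)) :
        (seedDecision f δ K r l).isSome := by
  induction K generalizing r l with
  | zero => exact isSome_treeDecision f (δ r) n 0 l (by omega)
  | succ K ih =>
    cases l with
    | nil => simp at hl; omega
    | cons s l => exact ih _ _ (by rw [List.length_cons] at hl; omega)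

theorem truthTable_bits {f : (Fin n → Bool) → Bool} (x : ℕ) :
    truthTable f x = if f (bits n x) = true then 1 else 0 := rfl

theorem exists_bits_eq (x : Fin n → Bool) : ∃ k < 2 ^ n, bits n k = x :=
  ⟨Nat.ofBits x, Nat.ofBits_lt_two_pow x, funext fun i => Nat.testBit_ofBits_lt x i i.2⟩

section Tree

variable {f : (Fin n → Bool) → Bool} {d : ℕ → ℕ} {g : ℕ → QueryAlgorithm n m}
  {gs : List (QueryAlgorithm n m)} {Z : ℝ}

theorem node_exactProblem_child (ha : Nat.clog 2 n + 1 ≤ m) {F : ℕ → ℕ} {h : ℕ} (hh : h + 1 ≤ n)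
    (a y : ℕ) (s : BasisState n m) :
    (exactProblem n m F d g Z).node h (a * 2 ^ m + code s) y =
      (g (n - (h + 1))).outcomeProb (bits n (y / 2)) s * (exactProblem n m F d g Z).node
          (h + 1) a y := by
  rw [exactProblem_node ha (by omega), exactProblem_node ha hh,
    show n - h = n - (h + 1) + 1 by omega,
    pathWeight_succ_mul_add _ (code_lt ha s), decode_code ha]
  ring

/-- In the coordinates of the errors, the outcome of a strategy is its probability of error. -/
theorem pay_exactProblem_even (ha : Nat.clog 2 n + 1 ≤ m) {x : ℕ}
    (hgs : ∀ b, returnProb (bits n x) b gs (readDecision f) = if f (bits n x) = b then 1 else 0)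
    (δ : ℕ → ℕ → ℕ) {h : ℕ} (hh : h ≤ n) (a : ℕ) :
    (exactProblem n m (truthTable f) d g Z).pay δ h a (2 * x) =
      errorWeight m * returnProb (bits n x) (!f (bits n x)) (lastStages g gs h)
        (treeDecision f δ h a) * (exactProblem n m (truthTable f) d g Z).node h a (2 * x) := by
  set G := exactProblem n m (truthTable f) d g Z with hG
  have e1 : 2 * x % 2 = 0 := by omega
  have e2 : 2 * x / 2 = x := by omega
  have h0 : G.halt 0 (2 * x) = errorWeight m * if false = !f (bits n x) then 1 else 0 := by
    change (haltPay m (truthTable f) 0 (2 * x) : ℝ) = _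
    rw [haltPay, if_pos e1, e2, truthTable_bits]
    cases f (bits n x) <;> simp
  have h1 : G.halt 1 (2 * x) = errorWeight m * if true = !f (bits n x) then 1 else 0 := by
    change (haltPay m (truthTable f) 1 (2 * x) : ℝ) = _
    rw [haltPay, if_pos e1, e2, truthTable_bits]
    cases f (bits n x) <;> simp
  have hs : ∀ h, G.step h (2 * x) = 0 := by
    intro h
    change (stepPay n d h (2 * x) : ℝ) = 0
    rw [stepPay, if_pos e1, Nat.cast_zero]
  have key : ∀ (D : List (BasisState n m) → Option Bool) (c : ℕ) (E : List (BasisState n m) →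
      Option Bool)
      (l : List (QueryAlgorithm n m)), (∀ l, D l = select c (some false) (some true) (E l)) →
      returnProb (bits n x) (!f (bits n x)) l D = select c (if false = !f (bits n x) then 1 else 0)
        (if true = !f (bits n x) then 1 else 0) (returnProb (bits n x) (!f (bits n x)) l E) := by
    intro D c E l hD
    by_cases c0 : c = 0
    · rw [returnProb_of_some (c := false) ((hD []).trans (if_pos c0)), select, if_pos c0]
    by_cases c1 : c = 1
    · rw [returnProb_of_some (c := true) ((hD []).trans ((if_neg c0).trans (if_pos c1))), select,
        if_neg c0, if_pos c1]
    · rw [select, if_neg c0, if_neg c1,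
        show D = E from funext fun l => (hD l).trans ((if_neg c0).trans (if_neg c1))]
  have hsel : ∀ (c : ℕ) (u v w z t : ℝ), z * select c u v w * t = select c (z * u * t) (z * v * t)
      (z * w * t) := by
    intro c u v w z t; unfold select; split_ifs <;> rfl
  induction h generalizing a with
  | zero =>
    rw [key (treeDecision f δ 0 a) _ _ _ fun l => rfl, hsel, Problem.pay, h0, h1, hs]
    simp [lastStages, hgs]
  | succ h ih =>
    rw [key (treeDecision f δ (h + 1) a) _ _ _ fun l => rfl, hsel, Problem.pay, h0, h1, hs,
      zero_mul, zero_add]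
    congr 1
    rw [lastStages, returnProb_cons_of_none rfl, Finset.mul_sum, Finset.sum_mul]
    change ∑ s ∈ Finset.range (2 ^ m), _ = _
    rw [← sum_code ha]
    refine Finset.sum_congr rfl fun s _ => ?_
    change G.pay δ h (a * 2 ^ m + code s) (2 * x) = _
    rw [ih (by omega), hG, node_exactProblem_child ha hh, e2]
    ring

/-- In the coordinates of the queries, the outcome of a strategy is its expected number of
queries. -/
theorem pay_exactProblem_odd (ha : Nat.clog 2 n + 1 ≤ m) {x : ℕ}
    (hgs : expectedQueries (bits n x) gs (readDecision f) = n)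
    (hq : ∀ k < n, (g k).numQueries = queryCount n d k) {F : ℕ → ℕ}
    (δ : ℕ → ℕ → ℕ) {h : ℕ} (hh : h ≤ n) (a : ℕ) :
    (exactProblem n m F d g Z).pay δ h a (2 * x + 1) =
      128 * expectedQueries (bits n x) (lastStages g gs h) (treeDecision f δ h a) *
        (exactProblem n m F d g Z).node h a (2 * x + 1) := by
  set G := exactProblem n m F d g Z with hG
  have e1 : ¬ (2 * x + 1) % 2 = 0 := by omega
  have e2 : (2 * x + 1) / 2 = x := by omega
  have h0 : ∀ b, G.halt b (2 * x + 1) = 0 := by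
    intro b
    change (haltPay m F b (2 * x + 1) : ℝ) = _
    rw [haltPay, if_neg e1, Nat.cast_zero]
  have key : ∀ (D : List (BasisState n m) → Option Bool) (c : ℕ) (E : List (BasisState n m) →
      Option Bool)
      (l : List (QueryAlgorithm n m)), (∀ l, D l = select c (some false) (some true) (E l)) →
      expectedQueries (bits n x) l D = select c 0 0 (expectedQueries (bits n x) l E) := by
    intro D c E l hD
    by_cases c0 : c = 0
    · rw [expectedQueries_of_some (c := false) ((hD []).trans (if_pos c0)), select, if_pos c0]
    by_cases c1 : c = 1
    · rw [expectedQueries_of_some (c := true) ((hD []).trans ((if_neg c0).trans (if_pos c1))),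
        select,
        if_neg c0, if_pos c1]
    · rw [select, if_neg c0, if_neg c1,
        show D = E from funext fun l => (hD l).trans ((if_neg c0).trans (if_neg c1))]
  have hsel : ∀ (c : ℕ) (w z t : ℝ), z * select c 0 0 w * t = select c 0 0 (z * w * t) := by
    intro c w z t; unfold select; split_ifs <;> simp
  induction h generalizing a with
  | zero =>
    rw [key (treeDecision f δ 0 a) _ _ _ fun l => rfl, hsel, Problem.pay, h0, h0, zero_mul,
      lastStages, hgs]
    congr 2
    change (stepPay n d 0 (2 * x + 1) : ℝ) = _
    rw [stepPay, if_neg e1, if_pos rfl]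
    push_cast; rfl
  | succ h ih =>
    rw [key (treeDecision f δ (h + 1) a) _ _ _ fun l => rfl, hsel, Problem.pay, h0, h0, zero_mul]
    congr 1
    rw [lastStages, expectedQueries_cons_of_none rfl, mul_add, add_mul]
    congr 1
    · congr 1
      change (stepPay n d (h + 1) (2 * x + 1) : ℝ) = _
      rw [stepPay, if_neg e1, if_neg (Nat.succ_ne_zero h), hq _ (by omega)]
      push_cast; rfl
    · rw [Finset.mul_sum, Finset.sum_mul]
      change ∑ s ∈ Finset.range (2 ^ m), _ = _
      rw [← sum_code ha]
      refine Finset.sum_congr rfl fun s _ => ?_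
      change G.pay δ h (a * 2 ^ m + code s) (2 * x + 1) = _
      rw [ih (by omega), hG, node_exactProblem_child ha hh, e2]
      ring

/-- With `K` uniformly distributed seeds, the strategy is uniformly distributed among `(2 ^ m) ^ K`
ones. -/
theorem average_seedDecision (ha : Nat.clog 2 n + 1 ≤ m) {σ : QueryAlgorithm n m}
    (h0 : σ.numQueries = 0) (hσ : ∀ x s, σ.outcomeProb x s = 1 / 2 ^ m) (δ : ℕ → ℕ → ℕ → ℕ)
    (x : Fin n → Bool) (b : Bool) (K r : ℕ) :
    (2 ^ m) ^ K * returnProb x b (List.replicate K σ ++ gs) (seedDecision f δ K r) =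
      ∑ j ∈ Finset.range ((2 ^ m) ^ K), returnProb x b gs (treeDecision f (δ (r * (2 ^ m) ^ K +
          j)) n 0) ∧
    (2 ^ m) ^ K * expectedQueries x (List.replicate K σ ++ gs) (seedDecision f δ K r) =
      ∑ j ∈ Finset.range ((2 ^ m) ^ K),
        expectedQueries x gs (treeDecision f (δ (r * (2 ^ m) ^ K + j)) n 0) := by
  have hS : (2 ^ m : ℝ) ≠ 0 := by positivity
  induction K generalizing r with
  | zero => simp [seedDecision]
  | succ K ih =>
    have e : ∀ s j, r * (2 ^ m) ^ (K + 1) + (s * (2 ^ m) ^ K + j) =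
        (r * 2 ^ m + s) * (2 ^ m) ^ K + j := by intro s j; ring
    rw [List.replicate_succ, List.cons_append, returnProb_cons_of_none rfl,
      expectedQueries_cons_of_none rfl, h0, Nat.cast_zero, zero_add]
    simp only [hσ, ← Finset.mul_sum]
    constructor
    · rw [pow_succ' (2 ^ m : ℕ), Finset.sum_range_mul_add, ← sum_code ha, pow_succ (2 ^ m : ℝ),
        mul_assoc, ← mul_assoc (2 ^ m : ℝ), mul_one_div_cancel hS, one_mul, Finset.mul_sum]
      refine Finset.sum_congr rfl fun s _ => ?_
      rw [← pow_succ']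
      simp only [e]
      exact (ih _).1
    · rw [pow_succ' (2 ^ m : ℕ), Finset.sum_range_mul_add, ← sum_code ha, pow_succ (2 ^ m : ℝ),
        mul_assoc, ← mul_assoc (2 ^ m : ℝ), mul_one_div_cancel hS, one_mul, Finset.mul_sum]
      refine Finset.sum_congr rfl fun s _ => ?_
      rw [← pow_succ']
      simp only [e]
      exact (ih _).2

end Tree

/-- The matrices of an accepted candidate are close to unitary ones, which make up the stages. -/
theorem Accepted.exists_approximates (ha : Nat.clog 2 n + 1 ≤ m) (hm : 2 ≤ m) {F d : ℕ → ℕ}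
    (h : Accepted n m F d) : ∃ g : ℕ → QueryAlgorithm n m, Approximates n m d (precision m) g := by
  choose! U hU using fun u hu => (h.unitary u hu).exists_close ha hm
  let g : ℕ → QueryAlgorithm n m := fun k =>
    ⟨U (offset n d k), List.ofFn fun j : Fin (queryCount n d k) => U (offset n d k + (j + 1))⟩
  have hT : ∀ k, (g k).numQueries = queryCount n d k := fun k => List.length_ofFn
  refine ⟨g, fun k _ => hT k, fun k hk j hj => ?_⟩
  rw [hT] at hj
  have hle : offset n d k + (queryCount n d k + 1) ≤ offset n d n := by
    unfold offset
    rw [← Finset.sum_range_succ fun j => queryCount n d j + 1]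
    exact Finset.sum_le_sum_of_subset (Finset.range_subset_range.2 hk)
  have hq := h.queries
  have e : (g k).unitary j = U (offset n d k + j) := by
    cases j with
    | zero => rfl
    | succ j =>
      change (List.ofFn fun j : Fin (queryCount n d k) => U (offset n d k + (j + 1))).getD j 1 = _
      rw [List.getD_eq_getElem _ _ (by simpa using hj)]
      simp
  rw [e]
  exact hU _ (by omega)

/-- An accepted candidate yields an algorithm. -/
theorem Accepted.exists_compositeAlgorithm (hm : 2 ≤ m) (hnm : n ≤ 2 ^ m)
    (ha : Nat.clog 2 n + 1 ≤ m) {f : (Fin n → Bool) → Bool} {d : ℕ → ℕ}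
    (h : Accepted n m (truthTable f) d) :
    ∃ Γ : CompositeAlgorithm n m, Γ.Computes f ∧ ∀ x, Γ.queries x ≤ ((d n : ℝ) + 2) / 128 := by
  obtain ⟨g, hg⟩ := h.exists_approximates ha hm
  obtain ⟨σ, hσ0, hσ⟩ := exists_uniform_stage (n := n) ha
  obtain ⟨gs, hgs, hr⟩ := exists_reading m f
  choose δ hδ using fun r => (problem n m (truthTable f) d).exists_best_eq_pay (2 * 2 ^ n)
    (weight n m (truthTable f) d r)
  obtain ⟨Γ, hΓ1, hΓ2⟩ := QuantumQuery.exists_compositeAlgorithm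
    (gs := List.replicate (n + 16) σ ++ lastStages g gs n) (D := seedDecision f δ (n + 16) 0)
    (by simp) rfl (fun l hl => isSome_seedDecision f δ _ _ l (by
      rw [hl, List.length_append, List.length_replicate, length_lastStages, hgs]))
  set Z : ℝ := (scale n m d : ℝ) with hZ
  have hZ0 : 0 < Z := by
    rw [hZ]
    have : 0 < scale n m d := Nat.pow_pos (den_pos m)
    exact_mod_cast this
  set R := rounds n m with hR
  have hR' : (R : ℝ) = (2 ^ m) ^ (n + 16) := by rw [hR]; unfold rounds; push_cast; rfl
  have hR0 : (0 : ℝ) < R := by rw [hR']; positivity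
  have hη' := one_add_precision_pow_le hm hnm
  set G := exactProblem n m (truthTable f) d g Z with hG
  have hnode : ∀ y, G.node n 0 y = Z := by
    intro y
    rw [hG, exactProblem_node ha le_rfl, Nat.sub_self, pathWeight, mul_one]
  -- The average of the outcomes meets the targets up to the error of approximation and the
  -- average gain of the weights, which are both at most `Z`.
  have key : ∀ y < 2 * 2 ^ n, ∑ r ∈ Finset.range R, G.pay (δ r) n 0 y ≤
      R * (target n m d y + 2 * Z) := by
    intro y hy
    have h1 : ∀ r, G.pay (δ r) n 0 y ≤
        ((problem n m (truthTable f) d).best (2 * 2 ^ n)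
          (weight n m (truthTable f) d r) n 0 y : ℕ) + Z := by
      intro r
      have := (abs_le.1 (abs_pay_sub_pay_le ha hnm (precision_nonneg m) hη' hg h.queries (δ r)
        (F := truthTable f) hy)).2
      rw [hδ]
      linarith
    have h2 : ∑ r ∈ Finset.range R,
        (problem n m (truthTable f) d).best (2 * 2 ^ n) (weight n m (truthTable f) d r) n 0 y ≤
          R * target n m d y + weight n m (truthTable f) d R y :=
      sum_payoffs_le (w := weight n m (truthTable f) d)
        (v := fun r => (problem n m (truthTable f) d).best (2 * 2 ^ n)
          (weight n m (truthTable f) d r) n 0)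
        (fun r y => rfl) R y
    have h3 := h.weights y hy
    have h4 : ((∑ r ∈ Finset.range R, (problem n m (truthTable f) d).best (2 * 2 ^ n)
        (weight n m (truthTable f) d r) n 0 y : ℕ) : ℝ) ≤ R * target n m d y + R * Z := by
      rw [hZ]
      exact_mod_cast h2.trans (Nat.add_le_add_left h3 _)
    refine (Finset.sum_le_sum fun r _ => h1 r).trans ?_
    rw [Finset.sum_add_distrib, Finset.sum_const, Finset.card_range, nsmul_eq_mul]
    push_cast at h4
    linarith
  have hS1 : (1 : ℝ) ≤ 2 ^ m := one_le_pow₀ (by norm_num)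
  refine ⟨Γ, fun X => ?_, fun X => ?_⟩
  · obtain ⟨x, hx, rfl⟩ := exists_bits_eq X
    have h1 := (average_seedDecision (gs := lastStages g gs n) (f := f) ha hσ0 hσ δ (bits n x)
      (!f (bits n x)) (n + 16) 0).1
    rw [← hΓ1] at h1
    have h2 := key (2 * x) (by omega)
    simp only [hG, pay_exactProblem_even ha (hr _).1 _ le_rfl] at h2
    rw [← hG] at h2
    simp only [hnode] at h2
    rw [← Finset.sum_mul, ← Finset.mul_sum] at h2
    simp only [zero_mul, zero_add] at h1
    change _ = ∑ j ∈ Finset.range R, _ at h1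
    rw [← h1, ← hR'] at h2
    have ht : (target n m d (2 * x) : ℝ) = (1024 * 2 ^ m - 2) * Z := by
      have : 2 ≤ 1024 * 2 ^ m := by have : 0 < 2 ^ m := by positivity
                                    omega
      rw [target, if_pos (by omega), hZ]
      push_cast [Nat.cast_sub this]
      rfl
    have he : (errorWeight m : ℝ) = 3 * (1024 * 2 ^ m) := by unfold errorWeight; push_cast; rfl
    rw [ht, he] at h2
    have h3 : R * Z * (1024 * 2 ^ m) * (3 * Γ.errorProb f (bits n x)) ≤ R * Z *
        (1024 * 2 ^ m) * 1 := by
      linarith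
    have := le_of_mul_le_mul_left h3 (by positivity)
    linarith
  · obtain ⟨x, hx, rfl⟩ := exists_bits_eq X
    have h1 := (average_seedDecision (gs := lastStages g gs n) (f := f) ha hσ0 hσ δ (bits n x)
      true (n + 16) 0).2
    rw [← hΓ2] at h1
    have h2 := key (2 * x + 1) (by omega)
    simp only [hG, pay_exactProblem_odd ha (hr _).2 hg.numQueries _ le_rfl] at h2
    rw [← hG] at h2
    simp only [hnode] at h2
    rw [← Finset.sum_mul, ← Finset.mul_sum] at h2
    simp only [zero_mul, zero_add] at h1
    change _ = ∑ j ∈ Finset.range R, _ at h1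
    rw [← h1, ← hR'] at h2
    have ht : (target n m d (2 * x + 1) : ℝ) = d n * Z := by
      rw [target, if_neg (by omega), hZ]
      push_cast
      rfl
    rw [ht] at h2
    have h3 : R * Z * (128 * Γ.queries (bits n x)) ≤ R * Z * (d n + 2) := by linarith
    have := le_of_mul_le_mul_left h3 (by positivity)
    rw [le_div_iff₀ (by norm_num)]
    linarith

/-- The classical algorithm that reads the whole input, as a composite algorithm. -/
theorem exists_compositeAlgorithm_queries_le (hn : 1 ≤ n) (m : ℕ) (f : (Fin n → Bool) → Bool) :
    ∃ Γ : CompositeAlgorithm n m, Γ.Computes f ∧ ∀ x, Γ.queries x ≤ n := by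
  obtain ⟨gs, hgs, hr⟩ := exists_reading m f
  obtain ⟨Γ, hΓ1, hΓ2⟩ := QuantumQuery.exists_compositeAlgorithm (gs := gs) (D := readDecision f)
    (by rintro rfl; simp at hgs; omega) (if_pos hn) (fun l hl => by
      rw [readDecision, if_neg (by omega)]; rfl)
  refine ⟨Γ, fun x => ?_, fun x => ?_⟩
  · rw [hΓ1, (hr x).1]
    cases f x <;> norm_num
  · rw [hΓ2, (hr x).2]

end Search

/-! ### From algorithms to accepted candidates -/

namespace Search

open QuantumQuery DecisionTree RAM

variable {n m : ℕ}

theorem sum_range_two_mul {M : Type*} [AddCommMonoid M] (a : ℕ) (F : ℕ → M) :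
    ∑ y ∈ Finset.range (2 * a), F y = ∑ x ∈ Finset.range a, (F (2 * x) + F (2 * x + 1)) := by
  rw [mul_comm, Finset.sum_range_mul_add]
  refine Finset.sum_congr rfl fun x _ => ?_
  rw [Finset.sum_range_succ, Finset.sum_range_one, add_zero, mul_comm]

/-- The least weighted outcome of a strategy for the stages in the list, when the input `x` has the
weight `u x`. -/
noncomputable def optimum (n m : ℕ) (F : ℕ → ℕ) (w : ℕ → ℝ) :
    List (QueryAlgorithm n m) → (ℕ → ℝ) → ℝ
  | [], u => min (∑ x ∈ Finset.range (2 ^ n), w (2 * x) * (haltPay m F 0 (2 * x) * u x))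
      (min (∑ x ∈ Finset.range (2 ^ n), w (2 * x) * (haltPay m F 1 (2 * x) * u x))
        (∑ x ∈ Finset.range (2 ^ n), w (2 * x + 1) * (128 * n * u x)))
  | g :: gs, u => min (∑ x ∈ Finset.range (2 ^ n), w (2 * x) * (haltPay m F 0 (2 * x) * u x))
      (min (∑ x ∈ Finset.range (2 ^ n), w (2 * x) * (haltPay m F 1 (2 * x) * u x))
        (∑ x ∈ Finset.range (2 ^ n), w (2 * x + 1) * (128 * g.numQueries * u x) +
          ∑ s, optimum n m F w gs fun x => u x * g.outcomeProb (bits n x) s))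

section Optimum

variable {F : ℕ → ℕ} {w : ℕ → ℝ} {u : ℕ → ℝ} {f : (Fin n → Bool) → Bool}

theorem optimum_le_halt_zero (gs : List (QueryAlgorithm n m)) : optimum n m F w gs u ≤
    ∑ x ∈ Finset.range (2 ^ n), w (2 * x) * (haltPay m F 0 (2 * x) * u x) := by
  cases gs <;> exact min_le_left _ _

theorem optimum_le_halt_one (gs : List (QueryAlgorithm n m)) : optimum n m F w gs u ≤
    ∑ x ∈ Finset.range (2 ^ n), w (2 * x) * (haltPay m F 1 (2 * x) * u x) := by
  cases gs <;> exact (min_le_right _ _).trans (min_le_left _ _)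

theorem optimum_le_halt (gs : List (QueryAlgorithm n m)) (c : Bool) :
    optimum n m (truthTable f) w gs u ≤ ∑ x ∈ Finset.range (2 ^ n), u x *
      (w (2 * x) * errorWeight m * if c = !f (bits n x) then 1 else 0) := by
  cases c
  · refine (optimum_le_halt_zero gs).trans (le_of_eq (Finset.sum_congr rfl fun x _ => ?_))
    rw [haltPay, if_pos (by omega), show 2 * x / 2 = x by omega, truthTable_bits]
    cases f (bits n x) <;> simp; ring
  · refine (optimum_le_halt_one gs).trans (le_of_eq (Finset.sum_congr rfl fun x _ => ?_))
    rw [haltPay, if_pos (by omega), show 2 * x / 2 = x by omega, truthTable_bits]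
    cases f (bits n x) <;> simp; ring

theorem optimum_nil_le : optimum n m F w [] u ≤
    ∑ x ∈ Finset.range (2 ^ n), w (2 * x + 1) * (128 * n * u x) :=
  (min_le_right _ _).trans (min_le_right _ _)

theorem optimum_cons_le (g : QueryAlgorithm n m) (gs : List (QueryAlgorithm n m)) :
    optimum n m F w (g :: gs) u ≤
      ∑ x ∈ Finset.range (2 ^ n), w (2 * x + 1) * (128 * g.numQueries * u x) +
        ∑ s, optimum n m F w gs fun x => u x * g.outcomeProb (bits n x) s :=
  (min_le_right _ _).trans (min_le_right _ _)

/-- The best response in the tree of histories attains the optimum for the exact stages. -/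
theorem sum_best_le_optimum (ha : Nat.clog 2 n + 1 ≤ m) {d : ℕ → ℕ} {g : ℕ → QueryAlgorithm n m}
    (hq : ∀ k < n, (g k).numQueries = queryCount n d k) {Z : ℝ} {h : ℕ} (hh : h ≤ n) (a : ℕ) :
    ∑ y ∈ Finset.range (2 * 2 ^ n), w y * (exactProblem n m F d g Z).best (2 * 2 ^ n) w h a y ≤
      optimum n m F w (lastStages g [] h) fun x => (exactProblem n m F d g Z).node h a (2 * x) := by
  set G := exactProblem n m F d g Z with hG
  have hnode : ∀ h ≤ n, ∀ a x, G.node h a (2 * x + 1) = G.node h a (2 * x) := by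
    intro h hh a x
    rw [hG, exactProblem_node ha hh, exactProblem_node ha hh,
      show (2 * x + 1) / 2 = 2 * x / 2 by omega]
  have hhalt : ∀ h a b, ∑ y ∈ Finset.range (2 * 2 ^ n), w y * (G.halt b y * G.node h a y) =
      ∑ x ∈ Finset.range (2 ^ n), w (2 * x) * (haltPay m F b (2 * x) * G.node h a (2 * x)) := by
    intro h a b
    rw [sum_range_two_mul]
    refine Finset.sum_congr rfl fun x _ => ?_
    have : G.halt b (2 * x + 1) = 0 := by
      change (haltPay m F b (2 * x + 1) : ℝ) = 0
      rw [haltPay, if_neg (by omega), Nat.cast_zero]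
    rw [this]
    simp only [zero_mul, mul_zero, add_zero]
    rfl
  have hstep : ∀ h ≤ n, ∀ a, ∑ y ∈ Finset.range (2 * 2 ^ n), w y * (G.step h y * G.node h a y) =
      ∑ x ∈ Finset.range (2 ^ n), w (2 * x + 1) *
        (128 * (if h = 0 then n else queryCount n d (n - h) : ℕ) * G.node h a (2 * x)) := by
    intro h hh a
    rw [sum_range_two_mul]
    refine Finset.sum_congr rfl fun x _ => ?_
    have h0 : G.step h (2 * x) = 0 := by
      change (stepPay n d h (2 * x) : ℝ) = 0
      rw [stepPay, if_pos (by omega), Nat.cast_zero]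
    have h1 : G.step h (2 * x + 1) = 128 * (if h = 0 then n else queryCount n d (n - h) : ℕ) := by
      change (stepPay n d h (2 * x + 1) : ℝ) = _
      rw [stepPay, if_neg (by omega), Nat.cast_mul]
      rfl
    rw [h0, h1, hnode h hh]
    simp only [zero_mul, mul_zero, zero_add]
  induction h generalizing a with
  | zero =>
    refine le_min ?_ (le_min ?_ ?_)
    · exact (Problem.pick_le _ _ _ _ _ 0).trans_eq (hhalt 0 a 0)
    · exact (Problem.pick_le _ _ _ _ _ 1).trans_eq (hhalt 0 a 1)
    · exact (Problem.pick_le _ _ _ _ _ 2).trans_eq (hstep 0 hh a)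
  | succ h ih =>
    refine le_min ?_ (le_min ?_ ?_)
    · exact (Problem.pick_le _ _ _ _ _ 0).trans_eq (hhalt (h + 1) a 0)
    · exact (Problem.pick_le _ _ _ _ _ 1).trans_eq (hhalt (h + 1) a 1)
    · refine (Problem.pick_le _ _ _ _ _ 2).trans ?_
      change ∑ y ∈ Finset.range (2 * 2 ^ n), w y * (G.step (h + 1) y * G.node (h + 1) a y +
        ∑ s ∈ Finset.range (2 ^ m), G.best (2 * 2 ^ n) w h (a * 2 ^ m + s) y) ≤ _
      simp only [mul_add, Finset.sum_add_distrib, Finset.mul_sum]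
      refine add_le_add (le_of_eq ?_) ?_
      · rw [hstep (h + 1) hh a, if_neg (Nat.succ_ne_zero h), hq _ (by omega)]
      · rw [Finset.sum_comm, ← sum_code ha]
        refine Finset.sum_le_sum fun s _ => (ih (by omega) (a * 2 ^ m + code s)).trans (le_of_eq ?_)
        congr 1
        funext x
        rw [hG, node_exactProblem_child ha hh, show 2 * x / 2 = x by omega, mul_comm]

/-- The list of stages without those that make no queries, up to the point where more than `b`
queries would be made. -/
def reduce : ℕ → List (QueryAlgorithm n m) → List (QueryAlgorithm n m)
  | _, [] => []
  | b, g :: gs => if g.numQueries = 0 then reduce b gs else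
      if g.numQueries ≤ b then g :: reduce (b - g.numQueries) gs else []

theorem sum_numQueries_reduce_le (b : ℕ) (gs : List (QueryAlgorithm n m)) :
    ((reduce b gs).map QueryAlgorithm.numQueries).sum ≤ b := by
  induction gs generalizing b with
  | nil => simp [reduce]
  | cons g gs ih =>
    rw [reduce]
    split_ifs with h0 h1
    · exact ih b
    · have := ih (b - g.numQueries)
      rw [List.map_cons, List.sum_cons]
      omega
    · simp

theorem length_reduce_le (b : ℕ) (gs : List (QueryAlgorithm n m)) : (reduce b gs).length ≤ b := by
  induction gs generalizing b with
  | nil => simp [reduce]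
  | cons g gs ih =>
    rw [reduce]
    split_ifs with h0 h1
    · exact ih b
    · have := ih (b - g.numQueries)
      rw [List.length_cons]
      omega
    · simp

theorem sum_mul_affine {ι : Type*} [Fintype ι] {p : ι → ℝ} (hp : ∑ s, p s = 1) (a b c k : ℝ)
    (r q : ι → ℝ) : ∑ s, p s * (a * r s + b * (k * q s + c)) =
      a * ∑ s, p s * r s + b * (k * ∑ s, p s * q s + c) := by
  calc _ = ∑ s, (a * (p s * r s) + b * k * (p s * q s) + b * c * p s) :=
        Finset.sum_congr rfl fun s _ => by ring
    _ = _ := by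
      rw [Finset.sum_add_distrib, Finset.sum_add_distrib, ← Finset.mul_sum, ← Finset.mul_sum,
        ← Finset.mul_sum, hp]
      ring

/-- Truncating an algorithm when it has made `n` queries, and then reading the whole input, at most
doubles the number of queries. -/
theorem optimum_reduce_le (hw : ∀ y, 0 ≤ w y) (gs : List (QueryAlgorithm n m))
    (D : List (BasisState n m) → Option Bool) (hD : ∀ l, l.length = gs.length → (D l).isSome)
    {b : ℕ} (hb : b ≤ n) (hu : ∀ x, 0 ≤ u x) :
    optimum n m (truthTable f) w (reduce b gs) u ≤ ∑ x ∈ Finset.range (2 ^ n), u x *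
      (w (2 * x) * errorWeight m * returnProb (bits n x) (!f (bits n x)) gs D +
        w (2 * x + 1) * (256 * expectedQueries (bits n x) gs D + 128 * ((n : ℝ) - b))) := by
  induction gs generalizing D b u with
  | nil =>
    have hbn : (b : ℝ) ≤ n := by exact_mod_cast hb
    obtain ⟨c, hc⟩ := Option.isSome_iff_exists.1 (hD [] rfl)
    refine (optimum_le_halt _ c).trans (Finset.sum_le_sum fun x _ => ?_)
    rw [returnProb_of_some hc, expectedQueries_of_some hc]
    refine mul_le_mul_of_nonneg_left (le_add_of_nonneg_right ?_) (hu x)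
    exact mul_nonneg (hw _) (by linarith)
  | cons g gs ih =>
    have hbn : (b : ℝ) ≤ n := by exact_mod_cast hb
    cases hc : D [] with
    | some c =>
      refine (optimum_le_halt _ c).trans (Finset.sum_le_sum fun x _ => ?_)
      rw [returnProb_of_some hc, expectedQueries_of_some hc]
      refine mul_le_mul_of_nonneg_left (le_add_of_nonneg_right ?_) (hu x)
      exact mul_nonneg (hw _) (by linarith)
    | none =>
      have hD' : ∀ s, ∀ l : List (BasisState n m), l.length = gs.length → (D (s :: l)).isSome :=
        fun s l hl => hD _ (by simpa using hl)
      simp only [returnProb_cons_of_none hc, expectedQueries_cons_of_none hc]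
      rw [reduce]
      split_ifs with h0 h1
      · -- The outcome of a stage without queries can be fixed in the best way for all inputs.
        have hp := fun x s => QueryAlgorithm.outcomeProb_of_numQueries_eq_zero h0 (bits n x)
            (bits n 0) s
        set p := g.outcomeProb (bits n 0)
        have hp1 : ∑ s, p s = 1 := g.sum_outcomeProb _
        calc optimum n m (truthTable f) w (reduce b gs) u
            = ∑ s, p s * optimum n m (truthTable f) w (reduce b gs) u := by
              rw [← Finset.sum_mul, hp1, one_mul]
          _ ≤ ∑ s, p s * ∑ x ∈ Finset.range (2 ^ n), u x *
              (w (2 * x) * errorWeight m *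
                returnProb (bits n x) (!f (bits n x)) gs (fun l => D (s :: l)) +
              w (2 * x + 1) * (256 * expectedQueries (bits n x) gs (fun l => D (s :: l)) +
                128 * ((n : ℝ) - b))) :=
              Finset.sum_le_sum fun s _ => mul_le_mul_of_nonneg_left
                (ih (fun l => D (s :: l)) (hD' s) hb hu) (g.outcomeProb_nonneg _ _)
          _ = _ := by
            simp only [Finset.mul_sum (s := Finset.range (2 ^ n))]
            rw [Finset.sum_comm]
            refine Finset.sum_congr rfl fun x _ => ?_
            simp only [h0, Nat.cast_zero, zero_add, hp x]
            rw [← sum_mul_affine hp1, Finset.mul_sum]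
            exact Finset.sum_congr rfl fun s _ => by ring
      · refine (optimum_cons_le _ _).trans ?_
        refine (add_le_add le_rfl (Finset.sum_le_sum fun s _ => ih (fun l => D (s :: l)) (hD' s)
          ((Nat.sub_le b g.numQueries).trans hb)
          fun x => mul_nonneg (hu x) (g.outcomeProb_nonneg _ _))).trans (le_of_eq ?_)
        rw [Finset.sum_comm, ← Finset.sum_add_distrib]
        refine Finset.sum_congr rfl fun x _ => ?_
        simp only [mul_assoc (u x)]
        rw [← Finset.mul_sum, sum_mul_affine (g.sum_outcomeProb _)]
        push_cast [Nat.cast_sub h1]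
        ring
      · refine optimum_nil_le.trans (Finset.sum_le_sum fun x _ => ?_)
        have h2 : (b : ℝ) ≤ g.numQueries := by exact_mod_cast (not_le.1 h1).le
        have h3 : 0 ≤ w (2 * x) * errorWeight m * ∑ s, g.outcomeProb (bits n x) s *
            returnProb (bits n x) (!f (bits n x)) gs fun l => D (s :: l) :=
          mul_nonneg (mul_nonneg (hw _) (Nat.cast_nonneg _)) (Finset.sum_nonneg fun s _ =>
            mul_nonneg (g.outcomeProb_nonneg _ _) (returnProb_nonneg _ _ _ _))
        have h4 : 0 ≤ ∑ s, g.outcomeProb (bits n x) s *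
            expectedQueries (bits n x) gs fun l => D (s :: l) :=
          Finset.sum_nonneg fun s _ =>
            mul_nonneg (g.outcomeProb_nonneg _ _) (expectedQueries_nonneg _ _ _)
        have hb0 : (0 : ℝ) ≤ b := Nat.cast_nonneg b
        calc w (2 * x + 1) * (128 * n * u x) = u x * (w (2 * x + 1) * (128 * n)) := by ring
          _ ≤ _ := by
            refine mul_le_mul_of_nonneg_left ?_ (hu x)
            refine le_add_of_nonneg_of_le h3 (mul_le_mul_of_nonneg_left ?_ (hw _))
            linarith

/-- One of the strategies makes all queries and then reads the whole input. -/
theorem optimum_le_sum_numQueries (gs : List (QueryAlgorithm n m)) : optimum n m F w gs u ≤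
    ∑ x ∈ Finset.range (2 ^ n), u x *
      (w (2 * x + 1) * (128 * ((gs.map QueryAlgorithm.numQueries).sum + n : ℕ))) := by
  induction gs generalizing u with
  | nil =>
    refine optimum_nil_le.trans (le_of_eq (Finset.sum_congr rfl fun x _ => ?_))
    simp; ring
  | cons g gs ih =>
    refine (optimum_cons_le _ _).trans ((add_le_add le_rfl (Finset.sum_le_sum fun s _ => ih)).trans
      (le_of_eq ?_))
    rw [Finset.sum_comm, ← Finset.sum_add_distrib]
    refine Finset.sum_congr rfl fun x _ => ?_
    rw [← Finset.sum_mul, ← Finset.mul_sum, g.sum_outcomeProb, List.map_cons, List.sum_cons]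
    push_cast
    ring

/-- The stage that does nothing. -/
def idleStage (n m : ℕ) : QueryAlgorithm n m := ⟨1, []⟩

theorem outcomeProb_idleStage (x : Fin n → Bool) (s : BasisState n m) :
    (idleStage n m).outcomeProb x s = if s = zeroState n m then 1 else 0 := by
  rw [QueryAlgorithm.outcomeProb_eq]
  change ‖(((1 : Matrix.unitaryGroup (BasisState n m) ℂ) :
    Matrix (BasisState n m) (BasisState n m) ℂ) *ᵥ _) s‖ ^ 2 = _
  rw [OneMemClass.coe_one, Matrix.one_mulVec, Pi.single_apply]
  split_ifs <;> simp

/-- Stages that do nothing can be put in front. -/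
theorem optimum_replicate_append_le (k : ℕ) (gs : List (QueryAlgorithm n m)) :
    optimum n m F w (List.replicate k (idleStage n m) ++ gs) u ≤ optimum n m F w gs u := by
  induction k with
  | zero => exact le_rfl
  | succ k ih =>
    rw [List.replicate_succ, List.cons_append]
    refine (optimum_cons_le _ _).trans (le_trans ?_ ih)
    have h0 : (idleStage n m).numQueries = 0 := rfl
    set l := List.replicate k (idleStage n m) ++ gs
    have h1 : optimum n m F w l (fun _ => 0) ≤ 0 := (optimum_le_halt_zero l).trans (by simp)
    rw [h0, ← Finset.add_sum_erase _ _ (Finset.mem_univ (zeroState n m))]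
    simp only [Nat.cast_zero, mul_zero, zero_mul, Finset.sum_const_zero, zero_add]
    have h2 : ∑ s ∈ Finset.univ.erase (zeroState n m),
        (optimum n m F w l fun x => u x * (idleStage n m).outcomeProb (bits n x) s) ≤ 0 := by
      refine Finset.sum_nonpos fun s hs => ?_
      simp only [outcomeProb_idleStage, if_neg (Finset.ne_of_mem_erase hs), mul_zero]
      exact h1
    have h3 : (fun x => u x * (idleStage n m).outcomeProb (bits n x) (zeroState n m)) = u := by
      funext x
      rw [outcomeProb_idleStage, if_pos rfl, mul_one]
    rw [h3]
    linarith

end Optimum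

end Search

namespace Search

open QuantumQuery DecisionTree RAM

variable {n m : ℕ}

theorem sum_getD {α : Type*} (l : List α) (e : α) (F : α → ℕ) :
    ∑ k ∈ Finset.range l.length, F (l.getD k e) = (l.map F).sum := by
  induction l with
  | nil => simp
  | cons a l ih =>
    rw [List.length_cons, Finset.sum_range_succ', List.map_cons, List.sum_cons, ← ih, add_comm]
    simp

theorem lastStages_getD {l : List (QueryAlgorithm n m)} (hl : l.length = n) (e : QueryAlgorithm n m)
    {h : ℕ} (hh : h ≤ n) : lastStages (fun k => l.getD k e) [] h = l.drop (n - h) := by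
  induction h with
  | zero => exact (List.drop_eq_nil_of_le hl.le).symm
  | succ h ih =>
    rw [lastStages, ih (by omega), List.drop_eq_getElem_cons (i := n - (h + 1)) (by omega),
      List.getD_eq_getElem _ _ (by omega), show n - (h + 1) + 1 = n - h by omega]

/-- The matrices of the stages can be numbered consecutively. -/
theorem exists_concat {α : Type*} [Inhabited α] (T : ℕ → ℕ) (v : ℕ → ℕ → α) (k : ℕ) :
    ∃ U : ℕ → α, ∀ i < k, ∀ j ≤ T i, U (∑ l ∈ Finset.range i, (T l + 1) + j) = v i j := by
  induction k with
  | zero => exact ⟨fun _ => default, fun i hi => by omega⟩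
  | succ k ih =>
    obtain ⟨U, hU⟩ := ih
    refine ⟨fun u => if u < ∑ l ∈ Finset.range k, (T l + 1) then U u else
      v k (u - ∑ l ∈ Finset.range k, (T l + 1)), fun i hi j hj => ?_⟩
    rcases Nat.lt_succ_iff_lt_or_eq.1 hi with h | rfl
    · have : ∑ l ∈ Finset.range i, (T l + 1) + (T i + 1) ≤ ∑ l ∈ Finset.range k, (T l + 1) := by
        rw [← Finset.sum_range_succ fun l => T l + 1]
        exact Finset.sum_le_sum_of_subset (Finset.range_subset_range.2 h)
      dsimp only
      rw [if_pos (by omega), hU i h j hj]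
    · dsimp only
      rw [if_neg (by omega), Nat.add_sub_cancel_left]

theorem four_le_two_pow (hm : 2 ≤ m) : 4 ≤ 2 ^ m := Nat.pow_le_pow_right (by norm_num : 0 < 2) hm

/-- The outcomes for a candidate are bounded by a multiple of the common denominator. -/
theorem best_le_mul_scale (hm : 2 ≤ m) (hnm : n ≤ 2 ^ m) (ha : Nat.clog 2 n + 1 ≤ m)
    {F d : ℕ → ℕ} {g : ℕ → QueryAlgorithm n m} (hg : Approximates n m d (precision m) g)
    (hd : offset n d n ≤ 2 * n) (w : ℕ → ℕ) {y : ℕ} (hy : y < 2 * 2 ^ n) :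
    (problem n m F d).best (2 * 2 ^ n) w n 0 y ≤ 2 ^ 12 * (2 ^ m * 2 ^ m) * scale n m d := by
  obtain ⟨δ, hδ⟩ := (problem n m F d).exists_best_eq_pay (2 * 2 ^ n) w
  rw [hδ]
  set G := exactProblem n m F d g (scale n m d) with hG
  have hZ0 : (0 : ℝ) ≤ scale n m d := Nat.cast_nonneg _
  have hb := payBound_problem (n := n) (m := m) (F := F) (d := d)
  have hc : G.PayBound fun h _ => (payCoeff n m h : ℝ) := by
    refine ⟨fun b h y => ?_, fun y => ?_, fun h y => ?_⟩
    · exact (Nat.cast_le (α := ℝ)).2 (hb.halt b h y)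
    · exact (Nat.cast_le (α := ℝ)).2 (hb.step_zero y)
    · have := (Nat.cast_le (α := ℝ)).2 (hb.step_succ h y)
      rw [Nat.cast_add] at this
      exact this
  have h1 := hc.pay_le (fun y a => mul_nonneg hZ0 (pathWeight_nonneg
    (fun k s => (g k).outcomeProb_nonneg _ _) _ _)) δ n 0 y
  rw [hG, exactProblem_node ha le_rfl, Nat.sub_self, pathWeight, mul_one, ← hG] at h1
  have h2 := (abs_le.1 (abs_pay_sub_pay_le ha hnm (precision_nonneg m)
    (one_add_precision_pow_le hm hnm) hg hd δ (F := F) hy)).1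
  have h3 : payCoeff n m n + 1 ≤ 2 ^ 12 * (2 ^ m * 2 ^ m) := by
    have hS := four_le_two_pow hm
    unfold payCoeff errorWeight
    have h4 : 128 * n * (n + 1) ≤ 128 * 2 ^ m * (2 ^ m + 1) :=
      Nat.mul_le_mul (Nat.mul_le_mul_left _ hnm) (by omega)
    nlinarith
  have h5 : ((payCoeff n m n : ℝ) + 1) ≤ 2 ^ 12 * (2 ^ m * 2 ^ m) := by exact_mod_cast h3
  have h6 := mul_le_mul_of_nonneg_right h5 hZ0
  have h7 : (((problem n m F d).pay δ n 0 y : ℕ) : ℝ) ≤ 2 ^ 12 * (2 ^ m * 2 ^ m) * scale n m d := by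
    linarith
  exact_mod_cast h7

/-- An algorithm yields an accepted candidate. -/
theorem exists_accepted (hn : 1 ≤ n) (hm : 2 ≤ m) (hnm : n ≤ 2 ^ m) (ha : Nat.clog 2 n + 1 ≤ m)
    {f : (Fin n → Bool) → Bool} {Γ : CompositeAlgorithm n m} (hΓ : Γ.Computes f) {q' : ℝ}
    (hΓq : ∀ x, Γ.queries x ≤ q') {q : ℕ} (hq : 256 * q' + 2 ≤ q) (hqn : q < 128 * n) :
    ∃ c < base m ^ numDigits n m, Accepted n m (truthTable f) (digit m c) ∧ digit m c n = q := by
  have hS4 := four_le_two_pow hm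
  set hs := reduce n (List.ofFn Γ.stage) with hhs
  set gs := List.replicate (n - hs.length) (idleStage n m) ++ hs with hgs
  have hlen : gs.length = n := by
    have : hs.length ≤ n := length_reduce_le _ _
    rw [hgs, List.length_append, List.length_replicate]
    omega
  set g : ℕ → QueryAlgorithm n m := fun k => gs.getD k (idleStage n m) with hg
  set T : ℕ → ℕ := fun k => (g k).numQueries with hT
  have hsum : ∑ k ∈ Finset.range n, T k ≤ n := by
    have h1 := sum_getD gs (idleStage n m) QueryAlgorithm.numQueries
    rw [hlen] at h1
    rw [hT, hg, h1, hgs, List.map_append, List.sum_append, List.map_replicate, List.sum_replicate,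
      show (idleStage n m).numQueries = 0 from rfl, smul_zero, zero_add]
    exact sum_numQueries_reduce_le _ _
  have hTn : ∀ k < n, T k ≤ n := fun k hk =>
    (Finset.single_le_sum (fun _ _ => Nat.zero_le _) (Finset.mem_range.2 hk)).trans hsum
  have hbase : 128 * 2 ^ m < base m := by
    unfold base den
    calc 128 * 2 ^ m < 4 ^ 15 * 2 ^ m := by omega
      _ ≤ (2 ^ m) ^ 15 * 2 ^ m := Nat.mul_le_mul_right _ (Nat.pow_le_pow_left hS4 _)
      _ = (2 ^ m) ^ 16 := by ring
      _ ≤ 2 * (2 ^ m) ^ 16 := by omega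
  obtain ⟨U, hU⟩ := exists_concat T (fun k j => (g k).unitary j) n
  obtain ⟨c, hc, hcT, hcq, hcU⟩ := exists_candidate ha (T := T) (q := q)
    (fun k hk => by have := hTn k hk; omega) (by omega) U
  refine ⟨c, hc, ?_, hcq⟩
  set d := digit m c with hd
  have hqc : ∀ k < n, queryCount n d k = T k := fun k hk => by
    rw [queryCount, hcT k hk, min_eq_left (hTn k hk)]
  have hoff : ∀ k ≤ n, offset n d k = ∑ l ∈ Finset.range k, (T l + 1) := fun k hk =>
    Finset.sum_congr rfl fun l hl => by rw [hqc l (by have := Finset.mem_range.1 hl; omega)]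
  have hoffn : offset n d n ≤ 2 * n := by
    rw [hoff n le_rfl, Finset.sum_add_distrib]
    simp only [Finset.sum_const, Finset.card_range, smul_eq_mul, mul_one]
    omega
  have happ : Approximates n m d (precision m) g := by
    refine ⟨fun k hk => (hqc k hk).symm, fun k hk j hj => ?_⟩
    have hle : offset n d k + (T k + 1) ≤ offset n d n := by
      rw [hoff k hk.le, hoff n le_rfl, ← Finset.sum_range_succ fun l => T l + 1]
      exact Finset.sum_le_sum_of_subset (Finset.range_subset_range.2 hk)
    have := (hcU (offset n d k + j) (by change j ≤ T k at hj; omega)).2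
    rwa [hoff k hk.le, hU k hk j hj, ← hoff k hk.le] at this
  set Z := scale n m d with hZ
  have hZ0 : (0 : ℝ) ≤ Z := Nat.cast_nonneg _
  have hS : (4 : ℝ) ≤ 2 ^ m := by exact_mod_cast hS4
  have hnS : (n : ℝ) ≤ 2 ^ m := by exact_mod_cast hnm
  have hq0 : 0 ≤ q' := by
    have h1 := hΓq fun _ => false
    rw [Γ.queries_eq] at h1
    exact (expectedQueries_nonneg _ _ _).trans h1
  -- The best response to any weights meets the targets on the weighted average.
  have key : ∀ w : ℕ → ℕ, ∑ y ∈ Finset.range (2 * 2 ^ n),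
      w y * (problem n m (truthTable f) d).best (2 * 2 ^ n) w n 0 y ≤
        ∑ y ∈ Finset.range (2 * 2 ^ n), w y * target n m d y := by
    intro w
    set G := exactProblem n m (truthTable f) d g Z with hG
    obtain ⟨δ, hδ⟩ := G.exists_best_eq_pay (2 * 2 ^ n) fun y => (w y : ℝ)
    set o := optimum n m (truthTable f) (fun y => (w y : ℝ)) hs (fun _ => (Z : ℝ)) with ho
    have h1 : ∑ y ∈ Finset.range (2 * 2 ^ n), (w y : ℝ) * G.pay δ n 0 y ≤ o := by
      simp only [← hδ]
      refine (sum_best_le_optimum ha (fun k hk => (hqc k hk).symm) le_rfl 0).trans ?_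
      rw [hg, lastStages_getD hlen _ le_rfl, Nat.sub_self, List.drop_zero]
      have : (fun x => (exactProblem n m (truthTable f) d (fun k => gs.getD k (idleStage n m))
          (Z : ℝ)).node n 0 (2 * x)) = fun _ => (Z : ℝ) := by
        funext x
        rw [exactProblem_node ha le_rfl, Nat.sub_self, pathWeight, mul_one]
      rw [this]
      exact optimum_replicate_append_le _ _
    have h2 : o ≤ ∑ x ∈ Finset.range (2 ^ n), (Z : ℝ) *
        (w (2 * x) * (1024 * 2 ^ m) + w (2 * x + 1) * (256 * q')) := by
      refine (optimum_reduce_le (fun y => Nat.cast_nonneg _) _ Γ.decisions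
        (fun l hl => Γ.isSome_decisions hl) le_rfl fun _ => hZ0).trans
          (Finset.sum_le_sum fun x _ => mul_le_mul_of_nonneg_left ?_ hZ0)
      rw [← Γ.errorProb_eq, ← Γ.queries_eq, sub_self, mul_zero, add_zero]
      have he := hΓ (bits n x)
      have hqx := hΓq (bits n x)
      refine add_le_add ?_ (mul_le_mul_of_nonneg_left (by linarith) (Nat.cast_nonneg _))
      rw [mul_assoc]
      refine mul_le_mul_of_nonneg_left ?_ (Nat.cast_nonneg _)
      unfold errorWeight
      push_cast
      nlinarith
    have h3 : o ≤ ∑ x ∈ Finset.range (2 ^ n), (Z : ℝ) * (w (2 * x + 1) * (256 * n)) := by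
      refine (optimum_le_sum_numQueries _).trans
        (Finset.sum_le_sum fun x _ => mul_le_mul_of_nonneg_left ?_ hZ0)
      refine mul_le_mul_of_nonneg_left ?_ (Nat.cast_nonneg _)
      have h4 : (hs.map QueryAlgorithm.numQueries).sum + n ≤ 2 * n := by
        have := sum_numQueries_reduce_le n (List.ofFn Γ.stage)
        rw [← hhs] at this
        omega
      have h5 : (((hs.map QueryAlgorithm.numQueries).sum + n : ℕ) : ℝ) ≤ 2 * n :=
          by exact_mod_cast h4
      linarith
    -- The weight of the strategy that reads the whole input, in a mixture that leaves room for the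
    -- errors of approximation.
    set γ : ℝ := 3 / (1024 * 2 ^ m) with hγ
    have hγ0 : 0 ≤ γ := by positivity
    have hγS : γ * (1024 * 2 ^ m) = 3 := by rw [hγ]; field_simp
    have hγ1 : γ ≤ 1 := by
      rw [hγ, div_le_one (by positivity)]
      linarith
    have hγn : γ * (256 * n) ≤ 1 := by
      calc γ * (256 * n) ≤ γ * (256 * 2 ^ m) := by gcongr
        _ = γ * (1024 * 2 ^ m) / 4 := by ring
        _ ≤ 1 := by rw [hγS]; norm_num
    have h4 : o ≤ ∑ x ∈ Finset.range (2 ^ n), (Z : ℝ) * (w (2 * x) * (1024 * 2 ^ m - 3) +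
        w (2 * x + 1) * (q - 1)) := by
      have h5 : o ≤ (1 - γ) * ∑ x ∈ Finset.range (2 ^ n), (Z : ℝ) *
          (w (2 * x) * (1024 * 2 ^ m) + w (2 * x + 1) * (256 * q')) +
          γ * ∑ x ∈ Finset.range (2 ^ n), (Z : ℝ) * (w (2 * x + 1) * (256 * n)) := by
        have h6 := mul_le_mul_of_nonneg_left h2 (by linarith : 0 ≤ 1 - γ)
        have h7 := mul_le_mul_of_nonneg_left h3 hγ0
        linarith
      refine h5.trans ?_
      rw [Finset.mul_sum, Finset.mul_sum, ← Finset.sum_add_distrib]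
      refine Finset.sum_le_sum fun x _ => ?_
      have e : (1 - γ) * ((Z : ℝ) * (w (2 * x) * (1024 * 2 ^ m) + w (2 * x + 1) * (256 * q'))) +
          γ * ((Z : ℝ) * (w (2 * x + 1) * (256 * n))) = (Z : ℝ) *
            (w (2 * x) * (1024 * 2 ^ m - γ * (1024 * 2 ^ m)) +
              w (2 * x + 1) * (256 * q' - γ * (256 * q') + γ * (256 * n))) := by ring
      rw [e, hγS]
      refine mul_le_mul_of_nonneg_left (add_le_add le_rfl
        (mul_le_mul_of_nonneg_left ?_ (Nat.cast_nonneg _))) hZ0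
      have : 0 ≤ γ * (256 * q') := by positivity
      linarith
    have h5 : ∑ y ∈ Finset.range (2 * 2 ^ n),
        w y * (problem n m (truthTable f) d).best (2 * 2 ^ n) w n 0 y ≤
          ∑ y ∈ Finset.range (2 * 2 ^ n), w y * (problem n m (truthTable f) d).pay δ n 0 y :=
      (problem n m (truthTable f) d).best_le_pay _ _ _ _ _
    have h6 : ((∑ y ∈ Finset.range (2 * 2 ^ n),
        w y * (problem n m (truthTable f) d).pay δ n 0 y : ℕ) : ℝ) ≤
          ((∑ y ∈ Finset.range (2 * 2 ^ n), w y * target n m d y : ℕ) : ℝ) := by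
      push_cast
      calc ∑ y ∈ Finset.range (2 * 2 ^ n),
            (w y : ℝ) * ((problem n m (truthTable f) d).pay δ n 0 y : ℕ)
          ≤ ∑ y ∈ Finset.range (2 * 2 ^ n), ((w y : ℝ) * G.pay δ n 0 y + w y * Z) := by
            refine Finset.sum_le_sum fun y hy => ?_
            rw [← mul_add]
            refine mul_le_mul_of_nonneg_left ?_ (Nat.cast_nonneg _)
            have := (abs_le.1 (abs_pay_sub_pay_le ha hnm (precision_nonneg m)
              (one_add_precision_pow_le hm hnm) happ hoffn δ (F := truthTable f)
              (Finset.mem_range.1 hy))).1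
            linarith
        _ ≤ o + ∑ x ∈ Finset.range (2 ^ n), ((w (2 * x) : ℝ) * Z + w (2 * x + 1) * Z) := by
            rw [Finset.sum_add_distrib, ← sum_range_two_mul _ fun y => (w y : ℝ) * Z]
            linarith
        _ ≤ _ := by
            refine (add_le_add h4 le_rfl).trans ?_
            rw [← Finset.sum_add_distrib, sum_range_two_mul]
            refine le_of_eq (Finset.sum_congr rfl fun x _ => ?_)
            have h2S : 2 ≤ 1024 * 2 ^ m := by omega
            rw [target, target, if_pos (by omega), if_neg (by omega), hcq, ← hZ]
            push_cast [Nat.cast_sub h2S]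
            ring
    exact h5.trans (by exact_mod_cast h6)
  have hB2 : ∀ y, target n m d y ≤ 2 ^ 12 * (2 ^ m * 2 ^ m) * Z := by
    intro y
    rw [target, hcq]
    split_ifs
    · refine Nat.mul_le_mul_right _ ((Nat.sub_le _ _).trans ?_)
      nlinarith
    · refine Nat.mul_le_mul_right _ ?_
      nlinarith
  refine ⟨hoffn, fun u hu => (hcU u hu).1, fun y hy => ?_⟩
  have h1 := sum_sq_le (w := weight n m (truthTable f) d)
    (v := fun r => (problem n m (truthTable f) d).best (2 * 2 ^ n)
        (weight n m (truthTable f) d r) n 0)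
    (τ := target n m d) (Y := 2 * 2 ^ n) (B := 2 ^ 12 * (2 ^ m * 2 ^ m) * Z) (fun y => rfl)
    (fun r y => rfl) (fun r => key _) (fun r y hy => best_le_mul_scale hm hnm ha happ hoffn _ hy)
    (fun y _ => hB2 y) (rounds n m)
  have h2 := (Finset.single_le_sum (f := fun y => weight n m (truthTable f) d (rounds n m) y ^ 2)
    (fun _ _ => Nat.zero_le _) (Finset.mem_range.2 hy)).trans h1
  have h3 : 2 * 2 ^ n * (2 ^ 12 * (2 ^ m * 2 ^ m)) ^ 2 ≤ rounds n m := by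
    unfold rounds
    have h4 : 2 * 2 ^ n ≤ (2 ^ m) ^ n := by
      calc 2 * 2 ^ n ≤ 2 ^ n * 2 ^ n := Nat.mul_le_mul_right _ (by
            calc 2 = 2 ^ 1 := rfl
              _ ≤ 2 ^ n := Nat.pow_le_pow_right (by norm_num) hn)
        _ = 4 ^ n := by rw [← Nat.mul_pow]
        _ ≤ (2 ^ m) ^ n := Nat.pow_le_pow_left hS4 n
    have h5 : (2 ^ 12 * (2 ^ m * 2 ^ m)) ^ 2 ≤ (2 ^ m) ^ 16 := by
      calc (2 ^ 12 * (2 ^ m * 2 ^ m)) ^ 2 = 4 ^ 12 * (2 ^ m) ^ 4 := by ring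
        _ ≤ (2 ^ m) ^ 12 * (2 ^ m) ^ 4 := Nat.mul_le_mul_right _ (Nat.pow_le_pow_left hS4 _)
        _ = _ := by ring
    rw [pow_add]
    exact Nat.mul_le_mul h4 h5
  refine (Nat.pow_le_pow_iff_left two_ne_zero).1 (h2.trans ?_)
  calc rounds n m * (2 * 2 ^ n * (2 ^ 12 * (2 ^ m * 2 ^ m) * Z) ^ 2)
      = rounds n m * (2 * 2 ^ n * (2 ^ 12 * (2 ^ m * 2 ^ m)) ^ 2) * Z ^ 2 := by ring
    _ ≤ rounds n m * rounds n m * Z ^ 2 := by gcongr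
    _ = _ := by ring

end Search

/-! ### The query complexity and the result of the search -/

namespace QuantumQuery

variable {n m : ℕ}

theorem returnProb_add_returnProb (x : Fin n → Bool) (b : Bool) (gs : List (QueryAlgorithm n m))
    (D : List (BasisState n m) → Option Bool) (hD : ∀ l, l.length = gs.length → (D l).isSome) :
    returnProb x b gs D + returnProb x (!b) gs D = 1 := by
  induction gs generalizing D with
  | nil =>
    obtain ⟨c, hc⟩ := Option.isSome_iff_exists.1 (hD [] rfl)
    rw [returnProb_of_some hc, returnProb_of_some hc]
    cases b <;> cases c <;> simp
  | cons g gs ih =>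
    cases hc : D [] with
    | some c =>
      rw [returnProb_of_some hc, returnProb_of_some hc]
      cases b <;> cases c <;> simp
    | none =>
      rw [returnProb_cons_of_none hc, returnProb_cons_of_none hc, ← Finset.sum_add_distrib,
        ← g.sum_outcomeProb x]
      refine Finset.sum_congr rfl fun s _ => ?_
      rw [← mul_add, ih (fun l => D (s :: l)) fun l hl => hD _ (by simpa using hl), mul_one]

theorem returnProb_le_one (x : Fin n → Bool) (b : Bool) (gs : List (QueryAlgorithm n m))
    (D : List (BasisState n m) → Option Bool) : returnProb x b gs D ≤ 1 := by
  induction gs generalizing D with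
  | nil => rw [returnProb]; split_ifs <;> norm_num
  | cons g gs ih =>
    cases hc : D [] with
    | some c => rw [returnProb_of_some hc]; split_ifs <;> norm_num
    | none =>
      rw [returnProb_cons_of_none hc, ← g.sum_outcomeProb x]
      exact Finset.sum_le_sum fun s _ =>
        mul_le_of_le_one_right (g.outcomeProb_nonneg _ _) (ih _)

/-- Two inputs can be told apart only by making a query. -/
theorem returnProb_le_add_expectedQueries (x y : Fin n → Bool) (b : Bool)
    (gs : List (QueryAlgorithm n m)) (D : List (BasisState n m) → Option Bool) :
    returnProb x b gs D ≤ returnProb y b gs D + expectedQueries x gs D := by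
  induction gs generalizing D with
  | nil => simp [returnProb, expectedQueries]
  | cons g gs ih =>
    cases hc : D [] with
    | some c => rw [returnProb_of_some hc, returnProb_of_some hc, expectedQueries_of_some hc,
        add_zero]
    | none =>
      have h2 : 0 ≤ ∑ s, g.outcomeProb x s * expectedQueries x gs fun l => D (s :: l) :=
        Finset.sum_nonneg fun s _ =>
          mul_nonneg (g.outcomeProb_nonneg _ _) (expectedQueries_nonneg _ _ _)
      rcases Nat.eq_zero_or_pos g.numQueries with h0 | h0
      · rw [returnProb_cons_of_none hc, returnProb_cons_of_none hc,
          expectedQueries_cons_of_none hc, h0, Nat.cast_zero, zero_add, ← Finset.sum_add_distrib]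
        refine Finset.sum_le_sum fun s _ => ?_
        rw [QueryAlgorithm.outcomeProb_of_numQueries_eq_zero h0 y x, ← mul_add]
        exact mul_le_mul_of_nonneg_left (ih _) (g.outcomeProb_nonneg _ _)
      · have h1 := returnProb_le_one x b (g :: gs) D
        have h3 := returnProb_nonneg y b (g :: gs) D
        have h4 : (1 : ℝ) ≤ g.numQueries := by exact_mod_cast h0
        rw [expectedQueries_cons_of_none hc]
        linarith

theorem CompositeAlgorithm.queries_nonneg (Γ : CompositeAlgorithm n m) (x : Fin n → Bool) :
    0 ≤ Γ.queries x := by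
  rw [Γ.queries_eq]
  exact expectedQueries_nonneg _ _ _

/-- An algorithm for a nonconstant function makes at least `1 / 3` queries. -/
theorem CompositeAlgorithm.one_third_le_queries {Γ : CompositeAlgorithm n m}
    {f : (Fin n → Bool) → Bool} (h : Γ.Computes f) {x y : Fin n → Bool} (hxy : f x ≠ f y) :
    1 / 3 ≤ Γ.queries x := by
  have h1 := h x
  have h2 := h y
  have h3 := returnProb_add_returnProb x (f x) _ Γ.decisions fun l hl => Γ.isSome_decisions hl
  have h4 := returnProb_le_add_expectedQueries x y (f x) (List.ofFn Γ.stage) Γ.decisions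
  rw [errorProb_eq] at h1 h2
  rw [show (!f y) = f x by cases hx : f x <;> cases hy : f y <;> simp_all] at h2
  rw [queries_eq]
  linarith

/-- A composite algorithm has at least one stage, which here does nothing. -/
theorem exists_composite_of_const (m : ℕ) {f : (Fin n → Bool) → Bool} {b : Bool}
    (hf : ∀ x, f x = b) : ∃ Γ : CompositeAlgorithm n m, Γ.Computes f ∧ ∀ x, Γ.queries x ≤ 0 := by
  obtain ⟨Γ, hΓ1, hΓ2⟩ := exists_compositeAlgorithm (gs := [Search.idleStage n m])
    (D := fun l => if l = [] then none else some b) (by simp) (if_pos rfl) fun l hl => by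
      rw [if_neg (by rintro rfl; simp at hl)]
      rfl
  refine ⟨Γ, fun x => ?_, fun x => ?_⟩
  · rw [hΓ1, returnProb_cons_of_none (if_pos rfl)]
    have : ∀ s : BasisState n m, returnProb x (!f x) []
        (fun l => if s :: l = [] then none else some b) = 0 := by
      intro s
      rw [returnProb_of_some (c := b) (by simp), if_neg (by rw [hf]; cases b <;> simp)]
    rw [Finset.sum_eq_zero fun s _ => by rw [this, mul_zero]]
    norm_num
  · rw [hΓ2, expectedQueries_cons_of_none (if_pos rfl)]
    simp [expectedQueries, show (Search.idleStage n m).numQueries = 0 from rfl]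

end QuantumQuery

namespace Search

open QuantumQuery RAM

variable {n m : ℕ}

theorem result_le_of_accepted {F : ℕ → ℕ} {c K : ℕ} (hc : c < K) (h : Accepted n m F (digit m c)) :
    result n m F K ≤ digit m c n := by
  induction K with
  | zero => omega
  | succ K ih =>
    rw [result]
    rcases Nat.lt_succ_iff_lt_or_eq.1 hc with h1 | rfl
    · have := ih h1
      split_ifs with h2
      · exact h2.2.le.trans this
      · exact this
    · split_ifs with h2
      · exact le_rfl
      · exact not_lt.1 fun h3 => h2 ⟨h, h3⟩

theorem result_eq (n m : ℕ) (F : ℕ → ℕ) (K : ℕ) : result n m F K = 128 * n ∨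
    ∃ c, Accepted n m F (digit m c) ∧ digit m c n = result n m F K := by
  induction K with
  | zero => exact Or.inl rfl
  | succ K ih =>
    rw [result]
    split_ifs with h
    · exact Or.inr ⟨K, h.1, rfl⟩
    · exact ih

theorem result_le (n m : ℕ) (F : ℕ → ℕ) (K : ℕ) : result n m F K ≤ 128 * n := by
  induction K with
  | zero => exact le_rfl
  | succ K ih =>
    rw [result]
    split_ifs with h
    · exact h.2.le.trans ih
    · exact ih

section Bounds

variable {f : (Fin n → Bool) → Bool}

theorem bddBelow_queries (m : ℕ) (f : (Fin n → Bool) → Bool) :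
    BddBelow {q : ℝ | ∃ Γ : CompositeAlgorithm n m, Γ.Computes f ∧ ∀ x, Γ.queries x ≤ q} := by
  refine ⟨0, ?_⟩
  rintro q ⟨Γ, -, h⟩
  exact (Γ.queries_nonneg fun _ => false).trans (h _)

theorem complexity_le {Γ : CompositeAlgorithm n m} (hΓ : Γ.Computes f) {q : ℝ}
    (h : ∀ x, Γ.queries x ≤ q) : spaceBoundedQueryComplexity m f ≤ q :=
  csInf_le (bddBelow_queries m f) ⟨Γ, hΓ, h⟩

theorem le_complexity (hn : 1 ≤ n) {a : ℝ} (h : ∀ (Γ : CompositeAlgorithm n m) (q : ℝ),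
    Γ.Computes f →
    (∀ x, Γ.queries x ≤ q) → a ≤ q) : a ≤ spaceBoundedQueryComplexity m f := by
  obtain ⟨Γ, h1, h2⟩ := exists_compositeAlgorithm_queries_le hn m f
  refine le_csInf ⟨n, Γ, h1, h2⟩ ?_
  rintro q ⟨Γ, h1, h2⟩
  exact h Γ q h1 h2

theorem complexity_le_result (hn : 1 ≤ n) (hm : 2 ≤ m) (hnm : n ≤ 2 ^ m)
    (ha : Nat.clog 2 n + 1 ≤ m) (K : ℕ) :
    spaceBoundedQueryComplexity m f ≤ ((result n m (truthTable f) K : ℝ) + 2) / 128 := by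
  rcases result_eq n m (truthTable f) K with h | ⟨c, hc, h⟩
  · obtain ⟨Γ, h1, h2⟩ := exists_compositeAlgorithm_queries_le hn m f
    refine (complexity_le h1 h2).trans ?_
    rw [h, le_div_iff₀ (by norm_num)]
    push_cast
    linarith
  · obtain ⟨Γ, h1, h2⟩ := hc.exists_compositeAlgorithm hm hnm ha
    rw [h] at h2
    exact complexity_le h1 h2

/-- The factor `2` against `complexity_le_result` comes from truncating the algorithm and reading
the whole input. -/
theorem result_le_complexity (hn : 1 ≤ n) (hm : 2 ≤ m) (hnm : n ≤ 2 ^ m)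
    (ha : Nat.clog 2 n + 1 ≤ m) :
    ((result n m (truthTable f) (base m ^ numDigits n m) : ℝ) - 3) / 256 ≤
      spaceBoundedQueryComplexity m f := by
  refine le_complexity hn fun Γ q' h1 h2 => ?_
  have hq0 : 0 ≤ q' := (Γ.queries_nonneg fun _ => false).trans (h2 _)
  rw [div_le_iff₀ (by norm_num)]
  set q := ⌈256 * q' + 2⌉₊ with hq
  have h3 : (q : ℝ) < 256 * q' + 2 + 1 := Nat.ceil_lt_add_one (by linarith)
  have h4 : result n m (truthTable f) (base m ^ numDigits n m) ≤ q := by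
    rcases lt_or_ge q (128 * n) with h | h
    · obtain ⟨c, hc, hacc, hcq⟩ := exists_accepted hn hm hnm ha h1 h2 (Nat.le_ceil _) h
      rw [← hq] at hcq
      rw [← hcq]
      exact result_le_of_accepted hc hacc
    · exact (result_le _ _ _ _).trans h
  have h5 : ((result n m (truthTable f) (base m ^ numDigits n m) : ℕ) : ℝ) ≤ q :=
      by exact_mod_cast h4
  linarith

/-- The search determines the query complexity up to the factor `2` and an additive error, which is
at most a small multiple of it, since a nonconstant function requires `1 / 3` query. The output lies
between the two bounds: it is off by the factor `3 / 2` at most from the upper one and, apart from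
the additive error, by `4 / 3` at most from the lower one. A constant function requires no queries,
and is treated separately. -/
theorem answer_bounds (hn : 1 ≤ n) (hm : 2 ≤ m) (hnm : n ≤ 2 ^ m) (ha : Nat.clog 2 n + 1 ≤ m)
    (f : (Fin n → Bool) → Bool) :
    0 ≤ spaceBoundedQueryComplexity m f ∧
      spaceBoundedQueryComplexity m f ≤ 3 / 2 * ((answer n m f : ℝ) / 384) ∧
      (answer n m f : ℝ) / 384 ≤ 3 / 2 * spaceBoundedQueryComplexity m f := by
  have h0 : 0 ≤ spaceBoundedQueryComplexity m f := le_complexity hn fun Γ q _ h2 =>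
    (Γ.queries_nonneg fun _ => false).trans (h2 _)
  refine ⟨h0, ?_⟩
  unfold answer
  split_ifs with h
  · obtain ⟨b, hb⟩ : ∃ b, ∀ x, f x = b := by
      rcases h with h | h
      · refine ⟨false, fun X => ?_⟩
        obtain ⟨x, hx, rfl⟩ := exists_bits_eq X
        have := h x hx
        rw [truthTable_bits] at this
        simpa using this
      · refine ⟨true, fun X => ?_⟩
        obtain ⟨x, hx, rfl⟩ := exists_bits_eq X
        have := h x hx
        rw [truthTable_bits] at this
        simpa using this
    obtain ⟨Γ, h1, h2⟩ := exists_composite_of_const m hb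
    have h3 := complexity_le h1 h2
    simp only [Nat.cast_zero, zero_div, mul_zero]
    exact ⟨h3, by linarith⟩
  · have h1 : 1 / 3 ≤ spaceBoundedQueryComplexity m f := by
      rw [not_or] at h
      push Not at h
      obtain ⟨⟨x, hx, hx0⟩, y, hy, hy1⟩ := h
      rw [truthTable_bits] at hx0 hy1
      have hfx : f (bits n x) = true := by simpa using hx0
      have hfy : f (bits n y) = false := by simpa using hy1
      exact le_complexity hn fun Γ q h1 h2 =>
        (CompositeAlgorithm.one_third_le_queries h1 (x := bits n x) (y := bits n y)
          (by rw [hfx, hfy]; simp)).trans (h2 _)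
    have h2 := complexity_le_result (f := f) hn hm hnm ha (base m ^ numDigits n m)
    have h3 := result_le_complexity (f := f) hn hm hnm ha
    rw [div_le_iff₀ (by norm_num)] at h3
    rw [le_div_iff₀ (by norm_num)] at h2
    push_cast
    constructor <;> linarith

end Bounds

/-! ### The running time -/

theorem size_of_log_le (hn : 1 ≤ n) (h : Real.logb 2 (n : ℝ) + 2 ≤ (m : ℝ)) :
    2 ≤ m ∧ n < 2 ^ m ∧ Nat.clog 2 n + 1 ≤ m := by
  have hn' : (1 : ℝ) ≤ n := by exact_mod_cast hn
  have h0 : 0 ≤ Real.logb 2 n := Real.logb_nonneg (by norm_num) hn'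
  have hm : 2 ≤ m := by
    have : (2 : ℝ) ≤ m := by linarith
    exact_mod_cast this
  obtain ⟨k, rfl⟩ := Nat.exists_eq_add_of_le' hm
  have h1 : (n : ℝ) ≤ (2 : ℝ) ^ (k : ℝ) := by
    rw [← Real.logb_le_iff_le_rpow (by norm_num) (by linarith)]
    push_cast at h
    linarith
  rw [Real.rpow_natCast] at h1
  have h2 : n ≤ 2 ^ k := by exact_mod_cast h1
  refine ⟨by omega, h2.trans_lt (Nat.pow_lt_pow_right (by norm_num) (by omega)), ?_⟩
  have := Nat.clog_le_of_le_pow h2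
  omega

/-- The last stage dominates: it takes a time polynomial in its cut-off `2 ^ exponent n m`. -/
theorem time_le (κ : ℕ) (hn : 1 ≤ n) (hm : 1 ≤ m) :
    3 * n + 12 * 2 ^ n + 36 + (n + m + 66) ^ κ + (exponent n m + 2) ^ κ +
      (2 ^ exponent n m + 2) ^ κ ≤ 2 ^ (4096 * (κ + 1) * (4 ^ m * m * n)) := by
  set X := 4 ^ m * m * n with hX
  have e : exponent n m = 1024 * X := by unfold exponent; rw [hX]; ring
  have h4 : 1 ≤ 4 ^ m := Nat.one_le_pow _ _ (by norm_num)
  have hnX : n ≤ X := by rw [hX]; exact Nat.le_mul_of_pos_left _ (by positivity)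
  have hmX : m ≤ X := by
    rw [hX, mul_assoc, mul_comm, mul_assoc]
    exact Nat.le_mul_of_pos_right _ (by positivity)
  set E := 2 ^ exponent n m with hE
  have hXE : exponent n m < E := Nat.lt_two_pow_self
  have h2n : 2 ^ n * 2 ^ 6 ≤ E := by
    rw [← pow_add, hE]
    exact Nat.pow_le_pow_right (by norm_num) (by omega)
  have hn2 : n < 2 ^ n := Nat.lt_two_pow_self
  have h1 : 3 * n + 12 * 2 ^ n + 36 ≤ (E + 2) ^ (κ + 1) :=
    (by omega : 3 * n + 12 * 2 ^ n + 36 ≤ E + 2).trans (Nat.le_self_pow (by omega) _)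
  have hk : ∀ a ≤ E + 2, a ^ κ ≤ (E + 2) ^ (κ + 1) := fun a h =>
    (Nat.pow_le_pow_left h κ).trans (Nat.pow_le_pow_right (by omega) (by omega))
  have h2 := hk (n + m + 66) (by omega)
  have h3 := hk (exponent n m + 2) (by omega)
  have h5 := hk (E + 2) le_rfl
  have hE2 : E + 2 ≤ 2 ^ (exponent n m + 1) := by rw [pow_succ]; omega
  calc _ ≤ 2 ^ 2 * (E + 2) ^ (κ + 1) := by omega
    _ ≤ 2 ^ 2 * (2 ^ (exponent n m + 1)) ^ (κ + 1) := by gcongr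
    _ = 2 ^ (2 + (exponent n m + 1) * (κ + 1)) := by rw [← pow_mul, ← pow_add]
    _ ≤ _ := by
      refine Nat.pow_le_pow_right (by norm_num) ?_
      rw [e]
      nlinarith [Nat.zero_le κ, Nat.zero_le (κ * X)]

/-- With logarithmically many qubits, the running time is quasipolynomial in `2 ^ n`. -/
theorem polylog_bound (C : ℕ) (c : ℝ) : ∃ k : ℕ, ∀ n m : ℕ, 1 ≤ n →
    (m : ℝ) ≤ c * (1 + Real.logb 2 (n : ℝ)) →
    2 ^ (C * (4 ^ m * m * n)) ≤ (2 ^ n) ^ (k * Nat.log 2 (2 ^ n) ^ k) := by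
  obtain ⟨a, hca⟩ := exists_nat_ge c
  refine ⟨C * 16 ^ a + 4 * a, fun n m hn h => ?_⟩
  have hn' : (1 : ℝ) ≤ n := by exact_mod_cast hn
  have h0 : 0 ≤ Real.logb 2 n := Real.logb_nonneg (by norm_num) hn'
  have h1 : 2 ^ m ≤ 2 ^ a * n ^ a := by
    have h2 : (m : ℝ) ≤ a * (1 + Real.logb 2 n) :=
      h.trans (mul_le_mul_of_nonneg_right hca (by linarith))
    have h3 : (2 : ℝ) ^ (m : ℝ) ≤ (2 : ℝ) ^ (a * (1 + Real.logb 2 n)) :=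
      Real.rpow_le_rpow_of_exponent_le (by norm_num) h2
    have h4 : (2 : ℝ) ^ (a * (1 + Real.logb 2 n)) = 2 ^ a * (n : ℝ) ^ a := by
      rw [mul_comm, Real.rpow_mul (by norm_num), Real.rpow_add (by norm_num), Real.rpow_one,
        Real.rpow_logb (by norm_num) (by norm_num) (by linarith), Real.rpow_natCast, mul_pow]
    rw [h4, Real.rpow_natCast] at h3
    exact_mod_cast h3
  have h2 : 4 ^ m * m ≤ 16 ^ a * n ^ (4 * a) := by
    calc 4 ^ m * m ≤ 4 ^ m * 4 ^ m :=
          Nat.mul_le_mul_left _ (Nat.lt_pow_self (by norm_num)).le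
      _ = (2 ^ m) ^ 4 := by
          rw [← mul_pow, ← pow_mul, mul_comm m 4, pow_mul]
          norm_num
      _ ≤ (2 ^ a * n ^ a) ^ 4 := Nat.pow_le_pow_left h1 4
      _ = _ := by
          rw [mul_pow, ← pow_mul, ← pow_mul, mul_comm a 4, pow_mul 2 4 a]
          norm_num
  rw [Nat.log_pow one_lt_two, ← pow_mul]
  refine Nat.pow_le_pow_right (by norm_num) ?_
  calc C * (4 ^ m * m * n) ≤ C * (16 ^ a * n ^ (4 * a) * n) := by gcongr
    _ = n * (C * 16 ^ a * n ^ (4 * a)) := by ring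
    _ ≤ n * ((C * 16 ^ a + 4 * a) * n ^ (C * 16 ^ a + 4 * a)) := by
        gcongr
        · omega
        · omega

end Search

theorem mainTheorem3 (ε : ℝ) (hε : 0 < ε) :
    ∃ P : RAM.Program,
      (∃ C : ℕ, ∀ (n m : ℕ) (f : (Fin n → Bool) → Bool),
        1 ≤ n → Real.logb 2 (n : ℝ) + 2 ≤ (m : ℝ) →
        ∃ t p q : ℕ, RAM.Outputs P n m f t p q ∧
          t ≤ 2 ^ (C * (4 ^ m * m * n)) ∧
          QuantumQuery.spaceBoundedQueryComplexity m f / (Real.sqrt 22 / 3 + ε)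
            ≤ (p : ℝ) / (q : ℝ) ∧
          (p : ℝ) / (q : ℝ)
            ≤ (Real.sqrt 22 / 3 + ε) * QuantumQuery.spaceBoundedQueryComplexity m f) ∧
      (∀ c : ℝ, ∃ k : ℕ, ∀ (n m : ℕ) (f : (Fin n → Bool) → Bool),
        1 ≤ n → Real.logb 2 (n : ℝ) + 2 ≤ (m : ℝ) → (m : ℝ) ≤ c * (1 + Real.logb 2 (n : ℝ)) →
        ∃ t p q : ℕ, RAM.Outputs P n m f t p q ∧
          t ≤ (2 ^ n) ^ (k * Nat.log 2 (2 ^ n) ^ k)) := by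
  obtain ⟨P, κ, hP⟩ := Search.exists_program
  have hρ : 3 / 2 ≤ Real.sqrt 22 / 3 + ε := by
    have : (9 / 2 : ℝ) ≤ Real.sqrt 22 := Real.le_sqrt_of_sq_le (by norm_num)
    linarith
  refine ⟨P, ⟨4096 * (κ + 1), fun n m f hn h => ?_⟩, fun c => ?_⟩
  · obtain ⟨hm, hnm, ha⟩ := Search.size_of_log_le hn h
    obtain ⟨t, ht, htle⟩ := hP n m f hn hm hnm ha
    obtain ⟨h0, h1, h2⟩ := Search.answer_bounds hn hm hnm.le ha f
    refine ⟨t, _, _, ht, htle.trans (Search.time_le κ hn (by omega)), ?_, ?_⟩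
    · rw [div_le_iff₀ (by linarith), mul_comm]
      push_cast
      exact h1.trans (mul_le_mul_of_nonneg_right hρ (by positivity))
    · push_cast
      exact h2.trans (mul_le_mul_of_nonneg_right hρ h0)
  · obtain ⟨k, hk⟩ := Search.polylog_bound (4096 * (κ + 1)) c
    refine ⟨k, fun n m f hn h hc => ?_⟩
    obtain ⟨hm, hnm, ha⟩ := Search.size_of_log_le hn h
    obtain ⟨t, ht, htle⟩ := hP n m f hn hm hnm ha
    exact ⟨t, _, _, ht, (htle.trans (Search.time_le κ hn (by omega))).trans (hk n m hn hc)⟩
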